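/- Let $n\ge 3$. A pair $(q,r)$ with $2\le q,r\le\infty$ is called admissible if $\frac2q+\frac nr=\frac n2$. For a compact interval $I$ write $$\|u\|_{\dot S^0(I\times\mathbb R^n)}:=\sup_{(q,r)\text{ admissible}}\|u\|_{L^q_tL^r_x(I\times\mathbb R^n)},\qquad \|u\|_{V(I)}:=\|u\|_{L^{2(n+2)/n}_{t,x}(I\times\mathbb R^n)},$$ and for a measurable function $e$ on $I\times\mathbb R^n$ let $\|e\|_{\dot N^0(I\times\mathbb R^n)}:=\sup\{\int_I\int_{\mathbb R^n}|e\varphi|\,dx\,dt:\ \varphi\text{ measurable},\ \|\varphi\|_{\dot S^0(I\times\mathbb R^n)}\le1\}$ be the norm dual to $\dot S^0(I\times\mathbb R^n)$. A solution of $(i\partial_t+\Delta)u=F$ on $I\times\mathbb R^n$ means a function $u\in C(I;L^2(\mathbb R^n))$ that solves the equation weakly, i.e. for every Schwartz function $\varphi$ on $\mathbb R^n$ the pairing $\int F(t,x)\varphi(x)\,dx$ is defined for almost every $t\in I$ and integrable over $I$, and for all $t_1,t_2\in I$, $$\int u(t_2)\varphi\,dx-\int u(t_1)\varphi\,dx=i\int_{t_1}^{t_2}\Bigl(\int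 u(s)\,\Delta\varphi\,dx-\int F(s)\,\varphi\,dx\Bigr)ds .$$ **Lemma 3.5 ($L^2_x$-critical stability).** For all $M,M',L>0$ there are constants $\varepsilon_1=\varepsilon_1(M,M',L)>0$ and $C=C(M,M',L)>0$ (depending also on $n$) with the following property. Let $I$ be a compact interval and let $\tilde v$ be an approximate solution of the defocusing $L^2_x$-critical nonlinear Schrödinger equation on $I\times\mathbb R^n$, in the sense that $$(i\partial_t+\Delta)\tilde v=|\tilde v|^{\frac4n}\tilde v+e$$ for some measurable function $e$. Assume that $$\|\tilde v\|_{L^\infty_tL^2_x(I\times\mathbb R^n)}\le M,\qquad \|\tilde v\|_{V(I)}\le L .$$ Let $t_0\in I$ and let $v_0\in L^2(\mathbb R^n)$ satisfy $\|v_0-\tilde v(t_0)\|_{L^2_x}\le M'$. Assume moreover that $$\bigl\|e^{i(t-t_0)\Delta}\bigl(v_0-\tilde v(t_0)\bigr)\bigr\|_{V(I)}\le\varepsilon,\qquad \|e\|_{\dot N^0(I\times\mathbb R^n)}\le\varepsilon$$ for some $0<\varepsilon\le\varepsilon_1$. Then there exists a solution $v$ of $$(i\partial_t+\Delta)v=|v|^{\frac4n}v$$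 on $I\times\mathbb R^n$ with $v(t_0)=v_0$, and it satisfies $$\|v-\tilde v\|_{V(I)}\le\varepsilon\,C,\qquad \|v-\tilde v\|_{\dot S^0(I\times\mathbb R^n)}\le C\,M',\qquad \|v\|_{\dot S^0(I\times\mathbb R^n)}\le C .$$ -/

import Mathlib

open MeasureTheory Set
open scoped ENNReal SchwartzMap FourierTransform Laplacian

noncomputable section

namespace NLS

/-- Physical space `ℝⁿ` with its Euclidean norm and Lebesgue measure. -/
abbrev Space (n : ℕ) : Type := EuclideanSpace ℝ (Fin n)

/-- The complex Hilbert space `L²(ℝⁿ)`. -/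
abbrev L2 (n : ℕ) : Type := Lp ℂ 2 (volume : Measure (Space n))

/-- Lebesgue measure on the spacetime slab `[a, b] × ℝⁿ`. -/
def slabMeasure (n : ℕ) (a b : ℝ) : Measure (ℝ × Space n) :=
  (volume.restrict (Icc a b)).prod volume

/-- The mixed norm `‖u‖_{L^q_t L^r_x([a, b] × ℝⁿ)}`, with values in `[0, ∞]`. -/
def mixedNorm {n : ℕ} (a b : ℝ) (q r : ℝ≥0∞) (u : ℝ → Space n → ℂ) : ℝ≥0∞ :=
  eLpNorm (fun t => eLpNorm (u t) r volume) q (volume.restrict (Icc a b))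

/-- The norm of `V([a, b]) = L^{2(n+2)/n}_{t,x}([a, b] × ℝⁿ)`. -/
def normV {n : ℕ} (a b : ℝ) (u : ℝ → Space n → ℂ) : ℝ≥0∞ :=
  mixedNorm a b (2 * (n + 2) / n) (2 * (n + 2) / n) u

/-- Schrödinger-admissible pairs: `2/q + n/r = n/2` and `2 ≤ q, r ≤ ∞`
(in `[0, ∞]`, so that `2/∞ = n/∞ = 0`). -/
def IsAdmissible (n : ℕ) (q r : ℝ≥0∞) : Prop :=
  2 ≤ q ∧ 2 ≤ r ∧ 2 / q + n / r = (n : ℝ≥0∞) / 2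

/-- The Strichartz norm `Ṡ⁰([a, b] × ℝⁿ)`: the supremum of the mixed norms over all
admissible pairs. -/
def normS0 {n : ℕ} (a b : ℝ) (u : ℝ → Space n → ℂ) : ℝ≥0∞ :=
  ⨆ (q : ℝ≥0∞) (r : ℝ≥0∞) (_ : IsAdmissible n q r), mixedNorm a b q r u

/-- The norm of `Ṅ⁰([a, b] × ℝⁿ)`, dual to `Ṡ⁰([a, b] × ℝⁿ)`, of a measurable function `e`: the
supremum of `|∫∫ e φ|` over all measurable `φ` with `‖φ‖_{Ṡ⁰} ≤ 1`. As `‖φ‖_{Ṡ⁰}` does not change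
when `φ` is multiplied by a function of modulus one, the modulus may be taken inside the
integral, and then the pairing makes sense in `[0, ∞]` in all cases. -/
def normN0 {n : ℕ} (a b : ℝ) (e : ℝ → Space n → ℂ) : ℝ≥0∞ :=
  ⨆ (φ : ℝ → Space n → ℂ)
    (_ : AEStronglyMeasurable (Function.uncurry φ) (slabMeasure n a b))
    (_ : normS0 a b φ ≤ 1),
    ∫⁻ p, ‖e p.1 p.2‖ₑ * ‖φ p.1 p.2‖ₑ ∂(slabMeasure n a b)

/-- The symbol `exp(-4π² i t |ξ|²)` of the free Schrödinger propagator `e^{itΔ}`. -/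
def freeSymbol {n : ℕ} (t : ℝ) (ξ : Space n) : ℂ :=
  Complex.exp (((-4 * Real.pi ^ 2 * t * ‖ξ‖ ^ 2 : ℝ) : ℂ) * Complex.I)

theorem memLp_freeSymbol_mul {n : ℕ} (t : ℝ) (g : L2 n) :
    MemLp (fun ξ => freeSymbol t ξ * g ξ) 2 volume := by
  have hc : Continuous (fun ξ : Space n => freeSymbol t ξ) := by
    unfold freeSymbol
    fun_prop
  refine (Lp.memLp g).of_le (hc.aestronglyMeasurable.mul (Lp.aestronglyMeasurable g)) ?_
  refine Filter.Eventually.of_forall fun ξ => ?_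
  rw [norm_mul, freeSymbol, Complex.norm_exp_ofReal_mul_I, one_mul]

/-- The free Schrödinger propagator `e^{itΔ}` on `L²(ℝⁿ)`: the Fourier transform of `e^{itΔ} f` is
`exp(-4π² i t |ξ|²)` times that of `f`, where the Fourier transform is
`f ↦ ∫ exp(-2π i x·ξ) f(x) dx`, extended to `L²` by Plancherel. -/
def freeEvolution {n : ℕ} (t : ℝ) (f : L2 n) : L2 n :=
  𝓕⁻ ((memLp_freeSymbol_mul t (𝓕 f)).toLp (fun ξ => freeSymbol t ξ * (𝓕 f : L2 n) ξ))

/-- The `L²`-critical nonlinearity `|z|^{4/n} z`. -/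
def nonlinearity (n : ℕ) (z : ℂ) : ℂ :=
  ((‖z‖ ^ ((4 : ℝ) / n) : ℝ) : ℂ) * z

/-- `u ∈ C([a, b]; L²(ℝⁿ))` solves `(i∂ₜ + Δ)u = F` on `[a, b] × ℝⁿ` in the weak sense: for every
Schwartz function `φ` on `ℝⁿ`, the function `t ↦ ∫ u(t) φ dx` is a primitive on `[a, b]` of
`i (∫ u Δφ dx - ∫ F φ dx)`. The first two integrability requirements only say that the pairing
of `F` with `φ` makes sense. -/
structure IsSchrodingerSolution {n : ℕ} (a b : ℝ) (u : ℝ → L2 n) (F : ℝ → Space n → ℂ) :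
    Prop where
  continuousOn : ContinuousOn u (Icc a b)
  integrable_slice : ∀ φ : 𝓢(Space n, ℂ), ∀ᵐ s ∂(volume.restrict (Icc a b)),
    Integrable (fun x => F s x * φ x) volume
  integrable_pairing : ∀ φ : 𝓢(Space n, ℂ),
    IntegrableOn (fun s => ∫ x, F s x * φ x) (Icc a b) volume
  weak : ∀ φ : 𝓢(Space n, ℂ), ∀ t₁ ∈ Icc a b, ∀ t₂ ∈ Icc a b,
    (∫ x, u t₂ x * φ x) - ∫ x, u t₁ x * φ x =
      Complex.I * ∫ s in t₁..t₂, ((∫ x, u s x * (Δ φ) x) - ∫ x, F s x * φ x)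

/-- `u` is an approximate solution of the defocusing `L²`-critical NLS with error `e`:
`(i∂ₜ + Δ)u = |u|^{4/n} u + e` on `[a, b] × ℝⁿ`. -/
def IsApproxSolution {n : ℕ} (a b : ℝ) (u : ℝ → L2 n) (e : ℝ → Space n → ℂ) : Prop :=
  IsSchrodingerSolution a b u (fun s x => nonlinearity n (u s x) + e s x)

/-- `v` is a solution of the defocusing `L²`-critical NLS
`(i∂ₜ + Δ)v = |v|^{4/n} v` on `[a, b] × ℝⁿ`. -/
def IsSolution {n : ℕ} (a b : ℝ) (v : ℝ → L2 n) : Prop :=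
  IsSchrodingerSolution a b v (fun s x => nonlinearity n (v s x))

end NLS

end

/-!
The theorem is perturbation theory on top of Strichartz estimates, and the Strichartz estimates,
including the double endpoint `(2, 2n/(n-2))`, are proved from scratch.

**The endpoint estimate.** Convolution with Gaussians of complex width gives the dispersive bound
`norm_inner_freeProp_le`. Following Keel and Tao, the retarded bilinear form
`∬_{s < t} ⟨e^{-itΔ} G(t), e^{-isΔ} G'(s)⟩` is cut into windows `t - s ∼ 2ʲ`, and the functions
`G(t)`, `G'(s)` in `L^{2n/(n+2)}` are cut into atoms supported where their moduli are of size `2ᵏ`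
and `2ˡ`. On each piece there are three bounds: one from dispersion alone, and two that use the `L²`
norm of one factor and dispersion for the other. Their exponents are linear in `(j, k, l)` and span a
triangle around zero (`exists_exponent_le`), so the best of the three decays both in the time scale
and in `|k - l|`, and the sum over `j`, `k`, `l` converges. No interpolation theorem is needed; the
outcome is `TestCurve.enorm_windowForm_le`.

**Duality.** The bilinear estimate is proved only for test curves that at each time are a multiple of
one of countably many functions. A countable family of Schwartz functions in the unit ball of
`L^{2n/(n+2)}` computes the `L^{2n/(n-2)}` norm up to a factor two (`exists_testFamily`), so these
test curves suffice (`mixedNorm_le_of_test`). With Hölder's inequality between the two endpoints this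
gives the homogeneous estimate `normS0_freeProp_le`. The retarded evolution of a test curve is bounded
in the Strichartz norm as well, and by pairing it with a forcing of finite dual norm the inhomogeneous
estimate `IsDuhamel.normS0_le` follows.

**The linear equation.** The Duhamel integral of a forcing that is known only through its dual norm is
described by its pairings with Schwartz functions. Weak solutions satisfy the Duhamel formula
(`IsSchrodingerSolution.isDuhamel`): the pairing with a free Schwartz solution, corrected by the
forcing, has vanishing right derivative. Conversely, the Riesz representation theorem constructs
Duhamel integrals, and for forcings in `L^{2(n+2)/(n+4)}` of space-time they are continuous solutions
(`exists_isSchrodingerSolution`).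

**Stability.** Where the approximate solution has small `V` norm, the solution is a fixed point of a
contraction on a ball around it (`isStable_of_le`). In general the interval is a union of boundedly
many such intervals. Two adjacent ones are glued (`IsStable.glue`): the free evolution of the
difference, restarted at the common end point, differs from the original one by a Duhamel term that
the forcing controls, so smallness propagates with worse constants. Induction on the number of
intervals gives `exists_isStable`, which contains existence and the bound in `V`; the Strichartz
bounds then follow from the linear estimates, applied to the difference and to the solution itself.
-/

open MeasureTheory Set
open scoped ENNReal SchwartzMap FourierTransform Laplacian

noncomputable section

namespace NLS

variable {n : ℕ}

/-! ### The free Schrödinger group on `L²` -/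

theorem norm_freeSymbol (t : ℝ) (ξ : Space n) : ‖freeSymbol t ξ‖ = 1 := by
  rw [freeSymbol, Complex.norm_exp_ofReal_mul_I]

theorem continuous_freeSymbol (t : ℝ) : Continuous (freeSymbol (n := n) t) := by
  unfold freeSymbol
  fun_prop

theorem freeSymbol_add (s t : ℝ) (ξ : Space n) :
    freeSymbol (s + t) ξ = freeSymbol s ξ * freeSymbol t ξ := by
  simp only [freeSymbol, ← Complex.exp_add]
  congr 1
  push_cast
  ring

theorem freeSymbol_zero (ξ : Space n) : freeSymbol 0 ξ = 1 := by
  simp [freeSymbol]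

theorem fourier_freeEvolution (t : ℝ) (f : L2 n) :
    (𝓕 (freeEvolution t f) : L2 n) =
      (memLp_freeSymbol_mul t (𝓕 f)).toLp (fun ξ => freeSymbol t ξ * (𝓕 f : L2 n) ξ) := by
  rw [freeEvolution, FourierTransform.fourier_fourierInv_eq]

theorem coeFn_fourier_freeEvolution (t : ℝ) (f : L2 n) :
    ((𝓕 (freeEvolution t f) : L2 n) : Space n → ℂ) =ᵐ[volume]
      fun ξ => freeSymbol t ξ * (𝓕 f : L2 n) ξ := by
  rw [fourier_freeEvolution]
  exact MemLp.coeFn_toLp _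

theorem fourier_injective {f g : L2 n} (h : (𝓕 f : L2 n) = 𝓕 g) : f = g := by
  rw [← FourierTransform.fourierInv_fourier_eq (F := L2 n) f, h,
    FourierTransform.fourierInv_fourier_eq]

theorem norm_freeEvolution (t : ℝ) (f : L2 n) : ‖freeEvolution t f‖ = ‖f‖ := by
  rw [← Lp.norm_fourier_eq, ← Lp.norm_fourier_eq f, Lp.norm_def, Lp.norm_def]
  congr 1
  rw [eLpNorm_congr_ae (coeFn_fourier_freeEvolution t f)]
  refine eLpNorm_congr_norm_ae (Filter.Eventually.of_forall fun ξ => ?_)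
  rw [norm_mul, norm_freeSymbol, one_mul]

/-- The propagator `e^{itΔ}` as a linear isometry of `L²`. -/
def freeProp (t : ℝ) : L2 n →ₗᵢ[ℂ] L2 n where
  toFun := freeEvolution t
  map_add' f g := by
    apply fourier_injective
    rw [FourierTransform.fourier_add]
    apply Lp.ext
    filter_upwards [coeFn_fourier_freeEvolution t (f + g), coeFn_fourier_freeEvolution t f,
      coeFn_fourier_freeEvolution t g,
      Lp.coeFn_add (𝓕 (freeEvolution t f) : L2 n) (𝓕 (freeEvolution t g)),
      Lp.coeFn_add (𝓕 f : L2 n) (𝓕 g)] with ξ h1 h2 h3 h4 h5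
    rw [h1, h4, Pi.add_apply, h2, h3, FourierTransform.fourier_add, h5, Pi.add_apply, mul_add]
  map_smul' c f := by
    apply fourier_injective
    rw [RingHom.id_apply, FourierTransform.fourier_smul]
    apply Lp.ext
    filter_upwards [coeFn_fourier_freeEvolution t (c • f), coeFn_fourier_freeEvolution t f,
      Lp.coeFn_smul c (𝓕 (freeEvolution t f) : L2 n),
      Lp.coeFn_smul c (𝓕 f : L2 n)] with ξ h1 h2 h3 h4
    rw [h1, h3, Pi.smul_apply, h2, FourierTransform.fourier_smul, h4, Pi.smul_apply, smul_eq_mul,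
      smul_eq_mul]
    ring
  norm_map' f := norm_freeEvolution t f

theorem freeProp_apply (t : ℝ) (f : L2 n) : freeProp t f = freeEvolution t f := rfl

theorem freeProp_add (s t : ℝ) (f : L2 n) : freeProp (s + t) f = freeProp s (freeProp t f) := by
  simp only [freeProp_apply]
  apply fourier_injective
  apply Lp.ext
  filter_upwards [coeFn_fourier_freeEvolution (s + t) f, coeFn_fourier_freeEvolution t f,
    coeFn_fourier_freeEvolution s (freeEvolution t f)] with ξ h1 h2 h3
  rw [h1, h3, h2, freeSymbol_add, mul_assoc]

theorem freeProp_zero (f : L2 n) : freeProp 0 f = f := by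
  simp only [freeProp_apply]
  apply fourier_injective
  apply Lp.ext
  filter_upwards [coeFn_fourier_freeEvolution 0 f] with ξ h1
  rw [h1, freeSymbol_zero, one_mul]

theorem freeProp_freeProp_neg (t : ℝ) (f : L2 n) : freeProp t (freeProp (-t) f) = f := by
  rw [← freeProp_add, add_neg_cancel, freeProp_zero]

theorem inner_freeProp_left (t : ℝ) (f g : L2 n) :
    inner ℂ (freeProp t f) g = inner ℂ f (freeProp (-t) g) := by
  rw [← (freeProp (n := n) t).inner_map_map f, freeProp_freeProp_neg]

theorem inner_freeProp_right (t : ℝ) (f g : L2 n) :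
    inner ℂ f (freeProp t g) = inner ℂ (freeProp (-t) f) g := by
  rw [inner_freeProp_left, neg_neg]

/-! ### The free group on Schwartz functions -/

theorem iteratedDeriv_exp_mul_I (k : ℕ) :
    iteratedDeriv k (fun r : ℝ => Complex.exp (r * Complex.I)) =
      fun r : ℝ => Complex.I ^ k * Complex.exp (r * Complex.I) := by
  induction k with
  | zero => simp
  | succ k ih =>
    rw [iteratedDeriv_succ, ih]
    funext r
    have h : HasDerivAt (fun r : ℝ => Complex.exp (r * Complex.I))
        (Complex.exp (r * Complex.I) * (1 * Complex.I)) r :=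
      ((Complex.ofRealCLM.hasDerivAt (x := r)).mul_const Complex.I).cexp
    rw [(h.const_mul _).deriv, pow_succ]
    ring

theorem hasTemperateGrowth_exp_mul_I :
    Function.HasTemperateGrowth (fun r : ℝ => Complex.exp (r * Complex.I)) := by
  refine ⟨(Complex.ofRealCLM.contDiff.mul contDiff_const).cexp, fun k => ⟨0, 1, fun r => ?_⟩⟩
  rw [norm_iteratedFDeriv_eq_norm_iteratedDeriv, iteratedDeriv_exp_mul_I, norm_mul, norm_pow,
    Complex.norm_I, Complex.norm_exp_ofReal_mul_I]
  simp

theorem hasTemperateGrowth_freeSymbol (t : ℝ) :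
    Function.HasTemperateGrowth (freeSymbol (n := n) t) := by
  have h : Function.HasTemperateGrowth
      (fun ξ : Space n => (-4 * Real.pi ^ 2 * t) * ‖ξ‖ ^ 2) :=
    (Function.HasTemperateGrowth.const _).mul (Function.hasTemperateGrowth_norm_sq _)
  exact hasTemperateGrowth_exp_mul_I.comp h

/-- The propagator `e^{itΔ}` on Schwartz functions. -/
def freeSchwartz (t : ℝ) : 𝓢(Space n, ℂ) →L[ℂ] 𝓢(Space n, ℂ) :=
  SchwartzMap.fourierMultiplierCLM ℂ (freeSymbol t)

theorem fourier_freeSchwartz (t : ℝ) (g : 𝓢(Space n, ℂ)) :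
    𝓕 (freeSchwartz t g) = SchwartzMap.smulLeftCLM ℂ (freeSymbol t) (𝓕 g) := by
  rw [freeSchwartz, SchwartzMap.fourierMultiplierCLM_apply,
    FourierTransform.fourier_fourierInv_eq]

theorem fourier_freeSchwartz_apply (t : ℝ) (g : 𝓢(Space n, ℂ)) (ξ : Space n) :
    (𝓕 (freeSchwartz t g) : 𝓢(Space n, ℂ)) ξ = freeSymbol t ξ * (𝓕 g : 𝓢(Space n, ℂ)) ξ := by
  rw [fourier_freeSchwartz, SchwartzMap.smulLeftCLM_apply_apply (hasTemperateGrowth_freeSymbol t),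
    smul_eq_mul]

/-- A Schwartz function, seen as an element of `L²`. -/
abbrev toL2 (g : 𝓢(Space n, ℂ)) : L2 n := g.toLp 2

theorem freeProp_toL2 (t : ℝ) (g : 𝓢(Space n, ℂ)) :
    freeProp t (toL2 g) = toL2 (freeSchwartz t g) := by
  apply fourier_injective
  apply Lp.ext
  rw [freeProp_apply]
  have h1 := SchwartzMap.coeFn_toLp (𝓕 g) 2 (volume : Measure (Space n))
  have h2 := SchwartzMap.coeFn_toLp (𝓕 (freeSchwartz t g)) 2 (volume : Measure (Space n))
  rw [toL2, toL2, SchwartzMap.toLp_fourier_eq]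
  filter_upwards [coeFn_fourier_freeEvolution t (toL2 g), h1, h2] with ξ h3 h4 h5
  rw [h3, h5, fourier_freeSchwartz_apply, SchwartzMap.toLp_fourier_eq, h4]

theorem denseRange_toL2 : DenseRange (toL2 : 𝓢(Space n, ℂ) → L2 n) :=
  SchwartzMap.denseRange_toLpCLM (p := 2) ENNReal.ofNat_ne_top

theorem toL2_smul (c : ℂ) (f : 𝓢(Space n, ℂ)) : toL2 (c • f) = c • toL2 f :=
  map_smul (SchwartzMap.toLpCLM ℂ ℂ 2 volume) c f

theorem toL2_sub (f g : 𝓢(Space n, ℂ)) : toL2 (f - g) = toL2 f - toL2 g :=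
  map_sub (SchwartzMap.toLpCLM ℂ ℂ 2 volume) f g

theorem fourier_laplacian_apply (g : 𝓢(Space n, ℂ)) (ξ : Space n) :
    (𝓕 (Δ g) : 𝓢(Space n, ℂ)) ξ =
      ((-4 * Real.pi ^ 2 * ‖ξ‖ ^ 2 : ℝ) : ℂ) * (𝓕 g : 𝓢(Space n, ℂ)) ξ := by
  have h : (fun x : Space n => ‖x‖ ^ 2).HasTemperateGrowth :=
    Function.hasTemperateGrowth_norm_sq _
  have h' : (fun x : Space n => ((‖x‖ ^ 2 : ℝ) : ℂ)).HasTemperateGrowth :=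
    Function.Complex.hasTemperateGrowth_ofReal.comp h
  have key : Δ g = -(2 * Real.pi) ^ 2 •
      SchwartzMap.fourierMultiplierCLM ℂ (fun x : Space n => ((‖x‖ ^ 2 : ℝ) : ℂ)) g := by
    rw [SchwartzMap.laplacian_eq_fourierMultiplierCLM]
    congr 1
    exact (SchwartzMap.fourierMultiplierCLM_ofReal ℂ h g).symm
  rw [key, ← Complex.coe_smul,
    FourierTransform.fourier_smul, SchwartzMap.fourierMultiplierCLM_apply,
    FourierTransform.fourier_fourierInv_eq, smul_apply,
    SchwartzMap.smulLeftCLM_apply_apply h', smul_eq_mul, smul_eq_mul]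
  push_cast
  ring

theorem laplacian_freeSchwartz (t : ℝ) (g : 𝓢(Space n, ℂ)) :
    Δ (freeSchwartz t g) = freeSchwartz t (Δ g) := by
  rw [← FourierTransform.fourierInv_fourier_eq (F := 𝓢(Space n, ℂ)) (Δ (freeSchwartz t g)),
    ← FourierTransform.fourierInv_fourier_eq (F := 𝓢(Space n, ℂ)) (freeSchwartz t (Δ g))]
  congr 1
  ext ξ
  rw [fourier_laplacian_apply, fourier_freeSchwartz_apply, fourier_freeSchwartz_apply,
    fourier_laplacian_apply]
  ring

/-! ### Differentiability in time -/

theorem norm_exp_mul_I_sub_le (x : ℝ) :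
    ‖Complex.exp ((x : ℂ) * Complex.I) - 1 - (x : ℂ) * Complex.I‖ ≤ 3 * x ^ 2 := by
  have hn : ‖(x : ℂ) * Complex.I‖ = |x| := by simp
  rcases le_total |x| 1 with h | h
  · have := Complex.norm_exp_sub_one_sub_id_le (x := (x : ℂ) * Complex.I) (by rw [hn]; exact h)
    rw [hn, sq_abs] at this
    nlinarith [sq_nonneg x]
  · calc _ ≤ ‖Complex.exp ((x : ℂ) * Complex.I)‖ + ‖(1 : ℂ)‖ + ‖(x : ℂ) * Complex.I‖ :=
        (norm_sub_le _ _).trans (add_le_add_left (norm_sub_le _ _) _)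
      _ = 2 + |x| := by rw [Complex.norm_exp_ofReal_mul_I, hn, norm_one]; ring
      _ ≤ 3 * x ^ 2 := by rw [← sq_abs x]; nlinarith

/-- The second-order Taylor bound behind the derivative of the propagator. -/
theorem norm_freeProp_toL2_sub_le (h : ℝ) (g : 𝓢(Space n, ℂ)) :
    ‖freeProp h (toL2 g) - toL2 g - ((h : ℂ) * Complex.I) • toL2 (Δ g)‖ ≤
      3 * h ^ 2 * ‖toL2 (Δ (Δ g))‖ := by
  have hL : ∀ φ : 𝓢(Space n, ℂ), ‖toL2 φ‖ = ‖toL2 (𝓕 φ)‖ := fun φ => by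
    rw [← Lp.norm_fourier_eq, toL2, toL2, SchwartzMap.toLp_fourier_eq]
  have h1 : ‖((3 * h ^ 2 : ℝ) : ℂ) • toL2 (Δ (Δ g))‖ = 3 * h ^ 2 * ‖toL2 (Δ (Δ g))‖ := by
    rw [norm_smul, Complex.norm_of_nonneg (by positivity)]
  rw [← h1, freeProp_toL2, ← toL2_sub, ← toL2_smul, ← toL2_sub, ← toL2_smul,
    hL (_ - _), hL (_ • Δ (Δ g))]
  refine Lp.norm_le_norm_of_ae_le ?_
  filter_upwards [SchwartzMap.coeFn_toLp (𝓕 (freeSchwartz h g - g - ((h : ℂ) * Complex.I) • Δ g)) 2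
      (volume : Measure (Space n)),
    SchwartzMap.coeFn_toLp (𝓕 (((3 * h ^ 2 : ℝ) : ℂ) • Δ (Δ g))) 2
      (volume : Measure (Space n))] with ξ h2 h3
  have e1 : (𝓕 (freeSchwartz h g - g - ((h : ℂ) * Complex.I) • Δ g) : 𝓢(Space n, ℂ)) ξ =
      (freeSymbol h ξ - 1 - ((-4 * Real.pi ^ 2 * h * ‖ξ‖ ^ 2 : ℝ) : ℂ) * Complex.I) *
        (𝓕 g : 𝓢(Space n, ℂ)) ξ := by
    have hs : ∀ φ ψ : 𝓢(Space n, ℂ), (𝓕 (φ - ψ) : 𝓢(Space n, ℂ)) = 𝓕 φ - 𝓕 ψ :=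
      map_sub (FourierTransform.fourierCLM ℂ 𝓢(Space n, ℂ))
    rw [hs, hs, FourierTransform.fourier_smul, sub_apply, sub_apply, smul_apply, fourier_freeSchwartz_apply, fourier_laplacian_apply,
      smul_eq_mul]
    push_cast
    ring
  have e2 : (𝓕 (((3 * h ^ 2 : ℝ) : ℂ) • Δ (Δ g)) : 𝓢(Space n, ℂ)) ξ =
      ((3 * (-4 * Real.pi ^ 2 * h * ‖ξ‖ ^ 2) ^ 2 : ℝ) : ℂ) * (𝓕 g : 𝓢(Space n, ℂ)) ξ := by
    rw [FourierTransform.fourier_smul, smul_apply, fourier_laplacian_apply,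
      fourier_laplacian_apply, smul_eq_mul]
    push_cast
    ring
  rw [h2, h3, e1, e2, norm_mul, norm_mul]
  refine mul_le_mul_of_nonneg_right ?_ (norm_nonneg _)
  rw [Complex.norm_of_nonneg (by positivity)]
  exact norm_exp_mul_I_sub_le _

/-- In `L²`, `∂ₜ e^{itΔ} g = i e^{itΔ} Δg` for Schwartz functions `g`. -/
theorem hasDerivAt_freeProp_toL2 (t : ℝ) (g : 𝓢(Space n, ℂ)) :
    HasDerivAt (fun s => freeProp s (toL2 g)) (Complex.I • freeProp t (toL2 (Δ g))) t := by
  rw [hasDerivAt_iff_isLittleO_nhds_zero]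
  refine Asymptotics.IsBigO.trans_isLittleO (g := fun h : ℝ => h ^ 2) ?_ ?_
  · refine Asymptotics.IsBigO.of_bound (3 * ‖toL2 (Δ (Δ g))‖)
      (Filter.Eventually.of_forall fun h => ?_)
    have e : freeProp (t + h) (toL2 g) - freeProp t (toL2 g) -
        h • Complex.I • freeProp t (toL2 (Δ g)) =
        freeProp t (freeProp h (toL2 g) - toL2 g - ((h : ℂ) * Complex.I) • toL2 (Δ g)) := by
      rw [freeProp_add, map_sub, map_sub, map_smul, mul_smul, Complex.coe_smul]
      rfl
    rw [e, LinearIsometry.norm_map, Real.norm_eq_abs, abs_of_nonneg (sq_nonneg h)]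
    calc _ ≤ _ := norm_freeProp_toL2_sub_le h g
      _ = _ := by ring
  · exact Asymptotics.isLittleO_pow_id one_lt_two

/-- The group is jointly continuous: the operators are isometries, and strong continuity need only
be checked on the dense set of Schwartz functions. -/
theorem continuous_freeProp_prod : Continuous (fun p : ℝ × L2 n => freeProp p.1 p.2) := by
  have h1 : ∀ f : L2 n, Continuous fun t : ℝ => freeProp t f := by
    intro f
    rw [continuous_iff_continuousAt]
    intro t
    rw [Metric.continuousAt_iff]
    intro ε hε
    obtain ⟨g, hg⟩ := Metric.denseRange_iff.1 denseRange_toL2 f (ε / 3) (by positivity)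
    obtain ⟨δ, hδ, H⟩ := Metric.continuousAt_iff.1
      (hasDerivAt_freeProp_toL2 t g).continuousAt (ε / 3) (by positivity)
    refine ⟨δ, hδ, fun s hs => ?_⟩
    calc dist (freeProp s f) (freeProp t f) ≤ dist (freeProp s f) (freeProp s (toL2 g)) +
        dist (freeProp s (toL2 g)) (freeProp t (toL2 g)) +
        dist (freeProp t (toL2 g)) (freeProp t f) := dist_triangle4 _ _ _ _
      _ < ε / 3 + ε / 3 + ε / 3 := by
        rw [LinearIsometry.dist_map, LinearIsometry.dist_map, dist_comm (toL2 g)]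
        exact add_lt_add (add_lt_add hg (H hs)) hg
      _ = ε := by ring
  rw [continuous_iff_continuousAt]
  rintro ⟨t, f⟩
  rw [Metric.continuousAt_iff]
  intro ε hε
  obtain ⟨δ, hδ, H⟩ := Metric.continuousAt_iff.1 (h1 f).continuousAt (ε / 2) (by positivity)
  refine ⟨min δ (ε / 2), by positivity, fun {p} hp => ?_⟩
  rw [Prod.dist_eq, max_lt_iff] at hp
  calc dist (freeProp p.1 p.2) (freeProp t f) ≤ dist (freeProp p.1 p.2) (freeProp p.1 f) +
      dist (freeProp p.1 f) (freeProp t f) := dist_triangle _ _ _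
    _ < ε / 2 + ε / 2 := by
      rw [LinearIsometry.dist_map]
      exact add_lt_add (hp.2.trans_le (min_le_right _ _)) (H (hp.1.trans_le (min_le_left _ _)))
    _ = ε := by ring

theorem continuous_freeProp_comp {X : Type*} [TopologicalSpace X] {τ : X → ℝ} {f : X → L2 n}
    (hτ : Continuous τ) (hf : Continuous f) : Continuous fun x => freeProp (τ x) (f x) := by
  have h1 := hτ.prodMk hf
  have h2 := Continuous.comp (continuous_freeProp_prod (n := n)) h1
  exact h2

/-! ### Pointwise values and decay of free Schwartz solutions -/

theorem freeSchwartz_apply (t : ℝ) (g : 𝓢(Space n, ℂ)) (x : Space n) :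
    freeSchwartz t g x = ∫ ξ, Complex.exp (((2 * Real.pi * inner ℝ ξ x : ℝ) : ℂ) * Complex.I) *
      (freeSymbol t ξ * (𝓕 g : 𝓢(Space n, ℂ)) ξ) := by
  have h1 := FourierTransform.fourierInv_fourier_eq (F := 𝓢(Space n, ℂ)) (freeSchwartz t g)
  conv_lhs => rw [← h1]
  rw [SchwartzMap.fourierInv_coe, Real.fourierInv_eq']
  simp_rw [fourier_freeSchwartz_apply, smul_eq_mul]

theorem continuous_freeSchwartz_apply (g : 𝓢(Space n, ℂ)) :
    Continuous fun p : ℝ × Space n => freeSchwartz p.1 g p.2 := by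
  simp_rw [freeSchwartz_apply]
  refine continuous_of_dominated (bound := fun ξ => ‖(𝓕 g : 𝓢(Space n, ℂ)) ξ‖) ?_ ?_ ?_ ?_
  · intro p
    refine Continuous.aestronglyMeasurable ?_
    have := continuous_freeSymbol (n := n) p.1
    have := (𝓕 g : 𝓢(Space n, ℂ)).continuous
    fun_prop
  · intro p
    refine Filter.Eventually.of_forall fun ξ => ?_
    rw [norm_mul, norm_mul, norm_freeSymbol, Complex.norm_exp_ofReal_mul_I, one_mul, one_mul]
  · exact (𝓕 g : 𝓢(Space n, ℂ)).integrable.norm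
  · refine Filter.Eventually.of_forall fun ξ => ?_
    unfold freeSymbol
    fun_prop

theorem norm_freeSchwartz_apply_le (t : ℝ) (g : 𝓢(Space n, ℂ)) (x : Space n) :
    ‖freeSchwartz t g x‖ ≤ ∫ ξ, ‖(𝓕 g : 𝓢(Space n, ℂ)) ξ‖ := by
  rw [freeSchwartz_apply]
  refine (norm_integral_le_integral_norm _).trans_eq (integral_congr_ae ?_)
  refine Filter.Eventually.of_forall fun ξ => ?_
  simp only
  rw [norm_mul, norm_mul, norm_freeSymbol, Complex.norm_exp_ofReal_mul_I, one_mul, one_mul]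

theorem hasDerivAt_freeSymbol (t : ℝ) (ξ : Space n) :
    HasDerivAt (fun s => freeSymbol s ξ)
      (freeSymbol t ξ * (((-4 * Real.pi ^ 2 * ‖ξ‖ ^ 2 : ℝ) : ℂ) * Complex.I)) t := by
  unfold freeSymbol
  have h1 : HasDerivAt (fun s : ℝ => -4 * Real.pi ^ 2 * s * ‖ξ‖ ^ 2)
      (-4 * Real.pi ^ 2 * 1 * ‖ξ‖ ^ 2) t :=
    ((hasDerivAt_id t).const_mul _).mul_const _
  have := (h1.ofReal_comp.mul_const Complex.I).cexp
  simpa using this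

theorem hasDerivAt_freeSchwartz_apply (t : ℝ) (g : 𝓢(Space n, ℂ)) (x : Space n) :
    HasDerivAt (fun s => freeSchwartz s g x) (Complex.I * freeSchwartz t (Δ g) x) t := by
  simp_rw [freeSchwartz_apply]
  rw [← integral_const_mul]
  have hc : ∀ (s : ℝ) (φ : 𝓢(Space n, ℂ)), Continuous fun ξ : Space n =>
      Complex.exp (((2 * Real.pi * inner ℝ ξ x : ℝ) : ℂ) * Complex.I) *
        (freeSymbol s ξ * (𝓕 φ : 𝓢(Space n, ℂ)) ξ) := by
    intro s φ
    have := continuous_freeSymbol (n := n) s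
    have := (𝓕 φ : 𝓢(Space n, ℂ)).continuous
    fun_prop
  refine (hasDerivAt_integral_of_dominated_loc_of_deriv_le (s := univ)
    (F' := fun s ξ => Complex.I * (Complex.exp (((2 * Real.pi * inner ℝ ξ x : ℝ) : ℂ) *
      Complex.I) * (freeSymbol s ξ * (𝓕 (Δ g) : 𝓢(Space n, ℂ)) ξ)))
    (bound := fun ξ => ‖(𝓕 (Δ g) : 𝓢(Space n, ℂ)) ξ‖) Filter.univ_mem ?_ ?_ ?_ ?_ ?_ ?_).2
  · exact Filter.Eventually.of_forall fun s => (hc s g).aestronglyMeasurable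
  · refine (𝓕 g : 𝓢(Space n, ℂ)).integrable.norm.mono' (hc t g).aestronglyMeasurable ?_
    refine Filter.Eventually.of_forall fun ξ => ?_
    rw [norm_mul, norm_mul, norm_freeSymbol, Complex.norm_exp_ofReal_mul_I, one_mul, one_mul]
  · exact ((hc t (Δ g)).const_mul _).aestronglyMeasurable
  · refine Filter.Eventually.of_forall fun ξ s _ => ?_
    rw [norm_mul, norm_mul, norm_mul, norm_freeSymbol, Complex.norm_exp_ofReal_mul_I,
      Complex.norm_I, one_mul, one_mul, one_mul]
  · exact (𝓕 (Δ g) : 𝓢(Space n, ℂ)).integrable.norm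
  · refine Filter.Eventually.of_forall fun ξ s _ => ?_
    have := ((hasDerivAt_freeSymbol s ξ).mul_const ((𝓕 g : 𝓢(Space n, ℂ)) ξ)).const_mul
      (Complex.exp (((2 * Real.pi * inner ℝ ξ x : ℝ) : ℂ) * Complex.I))
    refine this.congr_deriv ?_
    rw [fourier_laplacian_apply]
    ring

open LineDeriv in
/-- The Galilean commutation relation `x·m e^{itΔ} = e^{itΔ} (x·m - 2it ∂ₘ)`. -/
theorem inner_mul_freeSchwartz (t : ℝ) (g : 𝓢(Space n, ℂ)) (m x : Space n) :
    ((inner ℝ x m : ℝ) : ℂ) * freeSchwartz t g x =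
      freeSchwartz t (SchwartzMap.smulLeftCLM ℂ (inner ℝ · m) g) x +
        (-2 * Complex.I * t) * freeSchwartz t (∂_{m} g) x := by
  have hm : Function.HasTemperateGrowth (fun x : Space n => inner ℝ x m) :=
    Function.hasTemperateGrowth_inner_left m
  have hpi : (Real.pi : ℂ) ≠ 0 := by exact_mod_cast Real.pi_ne_zero
  have hF : ∀ (φ : 𝓢(Space n, ℂ)) (ξ : Space n),
      (𝓕 (SchwartzMap.smulLeftCLM ℂ (inner ℝ · m) φ) : 𝓢(Space n, ℂ)) ξ =
      (-(2 * Real.pi * Complex.I))⁻¹ * lineDeriv ℝ (𝓕 φ : 𝓢(Space n, ℂ)) ξ m := by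
    intro φ ξ
    rw [← SchwartzMap.lineDerivOp_apply, SchwartzMap.lineDerivOp_fourier_eq,
      FourierTransform.fourier_smul, smul_apply, smul_eq_mul, inv_mul_cancel_left₀]
    simp [hpi]
  have hD : ∀ (φ : 𝓢(Space n, ℂ)) (ξ : Space n), (𝓕 (∂_{m} φ) : 𝓢(Space n, ℂ)) ξ =
      (2 * Real.pi * Complex.I) * (((inner ℝ ξ m : ℝ) : ℂ) * (𝓕 φ : 𝓢(Space n, ℂ)) ξ) := by
    intro φ ξ
    rw [SchwartzMap.fourier_lineDerivOp_eq, smul_apply, SchwartzMap.smulLeftCLM_apply_apply hm]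
    simp
  have hS : ∀ ξ : Space n, HasLineDerivAt ℝ (freeSymbol t)
      (freeSymbol t ξ * (((-8 * Real.pi ^ 2 * t * inner ℝ ξ m : ℝ) : ℂ) * Complex.I)) ξ m := by
    intro ξ
    unfold HasLineDerivAt freeSymbol
    have h0 : HasDerivAt (fun s : ℝ => ξ + s • m) m 0 := by
      simpa using ((hasDerivAt_id (0 : ℝ)).smul_const m).const_add ξ
    have h1 := (h0.norm_sq.const_mul (-4 * Real.pi ^ 2 * t)).ofReal_comp.mul_const Complex.I
    have h2 := h1.cexp
    simp only [zero_smul, add_zero] at h2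
    refine h2.congr_deriv ?_
    push_cast
    ring
  have key : SchwartzMap.smulLeftCLM ℂ (inner ℝ · m) (freeSchwartz t g) =
      freeSchwartz t (SchwartzMap.smulLeftCLM ℂ (inner ℝ · m) g) +
        (-2 * Complex.I * t) • freeSchwartz t (∂_{m} g) := by
    rw [← FourierTransform.fourierInv_fourier_eq (F := 𝓢(Space n, ℂ))
        (SchwartzMap.smulLeftCLM ℂ (inner ℝ · m) (freeSchwartz t g)),
      ← FourierTransform.fourierInv_fourier_eq (F := 𝓢(Space n, ℂ))
        (freeSchwartz t (SchwartzMap.smulLeftCLM ℂ (inner ℝ · m) g) +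
        (-2 * Complex.I * t) • freeSchwartz t (∂_{m} g))]
    congr 1
    ext ξ
    rw [hF, FourierTransform.fourier_add, add_apply, FourierTransform.fourier_smul, smul_apply,
      fourier_freeSchwartz_apply, fourier_freeSchwartz_apply, hF, hD]
    have hl : HasLineDerivAt ℝ (𝓕 g : 𝓢(Space n, ℂ)) (lineDeriv ℝ (𝓕 g : 𝓢(Space n, ℂ)) ξ m)
        ξ m := ((𝓕 g : 𝓢(Space n, ℂ)).differentiableAt).lineDifferentiableAt.hasLineDerivAt
    have hp : HasLineDerivAt ℝ (𝓕 (freeSchwartz t g) : 𝓢(Space n, ℂ))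
        (freeSymbol t ξ * (((-8 * Real.pi ^ 2 * t * inner ℝ ξ m : ℝ) : ℂ) * Complex.I) *
          (𝓕 g : 𝓢(Space n, ℂ)) ξ +
          freeSymbol t ξ * lineDeriv ℝ (𝓕 g : 𝓢(Space n, ℂ)) ξ m) ξ m := by
      have := HasDerivAt.mul (hS ξ) hl
      unfold HasLineDerivAt
      simp only [zero_smul, add_zero] at this
      simp_rw [fourier_freeSchwartz_apply]
      exact this
    rw [hp.lineDeriv]
    simp only [smul_eq_mul]
    push_cast
    field_simp
    have hI : Complex.I ^ 3 = -Complex.I := by rw [pow_succ, Complex.I_sq]; ring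
    rw [hI]
    ring
  have := congrArg (fun φ : 𝓢(Space n, ℂ) => φ x) key
  simp only [SchwartzMap.smulLeftCLM_apply_apply hm, add_apply, smul_apply, smul_eq_mul] at this
  rw [← this]
  exact (Complex.real_smul).symm

/-- Free Schwartz solutions decay faster than every power, uniformly on bounded time intervals: each
power of `‖x‖` is traded, through the commutation relation, for a Schwartz datum and a factor `|t|`.
-/
theorem exists_norm_pow_mul_freeSchwartz_le (N : ℕ) (T : ℝ) (g : 𝓢(Space n, ℂ)) :
    ∃ C : ℝ, ∀ t x, |t| ≤ T → ‖x‖ ^ N * ‖freeSchwartz t g x‖ ≤ C := by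
  induction N generalizing g with
  | zero =>
    exact ⟨_, fun t x _ => by simpa using norm_freeSchwartz_apply_le t g x⟩
  | succ N ih =>
    let b := EuclideanSpace.basisFun (Fin n) ℝ
    choose C1 hC1 using fun i => ih (SchwartzMap.smulLeftCLM ℂ (inner ℝ · (b i)) g)
    choose C2 hC2 using fun i => ih (LineDeriv.lineDerivOp (b i) g)
    refine ⟨∑ i, (C1 i + 2 * |T| * C2 i), fun t x ht => ?_⟩
    have hx : ‖x‖ ≤ ∑ i, |inner ℝ x (b i)| := by
      conv_lhs => rw [← b.sum_repr x]
      refine (norm_sum_le _ _).trans (Finset.sum_le_sum fun i _ => ?_)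
      rw [norm_smul, b.norm_eq_one, mul_one, b.repr_apply_apply, real_inner_comm, Real.norm_eq_abs]
    calc ‖x‖ ^ (N + 1) * ‖freeSchwartz t g x‖
        ≤ ‖x‖ ^ N * ((∑ i, |inner ℝ x (b i)|) * ‖freeSchwartz t g x‖) := by
          rw [pow_succ, mul_assoc]
          gcongr
      _ = ∑ i, ‖x‖ ^ N * (|inner ℝ x (b i)| * ‖freeSchwartz t g x‖) := by
          rw [Finset.sum_mul, Finset.mul_sum]
      _ ≤ _ := by
          refine Finset.sum_le_sum fun i _ => ?_
          have e : |inner ℝ x (b i)| * ‖freeSchwartz t g x‖ =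
              ‖((inner ℝ x (b i) : ℝ) : ℂ) * freeSchwartz t g x‖ := by
            rw [norm_mul, Complex.norm_real, Real.norm_eq_abs]
          rw [e, inner_mul_freeSchwartz]
          have h2 := hC2 i t x ht
          have h2' : 0 ≤ C2 i := (by positivity : (0 : ℝ) ≤ _).trans h2
          calc _ ≤ ‖x‖ ^ N * (‖freeSchwartz t (SchwartzMap.smulLeftCLM ℂ (inner ℝ · (b i)) g) x‖ +
                2 * |t| * ‖freeSchwartz t (LineDeriv.lineDerivOp (b i) g) x‖) := by
                gcongr
                refine (norm_add_le _ _).trans_eq ?_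
                simp
            _ = ‖x‖ ^ N * ‖freeSchwartz t (SchwartzMap.smulLeftCLM ℂ (inner ℝ · (b i)) g) x‖ +
                2 * |t| * (‖x‖ ^ N * ‖freeSchwartz t (LineDeriv.lineDerivOp (b i) g) x‖) := by
                ring
            _ ≤ _ := by
                refine add_le_add (hC1 i t x ht) ?_
                refine (mul_le_mul_of_nonneg_left h2 (by positivity)).trans ?_
                have : |t| ≤ |T| := ht.trans (le_abs_self T)
                gcongr

/-- A fixed weight, integrable to every power at least one, that dominates free Schwartz solutions
on bounded time intervals. -/
def weight (n : ℕ) (x : Space n) : ℝ := ((1 + ‖x‖) ^ (n + 1))⁻¹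

theorem weight_pos (x : Space n) : 0 < weight n x := by
  unfold weight
  positivity

theorem weight_le_one (x : Space n) : weight n x ≤ 1 := by
  unfold weight
  exact inv_le_one_of_one_le₀ (one_le_pow₀ (by linarith [norm_nonneg x]))

theorem continuous_weight : Continuous (weight n) := by
  unfold weight
  refine Continuous.inv₀ (by fun_prop) fun x => ?_
  positivity

theorem exists_freeSchwartz_le_weight (T : ℝ) (g : 𝓢(Space n, ℂ)) :
    ∃ C : ℝ, 0 ≤ C ∧ ∀ t x, |t| ≤ T → ‖freeSchwartz t g x‖ ≤ C * weight n x := by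
  obtain ⟨C0, h0⟩ := exists_norm_pow_mul_freeSchwartz_le 0 T g
  obtain ⟨C1, h1⟩ := exists_norm_pow_mul_freeSchwartz_le (n + 1) T g
  refine ⟨2 ^ n * (|C0| + |C1|), by positivity, fun t x ht => ?_⟩
  unfold weight
  rw [← div_eq_mul_inv, le_div_iff₀ (by positivity)]
  have h2 : (1 + ‖x‖) ^ (n + 1) ≤ 2 ^ n * (1 ^ (n + 1) + ‖x‖ ^ (n + 1)) :=
    add_pow_le zero_le_one (norm_nonneg x) (n + 1)
  calc _ ≤ ‖freeSchwartz t g x‖ * (2 ^ n * (1 ^ (n + 1) + ‖x‖ ^ (n + 1))) := by gcongr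
    _ = 2 ^ n * (‖x‖ ^ 0 * ‖freeSchwartz t g x‖ + ‖x‖ ^ (n + 1) * ‖freeSchwartz t g x‖) := by ring
    _ ≤ _ := by
      gcongr
      · exact (h0 t x ht).trans (le_abs_self _)
      · exact (h1 t x ht).trans (le_abs_self _)

/-- Free Schwartz solutions are Lipschitz in time with respect to the weight. -/
theorem exists_freeSchwartz_sub_le_weight (T : ℝ) (g : 𝓢(Space n, ℂ)) :
    ∃ C : ℝ, 0 ≤ C ∧ ∀ s t x, |s| ≤ T → |t| ≤ T →
      ‖freeSchwartz s g x - freeSchwartz t g x‖ ≤ C * weight n x * |s - t| := by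
  obtain ⟨C, hC, h⟩ := exists_freeSchwartz_le_weight T (Δ g)
  refine ⟨C, hC, fun s t x hs ht => ?_⟩
  have := Convex.norm_image_sub_le_of_norm_hasDerivWithin_le (s := Icc (-T) T)
    (f := fun s => freeSchwartz s g x) (C := C * weight n x)
    (fun r _ => (hasDerivAt_freeSchwartz_apply r g x).hasDerivWithinAt)
    (fun r hr => by
      rw [norm_mul, Complex.norm_I, one_mul]
      exact h r x (abs_le.2 hr)) (convex_Icc _ _) (abs_le.1 ht) (abs_le.1 hs)
  rwa [Real.norm_eq_abs] at this

theorem integrable_weight : Integrable (weight n) := by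
  have h := integrable_one_add_norm (E := Space n) (μ := volume) (r := (n + 1 : ℕ)) (by simp)
  refine h.congr (Filter.Eventually.of_forall fun x => ?_)
  simp only [weight]
  rw [Real.rpow_neg (by positivity), Real.rpow_natCast]

/-! ### The dispersive estimate -/

theorem continuous_fourier {f : Space n → ℂ} (hf : Integrable f) : Continuous (𝓕 f) :=
  VectorFourier.fourierIntegral_continuous Real.continuous_fourierChar
    (by exact continuous_inner) hf

theorem norm_fourier_le (f : Space n → ℂ) (ξ : Space n) : ‖𝓕 f ξ‖ ≤ ∫ x, ‖f x‖ :=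
  VectorFourier.norm_fourierIntegral_le_integral_norm _ _ _ _ _

theorem integral_fourier_mul_eq {f g : Space n → ℂ} (hf : Integrable f) (hg : Integrable g) :
    ∫ ξ, 𝓕 f ξ * g ξ = ∫ x, f x * 𝓕 g x := by
  have h := VectorFourier.integral_fourierIntegral_smul_eq_flip (L := innerₗ (Space n))
    Real.continuous_fourierChar (by exact continuous_inner) hf hg
  simp only [flip_innerₗ] at h
  exact h

/-- On `L¹ ∩ L²` the Plancherel transform is the Fourier integral. -/
theorem coeFn_fourier_eq_of_integrable (f : L2 n) (hf : Integrable f) :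
    ((𝓕 f : L2 n) : Space n → ℂ) =ᵐ[volume] 𝓕 (f : Space n → ℂ) := by
  refine ae_eq_of_integral_contDiff_smul_eq ((Lp.memLp _).locallyIntegrable (by norm_num))
    (continuous_fourier hf).locallyIntegrable fun φ hφ hcs => ?_
  have hcs' : HasCompactSupport fun x => (φ x : ℂ) := hcs.comp_left Complex.ofReal_zero
  let ψ : 𝓢(Space n, ℂ) := hcs'.toSchwartzMap (Complex.ofRealCLM.contDiff.comp hφ)
  have hψ : ∀ x, ψ x = (φ x : ℂ) := fun x => rfl
  have h1 := congrArg (fun T : 𝓢'(Space n, ℂ) => T ψ) (Lp.fourier_toTemperedDistribution_eq f)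
  simp only [TemperedDistribution.fourier_apply, Lp.toTemperedDistribution_apply, smul_eq_mul,
    hψ] at h1
  have h2 : ∫ x, (φ x : ℂ) * 𝓕 (f : Space n → ℂ) x =
      ∫ x, (𝓕 ψ : 𝓢(Space n, ℂ)) x * f x := by
    rw [SchwartzMap.fourier_coe]
    have := integral_fourier_mul_eq ψ.integrable hf
    rw [this]
    rfl
  simp only [Complex.real_smul]
  rw [h2, h1]

/-- The multiplier `exp(-b|ξ|²)` is convolution with a Gaussian of supremum at most `(π/|b|)^{n/2}`,
hence is bounded from `L¹` to `L^∞` by that number. -/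
theorem norm_integral_fourier_gaussian_le {f g : Space n → ℂ} (hf : Integrable f)
    (hg : Integrable g) {b : ℂ} (hb : 0 < b.re) :
    ‖∫ ξ, (starRingEnd ℂ) (𝓕 f ξ) * (Complex.exp (-b * ‖ξ‖ ^ 2) * 𝓕 g ξ)‖ ≤
      (Real.pi / ‖b‖) ^ ((n : ℝ) / 2) * ((∫ x, ‖f x‖) * ∫ x, ‖g x‖) := by
  have hb0 : b ≠ 0 := by
    rintro rfl
    simp at hb
  have hG : Integrable fun ξ : Space n => Complex.exp (-b * ‖ξ‖ ^ 2) := by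
    simpa using GaussianFourier.integrable_cexp_neg_mul_sq_norm_add hb 0 (0 : Space n)
  have hfc := continuous_fourier hf
  have hA : Integrable fun ξ => (starRingEnd ℂ) (𝓕 f ξ) * Complex.exp (-b * ‖ξ‖ ^ 2) := by
    refine hG.bdd_mul (c := ∫ x, ‖f x‖)
      (Complex.continuous_conj.comp hfc).aestronglyMeasurable
      (Filter.Eventually.of_forall fun ξ => ?_)
    rw [RCLike.norm_conj]
    exact norm_fourier_le f ξ
  have h1 : ∫ ξ, (starRingEnd ℂ) (𝓕 f ξ) * (Complex.exp (-b * ‖ξ‖ ^ 2) * 𝓕 g ξ) =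
      ∫ y, 𝓕 (fun ξ => (starRingEnd ℂ) (𝓕 f ξ) * Complex.exp (-b * ‖ξ‖ ^ 2)) y * g y := by
    rw [integral_fourier_mul_eq hA hg]
    simp_rw [mul_assoc]
  -- the inner integral is the transform of a modulated Gaussian paired with `f`
  have h2 : ∀ y, ‖𝓕 (fun ξ => (starRingEnd ℂ) (𝓕 f ξ) * Complex.exp (-b * ‖ξ‖ ^ 2)) y‖ ≤
      (Real.pi / ‖b‖) ^ ((n : ℝ) / 2) * ∫ x, ‖f x‖ := by
    intro y
    let b' := (starRingEnd ℂ) b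
    have hb' : 0 < b'.re := by simpa [b'] using hb
    let H : Space n → ℂ := fun ξ =>
      Complex.exp (-b' * ‖ξ‖ ^ 2 + 2 * Real.pi * Complex.I * (inner ℝ y ξ : ℝ))
    have hH : Integrable H :=
      GaussianFourier.integrable_cexp_neg_mul_sq_norm_add hb' (2 * Real.pi * Complex.I) y
    have e1 : 𝓕 (fun ξ => (starRingEnd ℂ) (𝓕 f ξ) * Complex.exp (-b * ‖ξ‖ ^ 2)) y =
        (starRingEnd ℂ) (∫ ξ, 𝓕 f ξ * H ξ) := by
      rw [← integral_conj, Real.fourier_eq']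
      refine integral_congr_ae (Filter.Eventually.of_forall fun ξ => ?_)
      simp only [smul_eq_mul, map_mul, H, ← Complex.exp_conj, map_add, b', map_neg,
        Complex.conj_conj, map_pow, Complex.conj_ofReal, Complex.conj_I, map_ofNat]
      rw [Complex.exp_add, real_inner_comm ξ y]
      push_cast
      rw [show -2 * (Real.pi : ℂ) * (inner ℝ ξ y : ℝ) * Complex.I =
        2 * Real.pi * -Complex.I * (inner ℝ ξ y : ℝ) by ring]
      ring
    rw [e1, RCLike.norm_conj, integral_fourier_mul_eq hf hH]
    have hHb : ∀ x, ‖𝓕 H x‖ ≤ (Real.pi / ‖b‖) ^ ((n : ℝ) / 2) := by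
      intro x
      have hn : ((n : ℂ) / 2) = (((n : ℝ) / 2 : ℝ) : ℂ) := by push_cast; rfl
      rw [fourier_gaussian_innerProductSpace' hb' y x, finrank_euclideanSpace, Fintype.card_fin,
        hn, norm_mul, Complex.norm_cpow_real, norm_div, Complex.norm_exp]
      have e2 : ‖b'‖ = ‖b‖ := RCLike.norm_conj b
      rw [e2, Complex.norm_of_nonneg Real.pi_pos.le]
      refine mul_le_of_le_one_right (by positivity) (Real.exp_le_one_iff.2 ?_)
      have e3 : (-(Real.pi : ℂ) ^ 2 * (‖y - x‖ : ℂ) ^ 2 / b') =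
          ((-(Real.pi ^ 2 * ‖y - x‖ ^ 2) : ℝ) : ℂ) * b'⁻¹ := by
        push_cast
        ring
      rw [e3, Complex.re_ofReal_mul, Complex.inv_re]
      have : 0 ≤ b'.re / Complex.normSq b' := div_nonneg hb'.le (Complex.normSq_nonneg _)
      nlinarith [mul_nonneg (by positivity : 0 ≤ Real.pi ^ 2 * ‖y - x‖ ^ 2) this]
    calc _ ≤ ∫ x, ‖f x * 𝓕 H x‖ := norm_integral_le_integral_norm _
      _ ≤ ∫ x, (Real.pi / ‖b‖) ^ ((n : ℝ) / 2) * ‖f x‖ := by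
        refine integral_mono_of_nonneg (Filter.Eventually.of_forall fun x => norm_nonneg _)
          (hf.norm.const_mul _) (Filter.Eventually.of_forall fun x => ?_)
        simp only [norm_mul]
        rw [mul_comm]
        exact mul_le_mul_of_nonneg_right (hHb x) (norm_nonneg _)
      _ = _ := integral_const_mul _ _
  rw [h1]
  calc _ ≤ ∫ y, ‖𝓕 (fun ξ => (starRingEnd ℂ) (𝓕 f ξ) * Complex.exp (-b * ‖ξ‖ ^ 2)) y * g y‖ :=
        norm_integral_le_integral_norm _
    _ ≤ ∫ y, ((Real.pi / ‖b‖) ^ ((n : ℝ) / 2) * ∫ x, ‖f x‖) * ‖g y‖ := by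
        refine integral_mono_of_nonneg (Filter.Eventually.of_forall fun x => norm_nonneg _)
          (hg.norm.const_mul _) (Filter.Eventually.of_forall fun y => ?_)
        simp only [norm_mul]
        exact mul_le_mul_of_nonneg_right (h2 y) (norm_nonneg _)
    _ = _ := by rw [integral_const_mul, mul_assoc]

/-- The dispersive estimate. Regularising the symbol by `exp(-δ|ξ|²)` turns the propagator into
convolution with a Gaussian of complex width, which is bounded by `|t|^{-n/2}`. -/
theorem norm_inner_freeProp_le (f g : L2 n) (hf : Integrable f) (hg : Integrable g) {t : ℝ}
    (ht : t ≠ 0) :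
    ‖inner ℂ f (freeProp t g)‖ ≤ |t| ^ (-((n : ℝ) / 2)) * ((∫ x, ‖f x‖) * ∫ x, ‖g x‖) := by
  have h0 : inner ℂ f (freeProp t g) =
      ∫ ξ, (starRingEnd ℂ) ((𝓕 f : L2 n) ξ) * (freeSymbol t ξ * (𝓕 g : L2 n) ξ) := by
    rw [← Lp.inner_fourier_eq, freeProp_apply, L2.inner_def]
    refine integral_congr_ae ?_
    filter_upwards [coeFn_fourier_freeEvolution t g] with ξ h
    rw [h, RCLike.inner_apply, mul_comm]
  have hb : ∀ k : ℕ, 0 < (((1 / ((k : ℝ) + 1) : ℝ) : ℂ) +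
      ((4 * Real.pi ^ 2 * t : ℝ) : ℂ) * Complex.I).re := by
    intro k
    rw [Complex.add_re, Complex.ofReal_re, Complex.re_ofReal_mul, Complex.I_re, mul_zero, add_zero]
    positivity
  have hlim : Filter.Tendsto (fun k : ℕ => ∫ ξ, (starRingEnd ℂ) (𝓕 (f : Space n → ℂ) ξ) *
      (Complex.exp (-(((1 / ((k : ℝ) + 1) : ℝ) : ℂ) +
        ((4 * Real.pi ^ 2 * t : ℝ) : ℂ) * Complex.I) * ‖ξ‖ ^ 2) * 𝓕 (g : Space n → ℂ) ξ))
      Filter.atTop (nhds (inner ℂ f (freeProp t g))) := by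
    rw [h0]
    refine tendsto_integral_of_dominated_convergence
      (fun ξ => ‖(𝓕 f : L2 n) ξ‖ * ‖(𝓕 g : L2 n) ξ‖) ?_ ?_ ?_ ?_
    · intro k
      refine Continuous.aestronglyMeasurable ?_
      have := continuous_fourier hf
      have := continuous_fourier hg
      have h3 := Complex.continuous_conj.comp (continuous_fourier hf)
      exact h3.mul (by fun_prop)
    · have := (L2.integrable_inner (𝕜 := ℂ) (𝓕 f : L2 n) (𝓕 g : L2 n)).norm
      refine this.congr (Filter.Eventually.of_forall fun ξ => ?_)
      simp only [RCLike.inner_apply, norm_mul, RCLike.norm_conj]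
      rw [mul_comm]
    · intro k
      filter_upwards [coeFn_fourier_eq_of_integrable f hf,
        coeFn_fourier_eq_of_integrable g hg] with ξ h1 h2
      rw [h1, h2, norm_mul, norm_mul, RCLike.norm_conj, Complex.norm_exp]
      refine mul_le_mul_of_nonneg_left ?_ (norm_nonneg _)
      refine mul_le_of_le_one_left (norm_nonneg _) (Real.exp_le_one_iff.2 ?_)
      rw [← Complex.ofReal_pow, Complex.re_mul_ofReal, Complex.neg_re]
      nlinarith [mul_nonneg (hb k).le (sq_nonneg ‖ξ‖)]
    · filter_upwards [coeFn_fourier_eq_of_integrable f hf,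
        coeFn_fourier_eq_of_integrable g hg] with ξ h1 h2
      rw [h1, h2]
      refine Filter.Tendsto.const_mul _ (Filter.Tendsto.mul_const _ ?_)
      have h3 : Filter.Tendsto (fun k : ℕ => (1 / ((k : ℝ) + 1) : ℝ)) Filter.atTop (nhds 0) :=
        tendsto_one_div_add_atTop_nhds_zero_nat
      have h4 : Continuous fun δ : ℝ => Complex.exp (-((δ : ℂ) +
        ((4 * Real.pi ^ 2 * t : ℝ) : ℂ) * Complex.I) * ‖ξ‖ ^ 2) := by fun_prop
      have h5 := (h4.tendsto 0).comp h3
      have h6 : freeSymbol t ξ = Complex.exp (-(((0 : ℝ) : ℂ) +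
          ((4 * Real.pi ^ 2 * t : ℝ) : ℂ) * Complex.I) * ‖ξ‖ ^ 2) := by
        unfold freeSymbol
        congr 1
        push_cast
        ring
      rw [h6]
      exact h5
  refine le_of_tendsto hlim.norm (Filter.Eventually.of_forall fun k => ?_)
  refine (norm_integral_fourier_gaussian_le hf hg (hb k)).trans ?_
  refine mul_le_mul_of_nonneg_right ?_ (by positivity)
  rw [Real.rpow_neg (abs_nonneg t), ← Real.inv_rpow (abs_nonneg t)]
  refine Real.rpow_le_rpow (by positivity) ?_ (by positivity)
  have h7 : 4 * Real.pi ^ 2 * |t| ≤ ‖((1 / ((k : ℝ) + 1) : ℝ) : ℂ) +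
      ((4 * Real.pi ^ 2 * t : ℝ) : ℂ) * Complex.I‖ := by
    refine le_trans (le_of_eq ?_) (Complex.abs_im_le_norm _)
    rw [Complex.add_im, Complex.ofReal_im, Complex.im_ofReal_mul, Complex.I_im, mul_one, zero_add,
      abs_mul, abs_of_pos (by positivity : 0 < 4 * Real.pi ^ 2)]
  have h8 : 0 < |t| := abs_pos.2 ht
  have h9 := Real.pi_gt_three
  rw [div_le_iff₀ (lt_of_lt_of_le (by positivity) h7)]
  calc Real.pi ≤ |t|⁻¹ * (4 * Real.pi ^ 2 * |t|) := by
        field_simp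
        nlinarith
    _ ≤ _ := by gcongr

/-! ### Bilinear estimates on time windows -/

/-- Convolution with an integrable kernel is bounded on `L²`, in bilinear form. -/
theorem lintegral_sub_mul_mul_le {k φ ψ : ℝ → ℝ≥0∞} (hk : Measurable k) (hφ : Measurable φ)
    (hψ : Measurable ψ) :
    ∫⁻ p : ℝ × ℝ, k (p.1 - p.2) * φ p.1 * ψ p.2 ≤
      (∫⁻ u, k u) * ((∫⁻ t, φ t ^ 2) ^ (1 / 2 : ℝ) * (∫⁻ t, ψ t ^ 2) ^ (1 / 2 : ℝ)) := by
  have hs : Measurable fun p : ℝ × ℝ => p.1 - p.2 := measurable_fst.sub measurable_snd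
  have hks := hk.comp hs
  have h1 : ∀ p : ℝ × ℝ, k (p.1 - p.2) * φ p.1 * ψ p.2 =
      (k (p.1 - p.2) ^ (1 / 2 : ℝ) * φ p.1) * (k (p.1 - p.2) ^ (1 / 2 : ℝ) * ψ p.2) := by
    intro p
    have : k (p.1 - p.2) = k (p.1 - p.2) ^ (1 / 2 : ℝ) * k (p.1 - p.2) ^ (1 / 2 : ℝ) := by
      rw [← ENNReal.rpow_add_of_nonneg _ _ (by norm_num) (by norm_num)]
      norm_num
    conv_lhs => rw [this]
    ring
  have h2 : ∀ a b : ℝ≥0∞, (a ^ (1 / 2 : ℝ) * b) ^ (2 : ℝ) = a * b ^ 2 := by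
    intro a b
    rw [ENNReal.mul_rpow_of_nonneg _ _ (by norm_num), ← ENNReal.rpow_mul, ENNReal.rpow_two]
    norm_num
  have hA : ∫⁻ p : ℝ × ℝ, k (p.1 - p.2) * φ p.1 ^ 2 = (∫⁻ u, k u) * ∫⁻ t, φ t ^ 2 := by
    rw [Measure.volume_eq_prod, lintegral_prod _ (by fun_prop)]
    simp only
    have : ∀ t, ∫⁻ s, k (t - s) * φ t ^ 2 = (∫⁻ u, k u) * φ t ^ 2 := by
      intro t
      rw [lintegral_mul_const _ (by fun_prop), lintegral_sub_left_eq_self k t]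
    simp_rw [this]
    rw [lintegral_const_mul _ (by fun_prop)]
  have hB : ∫⁻ p : ℝ × ℝ, k (p.1 - p.2) * ψ p.2 ^ 2 = (∫⁻ u, k u) * ∫⁻ t, ψ t ^ 2 := by
    rw [Measure.volume_eq_prod, lintegral_prod_symm _ (by fun_prop)]
    simp only
    have : ∀ s, ∫⁻ t, k (t - s) * ψ s ^ 2 = (∫⁻ u, k u) * ψ s ^ 2 := by
      intro s
      rw [lintegral_mul_const _ (by fun_prop), lintegral_sub_right_eq_self k s]
    simp_rw [this]
    rw [lintegral_const_mul _ (by fun_prop)]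
  simp_rw [h1]
  refine (ENNReal.lintegral_mul_le_Lp_mul_Lq volume Real.HolderConjugate.two_two
    (by fun_prop) (by fun_prop)).trans_eq ?_
  simp_rw [h2]
  rw [hA, hB, ENNReal.mul_rpow_of_nonneg _ _ (by norm_num),
    ENNReal.mul_rpow_of_nonneg _ _ (by norm_num)]
  have : (∫⁻ u, k u) = (∫⁻ u, k u) ^ (1 / 2 : ℝ) * (∫⁻ u, k u) ^ (1 / 2 : ℝ) := by
    rw [← ENNReal.rpow_add_of_nonneg _ _ (by norm_num) (by norm_num)]
    norm_num
  conv_rhs => rw [this]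
  ring

/-- The kernel `|u|^{-1/2}` cut off to `|u| ≤ ℓ`. -/
def sqrtKernel (ℓ : ℝ) : ℝ → ℝ≥0∞ :=
  (Icc (-ℓ) ℓ).indicator fun u => ENNReal.ofReal (|u| ^ (-(1 / 2) : ℝ))

theorem measurable_sqrtKernel (ℓ : ℝ) : Measurable (sqrtKernel ℓ) := by
  unfold sqrtKernel
  exact Measurable.indicator (by fun_prop) measurableSet_Icc

theorem lintegral_sqrtKernel {ℓ : ℝ} (hℓ : 0 ≤ ℓ) :
    ∫⁻ u, sqrtKernel ℓ u ≤ ENNReal.ofReal (4 * ℓ ^ (1 / 2 : ℝ)) := by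
  have hI : ∫⁻ u in Ioc 0 ℓ, ENNReal.ofReal (|u| ^ (-(1 / 2) : ℝ)) =
      ENNReal.ofReal (2 * ℓ ^ (1 / 2 : ℝ)) := by
    have h1 : ∫⁻ u in Ioc 0 ℓ, ENNReal.ofReal (|u| ^ (-(1 / 2) : ℝ)) =
        ∫⁻ u in Ioc 0 ℓ, ENNReal.ofReal (u ^ (-(1 / 2) : ℝ)) := by
      refine setLIntegral_congr_fun measurableSet_Ioc fun u hu => ?_
      rw [abs_of_pos hu.1]
    have hint : IntervalIntegrable (fun u : ℝ => u ^ (-(1 / 2) : ℝ)) volume 0 ℓ :=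
      intervalIntegral.intervalIntegrable_rpow' (by norm_num)
    rw [h1, ← ofReal_integral_eq_lintegral_ofReal ((intervalIntegrable_iff_integrableOn_Ioc_of_le hℓ).1 hint)]
    · rw [← intervalIntegral.integral_of_le hℓ, integral_rpow (Or.inl (by norm_num))]
      congr 1
      rw [show (-(1 / 2) + 1 : ℝ) = 1 / 2 by norm_num, Real.zero_rpow (by norm_num)]
      ring
    · filter_upwards [ae_restrict_mem measurableSet_Ioc] with u hu
      exact Real.rpow_nonneg hu.1.le _
  have hJ : ∫⁻ u in Ico (-ℓ) 0, ENNReal.ofReal (|u| ^ (-(1 / 2) : ℝ)) =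
      ENNReal.ofReal (2 * ℓ ^ (1 / 2 : ℝ)) := by
    rw [← hI, ← lintegral_indicator measurableSet_Ico, ← lintegral_indicator measurableSet_Ioc,
      ← lintegral_neg_eq_self]
    congr 1
    funext u
    have hiff : -u ∈ Ico (-ℓ) 0 ↔ u ∈ Ioc 0 ℓ := by
      simp only [mem_Ico, mem_Ioc]
      constructor <;> rintro ⟨h1, h2⟩ <;> constructor <;> linarith
    by_cases hu : u ∈ Ioc 0 ℓ
    · rw [indicator_of_mem hu, indicator_of_mem (hiff.2 hu), abs_neg]
    · rw [indicator_of_notMem hu, indicator_of_notMem (fun h => hu (hiff.1 h))]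
  have hsub : Icc (-ℓ) ℓ ⊆ (Ico (-ℓ) 0 ∪ Ioc 0 ℓ) ∪ {0} := by
    intro u hu
    rcases lt_trichotomy u 0 with h | h | h
    · exact Or.inl (Or.inl ⟨hu.1, h⟩)
    · exact Or.inr h
    · exact Or.inl (Or.inr ⟨h, hu.2⟩)
  unfold sqrtKernel
  rw [lintegral_indicator measurableSet_Icc]
  calc _ ≤ ∫⁻ u in (Ico (-ℓ) 0 ∪ Ioc 0 ℓ) ∪ {0}, ENNReal.ofReal (|u| ^ (-(1 / 2) : ℝ)) :=
        lintegral_mono_set hsub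
    _ ≤ (ENNReal.ofReal (2 * ℓ ^ (1 / 2 : ℝ)) + ENNReal.ofReal (2 * ℓ ^ (1 / 2 : ℝ))) + 0 := by
        refine (lintegral_union_le _ _ _).trans (add_le_add ?_ ?_)
        · refine (lintegral_union_le _ _ _).trans (add_le_add hJ.le hI.le)
        · rw [Measure.restrict_singleton, Real.volume_singleton, zero_smul, lintegral_zero_measure]
    _ = _ := by
        rw [add_zero, ← ENNReal.ofReal_add (by positivity) (by positivity)]
        congr 1
        ring

section Window

variable {H : Type*} [NormedAddCommGroup H] [InnerProductSpace ℂ H]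

/-- The part of the bilinear form `∬ ⟨P t, Q s⟩` coming from time differences `t - s ∈ W`. -/
def windowForm (W : Set ℝ) (P Q : ℝ → H) : ℂ :=
  ∫ p in {p : ℝ × ℝ | p.1 - p.2 ∈ W}, inner ℂ (P p.1) (Q p.2)

theorem measurableSet_window {W : Set ℝ} (hW : MeasurableSet W) :
    MeasurableSet {p : ℝ × ℝ | p.1 - p.2 ∈ W} :=
  (measurable_fst.sub measurable_snd) hW

/-- The symmetric window estimate: on a window of length `ℓ`, correlations bounded by `A φ(t) ψ(s)`
give `A ℓ ‖φ‖₂ ‖ψ‖₂`. -/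
theorem enorm_windowForm_le_of_kernel {W : Set ℝ} (hW : MeasurableSet W) {P Q : ℝ → H}
    {φ ψ : ℝ → ℝ≥0∞} (hφ : Measurable φ) (hψ : Measurable ψ) {A ℓ : ℝ≥0∞} (hℓ : volume W ≤ ℓ)
    (h : ∀ t s, t - s ∈ W → ‖inner ℂ (P t) (Q s)‖ₑ ≤ A * φ t * ψ s) :
    ‖windowForm W P Q‖ₑ ≤
      A * ℓ * ((∫⁻ t, φ t ^ 2) ^ (1 / 2 : ℝ) * (∫⁻ t, ψ t ^ 2) ^ (1 / 2 : ℝ)) := by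
  have hmeas : Measurable (W.indicator fun _ : ℝ => A) := measurable_const.indicator hW
  calc ‖windowForm W P Q‖ₑ
      ≤ ∫⁻ p in {p : ℝ × ℝ | p.1 - p.2 ∈ W}, ‖inner ℂ (P p.1) (Q p.2)‖ₑ :=
        enorm_integral_le_lintegral_enorm _
    _ ≤ ∫⁻ p in {p : ℝ × ℝ | p.1 - p.2 ∈ W}, A * φ p.1 * ψ p.2 :=
        setLIntegral_mono' (measurableSet_window hW) fun p hp => h _ _ hp
    _ = ∫⁻ p : ℝ × ℝ, W.indicator (fun _ => A) (p.1 - p.2) * φ p.1 * ψ p.2 := by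
        rw [← lintegral_indicator (measurableSet_window hW)]
        congr 1
        funext p
        by_cases hp : p.1 - p.2 ∈ W
        · rw [indicator_of_mem (by exact hp), indicator_of_mem hp]
        · rw [indicator_of_notMem (by exact hp), indicator_of_notMem hp, zero_mul, zero_mul]
    _ ≤ (∫⁻ u, W.indicator (fun _ => A) u) *
        ((∫⁻ t, φ t ^ 2) ^ (1 / 2 : ℝ) * (∫⁻ t, ψ t ^ 2) ^ (1 / 2 : ℝ)) :=
        lintegral_sub_mul_mul_le hmeas hφ hψ
    _ ≤ _ := by
        rw [lintegral_indicator_const hW]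
        gcongr

/-- If the correlations of `Q` decay like `|t - s|^{-1/2}`, then its integral over a short set of
times is small. The square of the integral is a double integral of correlations, and the kernel `|t
- s|^{-1/2}` is integrable on bounded sets. -/
theorem enorm_setIntegral_sq_le [CompleteSpace H] {J : Set ℝ} (hJ : MeasurableSet J) {ℓ : ℝ} (hℓ : 0 ≤ ℓ)
    (hJℓ : ∀ x ∈ J, ∀ y ∈ J, |x - y| ≤ ℓ) {Q : ℝ → H} (hQ : Integrable Q) {ψ : ℝ → ℝ≥0∞}
    (hψ : Measurable ψ) {A : ℝ≥0∞}
    (h : ∀ t s, t ≠ s →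
      ‖inner ℂ (Q t) (Q s)‖ₑ ≤ A * ENNReal.ofReal (|t - s| ^ (-(1 / 2) : ℝ)) * ψ t * ψ s) :
    ‖∫ s in J, Q s‖ₑ ^ 2 ≤ A * ENNReal.ofReal (4 * ℓ ^ (1 / 2 : ℝ)) * ∫⁻ s in J, ψ s ^ 2 := by
  have hQJ : IntegrableOn Q J := hQ.integrableOn
  have e1 : inner ℂ (∫ s in J, Q s) (∫ s in J, Q s) =
      ∫ t in J, ∫ s in J, inner ℂ (Q t) (Q s) := by
    have h1 : inner ℂ (∫ s in J, Q s) (∫ s in J, Q s) =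
        ∫ t in J, inner ℂ (Q t) (∫ s in J, Q s) := by
      rw [← inner_conj_symm, ← integral_inner hQJ, ← integral_conj]
      simp_rw [inner_conj_symm]
    rw [h1]
    congr 1
    funext t
    exact (integral_inner hQJ (Q t)).symm
  have e2 : ‖∫ s in J, Q s‖ₑ ^ 2 = ‖inner ℂ (∫ s in J, Q s) (∫ s in J, Q s)‖ₑ := by
    rw [inner_self_eq_norm_sq_to_K, ← ofReal_norm, ← ofReal_norm,
      ← ENNReal.ofReal_pow (norm_nonneg _)]
    congr 1
    simp
  set ψJ : ℝ → ℝ≥0∞ := J.indicator ψ with hψJ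
  have hψJm : Measurable ψJ := hψ.indicator hJ
  have hne : ∀ t : ℝ, ∀ᵐ s : ℝ, t ≠ s := by
    intro t
    filter_upwards [compl_mem_ae_iff.2 (Real.volume_singleton (a := t))] with s hs
    exact fun h => hs h.symm
  have hk : Measurable fun u => A * sqrtKernel ℓ u := (measurable_sqrtKernel ℓ).const_mul A
  calc ‖∫ s in J, Q s‖ₑ ^ 2 = ‖∫ t in J, ∫ s in J, inner ℂ (Q t) (Q s)‖ₑ := by rw [e2, e1]
    _ ≤ ∫⁻ t in J, ‖∫ s in J, inner ℂ (Q t) (Q s)‖ₑ := enorm_integral_le_lintegral_enorm _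
    _ ≤ ∫⁻ t in J, ∫⁻ s in J, ‖inner ℂ (Q t) (Q s)‖ₑ :=
        lintegral_mono fun t => enorm_integral_le_lintegral_enorm _
    _ ≤ ∫⁻ t, ∫⁻ s, (A * sqrtKernel ℓ (t - s)) * ψJ t * ψJ s := by
        rw [← lintegral_indicator hJ]
        refine lintegral_mono fun t => ?_
        by_cases ht : t ∈ J
        · rw [indicator_of_mem ht, ← lintegral_indicator hJ]
          refine lintegral_mono_ae ?_
          filter_upwards [hne t] with s hs
          by_cases hsJ : s ∈ J
          · rw [indicator_of_mem hsJ, hψJ, indicator_of_mem ht, indicator_of_mem hsJ, sqrtKernel,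
              indicator_of_mem (mem_Icc.2 (abs_le.1 (hJℓ t ht s hsJ)))]
            exact h t s hs
          · rw [indicator_of_notMem hsJ]
            exact zero_le
        · rw [indicator_of_notMem ht]
          exact zero_le
    _ = ∫⁻ p : ℝ × ℝ, (A * sqrtKernel ℓ (p.1 - p.2)) * ψJ p.1 * ψJ p.2 := by
        rw [Measure.volume_eq_prod, lintegral_prod]
        exact (((hk.comp (measurable_fst.sub measurable_snd)).mul
          (hψJm.comp measurable_fst)).mul (hψJm.comp measurable_snd)).aemeasurable
    _ ≤ (∫⁻ u, A * sqrtKernel ℓ u) *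
        ((∫⁻ t, ψJ t ^ 2) ^ (1 / 2 : ℝ) * (∫⁻ t, ψJ t ^ 2) ^ (1 / 2 : ℝ)) :=
        lintegral_sub_mul_mul_le hk hψJm hψJm
    _ ≤ _ := by
        have e3 : ∫⁻ t, ψJ t ^ 2 = ∫⁻ s in J, ψ s ^ 2 := by
          rw [← lintegral_indicator hJ]
          congr 1
          funext t
          by_cases ht : t ∈ J <;> simp [hψJ, ht]
        rw [← ENNReal.rpow_add_of_nonneg _ _ (by norm_num) (by norm_num),
          lintegral_const_mul _ (measurable_sqrtKernel ℓ), e3]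
        norm_num only [ENNReal.rpow_one]
        gcongr
        exact lintegral_sqrtKernel hℓ

/-- The asymmetric window estimate: `L²` control of `P`, and decay of the correlations of `Q`. -/
theorem enorm_windowForm_le_of_decay [CompleteSpace H] {W : Set ℝ} (hW : MeasurableSet W) {ℓ : ℝ} (hℓ : 0 ≤ ℓ)
    (hWv : volume W ≤ ENNReal.ofReal ℓ) (hWℓ : ∀ x ∈ W, ∀ y ∈ W, |x - y| ≤ ℓ) {P Q : ℝ → H}
    (hP : Integrable P) (hQ : Integrable Q) {φ ψ : ℝ → ℝ≥0∞} (hφ : Measurable φ)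
    (hψ : Measurable ψ) {A μ : ℝ≥0∞} (hPφ : ∀ t, ‖P t‖ₑ ≤ μ * φ t)
    (h : ∀ t s, t ≠ s →
      ‖inner ℂ (Q t) (Q s)‖ₑ ≤ A * ENNReal.ofReal (|t - s| ^ (-(1 / 2) : ℝ)) * ψ t * ψ s) :
    ‖windowForm W P Q‖ₑ ≤
      μ * (A * ENNReal.ofReal (4 * ℓ ^ (1 / 2 : ℝ))) ^ (1 / 2 : ℝ) *
        ENNReal.ofReal ℓ ^ (1 / 2 : ℝ) *
        ((∫⁻ t, φ t ^ 2) ^ (1 / 2 : ℝ) * (∫⁻ t, ψ t ^ 2) ^ (1 / 2 : ℝ)) := by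
  set B := A * ENNReal.ofReal (4 * ℓ ^ (1 / 2 : ℝ)) with hB
  let J : ℝ → Set ℝ := fun t => {s | t - s ∈ W}
  have hJm : ∀ t, MeasurableSet (J t) := fun t => (measurable_const.sub measurable_id) hW
  have hint : Integrable (fun p : ℝ × ℝ => inner ℂ (P p.1) (Q p.2)) (volume.prod volume) := by
    refine Integrable.mono' (hP.norm.mul_prod hQ.norm) ?_ ?_
    · exact hP.aestronglyMeasurable.comp_fst.inner hQ.aestronglyMeasurable.comp_snd
    · exact Filter.Eventually.of_forall fun p => norm_inner_le_norm _ _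
  have e1 : windowForm W P Q = ∫ t, inner ℂ (P t) (∫ s in J t, Q s) := by
    unfold windowForm
    rw [← integral_indicator (measurableSet_window hW), Measure.volume_eq_prod,
      integral_prod _ (hint.indicator (measurableSet_window hW))]
    congr 1
    funext t
    rw [← integral_inner hQ.integrableOn, ← integral_indicator (hJm t)]
    rfl
  have e2 : ∀ t, ‖∫ s in J t, Q s‖ₑ ≤
      B ^ (1 / 2 : ℝ) * (∫⁻ s in J t, ψ s ^ 2) ^ (1 / 2 : ℝ) := by
    intro t
    have := enorm_setIntegral_sq_le (hJm t) hℓ (fun x hx y hy => by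
      have := hWℓ _ hx _ hy
      rwa [show t - x - (t - y) = -(x - y) by ring, abs_neg] at this) hQ hψ h
    rw [← ENNReal.mul_rpow_of_nonneg _ _ (by norm_num)]
    have h3 := ENNReal.rpow_le_rpow this (by norm_num : (0 : ℝ) ≤ 1 / 2)
    rwa [← ENNReal.rpow_two, ← ENNReal.rpow_mul, show (2 : ℝ) * (1 / 2) = 1 by norm_num,
      ENNReal.rpow_one] at h3
  have hΨ : Measurable fun t => ∫⁻ s in J t, ψ s ^ 2 := by
    have : (fun t => ∫⁻ s in J t, ψ s ^ 2) = fun t => ∫⁻ s, {p : ℝ × ℝ | p.1 - p.2 ∈ W}.indicator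
        (fun p => ψ p.2 ^ 2) (t, s) := by
      funext t
      rw [← lintegral_indicator (hJm t)]
      rfl
    rw [this]
    refine Measurable.lintegral_prod_right' (f := {p : ℝ × ℝ | p.1 - p.2 ∈ W}.indicator
        (fun p => ψ p.2 ^ 2)) ?_
    exact (by fun_prop : Measurable fun p : ℝ × ℝ => ψ p.2 ^ 2).indicator (measurableSet_window hW)
  have e3 : ∫⁻ t, ∫⁻ s in J t, ψ s ^ 2 ≤ ENNReal.ofReal ℓ * ∫⁻ s, ψ s ^ 2 := by
    have h1 : ∀ t, ∫⁻ s in J t, ψ s ^ 2 =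
        ∫⁻ s, W.indicator (fun _ => (1 : ℝ≥0∞)) (t - s) * ψ s ^ 2 := by
      intro t
      rw [← lintegral_indicator (hJm t)]
      congr 1
      funext s
      by_cases hs : t - s ∈ W
      · rw [indicator_of_mem (by exact hs), indicator_of_mem hs, one_mul]
      · rw [indicator_of_notMem (by exact hs), indicator_of_notMem hs, zero_mul]
    have hm1 : Measurable (W.indicator fun _ => (1 : ℝ≥0∞)) := measurable_const.indicator hW
    simp_rw [h1]
    rw [lintegral_lintegral_swap]
    · have h2 : ∀ s, ∫⁻ t, W.indicator (fun _ => (1 : ℝ≥0∞)) (t - s) * ψ s ^ 2 =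
          volume W * ψ s ^ 2 := by
        intro s
        rw [lintegral_mul_const _ (by fun_prop),
          lintegral_sub_right_eq_self (W.indicator fun _ => (1 : ℝ≥0∞)) s,
          lintegral_indicator_const hW, one_mul]
      simp_rw [h2]
      rw [lintegral_const_mul _ (by fun_prop)]
      gcongr
    · exact Measurable.aemeasurable (by fun_prop)
  rw [e1]
  calc _ ≤ ∫⁻ t, ‖inner ℂ (P t) (∫ s in J t, Q s)‖ₑ := enorm_integral_le_lintegral_enorm _
    _ ≤ ∫⁻ t, (μ * B ^ (1 / 2 : ℝ)) * (φ t * (∫⁻ s in J t, ψ s ^ 2) ^ (1 / 2 : ℝ)) := by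
        refine lintegral_mono fun t => ?_
        calc _ ≤ ‖P t‖ₑ * ‖∫ s in J t, Q s‖ₑ := by
              rw [← ofReal_norm, ← ofReal_norm, ← ofReal_norm,
                ← ENNReal.ofReal_mul (norm_nonneg _)]
              exact ENNReal.ofReal_le_ofReal (norm_inner_le_norm _ _)
          _ ≤ (μ * φ t) * (B ^ (1 / 2 : ℝ) * (∫⁻ s in J t, ψ s ^ 2) ^ (1 / 2 : ℝ)) :=
              mul_le_mul' (hPφ t) (e2 t)
          _ = _ := by ring
    _ = (μ * B ^ (1 / 2 : ℝ)) * ∫⁻ t, φ t * (∫⁻ s in J t, ψ s ^ 2) ^ (1 / 2 : ℝ) :=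
        lintegral_const_mul _ (hφ.mul (hΨ.pow_const _))
    _ ≤ (μ * B ^ (1 / 2 : ℝ)) * ((∫⁻ t, φ t ^ 2) ^ (1 / 2 : ℝ) *
        (ENNReal.ofReal ℓ * ∫⁻ s, ψ s ^ 2) ^ (1 / 2 : ℝ)) := by
        gcongr
        refine (ENNReal.lintegral_mul_le_Lp_mul_Lq volume Real.HolderConjugate.two_two
          hφ.aemeasurable (hΨ.pow_const _).aemeasurable).trans ?_
        simp_rw [← ENNReal.rpow_mul]
        norm_num only [ENNReal.rpow_one, ENNReal.rpow_two]
        gcongr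
    _ = _ := by
        rw [ENNReal.mul_rpow_of_nonneg (ENNReal.ofReal ℓ) _ (by norm_num)]
        ring

/-- Exchanging the two curves reflects the window. -/
theorem enorm_windowForm_swap {W : Set ℝ} (hW : MeasurableSet W) (P Q : ℝ → H) :
    ‖windowForm W P Q‖ₑ = ‖windowForm (Neg.neg ⁻¹' W) Q P‖ₑ := by
  have hW' : MeasurableSet (Neg.neg ⁻¹' W) := measurable_neg hW
  have : windowForm (Neg.neg ⁻¹' W) Q P = (starRingEnd ℂ) (windowForm W P Q) := by
    unfold windowForm
    rw [← integral_conj, ← integral_indicator (measurableSet_window hW),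
      ← integral_indicator (measurableSet_window hW'), Measure.volume_eq_prod,
      ← integral_prod_swap]
    congr 1
    funext p
    have : p.swap ∈ {p : ℝ × ℝ | p.1 - p.2 ∈ Neg.neg ⁻¹' W} ↔
        p ∈ {p : ℝ × ℝ | p.1 - p.2 ∈ W} := by
      simp
    by_cases hp : p ∈ {p : ℝ × ℝ | p.1 - p.2 ∈ W}
    · rw [indicator_of_mem hp, indicator_of_mem (this.2 hp), inner_conj_symm]
      rfl
    · rw [indicator_of_notMem hp, indicator_of_notMem (fun h => hp (this.1 h))]
  rw [this, ← ofReal_norm, ← ofReal_norm, RCLike.norm_conj]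

end Window

/-! ### Dyadic atoms -/

/-- `2ˣ` in `[0, ∞]`. -/
def twoPow (x : ℝ) : ℝ≥0∞ := ENNReal.ofReal ((2 : ℝ) ^ x)

theorem twoPow_add (x y : ℝ) : twoPow (x + y) = twoPow x * twoPow y := by
  unfold twoPow
  rw [← ENNReal.ofReal_mul (by positivity), Real.rpow_add two_pos]

theorem twoPow_rpow (x : ℝ) {c : ℝ} (hc : 0 ≤ c) : twoPow x ^ c = twoPow (x * c) := by
  unfold twoPow
  rw [ENNReal.ofReal_rpow_of_nonneg (by positivity) hc, Real.rpow_mul two_pos.le]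

theorem twoPow_mono {x y : ℝ} (h : x ≤ y) : twoPow x ≤ twoPow y :=
  ENNReal.ofReal_le_ofReal (Real.rpow_le_rpow_of_exponent_le one_le_two h)

theorem twoPow_ne_top (x : ℝ) : twoPow x ≠ ⊤ := ENNReal.ofReal_ne_top

/-- The exponent `2n/(n+2)`, dual to the endpoint exponent `2n/(n-2)`. -/
def dualExp (n : ℕ) : ℝ := 2 * n / (n + 2)

/-- The dyadic level set `{2ᵏ ≤ |g| < 2ᵏ⁺¹}`. -/
def levelSet (g : L2 n) (k : ℤ) : Set (Space n) :=
  {x | (2 : ℝ) ^ (k : ℝ) ≤ ‖g x‖ ∧ ‖g x‖ < (2 : ℝ) ^ ((k : ℝ) + 1)}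

theorem measurableSet_levelSet (g : L2 n) (k : ℤ) : MeasurableSet (levelSet g k) := by
  have h : Measurable fun x => ‖g x‖ := (Lp.stronglyMeasurable g).measurable.norm
  exact (measurableSet_le measurable_const h).inter (measurableSet_lt h measurable_const)

theorem disjoint_levelSet (g : L2 n) {k l : ℤ} (h : k ≠ l) :
    Disjoint (levelSet g k) (levelSet g l) := by
  wlog hkl : k < l generalizing k l
  · exact (this h.symm (lt_of_le_of_ne (not_lt.1 hkl) h.symm)).symm
  rw [Set.disjoint_left]
  rintro x ⟨_, h2⟩ ⟨h3, _⟩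
  have : (2 : ℝ) ^ ((k : ℝ) + 1) ≤ (2 : ℝ) ^ (l : ℝ) :=
    Real.rpow_le_rpow_of_exponent_le one_le_two (by exact_mod_cast hkl)
  linarith

/-- The restriction of `g` to its `k`-th dyadic level set. -/
def atom (g : L2 n) (k : ℤ) : L2 n :=
  ((Lp.memLp g).indicator (measurableSet_levelSet g k)).toLp _

theorem coeFn_atom (g : L2 n) (k : ℤ) :
    (atom g k : Space n → ℂ) =ᵐ[volume] (levelSet g k).indicator g :=
  MemLp.coeFn_toLp _

/-- The contribution of the `k`-th dyadic level set to `∫ |g|^{2n/(n+2)}`. -/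
def mass (g : L2 n) (k : ℤ) : ℝ≥0∞ := ∫⁻ x in levelSet g k, ‖g x‖ₑ ^ dualExp n

theorem sum_mass_le (g : L2 n) (s : Finset ℤ) :
    ∑ k ∈ s, mass g k ≤ ∫⁻ x, ‖g x‖ₑ ^ dualExp n := by
  unfold mass
  rw [← lintegral_biUnion_finset (fun k _ l _ hkl => disjoint_levelSet g hkl)
    (fun k _ => measurableSet_levelSet g k)]
  exact setLIntegral_le_lintegral _ _

theorem mass_le_sqrt {g : L2 n} (hg : ∫⁻ x, ‖g x‖ₑ ^ dualExp n ≤ 1) (k : ℤ) :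
    mass g k ≤ mass g k ^ (1 / 2 : ℝ) := by
  have h1 : mass g k ≤ 1 := (setLIntegral_le_lintegral _ _).trans hg
  calc mass g k = mass g k ^ (1 : ℝ) := (ENNReal.rpow_one _).symm
    _ ≤ _ := ENNReal.rpow_le_rpow_of_exponent_ge h1 (by norm_num)

theorem one_le_dualExp (hn : 3 ≤ n) : 1 ≤ dualExp n := by
  unfold dualExp
  have : (3 : ℝ) ≤ n := by exact_mod_cast hn
  rw [le_div_iff₀ (by positivity)]
  linarith

theorem dualExp_le_two : dualExp n ≤ 2 := by
  unfold dualExp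
  rw [div_le_iff₀ (by positivity)]
  linarith

/-- The `L¹` size of an atom. As `g` is at least `2ᵏ` on its support, `|g|` is at most `2^{-k(p-1)}
|g|^p` with `p = 2n/(n+2)`; the mass, being at most one, may be replaced by its root. -/
theorem lintegral_atom_le (hn : 3 ≤ n) {g : L2 n} (hg : ∫⁻ x, ‖g x‖ₑ ^ dualExp n ≤ 1) (k : ℤ) :
    ∫⁻ x, ‖atom g k x‖ₑ ≤ twoPow (-(k * (dualExp n - 1))) * mass g k ^ (1 / 2 : ℝ) := by
  refine le_trans ?_ (mul_le_mul_right (mass_le_sqrt hg k) _)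
  have h1 : ∫⁻ x, ‖atom g k x‖ₑ = ∫⁻ x in levelSet g k, ‖g x‖ₑ := by
    rw [← lintegral_indicator (measurableSet_levelSet g k)]
    refine lintegral_congr_ae ?_
    filter_upwards [coeFn_atom g k] with x hx
    rw [hx, enorm_indicator_eq_indicator_enorm]
  rw [h1, mass, ← lintegral_const_mul' _ _ (twoPow_ne_top _)]
  refine setLIntegral_mono' (measurableSet_levelSet g k) fun x hx => ?_
  have hp := one_le_dualExp hn
  have hy : 0 < ‖g x‖ := lt_of_lt_of_le (by positivity) hx.1
  rw [← ofReal_norm, ENNReal.ofReal_rpow_of_pos hy, twoPow, ← ENNReal.ofReal_mul (by positivity)]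
  refine ENNReal.ofReal_le_ofReal ?_
  have e : ‖g x‖ = ‖g x‖ ^ (-(dualExp n - 1)) * ‖g x‖ ^ dualExp n := by
    rw [← Real.rpow_add hy]
    norm_num
  conv_lhs => rw [e]
  refine mul_le_mul_of_nonneg_right ?_ (by positivity)
  rw [← mul_neg, Real.rpow_mul two_pos.le]
  exact Real.rpow_le_rpow_of_nonpos (by positivity) hx.1 (by linarith)

/-- The `L²` size of an atom. As `g` is less than `2ᵏ⁺¹` on its support, `|g|²` is at most
`2^{(k+1)(2-p)} |g|^p` with `p = 2n/(n+2)`. -/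
theorem enorm_atom_le {g : L2 n} (k : ℤ) :
    ‖atom g k‖ₑ ≤ twoPow (1 + k * (1 - dualExp n / 2)) * mass g k ^ (1 / 2 : ℝ) := by
  have h2 : ‖atom g k‖ₑ ^ (2 : ℝ) = ∫⁻ x in levelSet g k, ‖g x‖ₑ ^ (2 : ℝ) := by
    rw [Lp.enorm_def, eLpNorm_eq_lintegral_rpow_enorm_toReal (by norm_num) (by norm_num),
      ← ENNReal.rpow_mul]
    norm_num only [ENNReal.toReal_ofNat, ENNReal.rpow_one]
    rw [← lintegral_indicator (measurableSet_levelSet g k)]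
    refine lintegral_congr_ae ?_
    filter_upwards [coeFn_atom g k] with x hx
    rw [hx]
    by_cases h : x ∈ levelSet g k
    · rw [indicator_of_mem h, indicator_of_mem h]
    · rw [indicator_of_notMem h, indicator_of_notMem h, enorm_zero,
        ENNReal.zero_rpow_of_pos (by norm_num)]
  have h3 : ‖atom g k‖ₑ ^ (2 : ℝ) ≤ twoPow ((k + 1) * (2 - dualExp n)) * mass g k := by
    rw [h2, mass, ← lintegral_const_mul' _ _ (twoPow_ne_top _)]
    refine setLIntegral_mono' (measurableSet_levelSet g k) fun x hx => ?_
    have hp := dualExp_le_two (n := n)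
    have hy : 0 < ‖g x‖ := lt_of_lt_of_le (by positivity) hx.1
    rw [← ofReal_norm, ENNReal.ofReal_rpow_of_pos hy, ENNReal.ofReal_rpow_of_pos hy, twoPow,
      ← ENNReal.ofReal_mul (by positivity)]
    refine ENNReal.ofReal_le_ofReal ?_
    have e : ‖g x‖ ^ (2 : ℝ) = ‖g x‖ ^ (2 - dualExp n) * ‖g x‖ ^ dualExp n := by
      rw [← Real.rpow_add hy]
      norm_num
    rw [e]
    refine mul_le_mul_of_nonneg_right ?_ (by positivity)
    rw [Real.rpow_mul two_pos.le]
    exact Real.rpow_le_rpow hy.le hx.2.le (by linarith)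
  have h4 := ENNReal.rpow_le_rpow h3 (by norm_num : (0 : ℝ) ≤ 1 / 2)
  rw [← ENNReal.rpow_mul, show (2 : ℝ) * (1 / 2) = 1 by norm_num, ENNReal.rpow_one,
    ENNReal.mul_rpow_of_nonneg _ _ (by norm_num), twoPow_rpow _ (by norm_num)] at h4
  refine h4.trans (mul_le_mul_left (twoPow_mono ?_) _)
  have : 0 ≤ dualExp n := by unfold dualExp; positivity
  nlinarith

/-! ### Test curves -/

/-- A test curve in `L²_t L^{2n/(n+2)}_x`: at each time a scalar multiple of one of countably many
functions in the unit ball of `L^{2n/(n+2)}`. -/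
structure TestCurve (n : ℕ) where
  /-- The scalar coefficient. -/
  coeff : ℝ → ℂ
  /-- The index of the spatial profile in use. -/
  index : ℝ → ℕ
  /-- The spatial profiles. -/
  fn : ℕ → L2 n
  measurable_coeff : Measurable coeff
  integrable_coeff : Integrable coeff
  lintegral_sq_lt_top : ∫⁻ t, ‖coeff t‖ₑ ^ 2 < ⊤
  measurable_index : Measurable index
  lintegral_fn_le : ∀ i, ∫⁻ x, ‖fn i x‖ₑ ^ dualExp n ≤ 1
  exists_norm_fn_le : ∃ R, ∀ i, ‖fn i‖ ≤ R

namespace TestCurve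

/-- The curve `t ↦ e^{-itΔ} (κ(t) a_{ι(t)})` for a family `a` of profiles. -/
def pull (G : TestCurve n) (a : ℕ → L2 n) (t : ℝ) : L2 n :=
  freeProp (-t) (G.coeff t • a (G.index t))

/-- The bound `(∫ |κ|²)^{1/2}` for the `L²_t L^{2n/(n+2)}_x` norm of a test curve. -/
def size (G : TestCurve n) : ℝ≥0∞ := (∫⁻ t, ‖G.coeff t‖ₑ ^ 2) ^ (1 / 2 : ℝ)

theorem stronglyMeasurable_smul (G : TestCurve n) (a : ℕ → L2 n) :
    StronglyMeasurable fun t => G.coeff t • a (G.index t) := by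
  have h : StronglyMeasurable a := StronglyMeasurable.of_discrete
  exact G.measurable_coeff.stronglyMeasurable.smul (h.comp_measurable G.measurable_index)

theorem stronglyMeasurable_pull (G : TestCurve n) (a : ℕ → L2 n) :
    StronglyMeasurable (G.pull a) := by
  have h1 := (measurable_neg (G := ℝ)).stronglyMeasurable.prodMk (G.stronglyMeasurable_smul a)
  have h2 := Continuous.comp_stronglyMeasurable (continuous_freeProp_prod (n := n)) h1
  exact h2

theorem norm_pull (G : TestCurve n) (a : ℕ → L2 n) (t : ℝ) :
    ‖G.pull a t‖ = ‖G.coeff t‖ * ‖a (G.index t)‖ := by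
  rw [pull, LinearIsometry.norm_map, norm_smul]

theorem integrable_pull (G : TestCurve n) {a : ℕ → L2 n} {R : ℝ} (hR : ∀ i, ‖a i‖ ≤ R) :
    Integrable (G.pull a) := by
  refine (G.integrable_coeff.norm.mul_const R).mono'
    (G.stronglyMeasurable_pull a).aestronglyMeasurable (Filter.Eventually.of_forall fun t => ?_)
  rw [norm_pull]
  exact mul_le_mul_of_nonneg_left (hR _) (norm_nonneg _)

theorem enorm_inner_pull (G G' : TestCurve n) (a a' : ℕ → L2 n) (t s : ℝ) :
    ‖inner ℂ (G.pull a t) (G'.pull a' s)‖ₑ = ‖G.coeff t‖ₑ * ‖G'.coeff s‖ₑ *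
      ‖inner ℂ (a (G.index t)) (freeProp (t - s) (a' (G'.index s)))‖ₑ := by
  rw [pull, pull, inner_freeProp_left, neg_neg, ← freeProp_add, map_smul, inner_smul_left,
    inner_smul_right, enorm_mul, enorm_mul, sub_eq_add_neg, ← ofReal_norm ((starRingEnd ℂ) _),
    RCLike.norm_conj, ofReal_norm, mul_assoc]

end TestCurve

theorem norm_atom_le (g : L2 n) (k : ℤ) : ‖atom g k‖ ≤ ‖g‖ := by
  refine Lp.norm_le_norm_of_ae_le ?_
  filter_upwards [coeFn_atom g k] with x hx
  rw [hx]
  exact norm_indicator_le_norm_self _ _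

theorem integrable_atom (hn : 3 ≤ n) {g : L2 n} (hg : ∫⁻ x, ‖g x‖ₑ ^ dualExp n ≤ 1) (k : ℤ) :
    Integrable (atom g k) := by
  refine ⟨Lp.aestronglyMeasurable _, ?_⟩
  refine lt_of_le_of_lt (lintegral_atom_le hn hg k) ?_
  refine ENNReal.mul_lt_top (twoPow_ne_top _).lt_top ?_
  refine ENNReal.rpow_lt_top_of_nonneg (by norm_num) ?_
  exact ((setLIntegral_le_lintegral _ _).trans hg |>.trans_lt ENNReal.one_lt_top).ne

theorem enorm_inner_freeProp_le {f g : L2 n} (hf : Integrable f) (hg : Integrable g) {t : ℝ}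
    (ht : t ≠ 0) : ‖inner ℂ f (freeProp t g)‖ₑ ≤
      ENNReal.ofReal (|t| ^ (-((n : ℝ) / 2))) * ((∫⁻ x, ‖f x‖ₑ) * ∫⁻ x, ‖g x‖ₑ) := by
  rw [← ofReal_norm, ← ofReal_integral_norm_eq_lintegral_enorm hf,
    ← ofReal_integral_norm_eq_lintegral_enorm hg, ← ENNReal.ofReal_mul (by positivity),
    ← ENNReal.ofReal_mul (by positivity)]
  exact ENNReal.ofReal_le_ofReal (norm_inner_freeProp_le f g hf hg ht)

/-- The weight `|κ(t)| m_k(t)^{1/2}` of the `k`-th atoms of a test curve. -/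
def TestCurve.weight (G : TestCurve n) (k : ℤ) (t : ℝ) : ℝ≥0∞ :=
  ‖G.coeff t‖ₑ * mass (G.fn (G.index t)) k ^ (1 / 2 : ℝ)

theorem TestCurve.measurable_weight (G : TestCurve n) (k : ℤ) : Measurable (G.weight k) := by
  have h : Measurable fun i => mass (G.fn i) k ^ (1 / 2 : ℝ) := measurable_from_nat
  exact G.measurable_coeff.enorm.mul (h.comp G.measurable_index)

/-- The curve of `k`-th atoms, pulled back by the free evolution. -/
def TestCurve.atomPull (G : TestCurve n) (k : ℤ) : ℝ → L2 n := G.pull fun i => atom (G.fn i) k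

theorem TestCurve.integrable_atomPull (G : TestCurve n) (k : ℤ) : Integrable (G.atomPull k) := by
  obtain ⟨R, hR⟩ := G.exists_norm_fn_le
  exact G.integrable_pull fun i => (norm_atom_le _ k).trans (hR i)

theorem TestCurve.enorm_atomPull_le (G : TestCurve n) (k : ℤ) (t : ℝ) :
    ‖G.atomPull k t‖ₑ ≤ twoPow (1 + k * (1 - dualExp n / 2)) * G.weight k t := by
  rw [atomPull, ← ofReal_norm, G.norm_pull, ENNReal.ofReal_mul (norm_nonneg _), ofReal_norm,
    ofReal_norm, weight, mul_left_comm]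
  exact mul_le_mul_right (enorm_atom_le k) _

/-- Decay of the correlations of atoms, from the dispersive estimate. -/
theorem TestCurve.enorm_inner_atomPull_le (hn : 3 ≤ n) (G G' : TestCurve n) (k l : ℤ) {t s : ℝ}
    (hts : t ≠ s) : ‖inner ℂ (G.atomPull k t) (G'.atomPull l s)‖ₑ ≤
      ENNReal.ofReal (|t - s| ^ (-((n : ℝ) / 2))) * twoPow (-((k + l) * (dualExp n - 1))) *
        G.weight k t * G'.weight l s := by
  rw [atomPull, atomPull, enorm_inner_pull]
  have hg := G.lintegral_fn_le (G.index t)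
  have hg' := G'.lintegral_fn_le (G'.index s)
  refine (mul_le_mul_right (enorm_inner_freeProp_le (integrable_atom hn hg k)
    (integrable_atom hn hg' l) (sub_ne_zero.2 hts)) _).trans ?_
  refine (mul_le_mul_right (mul_le_mul_right (mul_le_mul' (lintegral_atom_le hn hg k)
    (lintegral_atom_le hn hg' l)) _) _).trans_eq ?_
  rw [show -(((k : ℝ) + l) * (dualExp n - 1)) =
    -(k * (dualExp n - 1)) + -(l * (dualExp n - 1)) by ring, twoPow_add, weight, weight]
  ring

/-- The geometric mean, with weights `1/n` and `1 - 1/n`, of the dispersive bound and of the trivial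
`L²` bound: the decay `|t - s|^{-n/2}`, which is not integrable, becomes `|t - s|^{-1/2}`. -/
theorem TestCurve.enorm_inner_atomPull_self_le (hn : 3 ≤ n) (G : TestCurve n) (l : ℤ) {t s : ℝ}
    (hts : t ≠ s) : ‖inner ℂ (G.atomPull l t) (G.atomPull l s)‖ₑ ≤
      twoPow (2 + 2 * l / (n + 2)) * ENNReal.ofReal (|t - s| ^ (-(1 / 2) : ℝ)) *
        G.weight l t * G.weight l s := by
  have hn0 : (3 : ℝ) ≤ n := by exact_mod_cast hn
  set x := ‖inner ℂ (G.atomPull l t) (G.atomPull l s)‖ₑ with hx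
  set w := G.weight l t * G.weight l s with hw
  have hd : 0 < |t - s| := abs_pos.2 (sub_ne_zero.2 hts)
  have h1 : x ≤ (ENNReal.ofReal (|t - s| ^ (-((n : ℝ) / 2))) *
      twoPow (-((l + l) * (dualExp n - 1)))) * w := by
    rw [hw, ← mul_assoc]
    exact G.enorm_inner_atomPull_le hn G l l hts
  have h2 : x ≤ twoPow (2 + l * (2 - dualExp n)) * w := by
    calc x ≤ ‖G.atomPull l t‖ₑ * ‖G.atomPull l s‖ₑ := by
          rw [hx, ← ofReal_norm, ← ofReal_norm, ← ofReal_norm,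
            ← ENNReal.ofReal_mul (norm_nonneg _)]
          exact ENNReal.ofReal_le_ofReal (norm_inner_le_norm _ _)
      _ ≤ _ := mul_le_mul' (G.enorm_atomPull_le l t) (G.enorm_atomPull_le l s)
      _ = _ := by
          have e := twoPow_add (1 + l * (1 - dualExp n / 2)) (1 + l * (1 - dualExp n / 2))
          rw [show (1 + l * (1 - dualExp n / 2)) + (1 + l * (1 - dualExp n / 2)) =
            2 + l * (2 - dualExp n) by ring] at e
          rw [e, hw]
          ring
  have hlam : (0 : ℝ) ≤ 1 / n := by positivity
  have hlam' : (0 : ℝ) ≤ 1 - 1 / n := by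
    rw [sub_nonneg, div_le_one (by linarith)]
    linarith
  have split : ∀ y : ℝ≥0∞, y = y ^ (1 / n : ℝ) * y ^ (1 - 1 / n : ℝ) := by
    intro y
    rw [← ENNReal.rpow_add_of_nonneg _ _ hlam hlam', add_sub_cancel, ENNReal.rpow_one]
  calc x = x ^ (1 / n : ℝ) * x ^ (1 - 1 / n : ℝ) := split x
    _ ≤ ((ENNReal.ofReal (|t - s| ^ (-((n : ℝ) / 2))) *
        twoPow (-((l + l) * (dualExp n - 1)))) * w) ^ (1 / n : ℝ) *
        (twoPow (2 + l * (2 - dualExp n)) * w) ^ (1 - 1 / n : ℝ) :=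
        mul_le_mul' (ENNReal.rpow_le_rpow h1 hlam) (ENNReal.rpow_le_rpow h2 hlam')
    _ = ENNReal.ofReal (|t - s| ^ (-(1 / 2) : ℝ)) *
        (twoPow (-((l + l) * (dualExp n - 1)) * (1 / n)) *
          twoPow ((2 + l * (2 - dualExp n)) * (1 - 1 / n))) *
        (w ^ (1 / n : ℝ) * w ^ (1 - 1 / n : ℝ)) := by
        rw [ENNReal.mul_rpow_of_nonneg _ _ hlam, ENNReal.mul_rpow_of_nonneg _ _ hlam,
          ENNReal.mul_rpow_of_nonneg _ _ hlam', twoPow_rpow _ hlam, twoPow_rpow _ hlam',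
          ENNReal.ofReal_rpow_of_pos (by positivity), ← Real.rpow_mul hd.le,
          show -((n : ℝ) / 2) * (1 / n) = -(1 / 2) by field_simp]
        ring
    _ ≤ ENNReal.ofReal (|t - s| ^ (-(1 / 2) : ℝ)) * twoPow (2 + 2 * l / (n + 2)) * w := by
        rw [← split w, ← twoPow_add]
        refine mul_le_mul_left (mul_le_mul_right (twoPow_mono ?_) _) _
        have e : -((l + l) * (dualExp n - 1)) * (1 / n) +
            (2 + l * (2 - dualExp n)) * (1 - 1 / n) = 2 - 2 / n + 2 * l / (n + 2) := by
          unfold dualExp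
          field_simp
          ring
        rw [e]
        have : (0 : ℝ) ≤ 2 / n := by positivity
        linarith
    _ = _ := by
        rw [hw]
        ring

/-! ### The Keel–Tao bilinear estimate -/

/-- The dyadic window `(2ʲ, 2ʲ⁺¹]` of time differences. -/
def dyadic (j : ℤ) : Set ℝ := Ioc ((2 : ℝ) ^ (j : ℝ)) ((2 : ℝ) ^ ((j : ℝ) + 1))

theorem two_rpow_add_one (x : ℝ) : (2 : ℝ) ^ (x + 1) = 2 * (2 : ℝ) ^ x := by
  rw [Real.rpow_add_one two_ne_zero, mul_comm]

theorem volume_dyadic (j : ℤ) : volume (dyadic j) = ENNReal.ofReal ((2 : ℝ) ^ (j : ℝ)) := by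
  rw [dyadic, Real.volume_Ioc, two_rpow_add_one]
  congr 1
  ring

theorem abs_sub_le_of_mem_dyadic {j : ℤ} {x y : ℝ} (hx : x ∈ dyadic j) (hy : y ∈ dyadic j) :
    |x - y| ≤ (2 : ℝ) ^ (j : ℝ) := by
  obtain ⟨h1, h2⟩ := hx
  obtain ⟨h3, h4⟩ := hy
  rw [two_rpow_add_one] at h2 h4
  rw [abs_le]
  constructor <;> linarith

theorem iUnion_dyadic : ⋃ j : ℤ, dyadic j = Ioi 0 := by
  ext x
  simp only [mem_iUnion, mem_Ioi]
  constructor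
  · rintro ⟨j, h, _⟩
    exact lt_trans (by positivity) h
  · intro hx
    obtain ⟨j, hj⟩ := exists_mem_Ioc_zpow hx one_lt_two
    refine ⟨j, ?_⟩
    rw [dyadic, Real.rpow_intCast, show ((j : ℝ) + 1) = ((j + 1 : ℤ) : ℝ) by push_cast; rfl,
      Real.rpow_intCast]
    exact hj

theorem pairwise_disjoint_dyadic : Pairwise (Function.onFun Disjoint dyadic) := by
  intro i j hij
  wlog h : i < j generalizing i j
  · exact (this hij.symm (lt_of_le_of_ne (not_lt.1 h) hij.symm)).symm
  rw [Function.onFun, Set.disjoint_left]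
  rintro x ⟨_, h2⟩ ⟨h3, _⟩
  have : (2 : ℝ) ^ ((i : ℝ) + 1) ≤ (2 : ℝ) ^ (j : ℝ) :=
    Real.rpow_le_rpow_of_exponent_le one_le_two (by exact_mod_cast h)
  linarith

/-- The `L²` norm in time of the weights of the `k`-th atoms. -/
def TestCurve.atomSize (G : TestCurve n) (k : ℤ) : ℝ≥0∞ :=
  (∫⁻ t, G.weight k t ^ 2) ^ (1 / 2 : ℝ)

/-- The dispersive bound for atoms of heights `2ᵏ` and `2ˡ` on the window of length `2ʲ`. With
`S = (k + l)/(n + 2) + j/2` it is `2^{-(n-2)S}`. -/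
theorem TestCurve.windowForm_le_symmetric (hn : 3 ≤ n) (G G' : TestCurve n) (j k l : ℤ) :
    ‖windowForm (dyadic j) (G.atomPull k) (G'.atomPull l)‖ₑ ≤
      twoPow (-((n - 2) * ((k + l) / (n + 2) + j / 2))) * (G.atomSize k * G'.atomSize l) := by
  refine (enorm_windowForm_le_of_kernel measurableSet_Ioc (G.measurable_weight k)
    (G'.measurable_weight l) (volume_dyadic j).le (A := twoPow (-(j * (n / 2))) *
      twoPow (-((k + l) * (dualExp n - 1)))) ?_).trans_eq ?_
  · intro t s hts
    have hpos : 0 < t - s := lt_trans (by positivity) hts.1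
    have hne : t ≠ s := (sub_ne_zero.1 hpos.ne')
    refine (G.enorm_inner_atomPull_le hn G' k l hne).trans ?_
    refine mul_le_mul_left (mul_le_mul_left (mul_le_mul_left ?_ _) _) _
    refine ENNReal.ofReal_le_ofReal ?_
    rw [abs_of_pos hpos, ← mul_neg, Real.rpow_mul two_pos.le]
    exact Real.rpow_le_rpow_of_nonpos (by positivity) hts.1.le
      (neg_nonpos.2 (by positivity))
  · have e : twoPow (-((n - 2) * ((k + l) / (n + 2) + j / 2))) = twoPow (-(j * (n / 2))) *
        twoPow (-((k + l) * (dualExp n - 1))) * twoPow j := by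
      rw [← twoPow_add, ← twoPow_add]
      congr 1
      unfold dualExp
      field_simp
      ring
    rw [e]
    rfl

theorem twoPow_window_const (j k l : ℤ) :
    twoPow (1 + k * (1 - dualExp n / 2)) * (twoPow (2 + 2 * l / (n + 2)) *
      ENNReal.ofReal (4 * ((2 : ℝ) ^ (j : ℝ)) ^ (1 / 2 : ℝ))) ^ (1 / 2 : ℝ) *
      ENNReal.ofReal ((2 : ℝ) ^ (j : ℝ)) ^ (1 / 2 : ℝ) =
    twoPow (3 + (3 / 2 * ((k + l) / (n + 2) + j / 2) + (k - l) / (n + 2) / 2)) := by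
  have e1 : ENNReal.ofReal (4 * ((2 : ℝ) ^ (j : ℝ)) ^ (1 / 2 : ℝ)) = twoPow (2 + j / 2) := by
    unfold twoPow
    congr 1
    rw [Real.rpow_add two_pos, ← Real.rpow_mul two_pos.le]
    norm_num
    congr 1
    ring
  have e2 : ENNReal.ofReal ((2 : ℝ) ^ (j : ℝ)) = twoPow j := rfl
  rw [e1, e2, ← twoPow_add, twoPow_rpow _ (by norm_num), twoPow_rpow _ (by norm_num),
    ← twoPow_add, ← twoPow_add]
  congr 1
  unfold dualExp
  field_simp
  ring

/-- The asymmetric bound with the `L²` estimate on the first curve. With `S = (k + l)/(n + 2) + j/2`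
and `D = (k - l)/(n + 2)` it is `2^{3 + 3S/2 + D/2}`. -/
theorem TestCurve.windowForm_le_left (hn : 3 ≤ n) (G G' : TestCurve n) (j k l : ℤ) :
    ‖windowForm (dyadic j) (G.atomPull k) (G'.atomPull l)‖ₑ ≤
      twoPow (3 + (3 / 2 * ((k + l) / (n + 2) + j / 2) + (k - l) / (n + 2) / 2)) *
        (G.atomSize k * G'.atomSize l) := by
  rw [← twoPow_window_const]
  exact enorm_windowForm_le_of_decay measurableSet_Ioc (by positivity) (volume_dyadic j).le
    (fun x hx y hy => abs_sub_le_of_mem_dyadic hx hy) (G.integrable_atomPull k)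
    (G'.integrable_atomPull l) (G.measurable_weight k) (G'.measurable_weight l)
    (G.enorm_atomPull_le k) (fun t s hts => G'.enorm_inner_atomPull_self_le hn l hts)

/-- The asymmetric bound with the `L²` estimate on the second curve. With `S = (k + l)/(n + 2) +
j/2` and `D = (k - l)/(n + 2)` it is `2^{3 + 3S/2 - D/2}`. -/
theorem TestCurve.windowForm_le_right (hn : 3 ≤ n) (G G' : TestCurve n) (j k l : ℤ) :
    ‖windowForm (dyadic j) (G.atomPull k) (G'.atomPull l)‖ₑ ≤
      twoPow (3 + (3 / 2 * ((k + l) / (n + 2) + j / 2) - (k - l) / (n + 2) / 2)) *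
        (G.atomSize k * G'.atomSize l) := by
  have e : (3 : ℝ) + (3 / 2 * ((k + l) / (n + 2) + j / 2) - (k - l) / (n + 2) / 2) =
      3 + (3 / 2 * ((l + k) / (n + 2) + j / 2) + (l - k) / (n + 2) / 2) := by ring
  have hm : MeasurableSet (dyadic j) := measurableSet_Ioc
  rw [e, ← twoPow_window_const, enorm_windowForm_swap hm, mul_comm (G.atomSize k)]
  refine enorm_windowForm_le_of_decay (measurable_neg hm) (by positivity) ?_
    (fun x hx y hy => ?_) (G'.integrable_atomPull l)
    (G.integrable_atomPull k) (G'.measurable_weight l) (G.measurable_weight k)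
    (G'.enorm_atomPull_le l) (fun t s hts => G.enorm_inner_atomPull_self_le hn k hts)
  · rw [Measure.measure_preimage_neg]
    exact (volume_dyadic j).le
  · have := abs_sub_le_of_mem_dyadic hx hy
    rwa [neg_sub_neg, abs_sub_comm] at this

/-- Zero lies in the interior of the triangle spanned by the three exponents, so the best of the
three window estimates decays in both `S` and `D`. -/
theorem exists_exponent_le {c : ℝ} (hc : 1 ≤ c) (S D : ℝ) :
    -(c * S) ≤ 3 - (|S| + |D|) / 12 ∨ 3 + (3 / 2 * S + D / 2) ≤ 3 - (|S| + |D|) / 12 ∨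
      3 + (3 / 2 * S - D / 2) ≤ 3 - (|S| + |D|) / 12 := by
  rcases le_total 0 S with hS | hS
  · rw [abs_of_nonneg hS]
    by_cases h : |D| / 6 ≤ S
    · left
      nlinarith [abs_nonneg D]
    · right
      push Not at h
      rcases le_total 0 D with hD | hD
      · rw [abs_of_nonneg hD] at h ⊢
        right
        linarith
      · rw [abs_of_nonpos hD] at h ⊢
        left
        linarith
  · rw [abs_of_nonpos hS]
    right
    rcases le_total 0 D with hD | hD
    · rw [abs_of_nonneg hD]
      right
      linarith
    · rw [abs_of_nonpos hD]
      left
      linarith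

/-- The best of the three window estimates, which is summable over the windows and decays in the
difference of the heights. -/
theorem TestCurve.windowForm_dyadic_le (hn : 3 ≤ n) (G G' : TestCurve n) (j k l : ℤ) :
    ‖windowForm (dyadic j) (G.atomPull k) (G'.atomPull l)‖ₑ ≤
      twoPow (-|((k + l) / (n + 2) : ℝ) + j / 2| / 12) *
        (8 * twoPow (-(1 / (12 * (n + 2)) * |((k - l : ℤ) : ℝ)|)) *
          (G.atomSize k * G'.atomSize l)) := by
  have hn0 : (3 : ℝ) ≤ n := by exact_mod_cast hn
  have e : twoPow (-|((k + l) / (n + 2) : ℝ) + j / 2| / 12) *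
        (8 * twoPow (-(1 / (12 * (n + 2)) * |((k - l : ℤ) : ℝ)|)) *
          (G.atomSize k * G'.atomSize l)) =
      twoPow (3 - (|((k + l) / (n + 2) : ℝ) + j / 2| + |((k - l) / (n + 2) : ℝ)|) / 12) *
        (G.atomSize k * G'.atomSize l) := by
    have h8 : (8 : ℝ≥0∞) = twoPow 3 := by
      unfold twoPow
      rw [show (2 : ℝ) ^ (3 : ℝ) = 8 by norm_num]
      norm_num
    rw [← mul_assoc, h8, ← twoPow_add, ← twoPow_add, abs_div, abs_of_pos (by linarith : (0 : ℝ) < n + 2)]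
    congr 2
    push_cast
    field_simp
    ring
  rw [e]
  rcases exists_exponent_le (by linarith : (1 : ℝ) ≤ n - 2) ((k + l) / (n + 2) + j / 2)
    ((k - l) / (n + 2)) with h | h | h
  · exact (G.windowForm_le_symmetric hn G' j k l).trans (mul_le_mul_left (twoPow_mono h) _)
  · exact (G.windowForm_le_left hn G' j k l).trans (mul_le_mul_left (twoPow_mono h) _)
  · exact (G.windowForm_le_right hn G' j k l).trans (mul_le_mul_left (twoPow_mono h) _)

theorem tsum_twoPow_ne_top {a : ℝ} (ha : 0 < a) :
    ∑' j : ℤ, twoPow (-(a * |(j : ℝ)|)) ≠ ⊤ := by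
  refine Summable.tsum_ofReal_ne_top ?_
  have h : Summable fun m : ℕ => ((2 : ℝ) ^ (-a)) ^ m :=
    summable_geometric_of_lt_one (by positivity)
      (Real.rpow_lt_one_of_one_lt_of_neg one_lt_two (by linarith))
  have h' : ∀ m : ℕ, ((2 : ℝ) ^ (-a)) ^ m = (2 : ℝ) ^ (-(a * |((m : ℤ) : ℝ)|)) := by
    intro m
    rw [← Real.rpow_natCast, ← Real.rpow_mul two_pos.le, Int.cast_natCast,
      abs_of_nonneg (by positivity), neg_mul]
  refine Summable.of_nat_of_neg (h.congr h') ?_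
  refine h.congr fun m => ?_
  rw [h', Int.cast_neg, abs_neg]

/-- A bound for `∑ⱼ 2^{-|x + j/2|/12}` that is uniform in `x`. -/
def dyadicSum : ℝ≥0∞ := twoPow (1 / 24) * ∑' j : ℤ, twoPow (-(1 / 24 * |(j : ℝ)|))

theorem dyadicSum_ne_top : dyadicSum ≠ ⊤ :=
  ENNReal.mul_ne_top (twoPow_ne_top _) (tsum_twoPow_ne_top (by norm_num))

theorem tsum_twoPow_le_dyadicSum (x : ℝ) : ∑' j : ℤ, twoPow (-|x + j / 2| / 12) ≤ dyadicSum := by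
  rw [dyadicSum, ← (Equiv.addLeft ⌊2 * x⌋).tsum_eq
    (fun j : ℤ => twoPow (-(1 / 24 * |(j : ℝ)|))), ← ENNReal.tsum_mul_left]
  refine ENNReal.tsum_le_tsum fun j => ?_
  rw [← twoPow_add]
  refine twoPow_mono ?_
  have h1 := Int.floor_le (2 * x)
  have h2 := Int.lt_floor_add_one (2 * x)
  have h3 : |((⌊2 * x⌋ + j : ℤ) : ℝ)| ≤ 2 * |x + j / 2| + 1 := by
    have e : ((⌊2 * x⌋ + j : ℤ) : ℝ) = 2 * (x + j / 2) + ((⌊2 * x⌋ : ℝ) - 2 * x) := by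
      push_cast
      ring
    rw [e]
    refine (abs_add_le _ _).trans (add_le_add (by rw [abs_mul, abs_of_pos two_pos]) ?_)
    rw [abs_le]
    constructor <;> linarith
  simp only [Equiv.coe_addLeft]
  linarith

theorem integrable_inner_prod {P Q : ℝ → L2 n} (hP : Integrable P) (hQ : Integrable Q) :
    Integrable (fun p : ℝ × ℝ => inner ℂ (P p.1) (Q p.2)) := by
  rw [Measure.volume_eq_prod]
  refine Integrable.mono' (hP.norm.mul_prod hQ.norm) ?_ ?_
  · exact hP.aestronglyMeasurable.comp_fst.inner hQ.aestronglyMeasurable.comp_snd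
  · exact Filter.Eventually.of_forall fun p => norm_inner_le_norm _ _

/-- The retarded form is the sum of its dyadic windows. -/
theorem enorm_windowForm_Ioi_le {P Q : ℝ → L2 n} (hP : Integrable P) (hQ : Integrable Q) :
    ‖windowForm (Ioi 0) P Q‖ₑ ≤ ∑' j : ℤ, ‖windowForm (dyadic j) P Q‖ₑ := by
  have hU : {p : ℝ × ℝ | p.1 - p.2 ∈ Ioi (0 : ℝ)} = ⋃ j : ℤ, {p : ℝ × ℝ | p.1 - p.2 ∈ dyadic j} := by
    rw [← iUnion_dyadic]
    ext p
    simp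
  have h : HasSum (fun j : ℤ => windowForm (dyadic j) P Q) (windowForm (Ioi 0) P Q) := by
    unfold windowForm
    rw [hU]
    refine hasSum_integral_iUnion (fun j => measurableSet_window measurableSet_Ioc) ?_
      (integrable_inner_prod hP hQ).integrableOn
    intro i j hij
    exact (pairwise_disjoint_dyadic hij).preimage fun p : ℝ × ℝ => p.1 - p.2
  rw [← h.tsum_eq]
  exact enorm_tsum_le_tsum_enorm

/-- The sum of the window estimates over all dyadic time scales. -/
theorem TestCurve.windowForm_atoms_le (hn : 3 ≤ n) (G G' : TestCurve n) (k l : ℤ) :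
    ‖windowForm (Ioi 0) (G.atomPull k) (G'.atomPull l)‖ₑ ≤
      8 * dyadicSum * (twoPow (-(1 / (12 * (n + 2)) * |((k - l : ℤ) : ℝ)|)) *
          (G.atomSize k * G'.atomSize l)) := by
  refine (enorm_windowForm_Ioi_le (G.integrable_atomPull k) (G'.integrable_atomPull l)).trans ?_
  refine (ENNReal.tsum_le_tsum fun j => G.windowForm_dyadic_le hn G' j k l).trans ?_
  rw [ENNReal.tsum_mul_right]
  refine (mul_le_mul_left (tsum_twoPow_le_dyadicSum _) _).trans_eq ?_
  ring

/-- Convolution with a summable even sequence is bounded on `ℓ²`, in bilinear form. -/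
theorem sum_convolution_le (w : ℤ → ℝ≥0∞) (hw : ∀ m, w (-m) = w m) (a b : ℤ → ℝ≥0∞)
    (s : Finset ℤ) :
    ∑ k ∈ s, ∑ l ∈ s, w (k - l) * (a k * b l) ≤
      (∑' m, w m) * ((∑ k ∈ s, a k ^ 2) ^ (1 / 2 : ℝ) * (∑ l ∈ s, b l ^ 2) ^ (1 / 2 : ℝ)) := by
  have h2 : ∀ x y : ℝ≥0∞, (x ^ (1 / 2 : ℝ) * y) ^ (2 : ℝ) = x * y ^ 2 := by
    intro x y
    rw [ENNReal.mul_rpow_of_nonneg _ _ (by norm_num), ← ENNReal.rpow_mul, ENNReal.rpow_two]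
    norm_num
  have hsq : ∀ x : ℝ≥0∞, x = x ^ (1 / 2 : ℝ) * x ^ (1 / 2 : ℝ) := by
    intro x
    rw [← ENNReal.rpow_add_of_nonneg _ _ (by norm_num) (by norm_num)]
    norm_num
  have hshift : ∀ k, ∑ l ∈ s, w (k - l) ≤ ∑' m, w m := by
    intro k
    refine (ENNReal.sum_le_tsum s).trans_eq ?_
    exact (Equiv.subLeft k).tsum_eq w
  have hA : ∑ p ∈ s ×ˢ s, w (p.1 - p.2) * a p.1 ^ 2 ≤ (∑' m, w m) * ∑ k ∈ s, a k ^ 2 := by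
    rw [Finset.sum_product, Finset.mul_sum]
    refine Finset.sum_le_sum fun k _ => ?_
    simp only
    rw [← Finset.sum_mul]
    exact mul_le_mul_left (hshift k) _
  have hB : ∑ p ∈ s ×ˢ s, w (p.1 - p.2) * b p.2 ^ 2 ≤ (∑' m, w m) * ∑ k ∈ s, b k ^ 2 := by
    rw [Finset.sum_product_right, Finset.mul_sum]
    refine Finset.sum_le_sum fun l _ => ?_
    simp only
    rw [← Finset.sum_mul]
    refine mul_le_mul_left ?_ _
    refine le_trans (le_of_eq (Finset.sum_congr rfl fun k _ => ?_)) (hshift l)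
    rw [← hw, neg_sub]
  rw [← Finset.sum_product']
  calc ∑ p ∈ s ×ˢ s, w (p.1 - p.2) * (a p.1 * b p.2)
      = ∑ p ∈ s ×ˢ s, (w (p.1 - p.2) ^ (1 / 2 : ℝ) * a p.1) *
          (w (p.1 - p.2) ^ (1 / 2 : ℝ) * b p.2) := by
        refine Finset.sum_congr rfl fun p _ => ?_
        conv_lhs => rw [hsq (w (p.1 - p.2))]
        ring
    _ ≤ _ := ENNReal.inner_le_Lp_mul_Lq _ _ _ Real.HolderConjugate.two_two
    _ ≤ ((∑' m, w m) * ∑ k ∈ s, a k ^ 2) ^ (1 / 2 : ℝ) *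
        ((∑' m, w m) * ∑ k ∈ s, b k ^ 2) ^ (1 / 2 : ℝ) := by
        simp_rw [h2]
        gcongr
    _ = _ := by
        rw [ENNReal.mul_rpow_of_nonneg _ _ (by norm_num),
          ENNReal.mul_rpow_of_nonneg _ _ (by norm_num)]
        conv_rhs => rw [hsq (∑' m, w m)]
        ring

/-- The atom sizes of a test curve are square summable because the level sets are disjoint and the
profiles lie in the unit ball of `L^{2n/(n+2)}`. -/
theorem TestCurve.sum_atomSize_sq_le (G : TestCurve n) (s : Finset ℤ) :
    (∑ k ∈ s, G.atomSize k ^ 2) ^ (1 / 2 : ℝ) ≤ G.size := by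
  unfold TestCurve.size
  refine ENNReal.rpow_le_rpow ?_ (by norm_num)
  have h : ∀ k, G.atomSize k ^ 2 = ∫⁻ t, G.weight k t ^ 2 := by
    intro k
    rw [atomSize, ← ENNReal.rpow_two, ← ENNReal.rpow_mul]
    norm_num
  simp_rw [h]
  rw [← lintegral_finsetSum _ fun k _ => (G.measurable_weight k).pow_const 2]
  refine lintegral_mono fun t => ?_
  have h2 : ∀ k, G.weight k t ^ 2 = ‖G.coeff t‖ₑ ^ 2 * mass (G.fn (G.index t)) k := by
    intro k
    rw [TestCurve.weight, mul_pow, ← ENNReal.rpow_two (mass _ _ ^ _), ← ENNReal.rpow_mul]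
    norm_num
  simp only [h2]
  rw [← Finset.mul_sum]
  exact mul_le_of_le_one_right zero_le
    ((sum_mass_le _ s).trans (G.lintegral_fn_le _))

/-- The constant of the Keel–Tao estimate. -/
def keelTaoConst (n : ℕ) : ℝ≥0∞ :=
  8 * dyadicSum * ∑' m : ℤ, twoPow (-(1 / (12 * ((n : ℝ) + 2)) * |(m : ℝ)|))

theorem keelTaoConst_ne_top (n : ℕ) : keelTaoConst n ≠ ⊤ :=
  ENNReal.mul_ne_top (ENNReal.mul_ne_top (by norm_num) dyadicSum_ne_top)
    (tsum_twoPow_ne_top (by positivity))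

theorem windowForm_sum {ι : Type*} (W : Set ℝ) (s : Finset ι) {P Q : ι → ℝ → L2 n}
    (hP : ∀ i, Integrable (P i)) (hQ : ∀ i, Integrable (Q i)) :
    windowForm W (fun t => ∑ k ∈ s, P k t) (fun t => ∑ l ∈ s, Q l t) =
      ∑ k ∈ s, ∑ l ∈ s, windowForm W (P k) (Q l) := by
  unfold windowForm
  have h : ∀ p : ℝ × ℝ, inner ℂ (∑ k ∈ s, P k p.1) (∑ l ∈ s, Q l p.2) =
      ∑ k ∈ s, ∑ l ∈ s, inner ℂ (P k p.1) (Q l p.2) := by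
    intro p
    rw [sum_inner]
    simp_rw [inner_sum]
  simp_rw [h]
  rw [integral_finsetSum _ fun k _ => integrable_finsetSum _ fun l _ =>
    (integrable_inner_prod (hP k) (hQ l)).integrableOn]
  refine Finset.sum_congr rfl fun k _ => ?_
  exact integral_finsetSum _ fun l _ => (integrable_inner_prod (hP k) (hQ l)).integrableOn

theorem exists_mem_levelSet {g : L2 n} {x : Space n} (hx : g x ≠ 0) : ∃ k, x ∈ levelSet g k := by
  obtain ⟨k, h1, h2⟩ := exists_mem_Ico_zpow (norm_pos_iff.2 hx) one_lt_two
  refine ⟨k, ?_⟩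
  rw [levelSet, mem_ofPred_eq, Real.rpow_intCast,
    show ((k : ℝ) + 1) = ((k + 1 : ℤ) : ℝ) by push_cast; rfl, Real.rpow_intCast]
  exact ⟨h1, h2⟩

theorem coeFn_sum_atom (g : L2 n) (s : Finset ℤ) :
    ((∑ k ∈ s, atom g k : L2 n) : Space n → ℂ) =ᵐ[volume]
      (⋃ k ∈ s, levelSet g k).indicator g := by
  have h1 := Lp.coeFn_finsetSum s fun k => atom g k
  have h2 : ∀ᵐ x, ∀ k : ℤ, atom g k x = (levelSet g k).indicator g x :=
    ae_all_iff.2 fun k => coeFn_atom g k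
  filter_upwards [h1, h2] with x hx1 hx2
  rw [hx1, Finset.indicator_biUnion _ _ fun k _ l _ hkl => disjoint_levelSet g hkl]
  simp [hx2]

/-- The finite sets of levels that exhaust `ℤ`. -/
abbrev levels (K : ℕ) : Finset ℤ := Finset.Icc (-(K : ℤ)) K

theorem norm_sum_atom_le (g : L2 n) (s : Finset ℤ) : ‖∑ k ∈ s, atom g k‖ ≤ ‖g‖ := by
  refine Lp.norm_le_norm_of_ae_le ?_
  filter_upwards [coeFn_sum_atom g s] with x hx
  rw [hx]
  exact norm_indicator_le_norm_self _ _

/-- The atoms of `g` sum to `g` in `L²`, by dominated convergence. -/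
theorem tendsto_sum_atom (g : L2 n) :
    Filter.Tendsto (fun K : ℕ => ∑ k ∈ levels K, atom g k) Filter.atTop (nhds g) := by
  rw [Lp.tendsto_Lp_iff_tendsto_eLpNorm']
  have h : ∀ K : ℕ, eLpNorm (⇑(∑ k ∈ levels K, atom g k : L2 n) - ⇑g) 2 volume =
      (∫⁻ x : Space n, (⋃ k ∈ levels K, levelSet g k)ᶜ.indicator (fun x => ‖g x‖ₑ ^ 2) x) ^ (1 / 2 : ℝ) := by
    intro K
    rw [eLpNorm_eq_lintegral_rpow_enorm_toReal (by norm_num) (by norm_num)]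
    norm_num only [ENNReal.toReal_ofNat, ENNReal.rpow_two]
    congr 1
    refine lintegral_congr_ae ?_
    filter_upwards [coeFn_sum_atom g (levels K)] with x hx
    rw [Pi.sub_apply, hx]
    by_cases hm : x ∈ ⋃ k ∈ levels K, levelSet g k
    · rw [indicator_of_mem hm, indicator_of_notMem (notMem_compl_iff.2 hm)]
      simp
    · rw [indicator_of_notMem hm, indicator_of_mem (mem_compl hm)]
      simp
  simp_rw [h]
  have h0 : Filter.Tendsto (fun K : ℕ => ∫⁻ x : Space n,
      (⋃ k ∈ levels K, levelSet g k)ᶜ.indicator (fun x => ‖g x‖ₑ ^ 2) x) Filter.atTop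
      (nhds (∫⁻ _ : Space n, (0 : ℝ≥0∞))) := by
    have hgm := (Lp.stronglyMeasurable g).measurable
    refine tendsto_lintegral_of_dominated_convergence (fun x => ‖g x‖ₑ ^ 2) ?_ ?_ ?_ ?_
    · intro K
      refine Measurable.indicator (hgm.enorm.pow_const 2) (MeasurableSet.compl ?_)
      exact Finset.measurableSet_biUnion _ fun k _ => measurableSet_levelSet g k
    · exact fun K => Filter.Eventually.of_forall fun x => indicator_le_self _ _ _
    · have := lintegral_rpow_enorm_lt_top_of_eLpNorm_lt_top (by norm_num) (by norm_num)
        (Lp.memLp g).2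
      norm_num only [ENNReal.toReal_ofNat, ENNReal.rpow_two] at this
      exact this.ne
    · refine Filter.Eventually.of_forall fun x => ?_
      refine tendsto_const_nhds.congr' ?_
      by_cases hx : g x = 0
      · refine Filter.Eventually.of_forall fun K => ?_
        simp [indicator, hx]
      · obtain ⟨k, hk⟩ := exists_mem_levelSet hx
        filter_upwards [Filter.eventually_ge_atTop k.natAbs] with K hK
        rw [indicator_of_notMem]
        rw [notMem_compl_iff, mem_iUnion₂]
        exact ⟨k, by rw [Finset.mem_Icc]; omega, hk⟩
  rw [lintegral_zero] at h0
  have := h0.ennrpow_const (1 / 2 : ℝ)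
  simpa using this

/-- The Keel–Tao estimate: the retarded bilinear form is bounded at the double endpoint. -/
theorem TestCurve.enorm_windowForm_le (hn : 3 ≤ n) (G G' : TestCurve n) :
    ‖windowForm (Ioi 0) (G.pull G.fn) (G'.pull G'.fn)‖ₑ ≤
      keelTaoConst n * (G.size * G'.size) := by
  -- The bound is proved for finitely many levels, with constants independent of their number.
  let PK : TestCurve n → ℕ → ℝ → L2 n := fun G K t => ∑ k ∈ levels K, G.atomPull k t
  have hPK : ∀ (G : TestCurve n) K t,
      PK G K t = G.pull (fun i => ∑ k ∈ levels K, atom (G.fn i) k) t := by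
    intro G K t
    simp only [PK, atomPull, pull]
    rw [Finset.smul_sum, map_sum]
  have hbound : ∀ K, ‖windowForm (Ioi 0) (PK G K) (PK G' K)‖ₑ ≤
      keelTaoConst n * (G.size * G'.size) := by
    intro K
    rw [windowForm_sum _ _ G.integrable_atomPull G'.integrable_atomPull]
    calc _ ≤ ∑ k ∈ levels K, ∑ l ∈ levels K,
          ‖windowForm (Ioi 0) (G.atomPull k) (G'.atomPull l)‖ₑ :=
          (enorm_sum_le _ _).trans (Finset.sum_le_sum fun k _ => enorm_sum_le _ _)
      _ ≤ ∑ k ∈ levels K, ∑ l ∈ levels K, 8 * dyadicSum *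
          (twoPow (-(1 / (12 * (n + 2)) * |((k - l : ℤ) : ℝ)|)) *
            (G.atomSize k * G'.atomSize l)) :=
          Finset.sum_le_sum fun k _ => Finset.sum_le_sum fun l _ =>
            G.windowForm_atoms_le hn G' k l
      _ = 8 * dyadicSum * ∑ k ∈ levels K, ∑ l ∈ levels K,
          (twoPow (-(1 / (12 * (n + 2)) * |((k - l : ℤ) : ℝ)|)) *
            (G.atomSize k * G'.atomSize l)) := by
          simp_rw [Finset.mul_sum]
      _ ≤ 8 * dyadicSum * ((∑' m : ℤ, twoPow (-(1 / (12 * (n + 2)) * |(m : ℝ)|))) *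
          ((∑ k ∈ levels K, G.atomSize k ^ 2) ^ (1 / 2 : ℝ) *
            (∑ l ∈ levels K, G'.atomSize l ^ 2) ^ (1 / 2 : ℝ))) := by
          refine mul_le_mul_right (sum_convolution_le
            (fun m : ℤ => twoPow (-(1 / (12 * (n + 2)) * |(m : ℝ)|))) ?_ _ _ _) _
          intro m
          simp only [Int.cast_neg, abs_neg]
      _ ≤ _ := by
          rw [keelTaoConst, mul_assoc (8 * dyadicSum)]
          gcongr
          · exact G.sum_atomSize_sq_le _
          · exact G'.sum_atomSize_sq_le _
  have hlim : Filter.Tendsto (fun K => windowForm (Ioi 0) (PK G K) (PK G' K)) Filter.atTop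
      (nhds (windowForm (Ioi 0) (G.pull G.fn) (G'.pull G'.fn))) := by
    obtain ⟨R, hR⟩ := G.exists_norm_fn_le
    obtain ⟨R', hR'⟩ := G'.exists_norm_fn_le
    have hpt : ∀ (G : TestCurve n) t,
        Filter.Tendsto (fun K => PK G K t) Filter.atTop (nhds (G.pull G.fn t)) := by
      intro G t
      simp_rw [hPK]
      exact ((freeProp (-t)).continuous.tendsto _).comp ((tendsto_sum_atom _).const_smul _)
    have hle : ∀ (G : TestCurve n) (R : ℝ) (_ : ∀ i, ‖G.fn i‖ ≤ R) K t,
        ‖PK G K t‖ ≤ ‖G.coeff t‖ * R := by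
      intro G R hR K t
      rw [hPK, norm_pull]
      exact mul_le_mul_of_nonneg_left ((norm_sum_atom_le _ _).trans (hR _)) (norm_nonneg _)
    have hmeas : ∀ (G : TestCurve n) K, Integrable (PK G K) := fun G K =>
      integrable_finsetSum _ fun k _ => G.integrable_atomPull k
    unfold windowForm
    refine tendsto_integral_of_dominated_convergence
      (fun p => (‖G.coeff p.1‖ * R) * (‖G'.coeff p.2‖ * R')) ?_ ?_ ?_ ?_
    · exact fun K => (integrable_inner_prod (hmeas G K) (hmeas G' K)).aestronglyMeasurable.restrict
    · refine Integrable.integrableOn ?_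
      rw [Measure.volume_eq_prod]
      exact (G.integrable_coeff.norm.mul_const R).mul_prod (G'.integrable_coeff.norm.mul_const R')
    · refine fun K => Filter.Eventually.of_forall fun p => ?_
      refine (norm_inner_le_norm _ _).trans ?_
      exact mul_le_mul (hle G R hR K _) (hle G' R' hR' K _) (norm_nonneg _)
        ((norm_nonneg _).trans (hle G R hR K _))
    · exact Filter.Eventually.of_forall fun p => (hpt G p.1).inner (hpt G' p.2)
  exact le_of_tendsto hlim.enorm (Filter.Eventually.of_forall hbound)

/-! ### Duality for the endpoint space norm -/

/-- The endpoint exponent `2n/(n-2)`. -/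
def endpointExp (n : ℕ) : ℝ := 2 * n / (n - 2)

theorem two_lt_endpointExp (hn : 3 ≤ n) : 2 < endpointExp n := by
  have : (3 : ℝ) ≤ n := by exact_mod_cast hn
  unfold endpointExp
  rw [lt_div_iff₀ (by linarith)]
  linarith

theorem dualExp_pos (hn : 3 ≤ n) : 0 < dualExp n := lt_of_lt_of_le one_pos (one_le_dualExp hn)

theorem eLpNorm_dualExp_eq (hn : 3 ≤ n) (g : Space n → ℂ) :
    eLpNorm g (ENNReal.ofReal (dualExp n)) volume =
      (∫⁻ x, ‖g x‖ₑ ^ dualExp n) ^ (1 / dualExp n) := by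
  have h := dualExp_pos hn
  rw [eLpNorm_eq_lintegral_rpow_enorm_toReal (by simpa using h) ENNReal.ofReal_ne_top,
    ENNReal.toReal_ofReal h.le]

theorem lintegral_le_one_of_eLpNorm (hn : 3 ≤ n) {g : Space n → ℂ}
    (hg : eLpNorm g (ENNReal.ofReal (dualExp n)) volume ≤ 1) : ∫⁻ x, ‖g x‖ₑ ^ dualExp n ≤ 1 := by
  have h := dualExp_pos hn
  rw [eLpNorm_dualExp_eq hn] at hg
  by_contra hc
  exact absurd hg (not_le.2 (ENNReal.one_lt_rpow (not_le.1 hc) (by positivity)))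

/-- The Schwartz functions in the unit ball of `L^{2n/(n+2)}` come arbitrarily close, in `L²`, to
each boundedly supported function in the ball of radius one half. -/
theorem exists_schwartz_near (hn : 3 ≤ n) {h : L2 n} {R : ℝ} (hR : 0 < R)
    (hsupp : ∀ᵐ x, R < ‖x‖ → h x = 0)
    (hh : eLpNorm h (ENNReal.ofReal (dualExp n)) volume ≤ 1 / 2) {ε : ℝ} (hε : 0 < ε) :
    ∃ g : 𝓢(Space n, ℂ), ∫⁻ x, ‖g x‖ₑ ^ dualExp n ≤ 1 ∧ ‖toL2 g - h‖ < ε := by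
  -- Approximate in `L²` and cut off. On a ball the `L²` norm controls the `L^p` norm, `p = 2n/(n+2)`,
  -- up to the power `θ` of the volume, so the cut-off stays in the unit ball of `L^p`.
  let χ : ContDiffBump (0 : Space n) := ⟨R, 2 * R, hR, by linarith⟩
  set V : ℝ≥0∞ := volume (Metric.ball (0 : Space n) (2 * R)) with hV
  have hVt : V ≠ ⊤ := measure_ball_lt_top.ne
  set θ : ℝ := 1 / dualExp n - 1 / 2 with hθ
  have hp := dualExp_pos hn
  have hθ0 : 0 ≤ θ := by
    rw [hθ, sub_nonneg]
    exact one_div_le_one_div_of_le hp dualExp_le_two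
  have hVθ : V ^ θ ≠ ⊤ := ENNReal.rpow_ne_top_of_nonneg hθ0 hVt
  obtain ⟨δ, hδ0, hδ⟩ : ∃ δ : ℝ, 0 < δ ∧ ENNReal.ofReal δ * V ^ θ ≤ 1 / 2 := by
    refine ⟨1 / (2 * ((V ^ θ).toReal + 1)), by positivity, ?_⟩
    rw [← ENNReal.ofReal_toReal hVθ, ← ENNReal.ofReal_mul (by positivity)]
    rw [show (1 / 2 : ℝ≥0∞) = ENNReal.ofReal (1 / 2) by
      rw [ENNReal.ofReal_div_of_pos two_pos]; simp]
    refine ENNReal.ofReal_le_ofReal ?_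
    have := ENNReal.toReal_nonneg (a := V ^ θ)
    rw [one_div_mul_eq_div, ENNReal.toReal_ofReal this, div_le_div_iff₀ (by positivity) two_pos]
    linarith
  obtain ⟨φ, hφ⟩ := Metric.denseRange_iff.1 denseRange_toL2 h (min ε δ) (lt_min hε hδ0)
  rw [dist_comm, dist_eq_norm] at hφ
  have hcs : HasCompactSupport fun x => ((χ x : ℝ) : ℂ) * φ x := by
    have h1 : HasCompactSupport fun x => ((χ x : ℝ) : ℂ) :=
      χ.hasCompactSupport.comp_left (g := fun r : ℝ => (r : ℂ)) rfl
    exact h1.mul_right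
  have hcd : ContDiff ℝ ((⊤ : ℕ∞) : WithTop ℕ∞) fun x => ((χ x : ℝ) : ℂ) * φ x :=
    (Complex.ofRealCLM.contDiff.comp χ.contDiff).mul (φ.smooth _)
  let g : 𝓢(Space n, ℂ) := hcs.toSchwartzMap hcd
  have hg : ∀ x, g x = ((χ x : ℝ) : ℂ) * φ x := fun x => rfl
  have hsub : ∀ᵐ x, g x - h x = ((χ x : ℝ) : ℂ) * (φ x - h x) := by
    filter_upwards [hsupp] with x hx
    rw [hg]
    by_cases hxR : ‖x‖ ≤ R
    · rw [χ.one_of_mem_closedBall (by simpa using hxR)]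
      simp
    · rw [hx (not_le.1 hxR)]
      ring
  have hle : ∀ᵐ x, ‖(toL2 g - h) x‖ ≤ ‖(toL2 φ - h) x‖ := by
    filter_upwards [hsub, Lp.coeFn_sub (toL2 g) h, Lp.coeFn_sub (toL2 φ) h,
      g.coeFn_toLp 2, φ.coeFn_toLp 2] with x h1 h2 h3 h4 h5
    rw [h2, h3, Pi.sub_apply, Pi.sub_apply, h4, h5, h1, norm_mul, Complex.norm_real,
      Real.norm_of_nonneg χ.nonneg]
    exact mul_le_of_le_one_left (norm_nonneg _) χ.le_one
  have hnorm : ‖toL2 g - h‖ < min ε δ := (Lp.norm_le_norm_of_ae_le hle).trans_lt hφ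
  refine ⟨g, lintegral_le_one_of_eLpNorm hn ?_, hnorm.trans_le (min_le_left _ _)⟩
  have hq2 : ENNReal.ofReal (dualExp n) ≤ 2 := by
    rw [show (2 : ℝ≥0∞) = ENNReal.ofReal 2 by simp]
    exact ENNReal.ofReal_le_ofReal dualExp_le_two
  have hq1 : 1 ≤ ENNReal.ofReal (dualExp n) := by
    rw [← ENNReal.ofReal_one]
    exact ENNReal.ofReal_le_ofReal (one_le_dualExp hn)
  have hdiff : eLpNorm (⇑(toL2 g - h)) (ENNReal.ofReal (dualExp n)) volume ≤ 1 / 2 := by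
    have hind : ⇑(toL2 g - h) =ᵐ[volume]
        (Metric.ball (0 : Space n) (2 * R)).indicator ⇑(toL2 g - h) := by
      filter_upwards [hsub, Lp.coeFn_sub (toL2 g) h, g.coeFn_toLp 2] with x h1 h2 h4
      by_cases hx : x ∈ Metric.ball (0 : Space n) (2 * R)
      · rw [indicator_of_mem hx]
      · rw [indicator_of_notMem hx, h2, Pi.sub_apply, h4, h1,
          χ.zero_of_le_dist (by simpa using hx)]
        simp
    rw [eLpNorm_congr_ae hind, eLpNorm_indicator_eq_eLpNorm_restrict Metric.isOpen_ball.measurableSet]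
    refine (eLpNorm_le_eLpNorm_mul_rpow_measure_univ hq2
      (Lp.aestronglyMeasurable _).restrict).trans ?_
    rw [ENNReal.toReal_ofReal hp.le, Measure.restrict_apply_univ, ENNReal.toReal_ofNat]
    refine le_trans (mul_le_mul_left ?_ _) hδ
    refine (eLpNorm_mono_measure _ Measure.restrict_le_self).trans ?_
    rw [← Lp.enorm_def, ← ofReal_norm]
    exact ENNReal.ofReal_le_ofReal (hnorm.le.trans (min_le_right _ _))
  have hsplit : (g : Space n → ℂ) =ᵐ[volume] ⇑(toL2 g - h) + ⇑h := by
    filter_upwards [Lp.coeFn_sub (toL2 g) h, g.coeFn_toLp 2] with x h2 h4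
    rw [Pi.add_apply, h2, Pi.sub_apply, h4, sub_add_cancel]
  rw [eLpNorm_congr_ae hsplit]
  refine (eLpNorm_add_le (Lp.aestronglyMeasurable _) (Lp.aestronglyMeasurable _) hq1).trans ?_
  refine (add_le_add hdiff hh).trans_eq (ENNReal.add_halves 1)

/-- If `h` and `f` have the same phase, their inner product is the integral of the product of the
moduli. -/
theorem enorm_inner_eq_lintegral {h f : L2 n}
    (H : ∀ᵐ x, inner ℂ (h x) (f x) = ((‖h x‖ * ‖f x‖ : ℝ) : ℂ)) :
    ‖inner ℂ h f‖ₑ = ∫⁻ x, ‖h x‖ₑ * ‖f x‖ₑ := by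
  have hi : Integrable (fun x => ‖h x‖ * ‖f x‖) := by
    have := (L2.integrable_inner (𝕜 := ℂ) h f).norm
    refine this.congr ?_
    filter_upwards [H] with x hx
    rw [hx, Complex.norm_real, Real.norm_of_nonneg (by positivity)]
  rw [L2.inner_def, integral_congr_ae H, integral_complex_ofReal, ← ofReal_norm, Complex.norm_real,
    Real.norm_of_nonneg (integral_nonneg fun x => by positivity),
    ofReal_integral_eq_lintegral_ofReal hi (Filter.Eventually.of_forall fun x => by positivity)]
  refine lintegral_congr fun x => ?_
  rw [ENNReal.ofReal_mul (norm_nonneg _), ofReal_norm, ofReal_norm]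

/-- The dual function `|f|^{r-2} f`, truncated to a set `E` on which `f` is bounded and normalised,
computes the `Lʳ(E)` norm of `f`. -/
theorem exists_dual_function (hn : 3 ≤ n) (f : L2 n) {E : Set (Space n)} (hE : MeasurableSet E)
    {N : ℝ} (hN : ∀ x ∈ E, ‖f x‖ ≤ N)
    (hA0 : ∫⁻ x in E, ‖f x‖ₑ ^ endpointExp n ≠ 0) (hAt : ∫⁻ x in E, ‖f x‖ₑ ^ endpointExp n ≠ ⊤) :
    ∃ h : L2 n, eLpNorm h (ENNReal.ofReal (dualExp n)) volume ≤ 1 / 2 ∧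
      (∀ᵐ x, x ∉ E → h x = 0) ∧
      (∫⁻ x in E, ‖f x‖ₑ ^ endpointExp n) ^ (1 / endpointExp n) = 2 * ‖inner ℂ h f‖ₑ := by
  set r := endpointExp n with hr
  set p := dualExp n with hpdef
  set A := ∫⁻ x in E, ‖f x‖ₑ ^ r with hA
  have hn0 : (3 : ℝ) ≤ n := by exact_mod_cast hn
  have hr2 : 2 < r := two_lt_endpointExp hn
  have hp0 : 0 < p := dualExp_pos hn
  have hrp : (r - 1) * p = r := by
    rw [hr, hpdef, endpointExp, dualExp]
    have : (n : ℝ) - 2 ≠ 0 := by linarith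
    field_simp
    ring
  have hrp' : 1 - 1 / p = 1 / r := by
    rw [hr, hpdef, endpointExp, dualExp]
    have : (n : ℝ) - 2 ≠ 0 := by linarith
    field_simp
    ring
  -- Norm one half rather than one leaves room for an approximation by Schwartz functions.
  set c : ℝ := (1 / 2) * A.toReal ^ (-(1 / p)) with hc
  have hApos : 0 < A.toReal := ENNReal.toReal_pos hA0 hAt
  have hc0 : 0 < c := by positivity
  have hce : ENNReal.ofReal c = 1 / 2 * A ^ (-(1 / p)) := by
    rw [hc, ENNReal.ofReal_mul (by norm_num), ← ENNReal.ofReal_rpow_of_pos hApos,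
      ENNReal.ofReal_toReal hAt, ENNReal.ofReal_div_of_pos two_pos]
    simp
  have hfm := (Lp.stronglyMeasurable f).measurable
  let k : Space n → ℂ := E.indicator fun x => ((c * ‖f x‖ ^ (r - 2) : ℝ) : ℂ) * f x
  have hkm : Measurable k := by
    refine Measurable.indicator ?_ hE
    exact (Complex.measurable_ofReal.comp ((hfm.norm.pow_const _).const_mul c)).mul hfm
  have hkn : ∀ x, ‖k x‖ₑ = E.indicator (fun x => ENNReal.ofReal c * ‖f x‖ₑ ^ (r - 1)) x := by
    intro x
    by_cases hx : x ∈ E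
    · simp only [k, indicator_of_mem hx]
      rw [enorm_mul, ← ofReal_norm, Complex.norm_real, Real.norm_of_nonneg (by positivity),
        ENNReal.ofReal_mul hc0.le, ← ENNReal.ofReal_rpow_of_nonneg (norm_nonneg _) (by linarith),
        ofReal_norm, mul_assoc]
      congr 1
      nth_rw 2 [← ENNReal.rpow_one ‖f x‖ₑ]
      rw [← ENNReal.rpow_add_of_nonneg _ _ (by linarith) zero_le_one]
      congr 1
      ring
    · simp only [k, indicator_of_notMem hx, enorm_zero]
  have hkLp : MemLp k 2 volume := by
    refine (Lp.memLp f).of_le_mul (c := c * N ^ (r - 2)) hkm.aestronglyMeasurable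
      (Filter.Eventually.of_forall fun x => ?_)
    by_cases hx : x ∈ E
    · simp only [k, indicator_of_mem hx]
      rw [norm_mul, Complex.norm_real, Real.norm_of_nonneg (by positivity)]
      have := Real.rpow_le_rpow (norm_nonneg _) (hN x hx) (by linarith : 0 ≤ r - 2)
      gcongr
    · simp only [k, indicator_of_notMem hx, norm_zero]
      by_cases hE' : E.Nonempty
      · obtain ⟨y, hy⟩ := hE'
        have : 0 ≤ N := (norm_nonneg _).trans (hN y hy)
        positivity
      · rw [not_nonempty_iff_eq_empty] at hE'
        exact absurd (by rw [hA, hE']; simp) hA0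
  have hcoe := hkLp.coeFn_toLp
  refine ⟨hkLp.toLp k, ?_, ?_, ?_⟩
  · rw [eLpNorm_congr_ae hcoe, eLpNorm_dualExp_eq hn]
    have : ∫⁻ x, ‖k x‖ₑ ^ p = (1 / 2) ^ p := by
      have h1 : ∀ x, ‖k x‖ₑ ^ p =
          E.indicator (fun x => ENNReal.ofReal c ^ p * ‖f x‖ₑ ^ r) x := by
        intro x
        rw [hkn]
        by_cases hx : x ∈ E
        · rw [indicator_of_mem hx, indicator_of_mem hx, ENNReal.mul_rpow_of_nonneg _ _ hp0.le,
            ← ENNReal.rpow_mul, hrp]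
        · rw [indicator_of_notMem hx, indicator_of_notMem hx, ENNReal.zero_rpow_of_pos hp0]
      simp_rw [h1]
      rw [lintegral_indicator hE, lintegral_const_mul _ (hfm.enorm.pow_const _), hce,
        ENNReal.mul_rpow_of_nonneg _ _ hp0.le, ← ENNReal.rpow_mul, mul_assoc,
        show -(1 / p) * p = -1 by field_simp, ENNReal.rpow_neg_one, ENNReal.inv_mul_cancel hA0 hAt,
        mul_one]
    rw [this, ← ENNReal.rpow_mul, mul_one_div_cancel hp0.ne', ENNReal.rpow_one]
  · filter_upwards [hcoe] with x hx hxE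
    rw [hx]
    exact indicator_of_notMem hxE _
  · rw [enorm_inner_eq_lintegral]
    · have h1 : ∀ᵐ x, ‖hkLp.toLp k x‖ₑ * ‖f x‖ₑ =
          E.indicator (fun x => ENNReal.ofReal c * ‖f x‖ₑ ^ r) x := by
        filter_upwards [hcoe] with x hx
        rw [hx, hkn]
        by_cases hxE : x ∈ E
        · rw [indicator_of_mem hxE, indicator_of_mem hxE, mul_assoc]
          congr 1
          nth_rw 2 [← ENNReal.rpow_one ‖f x‖ₑ]
          rw [← ENNReal.rpow_add_of_nonneg _ _ (by linarith) zero_le_one]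
          congr 1
          ring
        · rw [indicator_of_notMem hxE, indicator_of_notMem hxE, zero_mul]
      rw [lintegral_congr_ae h1, lintegral_indicator hE,
        lintegral_const_mul _ (hfm.enorm.pow_const _), hce, ← mul_assoc, ← mul_assoc,
        show (2 : ℝ≥0∞) * (1 / 2) = 1 by
          rw [one_div]; exact ENNReal.mul_inv_cancel two_ne_zero ENNReal.ofNat_ne_top, one_mul]
      change A ^ (1 / r) = A ^ (-(1 / p)) * A
      nth_rw 3 [← ENNReal.rpow_one A]
      rw [← ENNReal.rpow_add _ _ hA0 hAt]
      congr 1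
      linarith
    · filter_upwards [hcoe] with x hx
      rw [hx]
      by_cases hxE : x ∈ E
      · simp only [k, indicator_of_mem hxE]
        rw [norm_mul, Complex.norm_real, Real.norm_of_nonneg (by positivity), RCLike.inner_apply, map_mul, Complex.conj_ofReal,
          mul_left_comm, Complex.mul_conj, Complex.normSq_eq_norm_sq]
        push_cast
        ring
      · simp only [k, indicator_of_notMem hxE]
        simp

/-- A countable family of Schwartz functions in the unit ball of `L^{2n/(n+2)}` that controls the
`L^{2n/(n-2)}` norm. -/
theorem exists_testFamily (hn : 3 ≤ n) : ∃ g : ℕ → 𝓢(Space n, ℂ),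
    (∀ i, ∫⁻ x, ‖g i x‖ₑ ^ dualExp n ≤ 1) ∧ ∀ f : L2 n,
      eLpNorm f (ENNReal.ofReal (endpointExp n)) volume ≤ 2 * ⨆ i, ‖inner ℂ (toL2 (g i)) f‖ₑ := by
  have : Fact ((2 : ℝ≥0∞) ≠ ⊤) := ⟨by norm_num⟩
  let D : Set (L2 n) := {h | ∃ g : 𝓢(Space n, ℂ), ∫⁻ x, ‖g x‖ₑ ^ dualExp n ≤ 1 ∧ toL2 g = h}
  obtain ⟨t, htD, htc, hDt⟩ :=
    (TopologicalSpace.IsSeparable.of_separableSpace D).exists_countable_dense_subset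
  have hD : (0 : L2 n) ∈ D := by
    refine ⟨0, ?_, map_zero (SchwartzMap.toLpCLM ℂ ℂ 2 volume)⟩
    simp [dualExp_pos hn]
  have htn : t.Nonempty := closure_nonempty_iff.1 ⟨0, hDt hD⟩
  obtain ⟨d, hd⟩ := htc.exists_eq_range htn
  have hdD : ∀ i, d i ∈ D := fun i => htD (by rw [hd]; exact mem_range_self i)
  choose g hg1 hg2 using hdD
  refine ⟨g, hg1, fun f => ?_⟩
  set S : ℝ≥0∞ := ⨆ i, ‖inner ℂ (toL2 (g i)) f‖ₑ with hS
  have hr2 := two_lt_endpointExp hn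
  have hclosure : ∀ h ∈ closure D, ‖inner ℂ h f‖ₑ ≤ S := by
    have hclosed : IsClosed {h : L2 n | ‖inner ℂ h f‖ₑ ≤ S} :=
      isClosed_le (by fun_prop) continuous_const
    have h1 : closure D ⊆ closure t := closure_minimal hDt isClosed_closure
    refine fun h hh => closure_minimal ?_ hclosed (h1 hh)
    rw [hd]
    rintro _ ⟨i, rfl⟩
    rw [mem_ofPred_eq, ← hg2 i]
    exact le_iSup (fun i => ‖inner ℂ (toL2 (g i)) f‖ₑ) i
  have hfm := (Lp.stronglyMeasurable f).measurable
  let E : ℕ → Set (Space n) := fun N => {x | ‖x‖ ≤ N ∧ ‖f x‖ ≤ N}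
  have hEm : ∀ N, MeasurableSet (E N) := fun N =>
    (measurableSet_le measurable_norm measurable_const).inter
      (measurableSet_le hfm.norm measurable_const)
  have hEmono : Monotone E := by
    intro N M hNM x hx
    have : (N : ℝ) ≤ M := by exact_mod_cast hNM
    exact ⟨hx.1.trans this, hx.2.trans this⟩
  have hEU : ⋃ N, E N = univ := by
    refine eq_univ_of_forall fun x => mem_iUnion.2 ?_
    obtain ⟨N, hN⟩ := exists_nat_ge (max ‖x‖ ‖f x‖)
    exact ⟨N, (le_max_left _ _).trans hN, (le_max_right _ _).trans hN⟩
  have hlevel : ∀ N, (∫⁻ x in E N, ‖f x‖ₑ ^ endpointExp n) ^ (1 / endpointExp n) ≤ 2 * S := by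
    intro N
    set A := ∫⁻ x in E N, ‖f x‖ₑ ^ endpointExp n with hA
    by_cases hA0 : A = 0
    · rw [hA0, ENNReal.zero_rpow_of_pos (by positivity)]
      exact zero_le
    have hAt : A ≠ ⊤ := by
      have h1 : A ≤ ∫⁻ _ in E N, (ENNReal.ofReal N) ^ endpointExp n := by
        refine setLIntegral_mono measurable_const fun x hx => ?_
        refine ENNReal.rpow_le_rpow ?_ (by linarith)
        rw [← ofReal_norm]
        exact ENNReal.ofReal_le_ofReal hx.2
      refine ne_top_of_le_ne_top ?_ h1
      rw [setLIntegral_const]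
      refine ENNReal.mul_ne_top (ENNReal.rpow_ne_top_of_nonneg (by linarith)
        ENNReal.ofReal_ne_top) ?_
      have h2 : E N ⊆ Metric.closedBall 0 N := fun x hx => by simpa using hx.1
      exact ((measure_mono h2).trans_lt measure_closedBall_lt_top).ne
    obtain ⟨h, hh1, hh2, hh3⟩ := exists_dual_function hn f (hEm N) (fun x hx => hx.2) hA0 hAt
    rw [hh3]
    refine mul_le_mul_right (hclosure h ?_) _
    rw [Metric.mem_closure_iff]
    intro ε hε
    obtain ⟨g', hg', hgε⟩ := exists_schwartz_near hn (R := N + 1) (by positivity)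
      (hh2.mono fun x hx hxN => hx fun hxE => by linarith [hxE.1]) hh1 hε
    exact ⟨toL2 g', ⟨g', hg', rfl⟩, by rwa [dist_comm, dist_eq_norm]⟩
  have hr0 : 0 < endpointExp n := by linarith
  rw [eLpNorm_eq_lintegral_rpow_enorm_toReal (by simpa using hr0) ENNReal.ofReal_ne_top,
    ENNReal.toReal_ofReal hr0.le]
  rw [← setLIntegral_univ, ← hEU, setLIntegral_iUnion_of_directed _ hEmono.directed_le]
  rw [one_div, ENNReal.rpow_inv_le_iff hr0]
  refine iSup_le fun N => ?_
  have := hlevel N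
  rwa [one_div, ENNReal.rpow_inv_le_iff hr0] at this

/-! ### From test curves to Strichartz norms -/

/-- An admissible pair is `(∞, 2)` or consists of finite exponents. -/
theorem IsAdmissible.cases (hn : 3 ≤ n) {q r : ℝ≥0∞} (h : IsAdmissible n q r) :
    (q = ⊤ ∧ r = 2) ∨ ∃ q' r' : ℝ, q = ENNReal.ofReal q' ∧ r = ENNReal.ofReal r' ∧ 2 ≤ q' ∧
      2 ≤ r' ∧ 2 / q' + n / r' = n / 2 := by
  obtain ⟨hq, hr, he⟩ := h
  have hn0 : (3 : ℝ) ≤ n := by exact_mod_cast hn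
  have hnt : (n : ℝ≥0∞) ≠ ⊤ := ENNReal.natCast_ne_top n
  have hr0 : r ≠ 0 := (lt_of_lt_of_le two_pos hr).ne'
  have hq0 : q ≠ 0 := (lt_of_lt_of_le two_pos hq).ne'
  have hf1 : 2 / q ≠ ⊤ := ENNReal.div_ne_top (by norm_num) hq0
  have hf2 : (n : ℝ≥0∞) / r ≠ ⊤ := ENNReal.div_ne_top hnt hr0
  have he' := congrArg ENNReal.toReal he
  rw [ENNReal.toReal_add hf1 hf2, ENNReal.toReal_div, ENNReal.toReal_div, ENNReal.toReal_div,
    ENNReal.toReal_natCast, ENNReal.toReal_ofNat] at he'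
  have hq2 : q ≠ ⊤ → 2 ≤ q.toReal := fun hqt => by
    have := ENNReal.toReal_mono hqt hq
    rwa [ENNReal.toReal_ofNat] at this
  have hr2 : r ≠ ⊤ → 2 ≤ r.toReal := fun hrt => by
    have := ENNReal.toReal_mono hrt hr
    rwa [ENNReal.toReal_ofNat] at this
  by_cases hqt : q = ⊤
  · left
    refine ⟨hqt, ?_⟩
    rw [hqt, ENNReal.toReal_top, div_zero, zero_add] at he'
    by_cases hrt : r = ⊤
    · rw [hrt, ENNReal.toReal_top, div_zero] at he'
      linarith
    · have := hr2 hrt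
      rw [div_eq_div_iff (by linarith) two_ne_zero] at he'
      have h2 : r.toReal = 2 := by
        have h3 : (n : ℝ) * (r.toReal - 2) = 0 := by linarith
        rcases mul_eq_zero.1 h3 with h | h <;> linarith
      rw [← ENNReal.ofReal_toReal hrt, h2]
      simp
  · right
    have h2q := hq2 hqt
    have hrt : r ≠ ⊤ := by
      intro hrt
      rw [hrt, ENNReal.toReal_top, div_zero, add_zero, div_eq_div_iff (by linarith) two_ne_zero]
        at he'
      nlinarith
    exact ⟨q.toReal, r.toReal, (ENNReal.ofReal_toReal hqt).symm, (ENNReal.ofReal_toReal hrt).symm,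
      h2q, hr2 hrt, he'⟩

/-- Hölder interpolation between `L²` and the endpoint space, along an admissible pair. -/
theorem eLpNorm_rpow_le_interpolate (hn : 3 ≤ n) {f : Space n → ℂ}
    (hf : AEStronglyMeasurable f volume) {q r : ℝ} (hq : 2 ≤ q) (hr : 2 ≤ r)
    (h : 2 / q + n / r = n / 2) :
    eLpNorm f (ENNReal.ofReal r) volume ^ q ≤ eLpNorm f 2 volume ^ (q - 2) *
      eLpNorm f (ENNReal.ofReal (endpointExp n)) volume ^ (2 : ℝ) := by
  have hn0 : (3 : ℝ) ≤ n := by exact_mod_cast hn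
  have he2 := two_lt_endpointExp hn
  set e := endpointExp n with he
  have hq0 : 0 < q := by linarith
  have hr0 : 0 < r := by linarith
  have he0 : 0 < e := by linarith
  have hn2 : (n : ℝ) - 2 ≠ 0 := by linarith
  set x : ℝ := r * (q - 2) / (2 * q) with hx
  set y : ℝ := 2 * r / (e * q) with hy
  have hx0 : 0 ≤ x := by
    have : 0 ≤ q - 2 := by linarith
    positivity
  have hy0 : 0 ≤ y := by positivity
  have hxy : x + y = 1 := by
    rw [hx, hy, he, endpointExp]
    field_simp at h ⊢
    nlinarith
  have hpow : 2 * x + e * y = r := by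
    rw [hx, hy]
    field_simp
    ring
  rw [eLpNorm_eq_lintegral_rpow_enorm_toReal (by simpa using hr0) ENNReal.ofReal_ne_top,
    eLpNorm_eq_lintegral_rpow_enorm_toReal (by simpa using he0) ENNReal.ofReal_ne_top,
    eLpNorm_eq_lintegral_rpow_enorm_toReal two_ne_zero ENNReal.ofNat_ne_top,
    ENNReal.toReal_ofReal hr0.le, ENNReal.toReal_ofReal he0.le, ENNReal.toReal_ofNat,
    ← ENNReal.rpow_mul, ← ENNReal.rpow_mul, ← ENNReal.rpow_mul]
  have h1 : ∫⁻ z, ‖f z‖ₑ ^ r ≤ (∫⁻ z, ‖f z‖ₑ ^ (2 : ℝ)) ^ x * (∫⁻ z, ‖f z‖ₑ ^ e) ^ y := by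
    refine le_trans (le_of_eq ?_) (ENNReal.lintegral_mul_norm_pow_le
      (hf.enorm.pow_const (2 : ℝ)) (hf.enorm.pow_const e) hx0 hy0 hxy)
    refine lintegral_congr fun z => ?_
    rw [← ENNReal.rpow_mul, ← ENNReal.rpow_mul,
      ← ENNReal.rpow_add_of_nonneg _ _ (by positivity) (by positivity), hpow]
  refine (ENNReal.rpow_le_rpow h1 (by positivity : 0 ≤ 1 / r * q)).trans_eq ?_
  rw [ENNReal.mul_rpow_of_nonneg _ _ (by positivity), ← ENNReal.rpow_mul, ← ENNReal.rpow_mul]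
  congr 2
  · rw [hx]
    field_simp
  · rw [hy]
    field_simp

theorem mixedNorm_ofReal {a b : ℝ} {q : ℝ} (hq : 0 < q) (r : ℝ≥0∞) (u : ℝ → Space n → ℂ) :
    mixedNorm a b (ENNReal.ofReal q) r u =
      (∫⁻ t in Icc a b, eLpNorm (u t) r volume ^ q) ^ (1 / q) := by
  rw [mixedNorm, eLpNorm_eq_lintegral_rpow_enorm_toReal (by simpa using hq) ENNReal.ofReal_ne_top,
    ENNReal.toReal_ofReal hq.le]
  simp only [enorm_eq_self]

theorem mixedNorm_two {a b : ℝ} (r : ℝ≥0∞) (u : ℝ → Space n → ℂ) :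
    mixedNorm a b 2 r u = (∫⁻ t in Icc a b, eLpNorm (u t) r volume ^ (2 : ℝ)) ^ (1 / 2 : ℝ) := by
  rw [← mixedNorm_ofReal two_pos]
  simp

theorem mixedNorm_top_le {a b : ℝ} {r K : ℝ≥0∞} {u : ℝ → Space n → ℂ}
    (h : ∀ t ∈ Icc a b, eLpNorm (u t) r volume ≤ K) : mixedNorm a b ⊤ r u ≤ K := by
  rw [mixedNorm, eLpNorm_exponent_top]
  refine essSup_le_of_ae_le _ ?_
  filter_upwards [ae_restrict_mem measurableSet_Icc] with t ht
  rw [enorm_eq_self]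
  exact h t ht

/-- The Strichartz norm is controlled by its two endpoints. -/
theorem normS0_le_of_endpoints (hn : 3 ≤ n) {a b : ℝ} {K : ℝ≥0∞} {u : ℝ → Space n → ℂ}
    (hu : ∀ t ∈ Icc a b, AEStronglyMeasurable (u t) volume)
    (h2 : ∀ t ∈ Icc a b, eLpNorm (u t) 2 volume ≤ K)
    (hr : mixedNorm a b 2 (ENNReal.ofReal (endpointExp n)) u ≤ K) : normS0 a b u ≤ K := by
  refine iSup_le fun q => iSup_le fun r => iSup_le fun hqr => ?_
  rcases hqr.cases hn with ⟨rfl, rfl⟩ | ⟨q, r, rfl, rfl, hq, hr', h⟩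
  · exact mixedNorm_top_le h2
  · have hq0 : 0 < q := by linarith
    rw [mixedNorm_ofReal hq0, one_div, ENNReal.rpow_inv_le_iff hq0]
    rw [mixedNorm_two, one_div, ENNReal.rpow_inv_le_iff two_pos] at hr
    calc ∫⁻ t in Icc a b, eLpNorm (u t) (ENNReal.ofReal r) volume ^ q
        ≤ ∫⁻ t in Icc a b, K ^ (q - 2) *
            eLpNorm (u t) (ENNReal.ofReal (endpointExp n)) volume ^ (2 : ℝ) := by
          refine setLIntegral_mono' measurableSet_Icc fun t ht => ?_
          refine (eLpNorm_rpow_le_interpolate hn (hu t ht) hq hr' h).trans ?_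
          exact mul_le_mul_left (ENNReal.rpow_le_rpow (h2 t ht) (by linarith)) _
      _ ≤ K ^ (q - 2) * K ^ (2 : ℝ) := by
          by_cases hK : K = ⊤
          · by_cases hq2 : q = 2
            · subst hq2
              simp only [sub_self, ENNReal.rpow_zero, one_mul]
              exact hr
            · rw [hK, ENNReal.top_rpow_of_pos two_pos, ENNReal.top_rpow_of_pos
                (by rcases lt_or_eq_of_le hq with h | h; linarith; exact absurd h.symm hq2)]
              simp
          · rw [lintegral_const_mul' _ _ (ENNReal.rpow_ne_top_of_nonneg (by linarith) hK)]
            exact mul_le_mul_right hr _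
      _ = K ^ q := by
          rw [← ENNReal.rpow_add_of_nonneg _ _ (by linarith) two_pos.le, sub_add_cancel]

/-- A test curve with finitely many Schwartz profiles and a bounded coefficient that vanishes
outside `[a, b]`. -/
structure SchwartzCurve (n : ℕ) (a b : ℝ) extends TestCurve n where
  /-- The Schwartz functions representing the profiles. -/
  profile : ℕ → 𝓢(Space n, ℂ)
  fn_eq : ∀ i, fn i = toL2 (profile i)
  /-- All profiles beyond this index vanish. -/
  top : ℕ
  profile_eq_zero : ∀ i, top < i → profile i = 0
  exists_norm_coeff_le : ∃ R, ∀ t, ‖coeff t‖ ≤ R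
  coeff_eq_zero : ∀ t, t ∉ Icc a b → coeff t = 0

theorem measurable_indicator_of_continuousOn {a b : ℝ} {f : ℝ → ℂ} (hf : ContinuousOn f (Icc a b)) :
    Measurable ((Icc a b).indicator f) := by
  classical
  rw [← Set.piecewise_eq_indicator]
  exact hf.measurable_piecewise continuousOn_const measurableSet_Icc

/-- For finitely many measurable functions, a measurable choice of one of largest modulus. -/
theorem exists_measurable_argmax {c : ℕ → ℝ → ℂ} (hc : ∀ i, Measurable (c i)) (m : ℕ) :
    ∃ ι : ℝ → ℕ, Measurable ι ∧ ∀ t, ι t ≤ m ∧ ∀ j ≤ m, ‖c j t‖ ≤ ‖c (ι t) t‖ := by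
  classical
  have hex : ∀ t, ∃ i, i ≤ m ∧ ∀ j ≤ m, ‖c j t‖ ≤ ‖c i t‖ := by
    intro t
    obtain ⟨i, hi, hmax⟩ := Finset.exists_max_image (Finset.range (m + 1)) (fun i => ‖c i t‖)
      ⟨0, by simp⟩
    exact ⟨i, by simpa [Nat.lt_succ_iff] using hi, fun j hj => hmax j (by simp; omega)⟩
  refine ⟨fun t => Nat.find (hex t), measurable_find hex fun i => ?_, fun t => Nat.find_spec (hex t)⟩
  have : {t | i ≤ m ∧ ∀ j ≤ m, ‖c j t‖ ≤ ‖c i t‖} =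
      {_t | i ≤ m} ∩ ⋂ j : ℕ, ⋂ _ : j ≤ m, {t | ‖c j t‖ ≤ ‖c i t‖} := by
    ext t
    simp
  rw [this]
  refine (MeasurableSet.const _).inter (MeasurableSet.iInter fun j => MeasurableSet.iInter fun _ => ?_)
  exact measurableSet_le (hc j).norm (hc i).norm

theorem measurable_comp_index {X : Type*} [MeasurableSpace X] {c : ℕ → X → ℂ}
    (hc : ∀ i, Measurable (c i)) {ι : X → ℕ} (hι : Measurable ι) :
    Measurable fun t => c (ι t) t := by
  have h : Measurable fun p : ℕ × X => c p.1 p.2 := measurable_from_prod_countable_right hc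
  exact h.comp (hι.prodMk measurable_id)

theorem toL2_zero : toL2 (0 : 𝓢(Space n, ℂ)) = 0 := map_zero (SchwartzMap.toLpCLM ℂ ℂ 2 volume)

/-- Absorption: a finite quantity bounded by `K` times its square root is at most `K²`. -/
theorem le_of_le_mul_sqrt {I K : ℝ≥0∞} (hI : I ≠ ⊤) (h : I ≤ K * I ^ (1 / 2 : ℝ)) :
    I ≤ K ^ (2 : ℝ) := by
  by_cases h0 : I = 0
  · rw [h0]; exact zero_le
  have hs0 : I ^ (1 / 2 : ℝ) ≠ 0 := by
    rw [Ne, ENNReal.rpow_eq_zero_iff]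
    simp [h0]
  have hst : I ^ (1 / 2 : ℝ) ≠ ⊤ := ENNReal.rpow_ne_top_of_nonneg (by norm_num) hI
  have hsq : I ^ (1 / 2 : ℝ) * I ^ (1 / 2 : ℝ) = I := by
    rw [← ENNReal.rpow_add_of_nonneg _ _ (by norm_num) (by norm_num)]
    norm_num
  have h1 : I ^ (1 / 2 : ℝ) ≤ K := by
    nth_rw 1 [← hsq] at h
    exact (ENNReal.mul_le_mul_iff_left hs0 hst).1 h
  have := ENNReal.rpow_le_rpow h1 two_pos.le
  rwa [← ENNReal.rpow_mul, one_div_mul_cancel two_ne_zero, ENNReal.rpow_one] at this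

/-- Duality: the double endpoint norm of a curve is controlled by its pairings with test curves. -/
theorem mixedNorm_le_of_test (hn : 3 ≤ n) {a b : ℝ} {u : ℝ → L2 n}
    (hu : ContinuousOn u (Icc a b)) {K : ℝ≥0∞}
    (H : ∀ G : SchwartzCurve n a b,
      ‖∫ t in Icc a b, inner ℂ (G.coeff t • G.fn (G.index t)) (u t)‖ₑ ≤ K * G.size) :
    mixedNorm a b 2 (ENNReal.ofReal (endpointExp n)) (fun t => ⇑(u t)) ≤ 2 * K := by
  obtain ⟨g, hg, hgr⟩ := exists_testFamily hn
  let c : ℕ → ℝ → ℂ := fun i => (Icc a b).indicator fun t => inner ℂ (toL2 (g i)) (u t)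
  have hcm : ∀ i, Measurable (c i) := fun i =>
    measurable_indicator_of_continuousOn (continuousOn_const.inner hu)
  obtain ⟨B, hB⟩ : ∃ B, ∀ t ∈ Icc a b, ‖u t‖ ≤ B := by
    obtain ⟨B, hB⟩ := isCompact_Icc.exists_bound_of_continuousOn hu
    exact ⟨B, hB⟩
  have hcb : ∀ i t, ‖c i t‖ ≤ ‖toL2 (g i)‖ * |B| := by
    intro i t
    by_cases ht : t ∈ Icc a b
    · simp only [c, indicator_of_mem ht]
      exact (norm_inner_le_norm _ _).trans (mul_le_mul_of_nonneg_left
        ((hB t ht).trans (le_abs_self B)) (norm_nonneg _))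
    · simp only [c, indicator_of_notMem ht, norm_zero]
      positivity
  -- At each time use the best test function of index at most `m`, with the pairing as coefficient.
  -- The pairing of `u` with this curve is the square of the size of the curve.
  choose ι hιm hι using exists_measurable_argmax hcm
  let d : ℕ → ℝ → ℂ := fun m t => c (ι m t) t
  have hdm : ∀ m, Measurable (d m) := fun m => measurable_comp_index hcm (hιm m)
  have hd0 : ∀ m t, t ∉ Icc a b → d m t = 0 := fun m t ht => indicator_of_notMem ht _
  have hdb : ∀ m, ∃ R, ∀ t, ‖d m t‖ ≤ R := by
    intro m
    refine ⟨(∑ i ∈ Finset.range (m + 1), ‖toL2 (g i)‖) * |B|, fun t => (hcb _ t).trans ?_⟩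
    refine mul_le_mul_of_nonneg_right ?_ (abs_nonneg _)
    exact Finset.single_le_sum (f := fun i => ‖toL2 (g i)‖) (fun i _ => norm_nonneg _)
      (Finset.mem_range.2 (Nat.lt_succ_of_le (hι m t).1))
  have hdint : ∀ m, IntegrableOn (fun t => ‖d m t‖ ^ 2) (Icc a b) := by
    intro m
    obtain ⟨R, hR⟩ := hdb m
    refine Measure.integrableOn_of_bounded (M := R ^ 2) measure_Icc_lt_top.ne
      ((hdm m).norm.pow_const 2).aestronglyMeasurable (Filter.Eventually.of_forall fun t => ?_)
    rw [Real.norm_of_nonneg (by positivity)]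
    exact pow_le_pow_left₀ (norm_nonneg _) (hR t) 2
  have hsq : ∀ m, ∫⁻ t, ‖d m t‖ₑ ^ 2 = ∫⁻ t in Icc a b, ‖d m t‖ₑ ^ 2 := by
    intro m
    refine (setLIntegral_eq_of_support_subset ?_).symm
    intro t ht
    by_contra hc
    exact ht (by simp [hd0 m t hc])
  have hlt : ∀ m, ∫⁻ t, ‖d m t‖ₑ ^ 2 < ⊤ := by
    intro m
    rw [hsq]
    refine lt_of_le_of_lt (le_of_eq (lintegral_congr fun t => ?_)) (hdint m).2
    rw [← ofReal_norm, ← ENNReal.ofReal_pow (norm_nonneg _), ← ofReal_norm,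
      Real.norm_of_nonneg (by positivity)]
  let G : ℕ → SchwartzCurve n a b := fun m =>
    { coeff := d m
      index := ι m
      fn := fun i => toL2 (if i ≤ m then g i else 0)
      measurable_coeff := hdm m
      integrable_coeff := by
        obtain ⟨R, hR⟩ := hdb m
        have h1 : IntegrableOn (d m) (Icc a b) :=
          Measure.integrableOn_of_bounded (M := R) measure_Icc_lt_top.ne
            (hdm m).aestronglyMeasurable (Filter.Eventually.of_forall hR)
        refine (integrableOn_iff_integrable_of_support_subset ?_).1 h1
        intro t ht
        by_contra hc
        exact ht (hd0 m t hc)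
      lintegral_sq_lt_top := hlt m
      measurable_index := hιm m
      lintegral_fn_le := by
        intro i
        have h1 : ∫⁻ x, ‖toL2 (if i ≤ m then g i else 0) x‖ₑ ^ dualExp n =
            ∫⁻ x, ‖(if i ≤ m then g i else 0) x‖ₑ ^ dualExp n := by
          refine lintegral_congr_ae ?_
          filter_upwards [(if i ≤ m then g i else 0).coeFn_toLp 2] with x hx
          rw [hx]
        rw [h1]
        split_ifs
        · exact hg i
        · simp [dualExp_pos hn]
      exists_norm_fn_le := by
        refine ⟨∑ i ∈ Finset.range (m + 1), ‖toL2 (g i)‖, fun i => ?_⟩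
        split_ifs with hi
        · exact Finset.single_le_sum (f := fun i => ‖toL2 (g i)‖) (fun i _ => norm_nonneg _)
            (Finset.mem_range.2 (Nat.lt_succ_of_le hi))
        · rw [toL2_zero, norm_zero]
          exact Finset.sum_nonneg fun i _ => norm_nonneg _
      profile := fun i => if i ≤ m then g i else 0
      fn_eq := fun i => rfl
      top := m
      profile_eq_zero := fun i hi => if_neg (not_le.2 hi)
      exists_norm_coeff_le := hdb m
      coeff_eq_zero := hd0 m }
  have hbound : ∀ m, ∫⁻ t in Icc a b, ‖d m t‖ₑ ^ 2 ≤ K ^ (2 : ℝ) := by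
    intro m
    refine le_of_le_mul_sqrt (by rw [← hsq]; exact (hlt m).ne) ?_
    have h1 : ∫ t in Icc a b, inner ℂ ((G m).coeff t • (G m).fn ((G m).index t)) (u t) =
        ((∫ t in Icc a b, ‖d m t‖ ^ 2 : ℝ) : ℂ) := by
      rw [← integral_complex_ofReal]
      refine setIntegral_congr_fun measurableSet_Icc fun t ht => ?_
      change inner ℂ (d m t • toL2 (if ι m t ≤ m then g (ι m t) else 0)) (u t) = _
      rw [if_pos (hι m t).1, inner_smul_left]
      have : d m t = inner ℂ (toL2 (g (ι m t))) (u t) := indicator_of_mem ht _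
      rw [← this, Complex.conj_mul']
      push_cast
      rfl
    have h2 := H (G m)
    rw [h1, ← ofReal_norm, Complex.norm_real,
      Real.norm_of_nonneg (integral_nonneg fun t => by positivity),
      ofReal_integral_eq_lintegral_ofReal (hdint m)
        (Filter.Eventually.of_forall fun t => by positivity)] at h2
    have h3 : (G m).size = (∫⁻ t in Icc a b, ‖d m t‖ₑ ^ 2) ^ (1 / 2 : ℝ) := by
      rw [← hsq]
      rfl
    rw [← h3]
    refine le_trans (le_of_eq (lintegral_congr fun t => ?_)) h2
    rw [← ofReal_norm, ← ENNReal.ofReal_pow (norm_nonneg _)]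
  have hmono : ∀ t, Monotone fun m => ‖d m t‖ₑ ^ 2 := by
    intro t m m' hmm'
    refine pow_le_pow_left₀ zero_le ?_ 2
    rw [← ofReal_norm, ← ofReal_norm]
    exact ENNReal.ofReal_le_ofReal ((hι m' t).2 _ ((hι m t).1.trans hmm'))
  have hpt : ∀ t ∈ Icc a b, eLpNorm (u t) (ENNReal.ofReal (endpointExp n)) volume ^ (2 : ℝ) ≤
      4 * ⨆ m, ‖d m t‖ₑ ^ 2 := by
    intro t ht
    have h1 : ⨆ i, ‖inner ℂ (toL2 (g i)) (u t)‖ₑ ≤ (⨆ m, ‖d m t‖ₑ ^ 2) ^ (1 / 2 : ℝ) := by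
      refine iSup_le fun i => ?_
      rw [one_div, ENNReal.le_rpow_inv_iff two_pos, ENNReal.rpow_two]
      refine le_trans ?_ (le_iSup _ i)
      refine pow_le_pow_left₀ zero_le ?_ 2
      have : c i t = inner ℂ (toL2 (g i)) (u t) := indicator_of_mem ht _
      rw [← this, ← ofReal_norm, ← ofReal_norm]
      exact ENNReal.ofReal_le_ofReal ((hι i t).2 i le_rfl)
    refine (ENNReal.rpow_le_rpow ((hgr (u t)).trans (mul_le_mul_right h1 _)) two_pos.le).trans_eq ?_
    rw [ENNReal.mul_rpow_of_nonneg _ _ two_pos.le, ← ENNReal.rpow_mul,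
      one_div_mul_cancel two_ne_zero, ENNReal.rpow_one, ENNReal.rpow_two]
    norm_num
  rw [mixedNorm_two, one_div, ENNReal.rpow_inv_le_iff two_pos]
  calc ∫⁻ t in Icc a b, eLpNorm (u t) (ENNReal.ofReal (endpointExp n)) volume ^ (2 : ℝ)
      ≤ ∫⁻ t in Icc a b, 4 * ⨆ m, ‖d m t‖ₑ ^ 2 := setLIntegral_mono' measurableSet_Icc hpt
    _ = 4 * ⨆ m, ∫⁻ t in Icc a b, ‖d m t‖ₑ ^ 2 := by
        rw [lintegral_const_mul' _ _ (by norm_num),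
          lintegral_iSup (fun m => (hdm m).enorm.pow_const 2) fun m m' h t => hmono t h]
    _ ≤ 4 * K ^ (2 : ℝ) := mul_le_mul_right (iSup_le hbound) _
    _ = (2 * K) ^ (2 : ℝ) := by
        rw [ENNReal.mul_rpow_of_nonneg _ _ two_pos.le, ENNReal.rpow_two 2]
        norm_num

/-! ### Strichartz estimates for the free and the retarded evolution -/

theorem enorm_inner_le (f g : L2 n) : ‖inner ℂ f g‖ₑ ≤ ‖f‖ₑ * ‖g‖ₑ := by
  rw [← ofReal_norm, ← ofReal_norm, ← ofReal_norm, ← ENNReal.ofReal_mul (norm_nonneg _)]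
  exact ENNReal.ofReal_le_ofReal (norm_inner_le_norm _ _)

theorem inner_integral_left {μ : Measure ℝ} {P : ℝ → L2 n} (hP : Integrable P μ) (f : L2 n) :
    inner ℂ (∫ t, P t ∂μ) f = ∫ t, inner ℂ (P t) f ∂μ := by
  rw [← inner_conj_symm, ← integral_inner hP, ← integral_conj]
  simp_rw [inner_conj_symm]

theorem windowForm_eq_integral {W : Set ℝ} (hW : MeasurableSet W) {P Q : ℝ → L2 n}
    (hP : Integrable P) (hQ : Integrable Q) :
    windowForm W P Q = ∫ t, ∫ s in {s | t - s ∈ W}, inner ℂ (P t) (Q s) := by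
  have hms : ∀ t : ℝ, MeasurableSet {s : ℝ | t - s ∈ W} := fun t =>
    (measurable_const.sub measurable_id) hW
  rw [windowForm, ← integral_indicator (measurableSet_window hW), Measure.volume_eq_prod,
    integral_prod]
  · congr 1
    funext t
    rw [← integral_indicator (hms t)]
    rfl
  · rw [← Measure.volume_eq_prod]
    exact (integrable_inner_prod hP hQ).indicator (measurableSet_window hW)

theorem windowForm_Iic_eq_Iio (P Q : ℝ → L2 n) :
    windowForm (Iic 0) P Q = windowForm (Iio 0) P Q := by
  unfold windowForm
  refine setIntegral_congr_set ?_
  have h0 : volume {p : ℝ × ℝ | p.1 - p.2 = 0} = 0 := by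
    have hm : MeasurableSet {p : ℝ × ℝ | p.1 - p.2 = 0} :=
      measurableSet_eq_fun (by fun_prop) measurable_const
    rw [Measure.volume_eq_prod, Measure.measure_prod_null hm]
    refine Filter.Eventually.of_forall fun x => ?_
    have : Prod.mk x ⁻¹' {p : ℝ × ℝ | p.1 - p.2 = 0} = {x} := by
      ext y
      simp only [mem_preimage, mem_ofPred_eq, mem_singleton_iff, sub_eq_zero]
      exact eq_comm
    change volume (Prod.mk x ⁻¹' {p : ℝ × ℝ | p.1 - p.2 = 0}) = 0
    rw [this]
    simp
  filter_upwards [compl_mem_ae_iff.2 h0] with p hp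
  refine propext ⟨fun h => lt_of_le_of_ne h hp, fun h => ?_⟩
  exact le_of_lt (α := ℝ) h

theorem TestCurve.integrable_pull_fn (G : TestCurve n) : Integrable (G.pull G.fn) := by
  obtain ⟨R, hR⟩ := G.exists_norm_fn_le
  exact G.integrable_pull hR

/-- The constant in the dual of the homogeneous Strichartz estimate. -/
def dualConst (n : ℕ) : ℝ≥0∞ := (2 * keelTaoConst n) ^ (1 / 2 : ℝ)

theorem dualConst_ne_top (n : ℕ) : dualConst n ≠ ⊤ :=
  ENNReal.rpow_ne_top_of_nonneg (by norm_num)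
    (ENNReal.mul_ne_top (by norm_num) (keelTaoConst_ne_top n))

/-- The dual of the homogeneous Strichartz estimate, by expanding the square. -/
theorem TestCurve.enorm_integral_pull_le (hn : 3 ≤ n) (G : TestCurve n) :
    ‖∫ t, G.pull G.fn t‖ₑ ≤ dualConst n * G.size := by
  have hP := G.integrable_pull_fn
  have h1 : inner ℂ (∫ t, G.pull G.fn t) (∫ t, G.pull G.fn t) =
      windowForm (Ioi 0) (G.pull G.fn) (G.pull G.fn) +
        windowForm (Iio 0) (G.pull G.fn) (G.pull G.fn) := by
    rw [← windowForm_Iic_eq_Iio]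
    have h2 : {p : ℝ × ℝ | p.1 - p.2 ∈ Iic (0 : ℝ)} = {p : ℝ × ℝ | p.1 - p.2 ∈ Ioi (0 : ℝ)}ᶜ := by
      ext p
      simp
    unfold windowForm
    rw [h2, integral_add_compl (measurableSet_window measurableSet_Ioi) (integrable_inner_prod hP hP),
      Measure.volume_eq_prod, integral_prod _ (by
        rw [← Measure.volume_eq_prod]; exact integrable_inner_prod hP hP), inner_integral_left hP]
    congr 1
    funext t
    exact (integral_inner hP _).symm
  have h2 : ‖windowForm (Iio 0) (G.pull G.fn) (G.pull G.fn)‖ₑ =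
      ‖windowForm (Ioi 0) (G.pull G.fn) (G.pull G.fn)‖ₑ := by
    rw [enorm_windowForm_swap measurableSet_Iio]
    congr 2
    ext x
    simp
  have h3 : ‖∫ t, G.pull G.fn t‖ₑ ^ (2 : ℝ) ≤ 2 * keelTaoConst n * G.size ^ (2 : ℝ) := by
    have e2 : ‖∫ t, G.pull G.fn t‖ₑ ^ (2 : ℝ) =
        ‖inner ℂ (∫ t, G.pull G.fn t) (∫ t, G.pull G.fn t)‖ₑ := by
      rw [inner_self_eq_norm_sq_to_K, ← ofReal_norm, ← ofReal_norm, ENNReal.rpow_two,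
        ← ENNReal.ofReal_pow (norm_nonneg _)]
      congr 1
      simp
    rw [e2, h1]
    refine (enorm_add_le _ _).trans ?_
    rw [h2, ← two_mul, mul_assoc, ENNReal.rpow_two, pow_two]
    exact mul_le_mul_right (G.enorm_windowForm_le hn G) _
  rw [← ENNReal.rpow_le_rpow_iff two_pos]
  refine h3.trans_eq ?_
  rw [ENNReal.mul_rpow_of_nonneg _ _ two_pos.le, dualConst, ← ENNReal.rpow_mul,
    one_div_mul_cancel two_ne_zero, ENNReal.rpow_one]

/-- The restriction of a test curve to a set of times. -/
def TestCurve.restrict (G : TestCurve n) {S : Set ℝ} (hS : MeasurableSet S) : TestCurve n where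
  coeff := S.indicator G.coeff
  index := G.index
  fn := G.fn
  measurable_coeff := G.measurable_coeff.indicator hS
  integrable_coeff := G.integrable_coeff.indicator hS
  lintegral_sq_lt_top := by
    refine lt_of_le_of_lt (lintegral_mono fun t => ?_) G.lintegral_sq_lt_top
    exact pow_le_pow_left₀ zero_le (enorm_indicator_le_enorm_self _ _) 2
  measurable_index := G.measurable_index
  lintegral_fn_le := G.lintegral_fn_le
  exists_norm_fn_le := G.exists_norm_fn_le

/-- The dual homogeneous estimate over a set of times, by restricting the test curve to it. -/
theorem TestCurve.enorm_setIntegral_pull_le (hn : 3 ≤ n) (G : TestCurve n) {S : Set ℝ}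
    (hS : MeasurableSet S) : ‖∫ t in S, G.pull G.fn t‖ₑ ≤ dualConst n * G.size := by
  have h1 : ∫ t in S, G.pull G.fn t = ∫ t, (G.restrict hS).pull (G.restrict hS).fn t := by
    rw [← integral_indicator hS]
    congr 1
    funext t
    simp only [restrict, pull]
    by_cases ht : t ∈ S
    · rw [indicator_of_mem ht, indicator_of_mem ht]
      rfl
    · rw [indicator_of_notMem ht, indicator_of_notMem ht, zero_smul, map_zero]
  rw [h1]
  refine ((G.restrict hS).enorm_integral_pull_le hn).trans (mul_le_mul_right ?_ _)
  refine ENNReal.rpow_le_rpow (lintegral_mono fun t => ?_) (by norm_num)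
  exact pow_le_pow_left₀ zero_le (enorm_indicator_le_enorm_self _ _) 2

theorem SchwartzCurve.pull_eq_zero {a b : ℝ} (G : SchwartzCurve n a b) {t : ℝ} (ht : t ∉ Icc a b) :
    G.pull G.fn t = 0 := by
  rw [TestCurve.pull, G.coeff_eq_zero t ht, zero_smul, map_zero]

theorem SchwartzCurve.setIntegral_inner {a b : ℝ} (G : SchwartzCurve n a b) (v : ℝ → L2 n) :
    ∫ t in Icc a b, inner ℂ (G.coeff t • G.fn (G.index t)) (freeProp t (v t)) =
      ∫ t, inner ℂ (G.pull G.fn t) (v t) := by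
  rw [← integral_indicator measurableSet_Icc]
  congr 1
  funext t
  by_cases ht : t ∈ Icc a b
  · rw [indicator_of_mem ht, inner_freeProp_right]
    rfl
  · rw [indicator_of_notMem ht, G.pull_eq_zero ht, inner_zero_left]

/-- A constant for all Strichartz estimates in dimension `n`. -/
def strichartzConst (n : ℕ) : ℝ≥0∞ := 2 * keelTaoConst n + 2 * dualConst n + 1

theorem strichartzConst_ne_top (n : ℕ) : strichartzConst n ≠ ⊤ := by
  have h1 := keelTaoConst_ne_top n
  have h2 := dualConst_ne_top n
  unfold strichartzConst
  finiteness

theorem two_mul_dualConst_le (n : ℕ) : 2 * dualConst n ≤ strichartzConst n :=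
  le_trans le_add_self le_self_add

theorem two_mul_keelTaoConst_le (n : ℕ) : 2 * keelTaoConst n ≤ strichartzConst n :=
  le_trans le_self_add le_self_add

theorem dualConst_le (n : ℕ) : dualConst n ≤ strichartzConst n :=
  le_trans (le_mul_of_one_le_left zero_le one_le_two) (two_mul_dualConst_le n)

theorem one_le_strichartzConst (n : ℕ) : 1 ≤ strichartzConst n := le_add_self

theorem eLpNorm_two_eq_enorm (f : L2 n) : eLpNorm f 2 volume = ‖f‖ₑ := (Lp.enorm_def f).symm

theorem continuous_freeProp_sub (σ : ℝ) (f : L2 n) : Continuous fun t : ℝ => freeProp (t - σ) f :=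
  continuous_freeProp_comp (continuous_id.sub continuous_const) continuous_const

/-- The homogeneous Strichartz estimate. -/
theorem normS0_freeProp_le (hn : 3 ≤ n) (a b σ : ℝ) (f : L2 n) :
    normS0 a b (fun t => ⇑(freeProp (t - σ) f)) ≤ strichartzConst n * ‖f‖ₑ := by
  refine normS0_le_of_endpoints hn (fun t _ => Lp.aestronglyMeasurable _) (fun t _ => ?_) ?_
  · rw [eLpNorm_two_eq_enorm, ← ofReal_norm, LinearIsometry.norm_map, ofReal_norm]
    exact le_mul_of_one_le_left zero_le (one_le_strichartzConst n)
  · refine (mixedNorm_le_of_test hn (continuous_freeProp_sub σ f).continuousOn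
      (K := dualConst n * ‖f‖ₑ) fun G => ?_).trans ?_
    · simp_rw [sub_eq_add_neg, freeProp_add]
      rw [G.setIntegral_inner, ← inner_integral_left G.integrable_pull_fn]
      refine (enorm_inner_le _ _).trans ?_
      rw [← ofReal_norm (freeProp _ f), LinearIsometry.norm_map, ofReal_norm]
      refine (mul_le_mul_left (G.enorm_integral_pull_le hn) _).trans_eq ?_
      ring
    · rw [← mul_assoc]
      exact mul_le_mul_left (two_mul_dualConst_le n) _

/-- The retarded evolution `∫_s^b e^{i(s-t)Δ} G(t) dt` of a test curve. -/
def SchwartzCurve.tail {a b : ℝ} (G : SchwartzCurve n a b) (s : ℝ) : L2 n :=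
  freeProp s (∫ t in s..b, G.pull G.fn t)

theorem SchwartzCurve.continuous_tail {a b : ℝ} (G : SchwartzCurve n a b) : Continuous G.tail := by
  refine continuous_freeProp_comp continuous_id ?_
  simp_rw [intervalIntegral.integral_symm b]
  exact (intervalIntegral.continuous_primitive
    (fun _ _ => G.integrable_pull_fn.intervalIntegrable) b).neg

theorem SchwartzCurve.intervalIntegral_pull {a b : ℝ} (G : SchwartzCurve n a b) {s : ℝ}
    (hs : s ≤ b) : ∫ t in s..b, G.pull G.fn t = ∫ t in Ioi s, G.pull G.fn t := by
  rw [intervalIntegral.integral_of_le hs]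
  symm
  refine setIntegral_eq_of_subset_of_forall_sdiff_eq_zero measurableSet_Ioi Ioc_subset_Ioi_self ?_
  rintro t ⟨h1, h2⟩
  refine G.pull_eq_zero fun h => h2 ⟨h1, h.2⟩

theorem SchwartzCurve.enorm_tail_le (hn : 3 ≤ n) {a b : ℝ} (G : SchwartzCurve n a b) {s : ℝ}
    (hs : s ≤ b) : ‖G.tail s‖ₑ ≤ dualConst n * G.size := by
  rw [tail, ← ofReal_norm, LinearIsometry.norm_map, ofReal_norm, G.intervalIntegral_pull hs]
  exact G.enorm_setIntegral_pull_le hn measurableSet_Ioi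

/-- The retarded Strichartz estimate at the double endpoint. -/
theorem SchwartzCurve.normS0_tail_le (hn : 3 ≤ n) {a b : ℝ} (G : SchwartzCurve n a b) :
    normS0 a b (fun s => ⇑(G.tail s)) ≤ strichartzConst n * G.size := by
  refine normS0_le_of_endpoints hn (fun t _ => Lp.aestronglyMeasurable _) (fun t ht => ?_) ?_
  · rw [eLpNorm_two_eq_enorm]
    exact (G.enorm_tail_le hn ht.2).trans (mul_le_mul_left (dualConst_le n) _)
  · refine (mixedNorm_le_of_test hn G.continuous_tail.continuousOn
      (K := keelTaoConst n * G.size) fun H => ?_).trans ?_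
    · unfold tail
      rw [H.setIntegral_inner]
      have h1 : ∫ s, inner ℂ (H.pull H.fn s) (∫ t in s..b, G.pull G.fn t) =
          windowForm (Iio 0) (H.pull H.fn) (G.pull G.fn) := by
        rw [windowForm_eq_integral measurableSet_Iio H.integrable_pull_fn G.integrable_pull_fn]
        congr 1
        funext s
        have h2 : {t : ℝ | s - t ∈ Iio (0 : ℝ)} = Ioi s := by
          ext t
          simp
        rw [h2, integral_inner G.integrable_pull_fn.integrableOn]
        by_cases hs : s ∈ Icc a b
        · rw [G.intervalIntegral_pull hs.2]
        · rw [H.pull_eq_zero hs, inner_zero_left, inner_zero_left]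
      rw [h1, enorm_windowForm_swap measurableSet_Iio]
      have h3 : Neg.neg ⁻¹' Iio (0 : ℝ) = Ioi 0 := by
        ext x
        simp
      rw [h3]
      refine (G.enorm_windowForm_le hn H.toTestCurve).trans_eq ?_
      ring
    · rw [← mul_assoc]
      exact mul_le_mul_left (two_mul_keelTaoConst_le n) _

/-! ### Mixed norms -/

theorem mixedNorm_mono {a b : ℝ} {q r : ℝ≥0∞} {u v : ℝ → Space n → ℂ}
    (h : ∀ t ∈ Icc a b, ∀ᵐ x, ‖u t x‖ₑ ≤ ‖v t x‖ₑ) : mixedNorm a b q r u ≤ mixedNorm a b q r v := by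
  refine eLpNorm_mono_enorm_ae ?_
  filter_upwards [ae_restrict_mem measurableSet_Icc] with t ht
  simp only [enorm_eq_self]
  exact eLpNorm_mono_enorm_ae (h t ht)

theorem mixedNorm_congr {a b : ℝ} {q r : ℝ≥0∞} {u v : ℝ → Space n → ℂ}
    (h : ∀ t ∈ Icc a b, u t =ᵐ[volume] v t) : mixedNorm a b q r u = mixedNorm a b q r v :=
  le_antisymm (mixedNorm_mono fun t ht => (h t ht).mono fun x hx => by rw [hx])
    (mixedNorm_mono fun t ht => (h t ht).mono fun x hx => by rw [hx])

theorem normS0_mono {a b : ℝ} {u v : ℝ → Space n → ℂ}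
    (h : ∀ t ∈ Icc a b, ∀ᵐ x, ‖u t x‖ₑ ≤ ‖v t x‖ₑ) : normS0 a b u ≤ normS0 a b v :=
  iSup_mono fun _ => iSup_mono fun _ => iSup_mono fun _ => mixedNorm_mono h

theorem normS0_congr {a b : ℝ} {u v : ℝ → Space n → ℂ}
    (h : ∀ t ∈ Icc a b, u t =ᵐ[volume] v t) : normS0 a b u = normS0 a b v :=
  le_antisymm (normS0_mono fun t ht => (h t ht).mono fun x hx => by rw [hx])
    (normS0_mono fun t ht => (h t ht).mono fun x hx => by rw [hx])

theorem normV_congr {a b : ℝ} {u v : ℝ → Space n → ℂ}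
    (h : ∀ t ∈ Icc a b, u t =ᵐ[volume] v t) : normV a b u = normV a b v := mixedNorm_congr h

theorem mixedNorm_restrict_le {a b c d : ℝ} (h : Icc c d ⊆ Icc a b) (q r : ℝ≥0∞)
    (u : ℝ → Space n → ℂ) : mixedNorm c d q r u ≤ mixedNorm a b q r u :=
  eLpNorm_mono_measure _ (Measure.restrict_mono h le_rfl)

/-- Extending a function by zero does not increase its Strichartz norm. -/
theorem normS0_indicator_le {a b c d : ℝ} (φ : ℝ → Space n → ℂ) :
    normS0 a b (fun t x => (Icc c d).indicator (fun t => φ t x) t) ≤ normS0 c d φ := by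
  refine iSup_mono fun q => iSup_mono fun r => iSup_mono fun _ => ?_
  have h : (fun t => eLpNorm (fun x => (Icc c d).indicator (fun t => φ t x) t) r volume) =
      (Icc c d).indicator fun t => eLpNorm (φ t) r volume := by
    funext t
    by_cases ht : t ∈ Icc c d
    · simp only [indicator_of_mem ht]
    · simp only [indicator_of_notMem ht, eLpNorm_zero']
  rw [mixedNorm, h, eLpNorm_indicator_eq_eLpNorm_restrict measurableSet_Icc]
  refine eLpNorm_mono_measure _ ?_
  rw [Measure.restrict_restrict measurableSet_Icc]
  exact Measure.restrict_mono inter_subset_left le_rfl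

theorem normS0_const_mul_le (hn : 3 ≤ n) {a b : ℝ} (c : ℂ) (u : ℝ → Space n → ℂ) :
    normS0 a b (fun t x => c * u t x) ≤ ‖c‖ₑ * normS0 a b u := by
  refine iSup_le fun q => iSup_le fun r => iSup_le fun hqr => ?_
  have hle : mixedNorm a b q r u ≤ normS0 a b u :=
    le_iSup_of_le q (le_iSup_of_le r (le_iSup_of_le hqr le_rfl))
  refine le_trans (b := ‖c‖ₑ * mixedNorm a b q r u) ?_ (mul_le_mul_right hle _)
  have h : ∀ t, eLpNorm (fun x => c * u t x) r volume = ‖c‖ₑ * eLpNorm (u t) r volume := fun t =>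
    eLpNorm_const_smul c (u t) r volume
  rcases hqr.cases hn with ⟨rfl, rfl⟩ | ⟨q, r, rfl, rfl, hq, -, -⟩
  · simp only [mixedNorm, h, eLpNorm_exponent_top, eLpNormEssSup, enorm_eq_self]
    rw [ENNReal.essSup_const_mul]
  · have hq0 : 0 < q := by linarith
    simp only [mixedNorm_ofReal hq0, h]
    simp_rw [ENNReal.mul_rpow_of_nonneg _ _ hq0.le]
    rw [lintegral_const_mul' _ _ (ENNReal.rpow_ne_top_of_nonneg hq0.le enorm_ne_top),
      ENNReal.mul_rpow_of_nonneg _ _ (by positivity), ← ENNReal.rpow_mul,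
      mul_one_div_cancel hq0.ne', ENNReal.rpow_one]

/-! ### Jointly measurable representatives of curves in `L²` -/

theorem exists_dense_seq_L2 (n : ℕ) : ∃ d : ℕ → L2 n, DenseRange d := by
  have : Fact ((2 : ℝ≥0∞) ≠ ⊤) := ⟨by norm_num⟩
  exact TopologicalSpace.exists_dense_seq (L2 n)

/-- A measurable curve in `L²` has a jointly measurable representative: follow the curve along a
dense sequence with errors `2^{-k}`; then the series of squared errors converges almost
everywhere. -/
theorem exists_joint_of_stronglyMeasurable {u : ℝ → L2 n} (hu : StronglyMeasurable u) :
    ∃ φ : ℝ → Space n → ℂ, Measurable (Function.uncurry φ) ∧ ∀ t, φ t =ᵐ[volume] u t := by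
  classical
  obtain ⟨d, hd⟩ := exists_dense_seq_L2 n
  have hex : ∀ (k : ℕ) (t : ℝ), ∃ i, ‖d i - u t‖ < (1 / 2 : ℝ) ^ k := by
    intro k t
    obtain ⟨i, hi⟩ := Metric.denseRange_iff.1 hd (u t) ((1 / 2 : ℝ) ^ k) (by positivity)
    exact ⟨i, by rwa [dist_comm, dist_eq_norm] at hi⟩
  let ι : ℕ → ℝ → ℕ := fun k t => Nat.find (hex k t)
  have hιm : ∀ k, Measurable (ι k) := by
    intro k
    refine measurable_find (hex k) fun i => ?_
    have h1 : StronglyMeasurable fun t => ‖d i - u t‖ := (stronglyMeasurable_const.sub hu).norm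
    exact h1.measurable measurableSet_Iio
  have hι : ∀ k t, ‖d (ι k t) - u t‖ < (1 / 2 : ℝ) ^ k := fun k t => Nat.find_spec (hex k t)
  have hdm : Measurable fun p : ℕ × Space n => d p.1 p.2 :=
    measurable_from_prod_countable_right fun i => (Lp.stronglyMeasurable (d i)).measurable
  let f : ℕ → ℝ × Space n → ℂ := fun k p => d (ι k p.1) p.2
  have hfm : ∀ k, Measurable (f k) := fun k =>
    hdm.comp (((hιm k).comp measurable_fst).prodMk measurable_snd)
  let S : Set (ℝ × Space n) := {p | ∃ l, Filter.Tendsto (fun k => f k p) Filter.atTop (nhds l)}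
  have hS : MeasurableSet S := measurableSet_exists_tendsto hfm
  let g : ℝ × Space n → ℂ := S.indicator fun p => Filter.limUnder Filter.atTop fun k => f k p
  have hg : Measurable g := by
    refine measurable_of_tendsto_metrizable (fun k => (hfm k).indicator hS) ?_
    rw [tendsto_pi_nhds]
    intro p
    by_cases hp : p ∈ S
    · simp only [g, indicator_of_mem hp]
      exact tendsto_nhds_limUnder hp
    · simp only [g, indicator_of_notMem hp]
      exact tendsto_const_nhds
  refine ⟨fun t x => g (t, x), hg, fun t => ?_⟩
  have hsum : ∫⁻ x, ∑' k, ‖f k (t, x) - u t x‖ₑ ^ (2 : ℝ) ≠ ⊤ := by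
    have hm : ∀ k, Measurable fun x => ‖f k (t, x) - u t x‖ₑ ^ (2 : ℝ) := fun k =>
      ((((hfm k).comp measurable_prodMk_left).sub
        (Lp.stronglyMeasurable (u t)).measurable).enorm.pow_const _)
    rw [lintegral_tsum fun k => (hm k).aemeasurable]
    have hle : ∀ k, ∫⁻ x, ‖f k (t, x) - u t x‖ₑ ^ (2 : ℝ) ≤ ENNReal.ofReal ((1 / 4 : ℝ) ^ k) := by
      intro k
      have h1 : ∫⁻ x, ‖f k (t, x) - u t x‖ₑ ^ (2 : ℝ) = ‖d (ι k t) - u t‖ₑ ^ (2 : ℝ) := by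
        rw [Lp.enorm_def, eLpNorm_eq_lintegral_rpow_enorm_toReal two_ne_zero ENNReal.ofNat_ne_top,
          ENNReal.toReal_ofNat, ← ENNReal.rpow_mul, one_div_mul_cancel two_ne_zero,
          ENNReal.rpow_one]
        refine lintegral_congr_ae ?_
        filter_upwards [Lp.coeFn_sub (d (ι k t)) (u t)] with x hx
        rw [hx, Pi.sub_apply]
      rw [h1, ENNReal.rpow_two, ← ofReal_norm, ← ENNReal.ofReal_pow (norm_nonneg _)]
      refine ENNReal.ofReal_le_ofReal ((pow_le_pow_left₀ (norm_nonneg _) (hι k t).le 2).trans_eq ?_)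
      rw [← pow_mul, mul_comm k 2, pow_mul]
      norm_num
    refine ne_top_of_le_ne_top ?_ (ENNReal.tsum_le_tsum hle)
    exact (summable_geometric_of_lt_one (by norm_num) (by norm_num)).tsum_ofReal_ne_top
  have hae := ae_lt_top' (AEMeasurable.tsum fun k =>
    ((((hfm k).comp measurable_prodMk_left).sub
        (Lp.stronglyMeasurable (u t)).measurable).enorm.pow_const (2 : ℝ)).aemeasurable) hsum
  filter_upwards [hae] with x hx
  have h0 := ENNReal.tendsto_atTop_zero_of_tsum_ne_top hx.ne
  have h1 : Filter.Tendsto (fun k => ‖f k (t, x) - u t x‖ₑ) Filter.atTop (nhds 0) := by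
    have := h0.ennrpow_const (1 / 2 : ℝ)
    simp only [← ENNReal.rpow_mul] at this
    simpa using this
  have h2 : Filter.Tendsto (fun k => f k (t, x)) Filter.atTop (nhds (u t x)) :=
    tendsto_iff_edist_tendsto_0.2 (by simpa [edist_eq_enorm_sub] using h1)
  have hxS : (t, x) ∈ S := ⟨_, h2⟩
  simp only [g, indicator_of_mem hxS]
  exact h2.limUnder_eq

/-- A continuous curve in `L²` has a jointly measurable representative that agrees with it at every
time of the interval. -/
theorem exists_joint {a b : ℝ} {u : ℝ → L2 n} (hu : ContinuousOn u (Icc a b)) :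
    ∃ φ : ℝ → Space n → ℂ, Measurable (Function.uncurry φ) ∧
      ∀ t ∈ Icc a b, φ t =ᵐ[volume] u t := by
  rcases lt_or_ge b a with hab | hab
  · exact ⟨fun _ _ => 0, measurable_const, fun t ht => absurd (ht.1.trans ht.2) (not_le.2 hab)⟩
  have : Fact ((2 : ℝ≥0∞) ≠ ⊤) := ⟨by norm_num⟩
  have hc : Continuous (IccExtend hab ((Icc a b).domRestrict u)) :=
    (continuousOn_iff_continuous_domRestrict.1 hu).Icc_extend'
  obtain ⟨φ, hφ, h⟩ := exists_joint_of_stronglyMeasurable hc.stronglyMeasurable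
  refine ⟨φ, hφ, fun t ht => ?_⟩
  have := h t
  rwa [IccExtend_of_mem hab _ ht] at this

theorem aemeasurable_eLpNorm_slice {a b : ℝ} {φ : ℝ → Space n → ℂ}
    (hφ : AEStronglyMeasurable (Function.uncurry φ) (slabMeasure n a b)) {r : ℝ} (hr : 0 < r) :
    AEMeasurable (fun t => eLpNorm (φ t) (ENNReal.ofReal r) volume) (volume.restrict (Icc a b)) := by
  have h : ∀ t, eLpNorm (φ t) (ENNReal.ofReal r) volume = (∫⁻ x, ‖φ t x‖ₑ ^ r) ^ (1 / r) := by
    intro t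
    rw [eLpNorm_eq_lintegral_rpow_enorm_toReal (by simpa using hr) ENNReal.ofReal_ne_top,
      ENNReal.toReal_ofReal hr.le]
  simp_rw [h]
  exact AEMeasurable.pow_const (AEMeasurable.lintegral_prod_right' (hφ.enorm.pow_const r)) _

theorem mixedNorm_add_le {a b : ℝ} {q : ℝ≥0∞} (hq : 1 ≤ q) {r : ℝ} (hr : 1 ≤ r) {u v : ℝ → L2 n}
    (hu : ContinuousOn u (Icc a b)) (hv : ContinuousOn v (Icc a b)) :
    mixedNorm a b q (ENNReal.ofReal r) (fun t => ⇑(u t + v t)) ≤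
      mixedNorm a b q (ENNReal.ofReal r) (fun t => ⇑(u t)) +
        mixedNorm a b q (ENNReal.ofReal r) (fun t => ⇑(v t)) := by
  have hr0 : 0 < r := by linarith
  have hm : ∀ {u : ℝ → L2 n}, ContinuousOn u (Icc a b) →
      AEMeasurable (fun t => eLpNorm (u t) (ENNReal.ofReal r) volume)
        (volume.restrict (Icc a b)) := by
    intro u hu
    obtain ⟨φ, hφ, h⟩ := exists_joint hu
    refine (aemeasurable_eLpNorm_slice (a := a) (b := b) hφ.aestronglyMeasurable hr0).congr ?_
    filter_upwards [ae_restrict_mem measurableSet_Icc] with t ht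
    exact eLpNorm_congr_ae (h t ht)
  refine le_trans ?_ (eLpNorm_add_le (hm hu).aestronglyMeasurable (hm hv).aestronglyMeasurable hq)
  refine eLpNorm_mono_enorm_ae (Filter.Eventually.of_forall fun t => ?_)
  simp only [enorm_eq_self, Pi.add_apply]
  rw [eLpNorm_congr_ae (Lp.coeFn_add (u t) (v t))]
  refine eLpNorm_add_le (Lp.aestronglyMeasurable _) (Lp.aestronglyMeasurable _) ?_
  rw [← ENNReal.ofReal_one]
  exact ENNReal.ofReal_le_ofReal hr

theorem normS0_add_le (hn : 3 ≤ n) {a b : ℝ} {u v : ℝ → L2 n}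
    (hu : ContinuousOn u (Icc a b)) (hv : ContinuousOn v (Icc a b)) :
    normS0 a b (fun t => ⇑(u t + v t)) ≤
      normS0 a b (fun t => ⇑(u t)) + normS0 a b (fun t => ⇑(v t)) := by
  refine iSup_le fun q => iSup_le fun r => iSup_le fun hqr => ?_
  obtain ⟨ρ, hρ, rfl⟩ : ∃ ρ : ℝ, 1 ≤ ρ ∧ r = ENNReal.ofReal ρ := by
    rcases hqr.cases hn with ⟨-, rfl⟩ | ⟨q, ρ, -, rfl, -, hρ, -⟩
    · exact ⟨2, one_le_two, by simp⟩
    · exact ⟨ρ, by linarith, rfl⟩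
  refine (mixedNorm_add_le (one_le_two.trans hqr.1) hρ hu hv).trans (add_le_add ?_ ?_) <;>
  exact le_iSup_of_le q (le_iSup_of_le _ (le_iSup_of_le hqr le_rfl))

/-- The exponent `2(n+2)/n` of the norm of `V`. -/
def critExp (n : ℕ) : ℝ := 2 * (n + 2) / n

theorem critExp_gt (hn : 3 ≤ n) : 2 < critExp n := by
  have hn0 : (3 : ℝ) ≤ n := by exact_mod_cast hn
  rw [critExp, lt_div_iff₀ (by linarith)]
  linarith

theorem ofReal_critExp (hn : 3 ≤ n) :
    (2 * (n + 2) / n : ℝ≥0∞) = ENNReal.ofReal (critExp n) := by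
  have hn0 : (3 : ℝ) ≤ n := by exact_mod_cast hn
  rw [critExp, ENNReal.ofReal_div_of_pos (by linarith), ENNReal.ofReal_mul two_pos.le,
    ENNReal.ofReal_add (by linarith) two_pos.le, ENNReal.ofReal_natCast]
  simp

theorem isAdmissible_critExp (hn : 3 ≤ n) :
    IsAdmissible n (ENNReal.ofReal (critExp n)) (ENNReal.ofReal (critExp n)) := by
  have hn0 : (3 : ℝ) ≤ n := by exact_mod_cast hn
  have hp := critExp_gt hn
  have h2 : (2 : ℝ≥0∞) = ENNReal.ofReal 2 := by simp
  have h2p : (2 : ℝ≥0∞) ≤ ENNReal.ofReal (critExp n) := by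
    rw [h2]
    exact ENNReal.ofReal_le_ofReal hp.le
  refine ⟨h2p, h2p, ?_⟩
  rw [← ENNReal.ofReal_natCast n, h2, ← ENNReal.ofReal_div_of_pos (by linarith),
    ← ENNReal.ofReal_div_of_pos (by linarith), ← ENNReal.ofReal_div_of_pos two_pos,
    ← ENNReal.ofReal_add (div_nonneg two_pos.le (by linarith))
      (div_nonneg (by linarith) (by linarith))]
  congr 1
  rw [critExp]
  field_simp
  ring

theorem normV_eq_mixedNorm (hn : 3 ≤ n) {a b : ℝ} (u : ℝ → Space n → ℂ) :
    normV a b u = mixedNorm a b (ENNReal.ofReal (critExp n)) (ENNReal.ofReal (critExp n)) u := by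
  rw [normV, ofReal_critExp hn]

theorem normV_le_normS0 (hn : 3 ≤ n) {a b : ℝ} (u : ℝ → Space n → ℂ) :
    normV a b u ≤ normS0 a b u := by
  rw [normV_eq_mixedNorm hn]
  exact le_iSup_of_le _ (le_iSup_of_le _ (le_iSup_of_le (isAdmissible_critExp hn) le_rfl))

theorem normV_add_le (hn : 3 ≤ n) {a b : ℝ} {u v : ℝ → L2 n}
    (hu : ContinuousOn u (Icc a b)) (hv : ContinuousOn v (Icc a b)) :
    normV a b (fun t => ⇑(u t + v t)) ≤
      normV a b (fun t => ⇑(u t)) + normV a b (fun t => ⇑(v t)) := by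
  have hp := critExp_gt hn
  simp only [normV_eq_mixedNorm hn]
  refine mixedNorm_add_le ?_ (by linarith) hu hv
  exact one_le_two.trans (isAdmissible_critExp hn).1

/-- For jointly measurable functions the norm of `V` is the norm of a Lebesgue space on the slab. -/
theorem normV_eq_eLpNorm (hn : 3 ≤ n) {a b : ℝ} {φ : ℝ → Space n → ℂ}
    (hφ : AEStronglyMeasurable (Function.uncurry φ) (slabMeasure n a b)) :
    normV a b φ =
      eLpNorm (Function.uncurry φ) (ENNReal.ofReal (critExp n)) (slabMeasure n a b) := by
  have hp := critExp_gt hn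
  have hp0 : 0 < critExp n := by linarith
  rw [normV_eq_mixedNorm hn, mixedNorm_ofReal hp0,
    eLpNorm_eq_lintegral_rpow_enorm_toReal (by simpa using hp0) ENNReal.ofReal_ne_top,
    ENNReal.toReal_ofReal hp0.le, slabMeasure,
    lintegral_prod _ (hφ.enorm.pow_const (critExp n))]
  congr 1
  refine lintegral_congr fun t => ?_
  rw [eLpNorm_eq_lintegral_rpow_enorm_toReal (by simpa using hp0) ENNReal.ofReal_ne_top,
    ENNReal.toReal_ofReal hp0.le, ← ENNReal.rpow_mul, one_div_mul_cancel hp0.ne', ENNReal.rpow_one]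
  rfl

/-! ### The dual Strichartz norm -/

theorem lintegral_mul_le_normN0_of_ne_zero (hn : 3 ≤ n) {a b : ℝ} {F φ : ℝ → Space n → ℂ}
    (hφ : AEStronglyMeasurable (Function.uncurry φ) (slabMeasure n a b)) {c : ℝ≥0∞} (hc0 : c ≠ 0)
    (hct : c ≠ ⊤) (h : normS0 a b φ ≤ c) :
    ∫⁻ p, ‖F p.1 p.2‖ₑ * ‖φ p.1 p.2‖ₑ ∂(slabMeasure n a b) ≤ normN0 a b F * c := by
  have hcr : 0 < c.toReal := ENNReal.toReal_pos hc0 hct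
  set k : ℂ := ((c.toReal⁻¹ : ℝ) : ℂ) with hk
  have hke : ‖k‖ₑ = c⁻¹ := by
    rw [hk, ← ofReal_norm, Complex.norm_real, Real.norm_of_nonneg (by positivity),
      ENNReal.ofReal_inv_of_pos hcr, ENNReal.ofReal_toReal hct]
  have h1 : normS0 a b (fun t x => k * φ t x) ≤ 1 := by
    refine (normS0_const_mul_le hn k φ).trans ?_
    rw [hke, ← ENNReal.inv_mul_cancel hc0 hct]
    exact mul_le_mul_right h _
  have h2 : AEStronglyMeasurable (Function.uncurry fun t x => k * φ t x) (slabMeasure n a b) :=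
    hφ.const_mul k
  have h3 : ∫⁻ p, ‖F p.1 p.2‖ₑ * ‖k * φ p.1 p.2‖ₑ ∂(slabMeasure n a b) ≤ normN0 a b F :=
    le_iSup_of_le (fun t x => k * φ t x) (le_iSup_of_le h2 (le_iSup_of_le h1 le_rfl))
  have h4 : ∀ p : ℝ × Space n, ‖F p.1 p.2‖ₑ * ‖k * φ p.1 p.2‖ₑ =
      c⁻¹ * (‖F p.1 p.2‖ₑ * ‖φ p.1 p.2‖ₑ) := by
    intro p
    rw [enorm_mul, hke]
    ring
  simp_rw [h4] at h3
  rw [lintegral_const_mul' _ _ (ENNReal.inv_ne_top.2 hc0)] at h3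
  calc _ = c * c⁻¹ * ∫⁻ p, ‖F p.1 p.2‖ₑ * ‖φ p.1 p.2‖ₑ ∂(slabMeasure n a b) := by
        rw [ENNReal.mul_inv_cancel hc0 hct, one_mul]
    _ ≤ c * normN0 a b F := by
        rw [mul_assoc]
        exact mul_le_mul_right h3 _
    _ = _ := mul_comm _ _

/-- The pairing inequality that defines the dual norm, for arbitrary bounds. -/
theorem lintegral_mul_le_normN0 (hn : 3 ≤ n) {a b : ℝ} {F φ : ℝ → Space n → ℂ}
    (hF : normN0 a b F ≠ ⊤)
    (hφ : AEStronglyMeasurable (Function.uncurry φ) (slabMeasure n a b)) {c : ℝ≥0∞}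
    (hct : c ≠ ⊤) (h : normS0 a b φ ≤ c) :
    ∫⁻ p, ‖F p.1 p.2‖ₑ * ‖φ p.1 p.2‖ₑ ∂(slabMeasure n a b) ≤ normN0 a b F * c := by
  have hlim : Filter.Tendsto (fun k : ℕ => normN0 a b F * (c + ((k : ℝ≥0∞))⁻¹)) Filter.atTop
      (nhds (normN0 a b F * (c + 0))) :=
    ENNReal.Tendsto.const_mul (ENNReal.tendsto_inv_nat_nhds_zero.const_add c) (Or.inr hF)
  rw [add_zero] at hlim
  refine ge_of_tendsto hlim ?_
  filter_upwards [Filter.eventually_ge_atTop 1] with k hk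
  have hk0 : (k : ℝ≥0∞) ≠ 0 := by
    exact_mod_cast Nat.one_le_iff_ne_zero.1 hk
  refine lintegral_mul_le_normN0_of_ne_zero hn hφ ?_ ?_ (h.trans le_self_add)
  · simp
  · exact ENNReal.add_ne_top.2 ⟨hct, ENNReal.inv_ne_top.2 hk0⟩

theorem slabMeasure_restrict {a b c d : ℝ} (h : Icc c d ⊆ Icc a b) :
    (slabMeasure n a b).restrict (Icc c d ×ˢ univ) = slabMeasure n c d := by
  rw [slabMeasure, slabMeasure, ← Measure.prod_restrict, Measure.restrict_univ,
    Measure.restrict_restrict measurableSet_Icc, inter_eq_left.2 h]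

theorem slabMeasure_mono {a b c d : ℝ} (h : Icc c d ⊆ Icc a b) :
    slabMeasure n c d ≤ slabMeasure n a b := by
  rw [← slabMeasure_restrict h]
  exact Measure.restrict_le_self

theorem ae_slabMeasure_mem (n : ℕ) (a b : ℝ) : ∀ᵐ p ∂(slabMeasure n a b), p.1 ∈ Icc a b := by
  have h : ∀ᵐ t ∂(volume.restrict (Icc a b)), t ∈ Icc a b := ae_restrict_mem measurableSet_Icc
  exact Measure.quasiMeasurePreserving_fst.ae h

theorem normN0_restrict_le {a b c d : ℝ} (h : Icc c d ⊆ Icc a b) (e : ℝ → Space n → ℂ) :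
    normN0 c d e ≤ normN0 a b e := by
  refine iSup_le fun φ => iSup_le fun hφ => iSup_le fun hφ1 => ?_
  let φ' : ℝ → Space n → ℂ := fun t x => (Icc c d).indicator (fun t => φ t x) t
  have hS : MeasurableSet (Icc c d ×ˢ (univ : Set (Space n))) :=
    measurableSet_Icc.prod MeasurableSet.univ
  have e1 : Function.uncurry φ' = (Icc c d ×ˢ univ).indicator (Function.uncurry φ) := by
    funext p
    by_cases hp : p.1 ∈ Icc c d
    · rw [indicator_of_mem (by exact ⟨hp, mem_univ _⟩)]
      exact indicator_of_mem hp fun t => φ t p.2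
    · have hp' : p ∉ Icc c d ×ˢ (univ : Set (Space n)) := fun h => hp h.1
      rw [indicator_of_notMem hp']
      exact indicator_of_notMem hp fun t => φ t p.2
  have hφ' : AEStronglyMeasurable (Function.uncurry φ') (slabMeasure n a b) := by
    rw [e1, aestronglyMeasurable_indicator_iff hS, slabMeasure_restrict h]
    exact hφ
  have h1 : normS0 a b φ' ≤ 1 := (normS0_indicator_le φ).trans hφ1
  refine le_trans ?_ (le_iSup_of_le φ' (le_iSup_of_le hφ' (le_iSup_of_le h1 le_rfl)))
  rw [← slabMeasure_restrict h]
  refine (setLIntegral_mono_ae' hS ?_).trans (setLIntegral_le_lintegral (Icc c d ×ˢ univ) _)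
  refine Filter.Eventually.of_forall fun p hp => ?_
  simp only [φ', indicator_of_mem hp.1, le_refl]

theorem normN0_add_le {a b : ℝ} {e f : ℝ → Space n → ℂ}
    (he : AEStronglyMeasurable (Function.uncurry e) (slabMeasure n a b)) :
    normN0 a b (fun t x => e t x + f t x) ≤ normN0 a b e + normN0 a b f := by
  refine iSup_le fun φ => iSup_le fun hφ => iSup_le fun hφ1 => ?_
  have h1 : ∀ g : ℝ → Space n → ℂ,
      ∫⁻ p, ‖g p.1 p.2‖ₑ * ‖φ p.1 p.2‖ₑ ∂(slabMeasure n a b) ≤ normN0 a b g := fun g =>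
    le_iSup_of_le φ (le_iSup_of_le hφ (le_iSup_of_le hφ1 le_rfl))
  refine le_trans ?_ (add_le_add (h1 e) (h1 f))
  have hm : AEMeasurable (fun p : ℝ × Space n => ‖e p.1 p.2‖ₑ * ‖φ p.1 p.2‖ₑ)
      (slabMeasure n a b) := he.enorm.mul hφ.enorm
  rw [← lintegral_add_left' hm]
  refine lintegral_mono fun p => ?_
  rw [← add_mul]
  exact mul_le_mul_left (enorm_add_le _ _) _

theorem normN0_congr {a b : ℝ} {e f : ℝ → Space n → ℂ}
    (h : ∀ᵐ p ∂(slabMeasure n a b), ‖e p.1 p.2‖ₑ = ‖f p.1 p.2‖ₑ) :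
    normN0 a b e = normN0 a b f := by
  refine iSup_congr fun φ => iSup_congr fun hφ => iSup_congr fun hφ1 => lintegral_congr_ae ?_
  filter_upwards [h] with p hp
  rw [hp]

/-- The exponent `2(n+2)/(n+4)`, dual to the exponent of the norm of `V`. -/
def critDualExp (n : ℕ) : ℝ := 2 * (n + 2) / (n + 4)

theorem holderConjugate_critExp (hn : 3 ≤ n) : (critDualExp n).HolderConjugate (critExp n) := by
  have hn0 : (3 : ℝ) ≤ n := by exact_mod_cast hn
  refine Real.holderConjugate_iff.2 ⟨?_, ?_⟩
  · rw [critDualExp, lt_div_iff₀ (by linarith)]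
    linarith
  · rw [critDualExp, critExp]
    field_simp
    ring

/-- By Hölder's inequality, the dual norm is controlled by a dual space-time Lebesgue norm. -/
theorem normN0_le_eLpNorm (hn : 3 ≤ n) {a b : ℝ} {F : ℝ → Space n → ℂ}
    (hF : AEStronglyMeasurable (Function.uncurry F) (slabMeasure n a b)) :
    normN0 a b F ≤
      eLpNorm (Function.uncurry F) (ENNReal.ofReal (critDualExp n)) (slabMeasure n a b) := by
  have hpq := holderConjugate_critExp hn
  have hp := critExp_gt hn
  refine iSup_le fun φ => iSup_le fun hφ => iSup_le fun hφ1 => ?_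
  have h1 := ENNReal.lintegral_mul_le_Lp_mul_Lq (slabMeasure n a b) hpq hF.enorm hφ.enorm
  have h2 := (normV_le_normS0 hn φ).trans hφ1
  rw [normV_eq_eLpNorm hn hφ,
    eLpNorm_eq_lintegral_rpow_enorm_toReal (by simp; linarith) ENNReal.ofReal_ne_top,
    ENNReal.toReal_ofReal (by linarith)] at h2
  rw [eLpNorm_eq_lintegral_rpow_enorm_toReal (by simpa using hpq.pos) ENNReal.ofReal_ne_top,
    ENNReal.toReal_ofReal hpq.nonneg]
  exact h1.trans (mul_le_of_le_one_right zero_le h2)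

theorem eLpNorm_weight_lt_top {r : ℝ} (hr : 1 ≤ r) :
    eLpNorm (fun x : Space n => (weight n x : ℂ)) (ENNReal.ofReal r) volume < ⊤ := by
  have hr0 : 0 < r := by linarith
  rw [eLpNorm_eq_lintegral_rpow_enorm_toReal (by simpa using hr0) ENNReal.ofReal_ne_top,
    ENNReal.toReal_ofReal hr0.le]
  refine ENNReal.rpow_lt_top_of_nonneg (by positivity) ?_
  refine ne_top_of_le_ne_top (integrable_weight (n := n)).2.ne (lintegral_mono fun x => ?_)
  have h1 : ‖(weight n x : ℂ)‖ₑ = ‖weight n x‖ₑ := by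
    rw [← ofReal_norm, Complex.norm_real, ofReal_norm]
  rw [h1]
  nth_rw 2 [← ENNReal.rpow_one ‖weight n x‖ₑ]
  refine ENNReal.rpow_le_rpow_of_exponent_ge ?_ hr
  rw [← ofReal_norm, Real.norm_of_nonneg (weight_pos x).le]
  exact ENNReal.ofReal_le_one.2 (weight_le_one x)

theorem normS0_weight_ne_top (hn : 3 ≤ n) (a b : ℝ) :
    normS0 a b (fun _ (x : Space n) => (weight n x : ℂ)) ≠ ⊤ := by
  have he := two_lt_endpointExp hn
  set K : ℝ≥0∞ := eLpNorm (fun x : Space n => (weight n x : ℂ)) 2 volume +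
    mixedNorm a b 2 (ENNReal.ofReal (endpointExp n)) (fun _ (x : Space n) => (weight n x : ℂ))
    with hK
  have h2 : eLpNorm (fun x : Space n => (weight n x : ℂ)) 2 volume < ⊤ := by
    have := eLpNorm_weight_lt_top (n := n) one_le_two
    simpa using this
  have hr : mixedNorm a b 2 (ENNReal.ofReal (endpointExp n))
      (fun _ (x : Space n) => (weight n x : ℂ)) < ⊤ := by
    rw [mixedNorm_two]
    refine ENNReal.rpow_lt_top_of_nonneg (by norm_num) ?_
    rw [setLIntegral_const]
    refine ENNReal.mul_ne_top (ENNReal.rpow_ne_top_of_nonneg two_pos.le ?_) measure_Icc_lt_top.ne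
    exact (eLpNorm_weight_lt_top (by linarith)).ne
  refine ne_top_of_le_ne_top (ENNReal.add_lt_top.2 ⟨h2, hr⟩).ne
    (normS0_le_of_endpoints hn (fun t _ => ?_) (fun t _ => le_self_add) le_add_self)
  exact (Complex.continuous_ofReal.comp continuous_weight).aestronglyMeasurable

/-- A forcing of finite dual norm is integrable against a rapidly decaying weight. -/
theorem integrable_mul_weight (hn : 3 ≤ n) {a b : ℝ} {F : ℝ → Space n → ℂ}
    (hF : AEStronglyMeasurable (Function.uncurry F) (slabMeasure n a b))
    (hN : normN0 a b F ≠ ⊤) :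
    Integrable (fun p => ‖F p.1 p.2‖ * weight n p.2) (slabMeasure n a b) := by
  have hw : AEStronglyMeasurable (Function.uncurry fun (_ : ℝ) (x : Space n) => (weight n x : ℂ))
      (slabMeasure n a b) :=
    (Complex.continuous_ofReal.comp (continuous_weight.comp continuous_snd)).aestronglyMeasurable
  have h1 := lintegral_mul_le_normN0 hn hN hw (normS0_weight_ne_top hn a b) le_rfl
  have hF' : AEStronglyMeasurable (fun p : ℝ × Space n => F p.1 p.2) (slabMeasure n a b) := hF
  refine ⟨hF'.norm.mul (continuous_weight.comp continuous_snd).aestronglyMeasurable, ?_⟩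
  refine lt_of_le_of_lt (le_trans (le_of_eq (lintegral_congr fun p => ?_)) h1)
    (ENNReal.mul_lt_top hN.lt_top (normS0_weight_ne_top hn a b).lt_top)
  rw [enorm_mul, enorm_norm, ← ofReal_norm (weight n p.2 : ℂ), Complex.norm_real, ofReal_norm]

/-! ### The Duhamel form -/

theorem inner_toL2 (φ : 𝓢(Space n, ℂ)) (f : L2 n) :
    inner ℂ (toL2 φ) f = ∫ x, (starRingEnd ℂ) (φ x) * f x := by
  rw [L2.inner_def]
  refine integral_congr_ae ?_
  filter_upwards [φ.coeFn_toLp 2] with x hx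
  rw [hx, RCLike.inner_apply, mul_comm]

/-- An element of `L²` is determined by its pairings with Schwartz functions. -/
theorem eq_of_inner_toL2 {f g : L2 n}
    (h : ∀ φ : 𝓢(Space n, ℂ), inner ℂ (toL2 φ) f = inner ℂ (toL2 φ) g) : f = g := by
  refine ext_inner_left ℂ fun v => ?_
  have : (fun v : L2 n => inner ℂ v f) = fun v => inner ℂ v g :=
    denseRange_toL2.equalizer (by fun_prop) (by fun_prop) (funext h)
  exact congrFun this v

theorem enorm_le_of_inner_toL2 {f : L2 n} {K : ℝ≥0∞}
    (h : ∀ φ : 𝓢(Space n, ℂ), ‖inner ℂ (toL2 φ) f‖ₑ ≤ K * ‖toL2 φ‖ₑ) : ‖f‖ₑ ≤ K := by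
  by_cases hK : K = ⊤
  · rw [hK]; exact le_top
  have h1 : ∀ v : L2 n, ‖inner ℂ v f‖ ≤ K.toReal * ‖v‖ := by
    have hc : IsClosed {v : L2 n | ‖inner ℂ v f‖ ≤ K.toReal * ‖v‖} :=
      isClosed_le (by fun_prop) (by fun_prop)
    intro v
    refine closure_minimal ?_ hc (denseRange_toL2 v)
    rintro _ ⟨φ, rfl⟩
    have := h φ
    rw [← ENNReal.ofReal_toReal hK, ← ofReal_norm, ← ofReal_norm,
      ← ENNReal.ofReal_mul ENNReal.toReal_nonneg] at this
    exact (ENNReal.ofReal_le_ofReal_iff (by positivity)).1 this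
  have h2 := h1 f
  rw [inner_self_eq_norm_sq_to_K] at h2
  have h3 : ‖f‖ ^ 2 ≤ K.toReal * ‖f‖ := by simpa using h2
  rw [← ENNReal.ofReal_toReal hK, ← ofReal_norm]
  refine ENNReal.ofReal_le_ofReal ?_
  rcases eq_or_lt_of_le (norm_nonneg f) with h0 | h0
  · rw [← h0]; exact ENNReal.toReal_nonneg
  · nlinarith

/-- The pairing of `g` with the Duhamel term `-i ∫_a^t e^{i(t-s)Δ} F(s) ds`. -/
def duhamelForm (a b : ℝ) (F : ℝ → Space n → ℂ) (t : ℝ) (g : 𝓢(Space n, ℂ)) : ℂ :=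
  -Complex.I * ∫ p in {p : ℝ × Space n | p.1 < t},
    F p.1 p.2 * (starRingEnd ℂ) (freeSchwartz (p.1 - t) g p.2) ∂(slabMeasure n a b)

theorem measurableSet_fst_lt (t : ℝ) : MeasurableSet {p : ℝ × Space n | p.1 < t} :=
  measurableSet_lt measurable_fst measurable_const

theorem continuous_freeSchwartz_sub (t : ℝ) (g : 𝓢(Space n, ℂ)) :
    Continuous fun p : ℝ × Space n => freeSchwartz (p.1 - t) g p.2 := by
  have h := (continuous_freeSchwartz_apply g).comp
    (((continuous_fst (X := ℝ) (Y := Space n)).sub continuous_const).prodMk continuous_snd :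
      Continuous fun p : ℝ × Space n => (p.1 - t, p.2))
  exact h

theorem normS0_freeSchwartz_le (hn : 3 ≤ n) (a b t : ℝ) (g : 𝓢(Space n, ℂ)) :
    normS0 a b (fun s x => freeSchwartz (s - t) g x) ≤ strichartzConst n * ‖toL2 g‖ₑ := by
  refine le_trans (le_of_eq ?_) (normS0_freeProp_le hn a b t (toL2 g))
  refine normS0_congr fun s _ => ?_
  rw [freeProp_toL2]
  exact ((freeSchwartz (s - t) g).coeFn_toLp 2).symm

theorem enorm_setIntegral_duhamel_le (hn : 3 ≤ n) {a b : ℝ} {F : ℝ → Space n → ℂ}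
    (hN : normN0 a b F ≠ ⊤) (t : ℝ) (S : Set (ℝ × Space n)) (g : 𝓢(Space n, ℂ)) :
    ‖∫ p in S, F p.1 p.2 * (starRingEnd ℂ) (freeSchwartz (p.1 - t) g p.2)
      ∂(slabMeasure n a b)‖ₑ ≤ strichartzConst n * normN0 a b F * ‖toL2 g‖ₑ := by
  refine (enorm_integral_le_lintegral_enorm _).trans ((setLIntegral_le_lintegral _ _).trans ?_)
  have h1 := lintegral_mul_le_normN0 hn hN (φ := fun s x => freeSchwartz (s - t) g x)
    (continuous_freeSchwartz_sub t g).aestronglyMeasurable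
    (ENNReal.mul_ne_top (strichartzConst_ne_top n) enorm_ne_top)
    (normS0_freeSchwartz_le hn a b t g)
  refine le_trans (le_of_eq (lintegral_congr fun p => ?_)) (h1.trans_eq (by ring))
  rw [enorm_mul, ← ofReal_norm ((starRingEnd ℂ) _), RCLike.norm_conj, ofReal_norm]

/-- By the homogeneous Strichartz estimate, the Duhamel form is bounded in `L²` in its test
function. -/
theorem enorm_duhamelForm_le (hn : 3 ≤ n) {a b : ℝ} {F : ℝ → Space n → ℂ}
    (hN : normN0 a b F ≠ ⊤) (t : ℝ) (g : 𝓢(Space n, ℂ)) :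
    ‖duhamelForm a b F t g‖ₑ ≤ strichartzConst n * normN0 a b F * ‖toL2 g‖ₑ := by
  rw [duhamelForm, enorm_mul, enorm_neg, ← ofReal_norm, Complex.norm_I, ENNReal.ofReal_one, one_mul]
  exact enorm_setIntegral_duhamel_le hn hN t _ g

/-- The curve `z` is the Duhamel integral of `F`, in the sense of its pairings. -/
def IsDuhamel (a b : ℝ) (F : ℝ → Space n → ℂ) (z : ℝ → L2 n) : Prop :=
  ∀ t ∈ Icc a b, ∀ g : 𝓢(Space n, ℂ), inner ℂ (toL2 g) (z t) = duhamelForm a b F t g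

theorem IsDuhamel.enorm_le (hn : 3 ≤ n) {a b : ℝ} {F : ℝ → Space n → ℂ} {z : ℝ → L2 n}
    (hz : IsDuhamel a b F z) (hN : normN0 a b F ≠ ⊤) {t : ℝ} (ht : t ∈ Icc a b) :
    ‖z t‖ₑ ≤ strichartzConst n * normN0 a b F := by
  refine enorm_le_of_inner_toL2 fun φ => ?_
  rw [hz t ht]
  exact enorm_duhamelForm_le hn hN t φ

/-! ### The retarded estimate for forcings of finite dual norm -/

instance instSFiniteSlabMeasure (n : ℕ) (a b : ℝ) : SFinite (slabMeasure n a b) := by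
  unfold slabMeasure
  infer_instance

namespace SchwartzCurve

variable {a b : ℝ} (G : SchwartzCurve n a b)

/-- The integrand, at the time `t` of the test curve and the spacetime point `p`, of the retarded
evolution of a test curve. -/
def kernel (t : ℝ) (p : ℝ × Space n) : ℂ :=
  (Iio t).indicator
    (fun s => G.coeff t * freeSchwartz (s - t) (G.profile (G.index t)) p.2) p.1

theorem measurable_kernel : Measurable fun q : ℝ × (ℝ × Space n) => G.kernel q.1 q.2 := by
  have h1 : ∀ i : ℕ, Measurable fun q : ℝ × (ℝ × Space n) =>
      freeSchwartz (q.2.1 - q.1) (G.profile i) q.2.2 := by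
    intro i
    have h := (continuous_freeSchwartz_apply (G.profile i)).comp
      (((continuous_fst.comp (continuous_snd (X := ℝ) (Y := ℝ × Space n))).sub
        continuous_fst).prodMk (continuous_snd.comp continuous_snd) :
        Continuous fun q : ℝ × (ℝ × Space n) => (q.2.1 - q.1, q.2.2))
    exact h.measurable
  have h2 := measurable_comp_index h1 (G.measurable_index.comp measurable_fst)
  have h3 : Measurable fun q : ℝ × (ℝ × Space n) =>
      G.coeff q.1 * freeSchwartz (q.2.1 - q.1) (G.profile (G.index q.1)) q.2.2 :=
    (G.measurable_coeff.comp measurable_fst).mul h2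
  have h4 : MeasurableSet {q : ℝ × (ℝ × Space n) | q.2.1 < q.1} :=
    measurableSet_lt (measurable_fst.comp measurable_snd) measurable_fst
  exact h3.indicator h4

theorem kernel_eq_zero {t : ℝ} (ht : t ∉ Icc a b) (p : ℝ × Space n) : G.kernel t p = 0 := by
  rw [kernel, G.coeff_eq_zero t ht]
  simp

theorem exists_kernel_le : ∃ C : ℝ, 0 ≤ C ∧ ∀ t, ∀ p : ℝ × Space n, p.1 ∈ Icc a b →
    ‖G.kernel t p‖ ≤ (Icc a b).indicator (fun _ => C) t * NLS.weight n p.2 := by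
  obtain ⟨R, hR⟩ := G.exists_norm_coeff_le
  have hR0 : 0 ≤ R := (norm_nonneg _).trans (hR 0)
  choose C hC0 hC using fun i => exists_freeSchwartz_le_weight (b - a) (G.profile i)
  set S : ℝ := ∑ i ∈ Finset.range (G.top + 1), C i with hS
  have hS0 : 0 ≤ S := Finset.sum_nonneg fun i _ => hC0 i
  refine ⟨R * S, mul_nonneg hR0 hS0, fun t p hp => ?_⟩
  have hw := weight_pos p.2
  by_cases ht : t ∈ Icc a b
  · rw [indicator_of_mem ht]
    have hbound : ‖freeSchwartz (p.1 - t) (G.profile (G.index t)) p.2‖ ≤ S * NLS.weight n p.2 := by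
      by_cases hi : G.index t ≤ G.top
      · refine (hC _ (p.1 - t) p.2 ?_).trans (mul_le_mul_of_nonneg_right ?_ hw.le)
        · rw [abs_le]
          constructor <;> linarith [hp.1, hp.2, ht.1, ht.2]
        · exact Finset.single_le_sum (f := C) (fun i _ => hC0 i)
            (Finset.mem_range.2 (Nat.lt_succ_of_le hi))
      · rw [G.profile_eq_zero _ (not_le.1 hi), map_zero]
        simpa using mul_nonneg hS0 hw.le
    refine (norm_indicator_le_norm_self _ _).trans ?_
    rw [norm_mul, mul_assoc]
    exact mul_le_mul (hR t) hbound (norm_nonneg _) hR0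
  · rw [G.kernel_eq_zero ht, indicator_of_notMem ht]
    simp

/-- The retarded evolution of a test curve as a function on spacetime. -/
def tailFn (s : ℝ) (x : Space n) : ℂ := ∫ t, G.kernel t (s, x)

theorem stronglyMeasurable_tailFn : StronglyMeasurable (Function.uncurry G.tailFn) :=
  G.measurable_kernel.stronglyMeasurable.integral_prod_left'

/-- The pairing of the retarded evolution with a Schwartz function, as an iterated integral. -/
theorem inner_tail {s : ℝ} (hs : s ∈ Icc a b) (φ : 𝓢(Space n, ℂ)) :
    inner ℂ (toL2 φ) (G.tail s) = ∫ t, ∫ x, (starRingEnd ℂ) (φ x) * G.kernel t (s, x) := by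
  rw [tail, G.intervalIntegral_pull hs.2, inner_freeProp_right,
    ← integral_inner G.integrable_pull_fn.integrableOn, ← integral_indicator measurableSet_Ioi]
  congr 1
  funext t
  by_cases ht : t ∈ Ioi s
  · have hs' : s ∈ Iio t := ht
    simp only [indicator_of_mem ht, kernel, indicator_of_mem hs']
    rw [TestCurve.pull, inner_freeProp_left, neg_neg, ← freeProp_add, ← sub_eq_add_neg, map_smul,
      inner_smul_right, G.fn_eq, freeProp_toL2, inner_toL2, ← integral_const_mul]
    refine integral_congr_ae ?_
    filter_upwards [(freeSchwartz (s - t) (G.profile (G.index t))).coeFn_toLp 2] with x hx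
    rw [hx]
    ring
  · have hs' : s ∉ Iio t := ht
    simp only [indicator_of_notMem ht, kernel, indicator_of_notMem hs', mul_zero, integral_zero]

/-- At each time, the pointwise integral `tailFn` represents the `L²` element `tail`, as both have
the same pairings with Schwartz functions. -/
theorem tailFn_ae_eq {s : ℝ} (hs : s ∈ Icc a b) : G.tailFn s =ᵐ[volume] G.tail s := by
  obtain ⟨C, hC0, hC⟩ := G.exists_kernel_le
  have hCint : Integrable ((Icc a b).indicator fun _ : ℝ => C) :=
    (integrable_indicator_iff measurableSet_Icc).2 (integrableOn_const measure_Icc_lt_top.ne)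
  have hmeas : AEStronglyMeasurable (G.tailFn s) volume :=
    (G.stronglyMeasurable_tailFn.comp_measurable measurable_prodMk_left).aestronglyMeasurable
  have hw2 : MemLp (fun x : Space n => (NLS.weight n x : ℂ)) 2 volume := by
    refine ⟨(Complex.continuous_ofReal.comp continuous_weight).aestronglyMeasurable, ?_⟩
    simpa using eLpNorm_weight_lt_top (n := n) one_le_two
  have hbd : ∀ x, ‖G.tailFn s x‖ ≤ (∫ t, (Icc a b).indicator (fun _ : ℝ => C) t) *
      ‖(NLS.weight n x : ℂ)‖ := by
    intro x
    rw [Complex.norm_real, Real.norm_of_nonneg (weight_pos x).le, ← integral_mul_const]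
    exact norm_integral_le_of_norm_le (hCint.mul_const _)
      (Filter.Eventually.of_forall fun t => hC t (s, x) hs)
  have hLp : MemLp (G.tailFn s) 2 volume :=
    hw2.of_le_mul hmeas (Filter.Eventually.of_forall hbd)
  have key : hLp.toLp _ = G.tail s := by
    refine eq_of_inner_toL2 fun φ => ?_
    rw [G.inner_tail hs, inner_toL2]
    have h1 : ∫ x, (starRingEnd ℂ) (φ x) * hLp.toLp (G.tailFn s) x =
        ∫ x, ∫ t, (starRingEnd ℂ) (φ x) * G.kernel t (s, x) := by
      refine integral_congr_ae ?_
      filter_upwards [hLp.coeFn_toLp] with x hx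
      rw [hx, tailFn, integral_const_mul]
    rw [h1]
    refine integral_integral_swap ?_
    have hkm : Measurable fun q : Space n × ℝ => G.kernel q.2 (s, q.1) :=
      G.measurable_kernel.comp
        (measurable_snd.prodMk (measurable_const.prodMk measurable_fst))
    have hφi : Integrable fun x => ‖φ x‖ := φ.integrable.norm
    refine (hφi.mul_prod hCint).mono' ?_ ?_
    · exact ((Complex.continuous_conj.comp (φ.continuous.comp
        continuous_fst)).measurable.mul hkm).aestronglyMeasurable
    · refine Filter.Eventually.of_forall fun q => ?_
      change ‖(starRingEnd ℂ) (φ q.1) * G.kernel q.2 (s, q.1)‖ ≤ _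
      rw [norm_mul, RCLike.norm_conj]
      refine mul_le_mul_of_nonneg_left ((hC q.2 (s, q.1) hs).trans ?_) (norm_nonneg _)
      refine mul_le_of_le_one_right ?_ (weight_le_one _)
      exact indicator_nonneg (fun _ _ => hC0) _
  rw [← key]
  exact hLp.coeFn_toLp.symm

theorem normS0_tailFn_le (hn : 3 ≤ n) : normS0 a b G.tailFn ≤ strichartzConst n * G.size :=
  (normS0_congr fun _ hs => G.tailFn_ae_eq hs).trans_le (G.normS0_tail_le hn)

theorem size_ne_top : G.size ≠ ⊤ :=
  ENNReal.rpow_ne_top_of_nonneg (by norm_num) G.lintegral_sq_lt_top.ne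

/-- The pairing of a Duhamel integral with a test curve is the pairing of the forcing with the
retarded evolution of the test curve. -/
theorem setIntegral_inner_duhamel (hn : 3 ≤ n) {F : ℝ → Space n → ℂ}
    (hF : AEStronglyMeasurable (Function.uncurry F) (slabMeasure n a b))
    (hN : normN0 a b F ≠ ⊤) {z : ℝ → L2 n} (hz : IsDuhamel a b F z) :
    ∫ t in Icc a b, inner ℂ (G.coeff t • G.fn (G.index t)) (z t) =
      -Complex.I * ∫ p, F p.1 p.2 * (starRingEnd ℂ) (G.tailFn p.1 p.2) ∂(slabMeasure n a b) := by
  obtain ⟨C, hC0, hC⟩ := G.exists_kernel_le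
  have hCint : Integrable ((Icc a b).indicator fun _ : ℝ => C) :=
    (integrable_indicator_iff measurableSet_Icc).2 (integrableOn_const measure_Icc_lt_top.ne)
  have h1 : ∀ t ∈ Icc a b, inner ℂ (G.coeff t • G.fn (G.index t)) (z t) =
      -Complex.I * ∫ p, F p.1 p.2 * (starRingEnd ℂ) (G.kernel t p) ∂(slabMeasure n a b) := by
    intro t ht
    rw [inner_smul_left, G.fn_eq, hz t ht, duhamelForm, mul_left_comm, ← integral_const_mul,
      ← integral_indicator (measurableSet_fst_lt t)]
    congr 2
    funext p
    by_cases hp : p.1 ∈ Iio t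
    · have hp' : p ∈ {p : ℝ × Space n | p.1 < t} := hp
      rw [indicator_of_mem hp', kernel, indicator_of_mem hp, map_mul]
      ring
    · have hp' : p ∉ {p : ℝ × Space n | p.1 < t} := hp
      rw [indicator_of_notMem hp', kernel, indicator_of_notMem hp, map_zero, mul_zero]
  have h2 : ∫ t in Icc a b, inner ℂ (G.coeff t • G.fn (G.index t)) (z t) =
      ∫ t, -Complex.I * ∫ p, F p.1 p.2 * (starRingEnd ℂ) (G.kernel t p) ∂(slabMeasure n a b) := by
    rw [← integral_indicator measurableSet_Icc]
    congr 1
    funext t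
    by_cases ht : t ∈ Icc a b
    · rw [indicator_of_mem ht, h1 t ht]
    · rw [indicator_of_notMem ht]
      simp [G.kernel_eq_zero ht]
  rw [h2, integral_const_mul]
  congr 1
  rw [integral_integral_swap]
  · congr 1
    funext p
    rw [integral_const_mul, integral_conj]
    rfl
  · have hFm : AEStronglyMeasurable (fun q : ℝ × (ℝ × Space n) => F q.2.1 q.2.2)
        ((volume : Measure ℝ).prod (slabMeasure n a b)) := by
        exact hF.comp_snd
    have hkm : AEStronglyMeasurable (fun q : ℝ × (ℝ × Space n) => (starRingEnd ℂ) (G.kernel q.1 q.2))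
        ((volume : Measure ℝ).prod (slabMeasure n a b)) :=
      (Complex.continuous_conj.measurable.comp G.measurable_kernel).aestronglyMeasurable
    refine (hCint.mul_prod (integrable_mul_weight hn hF hN)).mono' (hFm.mul hkm) ?_
    have hae : ∀ᵐ q ∂((volume : Measure ℝ).prod (slabMeasure n a b)), q.2.1 ∈ Icc a b :=
      Measure.quasiMeasurePreserving_snd.ae (ae_slabMeasure_mem n a b)
    filter_upwards [hae] with q hq
    change ‖F q.2.1 q.2.2 * (starRingEnd ℂ) (G.kernel q.1 q.2)‖ ≤ _
    rw [norm_mul, RCLike.norm_conj]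
    refine (mul_le_mul_of_nonneg_left (hC q.1 q.2 hq) (norm_nonneg _)).trans_eq ?_
    ring

end SchwartzCurve

/-- The inhomogeneous Strichartz estimate for Duhamel integrals. -/
theorem IsDuhamel.normS0_le (hn : 3 ≤ n) {a b : ℝ} {F : ℝ → Space n → ℂ}
    (hF : AEStronglyMeasurable (Function.uncurry F) (slabMeasure n a b))
    (hN : normN0 a b F ≠ ⊤) {z : ℝ → L2 n} (hzc : ContinuousOn z (Icc a b))
    (hz : IsDuhamel a b F z) :
    normS0 a b (fun t => ⇑(z t)) ≤ 2 * (strichartzConst n * normN0 a b F) := by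
  refine normS0_le_of_endpoints hn (fun t _ => Lp.aestronglyMeasurable _) (fun t ht => ?_) ?_
  · rw [eLpNorm_two_eq_enorm]
    refine (hz.enorm_le hn hN ht).trans ?_
    exact le_mul_of_one_le_left zero_le one_le_two
  · refine mixedNorm_le_of_test hn hzc fun G => ?_
    rw [G.setIntegral_inner_duhamel hn hF hN hz, enorm_mul, enorm_neg, ← ofReal_norm Complex.I,
      Complex.norm_I, ENNReal.ofReal_one, one_mul]
    refine (enorm_integral_le_lintegral_enorm _).trans ?_
    have h1 := lintegral_mul_le_normN0 hn hN G.stronglyMeasurable_tailFn.aestronglyMeasurable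
      (ENNReal.mul_ne_top (strichartzConst_ne_top n) G.size_ne_top) (G.normS0_tailFn_le hn)
    refine le_trans (le_of_eq (lintegral_congr fun p => ?_)) (h1.trans_eq (by ring))
    rw [enorm_mul, ← ofReal_norm ((starRingEnd ℂ) _), RCLike.norm_conj, ofReal_norm]

/-! ### Solutions satisfy the Duhamel formula -/

/-- The complex conjugate of a Schwartz function. -/
def conjSchwartz (φ : 𝓢(Space n, ℂ)) : 𝓢(Space n, ℂ) :=
  φ.postcompCLM (Complex.conjCLE : ℂ →L[ℝ] ℂ)

theorem conjSchwartz_apply (φ : 𝓢(Space n, ℂ)) (x : Space n) :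
    conjSchwartz φ x = (starRingEnd ℂ) (φ x) := rfl

theorem laplacian_conjSchwartz_apply (φ : 𝓢(Space n, ℂ)) (x : Space n) :
    (Δ (conjSchwartz φ)) x = (starRingEnd ℂ) ((Δ φ) x) := by
  rw [SchwartzMap.laplacian_apply, SchwartzMap.laplacian_apply]
  have h : (conjSchwartz φ : Space n → ℂ) = Complex.conjCLE ∘ φ := rfl
  rw [h, InnerProductSpace.laplacian_CLE_comp_left]
  rfl

theorem inner_toL2_eq_integral_conj (φ : 𝓢(Space n, ℂ)) (f : L2 n) :
    inner ℂ (toL2 φ) f = ∫ x, f x * conjSchwartz φ x := by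
  rw [inner_toL2]
  simp_rw [conjSchwartz_apply, mul_comm]

/-- The weak formulation, tested in the form of inner products. -/
theorem IsSchrodingerSolution.inner_sub {a b : ℝ} {u : ℝ → L2 n} {F : ℝ → Space n → ℂ}
    (hu : IsSchrodingerSolution a b u F) (φ : 𝓢(Space n, ℂ)) {t₁ t₂ : ℝ} (h₁ : t₁ ∈ Icc a b)
    (h₂ : t₂ ∈ Icc a b) :
    inner ℂ (toL2 φ) (u t₂) - inner ℂ (toL2 φ) (u t₁) = Complex.I * ∫ s in t₁..t₂,
      (inner ℂ (toL2 (Δ φ)) (u s) - ∫ x, F s x * (starRingEnd ℂ) (φ x)) := by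
  have h := hu.weak (conjSchwartz φ) t₁ h₁ t₂ h₂
  rw [inner_toL2_eq_integral_conj, inner_toL2_eq_integral_conj, h]
  congr 2
  funext s
  congr 1
  rw [inner_toL2]
  congr 1
  funext x
  rw [laplacian_conjSchwartz_apply, mul_comm]

theorem setIntegral_fst_lt {a b t : ℝ} (ht : t ∈ Icc a b) {f : ℝ × Space n → ℂ}
    (hf : Integrable f (slabMeasure n a b)) :
    ∫ p in {p : ℝ × Space n | p.1 < t}, f p ∂(slabMeasure n a b) = ∫ s in a..t, ∫ x, f (s, x) := by
  have h1 : {p : ℝ × Space n | p.1 < t} = Iio t ×ˢ univ := by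
    ext p
    simp
  have h2 : (slabMeasure n a b).restrict (Iio t ×ˢ univ) =
      (volume.restrict (Ico a t)).prod volume := by
    rw [slabMeasure, ← Measure.prod_restrict, Measure.restrict_univ,
      Measure.restrict_restrict measurableSet_Iio]
    congr 2
    ext s
    simp only [mem_inter_iff, mem_Iio, mem_Icc, mem_Ico]
    exact ⟨fun h => ⟨h.2.1, h.1⟩, fun h => ⟨h.2, h.1, (h.2.trans_le ht.2).le⟩⟩
  have h3 := hf.restrict (s := Iio t ×ˢ univ)
  rw [h2] at h3
  rw [h1, h2, integral_prod _ h3, intervalIntegral.integral_of_le ht.1, integral_Ico_eq_integral_Ioc]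

/-- A forcing that is integrable against the weight is integrable against every function that the
weight dominates. -/
theorem integrable_mul_of_le_weight {a b : ℝ} {F : ℝ → Space n → ℂ}
    (hF : AEStronglyMeasurable (Function.uncurry F) (slabMeasure n a b))
    (hW : Integrable (fun p => ‖F p.1 p.2‖ * weight n p.2) (slabMeasure n a b))
    {ψ : ℝ × Space n → ℂ} (hψ : AEStronglyMeasurable ψ (slabMeasure n a b)) {C : ℝ}
    (h : ∀ s ∈ Icc a b, ∀ x, ‖ψ (s, x)‖ ≤ C * weight n x) :
    Integrable (fun p => F p.1 p.2 * ψ p) (slabMeasure n a b) := by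
  have hF' : AEStronglyMeasurable (fun p : ℝ × Space n => F p.1 p.2) (slabMeasure n a b) := hF
  refine (hW.const_mul C).mono' (hF'.mul hψ) ?_
  filter_upwards [ae_slabMeasure_mem n a b] with p hp
  rw [norm_mul]
  refine (mul_le_mul_of_nonneg_left (h p.1 hp p.2) (norm_nonneg _)).trans_eq ?_
  ring

theorem exists_continuous_extension {a b : ℝ} (hab : a ≤ b) {u : ℝ → L2 n}
    (hu : ContinuousOn u (Icc a b)) : ∃ U : ℝ → L2 n, Continuous U ∧ ∀ t ∈ Icc a b, U t = u t :=
  ⟨IccExtend hab ((Icc a b).domRestrict u),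
    (continuousOn_iff_continuous_domRestrict.1 hu).Icc_extend',
    fun _ ht => IccExtend_of_mem hab _ ht⟩

/-- The derivative of `τ ↦ ⟨P(τ) - P(σ), U(τ)⟩` at `σ`. -/
theorem hasDerivAt_inner_sub {P U : ℝ → L2 n} {P' : L2 n} {σ : ℝ} (hP : HasDerivAt P P' σ)
    (hU : Continuous U) :
    HasDerivAt (fun τ => inner ℂ (P τ - P σ) (U τ)) (inner ℂ P' (U σ)) σ := by
  rw [hasDerivAt_iff_tendsto_slope] at hP ⊢
  have h := hP.inner (𝕜 := ℂ) ((hU.tendsto σ).mono_left nhdsWithin_le_nhds)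
  refine h.congr fun τ => ?_
  rw [slope_def_module, slope_def_module, sub_self, inner_zero_left, sub_zero,
    inner_smul_left_eq_smul]

/-- A primitive of a function that is small near `σ` in the sense of the bound below has derivative
zero at `σ` from the right. -/
theorem hasDerivWithinAt_zero_of_le {D : ℝ → ℂ} {σ T C : ℝ} (hσT : σ < T) {W : ℝ → ℝ}
    (hW : Integrable W) (h : ∀ τ ∈ Icc σ T, ‖D τ‖ ≤ C * (τ - σ) * ∫ s in σ..τ, W s) :
    HasDerivWithinAt D 0 (Ici σ) σ := by
  rw [hasDerivWithinAt_iff_tendsto_slope]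
  have hD0 : D σ = 0 := by
    have := h σ (left_mem_Icc.2 hσT.le)
    simpa using this
  have hlim : Filter.Tendsto (fun τ => C * ∫ s in σ..τ, W s) (nhdsWithin σ (Ici σ \ {σ}))
      (nhds 0) := by
    have h1 := ((intervalIntegral.continuous_primitive
      (fun _ _ => hW.intervalIntegrable) σ).const_mul C).tendsto σ
    simp only [intervalIntegral.integral_same, mul_zero] at h1
    exact h1.mono_left nhdsWithin_le_nhds
  refine squeeze_zero_norm' ?_ hlim
  have hmem : Icc σ T ∈ nhdsWithin σ (Ici σ \ {σ}) :=
    nhdsWithin_mono σ sdiff_subset (Icc_mem_nhdsGE hσT)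
  filter_upwards [hmem, self_mem_nhdsWithin] with τ hτ hτ2
  have hpos : 0 < τ - σ := sub_pos.2 (lt_of_le_of_ne hτ.1 (fun h => hτ2.2 h.symm))
  rw [slope_def_module, hD0, sub_zero, norm_smul, norm_inv, Real.norm_of_nonneg hpos.le,
    inv_mul_le_iff₀ hpos]
  exact (h τ hτ).trans_eq (by ring)

/-- A solution minus the free evolution of its initial value is the Duhamel integral of the
forcing: the pairing of the solution with a free Schwartz solution, corrected by the forcing, has
vanishing right derivative. -/
theorem IsSchrodingerSolution.isDuhamel (hn : 3 ≤ n) {a b : ℝ} {u : ℝ → L2 n}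
    {F : ℝ → Space n → ℂ} (hu : IsSchrodingerSolution a b u F)
    (hF : AEStronglyMeasurable (Function.uncurry F) (slabMeasure n a b))
    (hN : normN0 a b F ≠ ⊤) :
    IsDuhamel a b F (fun t => u t - freeProp (t - a) (u a)) := by
  intro t ht g
  have hab : a ≤ b := ht.1.trans ht.2
  have hW := integrable_mul_weight hn hF hN
  obtain ⟨U, hUc, hU⟩ := exists_continuous_extension hab hu.continuousOn
  obtain ⟨C, hC0, hC⟩ := exists_freeSchwartz_le_weight (b - a) g
  obtain ⟨C', hC'0, hC'⟩ := exists_freeSchwartz_sub_le_weight (b - a) g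
  have hTle : ∀ s ∈ Icc a b, |s - t| ≤ b - a := by
    intro s hs
    rw [abs_le]
    constructor <;> linarith [hs.1, hs.2, ht.1, ht.2]
  set W : ℝ → ℝ := fun s => ∫ x, ‖F s x‖ * weight n x with hWdef
  have hWint : Integrable ((Icc a b).indicator W) :=
    (integrable_indicator_iff measurableSet_Icc).2 hW.integral_prod_left
  have hWae : ∀ᵐ s ∂(volume.restrict (Icc a b)), Integrable fun x => ‖F s x‖ * weight n x :=
    hW.prod_right_ae
  -- The moving test function and its pairing with the forcing.
  let P : ℝ → L2 n := fun τ => freeProp (τ - t) (toL2 g)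
  have hψ : Integrable (fun p : ℝ × Space n =>
      F p.1 p.2 * (starRingEnd ℂ) (freeSchwartz (p.1 - t) g p.2)) (slabMeasure n a b) := by
    refine integrable_mul_of_le_weight hF hW
      (Complex.continuous_conj.comp (continuous_freeSchwartz_sub t g)).aestronglyMeasurable
      (C := C) fun s hs x => ?_
    change ‖(starRingEnd ℂ) (freeSchwartz (s - t) g x)‖ ≤ _
    rw [RCLike.norm_conj]
    exact hC _ _ (hTle s hs)
  let J : ℝ → ℂ := fun s => ∫ x, F s x * (starRingEnd ℂ) (freeSchwartz (s - t) g x)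
  have hJ : IntegrableOn J (Icc a b) := hψ.integral_prod_left
  have hJi : ∀ τ₁ ∈ Icc a b, ∀ τ₂ ∈ Icc a b, IntervalIntegrable J volume τ₁ τ₂ :=
    fun τ₁ h₁ τ₂ h₂ => (hJ.mono_set (uIcc_subset_Icc h₁ h₂)).intervalIntegrable
  let Φ : ℝ → ℂ := fun τ => inner ℂ (P τ) (U τ) + Complex.I * ∫ s in a..τ, J s
  have hPc : Continuous P := continuous_freeProp_sub t (toL2 g)
  have hΦc : ContinuousOn Φ (Icc a t) := by
    refine (hPc.inner hUc).continuousOn.add (continuousOn_const.mul ?_)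
    refine (intervalIntegral.continuousOn_primitive_interval
      (hJ.mono_set ?_)).mono (by rw [uIcc_of_le ht.1])
    rw [uIcc_of_le ht.1]
    exact Icc_subset_Icc_right ht.2
  have hderiv : ∀ σ ∈ Ico a t, HasDerivWithinAt Φ 0 (Ici σ) σ := by
    intro σ hσ
    have hσab : σ ∈ Icc a b := ⟨hσ.1, (hσ.2.trans_le ht.2).le⟩
    set gσ : 𝓢(Space n, ℂ) := freeSchwartz (σ - t) g with hgσ
    have hPσ : P σ = toL2 gσ := freeProp_toL2 _ _
    have hkc : Integrable (fun p : ℝ × Space n => F p.1 p.2 * (starRingEnd ℂ) (gσ p.2))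
        (slabMeasure n a b) := by
      refine integrable_mul_of_le_weight hF hW
        (Complex.continuous_conj.comp (gσ.continuous.comp continuous_snd)).aestronglyMeasurable
        (C := C) fun s hs x => ?_
      change ‖(starRingEnd ℂ) (gσ x)‖ ≤ _
      rw [RCLike.norm_conj]
      exact hC _ _ (hTle σ hσab)
    let K : ℝ → ℂ := fun s => ∫ x, F s x * (starRingEnd ℂ) (gσ x)
    have hK : IntegrableOn K (Icc a b) := hkc.integral_prod_left
    let D : ℝ → ℂ := fun τ => ∫ s in σ..τ, (J s - K s)
    have hD : HasDerivWithinAt D 0 (Ici σ) σ := by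
      refine hasDerivWithinAt_zero_of_le hσ.2 (C := C') hWint fun τ hτ => ?_
      rw [← intervalIntegral.integral_const_mul]
      refine intervalIntegral.norm_integral_le_of_norm_le hτ.1 ?_
        (hWint.const_mul _).intervalIntegrable
      have h1 := (ae_restrict_iff' measurableSet_Icc).1
        ((hψ.prod_right_ae).and ((hkc.prod_right_ae).and hWae))
      filter_upwards [h1] with s hs hsτ
      have hsab : s ∈ Icc a b :=
        ⟨hσ.1.trans hsτ.1.le, hsτ.2.trans (hτ.2.trans ht.2)⟩
      obtain ⟨h2, h3, h4⟩ := hs hsab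
      rw [indicator_of_mem hsab, ← integral_sub h2 h3, hWdef, ← integral_const_mul]
      refine norm_integral_le_of_norm_le (h4.const_mul _) (Filter.Eventually.of_forall fun x => ?_)
      rw [← mul_sub, ← map_sub, norm_mul, RCLike.norm_conj]
      have h5 := hC' (s - t) (σ - t) x (hTle s hsab) (hTle σ hσab)
      rw [sub_sub_sub_cancel_right, abs_of_pos (sub_pos.2 hsτ.1)] at h5
      have h6 : C' * weight n x * (s - σ) ≤ C' * weight n x * (τ - σ) :=
        mul_le_mul_of_nonneg_left (by linarith [hsτ.2]) (mul_nonneg hC'0 (weight_pos x).le)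
      refine (mul_le_mul_of_nonneg_left (h5.trans h6) (norm_nonneg _)).trans_eq ?_
      ring
    have hA : HasDerivAt (fun τ => inner ℂ (P τ - P σ) (U τ))
        (-Complex.I * inner ℂ (toL2 (Δ gσ)) (U σ)) σ := by
      have hP' : HasDerivAt P (Complex.I • freeProp (σ - t) (toL2 (Δ g))) σ :=
        (hasDerivAt_freeProp_toL2 (σ - t) g).comp_sub_const σ t
      refine (hasDerivAt_inner_sub hP' hUc).congr_deriv ?_
      rw [inner_smul_left, freeProp_toL2, hgσ, laplacian_freeSchwartz, Complex.conj_I]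
    have hB : HasDerivAt (fun τ => ∫ s in σ..τ, inner ℂ (toL2 (Δ gσ)) (U s))
        (inner ℂ (toL2 (Δ gσ)) (U σ)) σ := by
      have hc : Continuous fun s => inner ℂ (toL2 (Δ gσ)) (U s) := continuous_const.inner hUc
      exact (hc.integral_hasStrictDerivAt σ σ).hasDerivAt
    have hsum := ((hA.hasDerivWithinAt (s := Ici σ)).add
      ((hB.hasDerivWithinAt (s := Ici σ)).const_mul Complex.I)).add (hD.const_mul Complex.I)
    have hsum' := (hsum.const_add (Φ σ)).congr_deriv (g' := 0) (by ring)
    refine hsum'.congr_of_eventuallyEq ?_ ?_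
    · filter_upwards [Icc_mem_nhdsGE hσ.2] with τ hτ
      have hτab : τ ∈ Icc a b := ⟨hσ.1.trans hτ.1, hτ.2.trans ht.2⟩
      have hw := hu.inner_sub gσ hσab hτab
      have hsub : Icc σ τ ⊆ Icc a b := Icc_subset_Icc hσ.1 (hτ.2.trans ht.2)
      have hKi : IntervalIntegrable K volume σ τ :=
        (hK.mono_set (uIcc_subset_Icc hσab hτab)).intervalIntegrable
      have hUi : IntervalIntegrable (fun s => inner ℂ (toL2 (Δ gσ)) (U s)) volume σ τ :=
        (continuous_const.inner hUc).intervalIntegrable _ _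
      have hcongr : ∫ s in σ..τ, (inner ℂ (toL2 (Δ gσ)) (u s) -
          ∫ x, F s x * (starRingEnd ℂ) (gσ x)) =
          ∫ s in σ..τ, (inner ℂ (toL2 (Δ gσ)) (U s) - K s) := by
        refine intervalIntegral.integral_congr fun s hs => ?_
        rw [uIcc_of_le hτ.1] at hs
        simp only [hU s (hsub hs), K]
      rw [hcongr, intervalIntegral.integral_sub hUi hKi, ← hU σ hσab, ← hU τ hτab, ← hPσ] at hw
      have hadd := intervalIntegral.integral_add_adjacent_intervals
        (hJi a (left_mem_Icc.2 hab) σ hσab) (hJi σ hσab τ hτab)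
      simp only [Φ, D, Pi.add_apply]
      rw [intervalIntegral.integral_sub (hJi σ hσab τ hτab) hKi, ← hadd, inner_sub_left]
      linear_combination hw
    · simp [D]
  have hfin := constant_of_has_deriv_right_zero hΦc hderiv t (right_mem_Icc.2 ht.1)
  simp only [Φ, P, sub_self, freeProp_zero, intervalIntegral.integral_same, mul_zero,
    add_zero] at hfin
  rw [hU t ht, hU a (left_mem_Icc.2 hab), inner_freeProp_left, neg_sub] at hfin
  rw [inner_sub_right, duhamelForm, setIntegral_fst_lt ht hψ]
  linear_combination hfin

/-! ### Existence for the linear equation -/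

theorem freeSchwartz_add (s t : ℝ) (g : 𝓢(Space n, ℂ)) :
    freeSchwartz (s + t) g = freeSchwartz s (freeSchwartz t g) := by
  rw [← FourierTransform.fourierInv_fourier_eq (F := 𝓢(Space n, ℂ)) (freeSchwartz (s + t) g),
    ← FourierTransform.fourierInv_fourier_eq (F := 𝓢(Space n, ℂ))
      (freeSchwartz s (freeSchwartz t g))]
  congr 1
  ext ξ
  rw [fourier_freeSchwartz_apply, fourier_freeSchwartz_apply, fourier_freeSchwartz_apply,
    freeSymbol_add, mul_assoc]

theorem freeSchwartz_zero (g : 𝓢(Space n, ℂ)) : freeSchwartz 0 g = g := by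
  rw [← FourierTransform.fourierInv_fourier_eq (F := 𝓢(Space n, ℂ)) (freeSchwartz 0 g),
    ← FourierTransform.fourierInv_fourier_eq (F := 𝓢(Space n, ℂ)) g]
  congr 1
  ext ξ
  rw [FourierTransform.fourierInv_fourier_eq, fourier_freeSchwartz_apply, freeSymbol_zero, one_mul]

theorem exists_schwartz_le_weight (g : 𝓢(Space n, ℂ)) :
    ∃ C : ℝ, 0 ≤ C ∧ ∀ x, ‖g x‖ ≤ C * weight n x := by
  obtain ⟨C, hC0, hC⟩ := exists_freeSchwartz_le_weight 0 g
  refine ⟨C, hC0, fun x => ?_⟩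
  have := hC 0 x (by simp)
  rwa [freeSchwartz_zero] at this

section Weighted

variable {a b : ℝ} {F : ℝ → Space n → ℂ}

theorem integrable_duhamel (hF : AEStronglyMeasurable (Function.uncurry F) (slabMeasure n a b))
    (hW : Integrable (fun p => ‖F p.1 p.2‖ * weight n p.2) (slabMeasure n a b)) {t : ℝ}
    (ht : t ∈ Icc a b) (g : 𝓢(Space n, ℂ)) :
    Integrable (fun p : ℝ × Space n =>
      F p.1 p.2 * (starRingEnd ℂ) (freeSchwartz (p.1 - t) g p.2)) (slabMeasure n a b) := by
  obtain ⟨C, hC0, hC⟩ := exists_freeSchwartz_le_weight (b - a) g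
  refine integrable_mul_of_le_weight hF hW
    (Complex.continuous_conj.comp (continuous_freeSchwartz_sub t g)).aestronglyMeasurable
    (C := C) fun s hs x => ?_
  change ‖(starRingEnd ℂ) (freeSchwartz (s - t) g x)‖ ≤ _
  rw [RCLike.norm_conj]
  refine hC _ _ ?_
  rw [abs_le]
  constructor <;> linarith [hs.1, hs.2, ht.1, ht.2]

theorem integrable_pairing (hF : AEStronglyMeasurable (Function.uncurry F) (slabMeasure n a b))
    (hW : Integrable (fun p => ‖F p.1 p.2‖ * weight n p.2) (slabMeasure n a b))
    (g : 𝓢(Space n, ℂ)) :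
    Integrable (fun p : ℝ × Space n => F p.1 p.2 * g p.2) (slabMeasure n a b) := by
  obtain ⟨C, hC0, hC⟩ := exists_schwartz_le_weight g
  exact integrable_mul_of_le_weight hF hW
    (g.continuous.comp continuous_snd).aestronglyMeasurable (C := C) fun s _ x => hC x

/-- The Duhamel integral at one time, from the Riesz representation theorem: the Duhamel form is
bounded on the dense subspace of Schwartz functions. -/
theorem exists_duhamel_at (hn : 3 ≤ n)
    (hF : AEStronglyMeasurable (Function.uncurry F) (slabMeasure n a b))
    (hN : normN0 a b F ≠ ⊤) {t : ℝ} (ht : t ∈ Icc a b) :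
    ∃ z : L2 n, ∀ g : 𝓢(Space n, ℂ), inner ℂ (toL2 g) z = duhamelForm a b F t g := by
  have hW := integrable_mul_weight hn hF hN
  -- The Duhamel form is conjugate linear, so its conjugate is the functional to be represented.
  let f : 𝓢(Space n, ℂ) →ₗ[ℂ] ℂ :=
    { toFun := fun g => (starRingEnd ℂ) (duhamelForm a b F t g)
      map_add' := by
        intro g h
        rw [← map_add]
        congr 1
        unfold duhamelForm
        rw [← mul_add, ← integral_add (integrable_duhamel hF hW ht g).integrableOn
          (integrable_duhamel hF hW ht h).integrableOn]
        congr 2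
        funext p
        rw [map_add, add_apply, map_add, mul_add]
      map_smul' := by
        intro c g
        unfold duhamelForm
        have h1 : ∀ p : ℝ × Space n, F p.1 p.2 * (starRingEnd ℂ) (freeSchwartz (p.1 - t) (c • g) p.2) =
            (starRingEnd ℂ) c * (F p.1 p.2 * (starRingEnd ℂ) (freeSchwartz (p.1 - t) g p.2)) := by
          intro p
          rw [map_smul, smul_apply, smul_eq_mul, map_mul]
          ring
        simp_rw [h1]
        rw [integral_const_mul, mul_left_comm, map_mul, Complex.conj_conj]
        rfl }
  let e : 𝓢(Space n, ℂ) →ₗ[ℂ] L2 n := (SchwartzMap.toLpCLM ℂ ℂ 2 volume).toLinearMap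
  have hK : strichartzConst n * normN0 a b F ≠ ⊤ := ENNReal.mul_ne_top (strichartzConst_ne_top n) hN
  have hfe : ∀ g, ‖f g‖ ≤ (strichartzConst n * normN0 a b F).toReal * ‖e g‖ := by
    intro g
    change ‖(starRingEnd ℂ) (duhamelForm a b F t g)‖ ≤ _ * ‖toL2 g‖
    rw [RCLike.norm_conj]
    have h1 := enorm_duhamelForm_le hn hN t g
    rw [← ENNReal.ofReal_toReal hK, ← ofReal_norm, ← ofReal_norm,
      ← ENNReal.ofReal_mul ENNReal.toReal_nonneg] at h1
    exact (ENNReal.ofReal_le_ofReal_iff (by positivity)).1 h1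
  refine ⟨(InnerProductSpace.toDual ℂ (L2 n)).symm (f.extendOfNorm e), fun g => ?_⟩
  rw [← inner_conj_symm, InnerProductSpace.toDual_symm_apply]
  have h2 : f.extendOfNorm e (toL2 g) = f g :=
    LinearMap.extendOfNorm_eq denseRange_toL2 ⟨_, hfe⟩ g
  rw [h2]
  exact Complex.conj_conj _

theorem exists_isDuhamel (hn : 3 ≤ n)
    (hF : AEStronglyMeasurable (Function.uncurry F) (slabMeasure n a b))
    (hN : normN0 a b F ≠ ⊤) : ∃ z : ℝ → L2 n, IsDuhamel a b F z := by
  classical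
  choose z hz using fun t : Icc a b => exists_duhamel_at hn hF hN t.2
  refine ⟨fun t => if ht : t ∈ Icc a b then z ⟨t, ht⟩ else 0, fun t ht g => ?_⟩
  simp only [dif_pos ht]
  exact hz ⟨t, ht⟩ g

/-- The increment of a Duhamel integral over a short time interval is controlled by the forcing on
that interval. -/
theorem IsDuhamel.enorm_sub_freeProp_le (hn : 3 ≤ n)
    (hF : AEStronglyMeasurable (Function.uncurry F) (slabMeasure n a b))
    (hN : normN0 a b F ≠ ⊤) {z : ℝ → L2 n} (hz : IsDuhamel a b F z) {t t' : ℝ} (ht : t ∈ Icc a b)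
    (ht' : t' ∈ Icc a b) (htt' : t ≤ t') :
    ‖z t' - freeProp (t' - t) (z t)‖ₑ ≤ strichartzConst n * normN0 t t' F := by
  have hW := integrable_mul_weight hn hF hN
  have hsub : Icc t t' ⊆ Icc a b := Icc_subset_Icc ht.1 ht'.2
  have hNt : normN0 t t' F ≠ ⊤ := ne_top_of_le_ne_top hN (normN0_restrict_le hsub F)
  refine enorm_le_of_inner_toL2 fun g => ?_
  set f : ℝ × Space n → ℂ := fun p => F p.1 p.2 * (starRingEnd ℂ) (freeSchwartz (p.1 - t') g p.2)
    with hf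
  have hfi : Integrable f (slabMeasure n a b) := integrable_duhamel hF hW ht' g
  have h1 : inner ℂ (toL2 g) (freeProp (t' - t) (z t)) =
      -Complex.I * ∫ p in {p : ℝ × Space n | p.1 < t}, f p ∂(slabMeasure n a b) := by
    rw [inner_freeProp_right, neg_sub, freeProp_toL2, hz t ht, duhamelForm]
    simp_rw [← freeSchwartz_add, sub_add_sub_cancel]
    rfl
  have h2 : {p : ℝ × Space n | p.1 < t'} =
      {p : ℝ × Space n | p.1 < t} ∪ {p : ℝ × Space n | t ≤ p.1 ∧ p.1 < t'} := by
    ext p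
    simp only [mem_union, mem_ofPred_eq]
    constructor
    · intro h
      rcases lt_or_ge p.1 t with h' | h'
      · exact Or.inl h'
      · exact Or.inr ⟨h', h⟩
    · rintro (h | h)
      · exact h.trans_le htt'
      · exact h.2
  have hms : MeasurableSet {p : ℝ × Space n | t ≤ p.1 ∧ p.1 < t'} :=
    (measurableSet_le measurable_const measurable_fst).inter (measurableSet_fst_lt t')
  have h3 : inner ℂ (toL2 g) (z t' - freeProp (t' - t) (z t)) =
      -Complex.I * ∫ p in {p : ℝ × Space n | t ≤ p.1 ∧ p.1 < t'}, f p ∂(slabMeasure n a b) := by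
    rw [inner_sub_right, h1, hz t' ht', duhamelForm, h2, setIntegral_union _ hms hfi.integrableOn
      hfi.integrableOn]
    · ring
    · rw [Set.disjoint_left]
      rintro p hp ⟨hp', _⟩
      exact absurd hp (not_lt.2 hp')
  rw [h3, enorm_mul, enorm_neg, ← ofReal_norm Complex.I, Complex.norm_I, ENNReal.ofReal_one, one_mul]
  have hsub2 : {p : ℝ × Space n | t ≤ p.1 ∧ p.1 < t'} ⊆ Icc t t' ×ˢ univ :=
    fun p hp => ⟨⟨hp.1, hp.2.le⟩, mem_univ _⟩
  refine (enorm_integral_le_lintegral_enorm _).trans ((lintegral_mono_set hsub2).trans ?_)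
  rw [slabMeasure_restrict hsub]
  have h4 := lintegral_mul_le_normN0 hn hNt (φ := fun s x => freeSchwartz (s - t') g x)
    (continuous_freeSchwartz_sub t' g).aestronglyMeasurable
    (ENNReal.mul_ne_top (strichartzConst_ne_top n) enorm_ne_top)
    (normS0_freeSchwartz_le hn t t' t' g)
  refine le_trans (le_of_eq (lintegral_congr fun p => ?_)) (h4.trans_eq (by ring))
  rw [hf, enorm_mul, ← ofReal_norm ((starRingEnd ℂ) _), RCLike.norm_conj, ofReal_norm]

/-- The space-time Lebesgue norm of the forcing over short time intervals is small. -/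
theorem tendsto_eLpNorm_slab (hn : 3 ≤ n)
    (hF : AEStronglyMeasurable (Function.uncurry F) (slabMeasure n a b))
    (hFp : eLpNorm (Function.uncurry F) (ENNReal.ofReal (critDualExp n)) (slabMeasure n a b) ≠ ⊤)
    {t : ℝ} (ht : t ∈ Icc a b) :
    Filter.Tendsto (fun s => eLpNorm (Function.uncurry F) (ENNReal.ofReal (critDualExp n))
      (slabMeasure n (min t s) (max t s))) (nhdsWithin t (Icc a b)) (nhds 0) := by
  have hp := (holderConjugate_critExp hn).pos
  set w : ℝ → ℝ≥0∞ := fun s => ∫⁻ x, ‖F s x‖ₑ ^ critDualExp n with hw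
  have hform : ∀ c d, Icc c d ⊆ Icc a b →
      eLpNorm (Function.uncurry F) (ENNReal.ofReal (critDualExp n)) (slabMeasure n c d) =
        (∫⁻ s in Icc c d, w s ∂(volume.restrict (Icc a b))) ^ (1 / critDualExp n) := by
    intro c d h
    have hFc : AEStronglyMeasurable (Function.uncurry F) (slabMeasure n c d) :=
      hF.mono_measure (slabMeasure_mono h)
    rw [eLpNorm_eq_lintegral_rpow_enorm_toReal (by simpa using hp) ENNReal.ofReal_ne_top,
      ENNReal.toReal_ofReal hp.le, slabMeasure, lintegral_prod _ (hFc.enorm.pow_const _),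
      Measure.restrict_restrict measurableSet_Icc, inter_eq_left.2 h]
    rfl
  have hfin : ∫⁻ s, w s ∂(volume.restrict (Icc a b)) ≠ ⊤ := by
    intro htop
    apply hFp
    rw [hform a b le_rfl, Measure.restrict_restrict measurableSet_Icc, inter_self, htop,
      ENNReal.top_rpow_of_pos (by positivity)]
  have hmeas : Filter.Tendsto ((volume.restrict (Icc a b)) ∘ fun s => Icc (min t s) (max t s))
      (nhdsWithin t (Icc a b)) (nhds 0) := by
    have h0 : Filter.Tendsto (fun s : ℝ => ENNReal.ofReal (max t s - min t s))
        (nhdsWithin t (Icc a b)) (nhds 0) := by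
      have hc : Continuous fun s : ℝ => ENNReal.ofReal (max t s - min t s) :=
        ENNReal.continuous_ofReal.comp (by fun_prop)
      have := hc.tendsto t
      simp only [max_self, min_self, sub_self, ENNReal.ofReal_zero] at this
      exact this.mono_left nhdsWithin_le_nhds
    refine tendsto_of_tendsto_of_tendsto_of_le_of_le tendsto_const_nhds h0 (fun _ => zero_le) ?_
    intro s
    refine (Measure.restrict_apply_le _ _).trans ?_
    rw [Real.volume_Icc]
  have h1 := (tendsto_setLIntegral_zero hfin hmeas).ennrpow_const (1 / critDualExp n)
  rw [ENNReal.zero_rpow_of_pos (by positivity)] at h1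
  refine h1.congr' ?_
  filter_upwards [self_mem_nhdsWithin] with s hs
  rw [hform _ _ (Icc_subset_Icc (le_min ht.1 hs.1) (max_le ht.2 hs.2))]

/-- Duhamel integrals are continuous in time: the increment over a short interval is controlled by
the forcing on that interval, whose Lebesgue norm is small. -/
theorem IsDuhamel.continuousOn (hn : 3 ≤ n)
    (hF : AEStronglyMeasurable (Function.uncurry F) (slabMeasure n a b))
    (hFp : eLpNorm (Function.uncurry F) (ENNReal.ofReal (critDualExp n)) (slabMeasure n a b) ≠ ⊤)
    {z : ℝ → L2 n} (hz : IsDuhamel a b F z) : ContinuousOn z (Icc a b) := by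
  have hN : normN0 a b F ≠ ⊤ := ne_top_of_le_ne_top hFp (normN0_le_eLpNorm hn hF)
  intro t ht
  have h1 : ∀ s ∈ Icc a b, ‖z s - freeProp (s - t) (z t)‖ₑ ≤ strichartzConst n *
      eLpNorm (Function.uncurry F) (ENNReal.ofReal (critDualExp n))
        (slabMeasure n (min t s) (max t s)) := by
    intro s hs
    have hsub : Icc (min t s) (max t s) ⊆ Icc a b :=
      Icc_subset_Icc (le_min ht.1 hs.1) (max_le ht.2 hs.2)
    refine le_trans ?_ (mul_le_mul_right
      (normN0_le_eLpNorm hn (hF.mono_measure (slabMeasure_mono hsub))) _)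
    rcases le_total t s with hts | hts
    · rw [min_eq_left hts, max_eq_right hts]
      exact hz.enorm_sub_freeProp_le hn hF hN ht hs hts
    · rw [min_eq_right hts, max_eq_left hts]
      refine le_trans (le_of_eq ?_) (hz.enorm_sub_freeProp_le hn hF hN hs ht hts)
      have h2 : z s - freeProp (s - t) (z t) = -freeProp (s - t) (z t - freeProp (t - s) (z s)) := by
        rw [map_sub, ← freeProp_add, sub_add_sub_cancel, sub_self, freeProp_zero, neg_sub]
      rw [h2, enorm_neg, ← ofReal_norm, LinearIsometry.norm_map, ofReal_norm]
  have h3 : Filter.Tendsto (fun s => ‖z s - freeProp (s - t) (z t)‖ₑ) (nhdsWithin t (Icc a b))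
      (nhds 0) := by
    have h4 := ENNReal.Tendsto.const_mul (a := strichartzConst n)
      (tendsto_eLpNorm_slab hn hF hFp ht) (Or.inr (strichartzConst_ne_top n))
    rw [mul_zero] at h4
    refine tendsto_of_tendsto_of_tendsto_of_le_of_le' tendsto_const_nhds h4
      (Filter.Eventually.of_forall fun _ => zero_le) ?_
    filter_upwards [self_mem_nhdsWithin] with s hs using h1 s hs
  have h5 : Filter.Tendsto (fun s => z s - freeProp (s - t) (z t)) (nhdsWithin t (Icc a b))
      (nhds 0) := by
    rw [tendsto_iff_edist_tendsto_0]
    simpa [edist_eq_enorm_sub] using h3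
  have h6 : Filter.Tendsto (fun s => freeProp (s - t) (z t)) (nhdsWithin t (Icc a b))
      (nhds (z t)) := by
    have := (continuous_freeProp_sub t (z t)).tendsto t
    rw [sub_self, freeProp_zero] at this
    exact this.mono_left nhdsWithin_le_nhds
  have := h5.add h6
  simp only [sub_add_cancel, zero_add] at this
  exact this

/-- The integrated form of the free Schrödinger equation for Schwartz functions, conjugated and read
backwards in time. -/
theorem integral_freeSchwartz_sub (s t : ℝ) (ψ : 𝓢(Space n, ℂ)) (x : Space n) :
    ∫ τ in s..t, (starRingEnd ℂ) (freeSchwartz (s - τ) (Δ ψ) x) =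
      -Complex.I * ((starRingEnd ℂ) (freeSchwartz (s - t) ψ x) - (starRingEnd ℂ) (ψ x)) := by
  have hcont : Continuous fun τ : ℝ => (starRingEnd ℂ) (freeSchwartz (s - τ) (Δ ψ) x) := by
    have h := (continuous_freeSchwartz_apply (Δ ψ)).comp
      ((continuous_const.sub continuous_id).prodMk continuous_const :
        Continuous fun τ : ℝ => (s - τ, x))
    exact Complex.continuous_conj.comp h
  have hder : ∀ τ ∈ uIcc s t, HasDerivAt
      (fun τ => -Complex.I * (starRingEnd ℂ) (freeSchwartz (s - τ) ψ x))
      ((starRingEnd ℂ) (freeSchwartz (s - τ) (Δ ψ) x)) τ := by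
    intro τ _
    have h1 := (hasDerivAt_freeSchwartz_apply (s - τ) ψ x).comp_const_sub s τ
    have h2 := (h1.star).const_mul (-Complex.I)
    refine h2.congr_deriv ?_
    change -Complex.I * (starRingEnd ℂ) (-(Complex.I * freeSchwartz (s - τ) (Δ ψ) x)) = _
    rw [map_neg, map_mul, Complex.conj_I]
    linear_combination (-(starRingEnd ℂ) (freeSchwartz (s - τ) (Δ ψ) x)) * Complex.I_mul_I
  rw [intervalIntegral.integral_eq_sub_of_hasDerivAt hder (hcont.intervalIntegrable _ _),
    sub_self, freeSchwartz_zero]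
  ring

end Weighted

/-! ### Duhamel integrals solve the linear equation -/

theorem conjSchwartz_conjSchwartz (φ : 𝓢(Space n, ℂ)) : conjSchwartz (conjSchwartz φ) = φ := by
  ext x
  rw [conjSchwartz_apply, conjSchwartz_apply, Complex.conj_conj]

/-- The weak formulation of the equation may be tested in the form of inner products. -/
theorem IsSchrodingerSolution.of_inner {a b : ℝ} {u : ℝ → L2 n} {F : ℝ → Space n → ℂ}
    (hc : ContinuousOn u (Icc a b))
    (hF : ∀ φ : 𝓢(Space n, ℂ),
      Integrable (fun p : ℝ × Space n => F p.1 p.2 * φ p.2) (slabMeasure n a b))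
    (h : ∀ φ : 𝓢(Space n, ℂ), ∀ t₁ ∈ Icc a b, ∀ t₂ ∈ Icc a b,
      inner ℂ (toL2 φ) (u t₂) - inner ℂ (toL2 φ) (u t₁) = Complex.I * ∫ s in t₁..t₂,
        (inner ℂ (toL2 (Δ φ)) (u s) - ∫ x, F s x * (starRingEnd ℂ) (φ x))) :
    IsSchrodingerSolution a b u F where
  continuousOn := hc
  integrable_slice φ := (hF φ).prod_right_ae
  integrable_pairing φ := (hF φ).integral_prod_left
  weak φ t₁ h₁ t₂ h₂ := by
    have h0 := h (conjSchwartz φ) t₁ h₁ t₂ h₂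
    rw [inner_toL2_eq_integral_conj, inner_toL2_eq_integral_conj, conjSchwartz_conjSchwartz] at h0
    rw [h0]
    congr 2
    funext s
    congr 1
    · rw [inner_toL2]
      congr 1
      funext x
      rw [laplacian_conjSchwartz_apply, Complex.conj_conj, mul_comm]
    · congr 1
      funext x
      rw [conjSchwartz_apply, Complex.conj_conj]

/-- Free evolutions solve the free equation in the weak sense. -/
theorem isSchrodingerSolution_freeProp (a b σ : ℝ) (f : L2 n) :
    IsSchrodingerSolution a b (fun t => freeProp (t - σ) f) (fun _ _ => 0) := by
  refine .of_inner (continuous_freeProp_sub σ f).continuousOn (fun φ => ?_)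
    fun φ t₁ _ t₂ _ => ?_
  · simp
  · have hc : Continuous fun s => inner ℂ (toL2 (Δ φ)) (freeProp (s - σ) f) :=
      continuous_const.inner (continuous_freeProp_sub σ f)
    have hder : ∀ τ ∈ uIcc t₁ t₂, HasDerivAt (fun τ => inner ℂ (toL2 φ) (freeProp (τ - σ) f))
        (Complex.I * inner ℂ (toL2 (Δ φ)) (freeProp (τ - σ) f)) τ := by
      intro τ _
      have h1 := (hasDerivAt_freeProp_toL2 (σ - τ) φ).comp_const_sub σ τ
      have h2 := h1.inner ℂ (hasDerivAt_const τ f)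
      simp only [inner_zero_right, zero_add] at h2
      have h3 : ∀ (g : L2 n) (τ : ℝ), inner ℂ g (freeProp (τ - σ) f) =
          inner ℂ (freeProp (σ - τ) g) f := fun g τ => by
        rw [inner_freeProp_right, neg_sub]
      simp_rw [h3]
      refine h2.congr_deriv ?_
      rw [inner_neg_left, inner_smul_left, Complex.conj_I]
      ring
    simp only [zero_mul, integral_zero, sub_zero]
    rw [← intervalIntegral.integral_const_mul, intervalIntegral.integral_eq_sub_of_hasDerivAt hder
      ((hc.const_mul _).intervalIntegrable _ _)]

/-- The weak equation for the Duhamel form: by Fubini's theorem, the time integral of its pairing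
with `Δψ` falls on the free Schwartz solution, where it can be computed. -/
theorem intervalIntegral_duhamelForm {a b : ℝ} {F : ℝ → Space n → ℂ}
    (hF : AEStronglyMeasurable (Function.uncurry F) (slabMeasure n a b))
    (hW : Integrable (fun p => ‖F p.1 p.2‖ * weight n p.2) (slabMeasure n a b)) {t : ℝ}
    (ht : t ∈ Icc a b) (ψ : 𝓢(Space n, ℂ)) :
    ∫ τ in a..t, duhamelForm a b F τ (Δ ψ) =
      -Complex.I * duhamelForm a b F t ψ + ∫ s in a..t, ∫ x, F s x * (starRingEnd ℂ) (ψ x) := by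
  obtain ⟨C, hC0, hC⟩ := exists_freeSchwartz_le_weight (b - a) (Δ ψ)
  have hψi : Integrable (fun p : ℝ × Space n => F p.1 p.2 * (starRingEnd ℂ) (ψ p.2))
      (slabMeasure n a b) := integrable_pairing hF hW (conjSchwartz ψ)
  let k : ℝ → ℝ × Space n → ℂ := fun τ p =>
    F p.1 p.2 * (starRingEnd ℂ) (freeSchwartz (p.1 - τ) (Δ ψ) p.2)
  let f : ℝ → ℝ × Space n → ℂ := fun τ => {p : ℝ × Space n | p.1 < τ}.indicator (k τ)
  have hS : MeasurableSet {q : ℝ × (ℝ × Space n) | q.2.1 < q.1} :=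
    measurableSet_lt (measurable_fst.comp measurable_snd) measurable_fst
  have hfu : Function.uncurry f =
      {q : ℝ × (ℝ × Space n) | q.2.1 < q.1}.indicator (Function.uncurry k) := by
    funext q
    rfl
  have hkc : Continuous fun q : ℝ × (ℝ × Space n) =>
      (starRingEnd ℂ) (freeSchwartz (q.2.1 - q.1) (Δ ψ) q.2.2) := by
    have h := (continuous_freeSchwartz_apply (Δ ψ)).comp
      ((((continuous_fst.comp continuous_snd).sub continuous_fst).prodMk
        (continuous_snd.comp continuous_snd)) :
        Continuous fun q : ℝ × (ℝ × Space n) => (q.2.1 - q.1, q.2.2))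
    exact Complex.continuous_conj.comp h
  have hfi : Integrable (Function.uncurry f)
      ((volume.restrict (Ioc a t)).prod (slabMeasure n a b)) := by
    have hm : AEStronglyMeasurable (Function.uncurry f)
        ((volume.restrict (Ioc a t)).prod (slabMeasure n a b)) := by
      rw [hfu]
      exact (AEStronglyMeasurable.mul hF.comp_snd hkc.aestronglyMeasurable).indicator hS
    refine ((hW.const_mul C).comp_snd (volume.restrict (Ioc a t))).mono' hm ?_
    have h1 : ∀ᵐ q ∂((volume.restrict (Ioc a t)).prod (slabMeasure n a b)), q.1 ∈ Ioc a t :=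
      Measure.quasiMeasurePreserving_fst.ae (ae_restrict_mem measurableSet_Ioc)
    have h2 : ∀ᵐ q ∂((volume.restrict (Ioc a t)).prod (slabMeasure n a b)), q.2.1 ∈ Icc a b :=
      Measure.quasiMeasurePreserving_snd.ae (ae_slabMeasure_mem n a b)
    filter_upwards [h1, h2] with q hq1 hq2
    rw [hfu]
    refine (norm_indicator_le_norm_self _ _).trans ?_
    change ‖F q.2.1 q.2.2 * (starRingEnd ℂ) (freeSchwartz (q.2.1 - q.1) (Δ ψ) q.2.2)‖ ≤ _
    rw [norm_mul, RCLike.norm_conj]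
    have h3 := hC (q.2.1 - q.1) q.2.2 (by
      rw [abs_le]
      constructor <;> linarith [hq1.1, hq1.2, ht.2, hq2.1, hq2.2])
    refine (mul_le_mul_of_nonneg_left h3 (norm_nonneg _)).trans_eq ?_
    ring
  have hinner : ∀ p : ℝ × Space n, p.1 ∈ Icc a b → ∫ τ in Ioc a t, f τ p =
      {p : ℝ × Space n | p.1 < t}.indicator (fun p => -Complex.I * (F p.1 p.2 *
        (starRingEnd ℂ) (freeSchwartz (p.1 - t) ψ p.2)) +
        Complex.I * (F p.1 p.2 * (starRingEnd ℂ) (ψ p.2))) p := by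
    intro p hp
    have h1 : (fun τ => f τ p) = (Ioi p.1).indicator (fun τ => k τ p) := by
      funext τ
      rfl
    rw [h1, setIntegral_indicator measurableSet_Ioi, Ioc_inter_Ioi, sup_eq_right.2 hp.1]
    by_cases hpt : p.1 < t
    · have hp' : p ∈ {p : ℝ × Space n | p.1 < t} := hpt
      rw [indicator_of_mem hp', ← intervalIntegral.integral_of_le hpt.le,
        intervalIntegral.integral_const_mul, integral_freeSchwartz_sub]
      ring
    · have hp' : p ∉ {p : ℝ × Space n | p.1 < t} := hpt
      rw [indicator_of_notMem hp', Ioc_eq_empty hpt, setIntegral_empty]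
  have hsw : ∫ τ in Ioc a t, ∫ p, f τ p ∂(slabMeasure n a b) =
      ∫ p, (∫ τ in Ioc a t, f τ p) ∂(slabMeasure n a b) := integral_integral_swap hfi
  have hd : ∀ τ, duhamelForm a b F τ (Δ ψ) = -Complex.I * ∫ p, f τ p ∂(slabMeasure n a b) := by
    intro τ
    rw [duhamelForm, integral_indicator (measurableSet_fst_lt τ)]
  have hdt : Integrable (fun p : ℝ × Space n => F p.1 p.2 *
      (starRingEnd ℂ) (freeSchwartz (p.1 - t) ψ p.2)) (slabMeasure n a b) :=
    integrable_duhamel hF hW ht ψ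
  simp_rw [hd]
  rw [intervalIntegral.integral_const_mul, intervalIntegral.integral_of_le ht.1, hsw,
    integral_congr_ae ((ae_slabMeasure_mem n a b).mono hinner),
    integral_indicator (measurableSet_fst_lt t),
    integral_add (hdt.integrableOn.const_mul _) (hψi.integrableOn.const_mul _),
    integral_const_mul, integral_const_mul, setIntegral_fst_lt ht hψi, duhamelForm]
  linear_combination (-(∫ s in a..t, ∫ x, F s x * (starRingEnd ℂ) (ψ x))) * Complex.I_mul_I

/-- Continuous Duhamel integrals solve the linear equation in the weak sense. -/
theorem IsDuhamel.isSchrodingerSolution (hn : 3 ≤ n) {a b : ℝ} {F : ℝ → Space n → ℂ}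
    (hF : AEStronglyMeasurable (Function.uncurry F) (slabMeasure n a b))
    (hN : normN0 a b F ≠ ⊤) {z : ℝ → L2 n} (hzc : ContinuousOn z (Icc a b))
    (hz : IsDuhamel a b F z) : IsSchrodingerSolution a b z F := by
  have hW := integrable_mul_weight hn hF hN
  refine .of_inner hzc (integrable_pairing hF hW) fun φ t₁ h₁ t₂ h₂ => ?_
  have hi1 : ∀ t₁ ∈ Icc a b, ∀ t₂ ∈ Icc a b,
      IntervalIntegrable (fun s => inner ℂ (toL2 (Δ φ)) (z s)) volume t₁ t₂ := by
    intro t₁ h₁ t₂ h₂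
    exact ((continuousOn_const.inner hzc).mono (uIcc_subset_Icc h₁ h₂)).intervalIntegrable
  have hi2 : ∀ t₁ ∈ Icc a b, ∀ t₂ ∈ Icc a b,
      IntervalIntegrable (fun s => ∫ x, F s x * (starRingEnd ℂ) (φ x)) volume t₁ t₂ := by
    intro t₁ h₁ t₂ h₂
    have h : IntegrableOn (fun s => ∫ x, F s x * (starRingEnd ℂ) (φ x)) (Icc a b) :=
      (integrable_pairing hF hW (conjSchwartz φ)).integral_prod_left
    exact (h.mono_set (uIcc_subset_Icc h₁ h₂)).intervalIntegrable
  have hab : a ∈ Icc a b := ⟨le_rfl, h₁.1.trans h₁.2⟩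
  have key : ∀ t ∈ Icc a b, inner ℂ (toL2 φ) (z t) = Complex.I * ∫ s in a..t,
      (inner ℂ (toL2 (Δ φ)) (z s) - ∫ x, F s x * (starRingEnd ℂ) (φ x)) := by
    intro t ht
    rw [intervalIntegral.integral_sub (hi1 a hab t ht) (hi2 a hab t ht), hz t ht]
    have h1 : ∫ s in a..t, inner ℂ (toL2 (Δ φ)) (z s) = ∫ s in a..t, duhamelForm a b F s (Δ φ) := by
      refine intervalIntegral.integral_congr fun s hs => ?_
      exact hz s (uIcc_subset_Icc hab ht hs) _
    rw [h1, intervalIntegral_duhamelForm hF hW ht φ]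
    linear_combination duhamelForm a b F t φ * Complex.I_mul_I
  rw [key t₁ h₁, key t₂ h₂, ← mul_sub, intervalIntegral.integral_interval_sub_left
    ((hi1 a hab t₂ h₂).sub (hi2 a hab t₂ h₂)) ((hi1 a hab t₁ h₁).sub (hi2 a hab t₁ h₁))]

/-! ### Algebra of solutions -/

section Algebra

variable {a b : ℝ} {u u' : ℝ → L2 n} {F F' : ℝ → Space n → ℂ}

theorem integral_coeFn_sub_mul (f g : L2 n) (φ : 𝓢(Space n, ℂ)) :
    ∫ x, (f - g : L2 n) x * φ x = (∫ x, f x * φ x) - ∫ x, g x * φ x := by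
  have h : ∀ f : L2 n, ∫ x, f x * φ x = inner ℂ (toL2 (conjSchwartz φ)) f := fun f => by
    rw [inner_toL2_eq_integral_conj, conjSchwartz_conjSchwartz]
  rw [h, h, h, inner_sub_right]

theorem IsSchrodingerSolution.continuousOn_pairing (hu : IsSchrodingerSolution a b u F)
    (φ : 𝓢(Space n, ℂ)) : ContinuousOn (fun s => ∫ x, u s x * φ x) (Icc a b) := by
  have h : (fun s => ∫ x, u s x * φ x) = fun s => inner ℂ (toL2 (conjSchwartz φ)) (u s) := by
    funext s
    rw [inner_toL2_eq_integral_conj, conjSchwartz_conjSchwartz]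
  rw [h]
  exact continuousOn_const.inner hu.continuousOn

theorem IsSchrodingerSolution.intervalIntegrable (hu : IsSchrodingerSolution a b u F)
    (φ : 𝓢(Space n, ℂ)) {t₁ t₂ : ℝ} (h₁ : t₁ ∈ Icc a b) (h₂ : t₂ ∈ Icc a b) :
    IntervalIntegrable (fun s => (∫ x, u s x * (Δ φ) x) - ∫ x, F s x * φ x) volume t₁ t₂ :=
  ((hu.continuousOn_pairing (Δ φ)).mono (uIcc_subset_Icc h₁ h₂)).intervalIntegrable.sub
    ((hu.integrable_pairing φ).mono_set (uIcc_subset_Icc h₁ h₂)).intervalIntegrable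

theorem IsSchrodingerSolution.sub (hu : IsSchrodingerSolution a b u F)
    (hu' : IsSchrodingerSolution a b u' F') :
    IsSchrodingerSolution a b (fun t => u t - u' t) (fun t x => F t x - F' t x) := by
  have hF : ∀ φ : 𝓢(Space n, ℂ), ∀ᵐ s ∂(volume.restrict (Icc a b)),
      ∫ x, (F s x - F' s x) * φ x = (∫ x, F s x * φ x) - ∫ x, F' s x * φ x := by
    intro φ
    filter_upwards [hu.integrable_slice φ, hu'.integrable_slice φ] with s h1 h2
    simp_rw [sub_mul]
    exact integral_sub h1 h2
  refine ⟨hu.continuousOn.sub hu'.continuousOn, fun φ => ?_, fun φ => ?_, fun φ t₁ h₁ t₂ h₂ => ?_⟩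
  · filter_upwards [hu.integrable_slice φ, hu'.integrable_slice φ] with s h1 h2
    simp_rw [sub_mul]
    exact h1.sub h2
  · exact ((hu.integrable_pairing φ).sub (hu'.integrable_pairing φ)).congr
      ((hF φ).mono fun s hs => hs.symm)
  · rw [integral_coeFn_sub_mul, integral_coeFn_sub_mul]
    have h3 : ∫ s in t₁..t₂, ((∫ x, (u s - u' s : L2 n) x * (Δ φ) x) -
        ∫ x, (F s x - F' s x) * φ x) =
        ∫ s in t₁..t₂, (((∫ x, u s x * (Δ φ) x) - ∫ x, F s x * φ x) -
          ((∫ x, u' s x * (Δ φ) x) - ∫ x, F' s x * φ x)) := by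
      refine intervalIntegral.integral_congr_ae ?_
      have h4 := (ae_restrict_iff' measurableSet_Icc).1 (hF φ)
      filter_upwards [h4] with s hs hst
      rw [hs (uIcc_subset_Icc h₁ h₂ (uIoc_subset_uIcc hst)), integral_coeFn_sub_mul]
      ring
    rw [h3, intervalIntegral.integral_sub (hu.intervalIntegrable φ h₁ h₂)
      (hu'.intervalIntegrable φ h₁ h₂), mul_sub, ← hu.weak φ t₁ h₁ t₂ h₂, ← hu'.weak φ t₁ h₁ t₂ h₂]
    ring

theorem IsSchrodingerSolution.congr (hu : IsSchrodingerSolution a b u F)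
    (hu' : ∀ t ∈ Icc a b, u' t = u t)
    (h : ∀ᵐ s ∂(volume.restrict (Icc a b)), F' s =ᵐ[volume] F s) :
    IsSchrodingerSolution a b u' F' := by
  have hF : ∀ φ : 𝓢(Space n, ℂ), ∀ᵐ s ∂(volume.restrict (Icc a b)),
      ∫ x, F' s x * φ x = ∫ x, F s x * φ x := by
    intro φ
    filter_upwards [h] with s hs
    refine integral_congr_ae ?_
    filter_upwards [hs] with x hx
    rw [hx]
  refine ⟨hu.continuousOn.congr hu', fun φ => ?_, fun φ => ?_, fun φ t₁ h₁ t₂ h₂ => ?_⟩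
  · filter_upwards [hu.integrable_slice φ, h] with s h1 hs
    refine h1.congr ?_
    filter_upwards [hs] with x hx
    rw [hx]
  · exact (hu.integrable_pairing φ).congr ((hF φ).mono fun s hs => hs.symm)
  · rw [hu' t₁ h₁, hu' t₂ h₂, hu.weak φ t₁ h₁ t₂ h₂]
    congr 1
    refine intervalIntegral.integral_congr_ae ?_
    have h4 := (ae_restrict_iff' measurableSet_Icc).1 (hF φ)
    filter_upwards [h4] with s hs hst
    have hs' := uIcc_subset_Icc h₁ h₂ (uIoc_subset_uIcc hst)
    rw [hs hs', hu' s hs']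

theorem IsSchrodingerSolution.restrict (hu : IsSchrodingerSolution a b u F) {c d : ℝ}
    (h : Icc c d ⊆ Icc a b) : IsSchrodingerSolution c d u F where
  continuousOn := hu.continuousOn.mono h
  integrable_slice φ := ae_restrict_of_ae_restrict_of_subset h (hu.integrable_slice φ)
  integrable_pairing φ := (hu.integrable_pairing φ).mono_set h
  weak φ t₁ h₁ t₂ h₂ := hu.weak φ t₁ (h h₁) t₂ (h h₂)

/-- The weak equation on two adjacent intervals gives the weak equation on their union. -/
theorem IsSchrodingerSolution.glue {m : ℝ} (hm : m ∈ Icc a b)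
    (h₁ : IsSchrodingerSolution a m u F) (h₂ : IsSchrodingerSolution m b u F) :
    IsSchrodingerSolution a b u F := by
  have hI : Icc a b = Icc a m ∪ Icc m b := (Icc_union_Icc_eq_Icc hm.1 hm.2).symm
  refine ⟨?_, fun φ => ?_, fun φ => ?_, fun φ => ?_⟩
  · rw [hI]
    exact h₁.continuousOn.union_of_isClosed h₂.continuousOn isClosed_Icc isClosed_Icc
  · rw [hI, ae_restrict_union_iff]
    exact ⟨h₁.integrable_slice φ, h₂.integrable_slice φ⟩
  · rw [hI]
    exact (h₁.integrable_pairing φ).union (h₂.integrable_pairing φ)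
  · have ham : m ∈ Icc a m := right_mem_Icc.2 hm.1
    have hmb : m ∈ Icc m b := left_mem_Icc.2 hm.2
    have hint : ∀ t ∈ Icc a b, IntervalIntegrable
        (fun s => (∫ x, u s x * (Δ φ) x) - ∫ x, F s x * φ x) volume m t ∧
        (∫ x, u t x * φ x) - ∫ x, u m x * φ x =
      Complex.I * ∫ s in m..t, ((∫ x, u s x * (Δ φ) x) - ∫ x, F s x * φ x) := by
      intro t ht
      rw [hI] at ht
      rcases ht with ht | ht
      · exact ⟨h₁.intervalIntegrable φ ham ht, h₁.weak φ m ham t ht⟩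
      · exact ⟨h₂.intervalIntegrable φ hmb ht, h₂.weak φ m hmb t ht⟩
    intro t₁ ht₁ t₂ ht₂
    obtain ⟨i1, e1⟩ := hint t₁ ht₁
    obtain ⟨i2, e2⟩ := hint t₂ ht₂
    rw [← intervalIntegral.integral_interval_sub_left i2 i1, mul_sub, ← e1, ← e2]
    ring

end Algebra

/-! ### The linear equation with initial data at an arbitrary time -/

/-- A constant for all linear estimates at once: homogeneous and inhomogeneous, with initial data
at an arbitrary time of the interval. -/
def linearConst (n : ℕ) : ℝ≥0∞ := 3 * strichartzConst n ^ 2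

theorem linearConst_ne_top (n : ℕ) : linearConst n ≠ ⊤ :=
  ENNReal.mul_ne_top (by norm_num) (ENNReal.pow_ne_top (strichartzConst_ne_top n))

theorem strichartzConst_le_sq (n : ℕ) : strichartzConst n ≤ strichartzConst n ^ 2 :=
  le_self_pow₀ (one_le_strichartzConst n) two_ne_zero

theorem one_le_linearConst (n : ℕ) : 1 ≤ linearConst n := by
  have h := (one_le_strichartzConst n).trans (strichartzConst_le_sq n)
  refine h.trans ?_
  rw [linearConst]
  exact le_mul_of_one_le_left zero_le (by norm_num)

theorem linearConst_ne_zero (n : ℕ) : linearConst n ≠ 0 :=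
  (zero_lt_one.trans_le (one_le_linearConst n)).ne'

theorem two_mul_strichartzConst_le (n : ℕ) : 2 * strichartzConst n ≤ linearConst n :=
  mul_le_mul' (by norm_num) (strichartzConst_le_sq n)

theorem normS0_freeProp_le_linearConst (hn : 3 ≤ n) (a b σ : ℝ) (f : L2 n) :
    normS0 a b (fun t => ⇑(freeProp (t - σ) f)) ≤ linearConst n * ‖f‖ₑ := by
  refine (normS0_freeProp_le hn a b σ f).trans (mul_le_mul_left ?_ _)
  refine le_trans ?_ (two_mul_strichartzConst_le n)
  exact le_mul_of_one_le_left zero_le (by norm_num)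

section

variable {a b σ : ℝ} {F : ℝ → Space n → ℂ} {u : ℝ → L2 n}

/-- Changing the base point of the Duhamel formula. -/
theorem sub_freeProp_eq (u : ℝ → L2 n) (a σ t : ℝ) :
    u t - freeProp (t - σ) (u σ) =
      (u t - freeProp (t - a) (u a)) - freeProp (t - σ) (u σ - freeProp (σ - a) (u a)) := by
  rw [map_sub, ← freeProp_add, sub_add_sub_cancel]
  abel

theorem IsSchrodingerSolution.enorm_sub_freeProp_le (hn : 3 ≤ n)
    (hu : IsSchrodingerSolution a b u F)
    (hF : AEStronglyMeasurable (Function.uncurry F) (slabMeasure n a b)) (hσ : σ ∈ Icc a b) {t : ℝ}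
    (ht : t ∈ Icc a b) :
    ‖u t - freeProp (t - σ) (u σ)‖ₑ ≤ linearConst n * normN0 a b F := by
  by_cases hN : normN0 a b F = ⊤
  · rw [hN, ENNReal.mul_top (linearConst_ne_zero n)]
    exact le_top
  have hz := hu.isDuhamel hn hF hN
  rw [sub_freeProp_eq u a σ t]
  refine (enorm_sub_le).trans ?_
  rw [← ofReal_norm (freeProp (t - σ) _), LinearIsometry.norm_map, ofReal_norm]
  refine (add_le_add (hz.enorm_le hn hN ht) (hz.enorm_le hn hN hσ)).trans ?_
  rw [← two_mul, ← mul_assoc]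
  exact mul_le_mul_left (two_mul_strichartzConst_le n) _

theorem IsSchrodingerSolution.normS0_sub_freeProp_le (hn : 3 ≤ n)
    (hu : IsSchrodingerSolution a b u F)
    (hF : AEStronglyMeasurable (Function.uncurry F) (slabMeasure n a b)) (hσ : σ ∈ Icc a b) :
    normS0 a b (fun t => ⇑(u t - freeProp (t - σ) (u σ))) ≤ linearConst n * normN0 a b F := by
  by_cases hN : normN0 a b F = ⊤
  · rw [hN, ENNReal.mul_top (linearConst_ne_zero n)]
    exact le_top
  have hz := hu.isDuhamel hn hF hN
  have hzc : ContinuousOn (fun t => u t - freeProp (t - a) (u a)) (Icc a b) :=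
    hu.continuousOn.sub (continuous_freeProp_sub a (u a)).continuousOn
  set f : L2 n := -(u σ - freeProp (σ - a) (u a)) with hf
  have hfle : ‖f‖ₑ ≤ strichartzConst n * normN0 a b F := by
    rw [hf, enorm_neg]
    exact hz.enorm_le hn hN hσ
  have h1 : (fun t => (⇑(u t - freeProp (t - σ) (u σ)) : Space n → ℂ)) =
      fun t => ⇑((u t - freeProp (t - a) (u a)) + freeProp (t - σ) f) := by
    funext t
    rw [sub_freeProp_eq u a σ t, hf, map_neg, sub_eq_add_neg]
  rw [h1]
  refine (normS0_add_le hn hzc (continuous_freeProp_sub σ f).continuousOn).trans ?_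
  refine (add_le_add (hz.normS0_le hn hF hN hzc) ((normS0_freeProp_le hn a b σ f).trans
    (mul_le_mul_right hfle _))).trans ?_
  rw [← mul_assoc, ← mul_assoc, ← add_mul, linearConst]
  refine mul_le_mul_left ?_ _
  calc 2 * strichartzConst n + strichartzConst n * strichartzConst n
      ≤ 2 * strichartzConst n ^ 2 + strichartzConst n ^ 2 := by
        rw [sq]
        refine add_le_add (mul_le_mul_right ?_ _) le_rfl
        rw [← sq]
        exact strichartzConst_le_sq n
    _ = 3 * strichartzConst n ^ 2 := by ring

/-- A solution splits into the free evolution of its value at `σ` and a remainder controlled by the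
forcing. -/
theorem IsSchrodingerSolution.normS0_le (hn : 3 ≤ n) (hu : IsSchrodingerSolution a b u F)
    (hF : AEStronglyMeasurable (Function.uncurry F) (slabMeasure n a b)) (hσ : σ ∈ Icc a b) :
    normS0 a b (fun t => ⇑(u t)) ≤ linearConst n * ‖u σ‖ₑ + linearConst n * normN0 a b F := by
  have h := normS0_add_le hn (v := fun t => u t - freeProp (t - σ) (u σ))
    (continuous_freeProp_sub σ (u σ)).continuousOn
    (hu.continuousOn.sub (continuous_freeProp_sub σ (u σ)).continuousOn)
  simp only [add_sub_cancel] at h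
  exact h.trans (add_le_add (normS0_freeProp_le_linearConst hn a b σ _)
    (hu.normS0_sub_freeProp_le hn hF hσ))

theorem IsSchrodingerSolution.normV_le (hn : 3 ≤ n) (hu : IsSchrodingerSolution a b u F)
    (hF : AEStronglyMeasurable (Function.uncurry F) (slabMeasure n a b)) (hσ : σ ∈ Icc a b) :
    normV a b (fun t => ⇑(u t)) ≤
      normV a b (fun t => ⇑(freeProp (t - σ) (u σ))) + linearConst n * normN0 a b F := by
  have h := normV_add_le hn (v := fun t => u t - freeProp (t - σ) (u σ))
    (continuous_freeProp_sub σ (u σ)).continuousOn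
    (hu.continuousOn.sub (continuous_freeProp_sub σ (u σ)).continuousOn)
  simp only [add_sub_cancel] at h
  exact h.trans (add_le_add le_rfl
    ((normV_le_normS0 hn _).trans (hu.normS0_sub_freeProp_le hn hF hσ)))

/-- The linear equation with a forcing in the dual space-time Lebesgue space can be solved with
prescribed value at an arbitrary time. -/
theorem exists_isSchrodingerSolution (hn : 3 ≤ n)
    (hF : AEStronglyMeasurable (Function.uncurry F) (slabMeasure n a b))
    (hFp : eLpNorm (Function.uncurry F) (ENNReal.ofReal (critDualExp n)) (slabMeasure n a b) ≠ ⊤)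
    (σ : ℝ) (f : L2 n) : ∃ u, IsSchrodingerSolution a b u F ∧ u σ = f := by
  have hN : normN0 a b F ≠ ⊤ := ne_top_of_le_ne_top hFp (normN0_le_eLpNorm hn hF)
  obtain ⟨z, hz⟩ := exists_isDuhamel hn hF hN
  have hzs := hz.isSchrodingerSolution hn hF hN (hz.continuousOn hn hF hFp)
  refine ⟨fun t => z t - freeProp (t - σ) (z σ - f), ?_, ?_⟩
  · refine (hzs.sub (isSchrodingerSolution_freeProp a b σ (z σ - f))).congr (fun t _ => rfl) ?_
    exact Filter.Eventually.of_forall fun s => by simp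
  · simp only [sub_self, freeProp_zero, sub_sub_cancel]

end

/-! ### The nonlinearity -/

/-- The Lipschitz bound for the nonlinearity, by scaling to the ratio `‖w‖ / ‖z‖ ≤ 1`. -/
theorem norm_nonlinearity_sub_le_of_le (hn : 3 ≤ n) {z w : ℂ} (hwz : ‖w‖ ≤ ‖z‖) :
    ‖nonlinearity n z - nonlinearity n w‖ ≤ 3 * (‖z - w‖ * ‖z‖ ^ ((4 : ℝ) / n)) := by
  have hn0 : (3 : ℝ) ≤ n := by exact_mod_cast hn
  set α : ℝ := (4 : ℝ) / n with hα
  have hα0 : 0 < α := by positivity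
  have hα2 : α ≤ 2 := by
    rw [hα, div_le_iff₀ (by linarith)]
    linarith
  rcases eq_or_lt_of_le (norm_nonneg z) with hz0 | hz0
  · have hw0 : w = 0 := norm_le_zero_iff.1 (hwz.trans_eq hz0.symm)
    have hz0' : z = 0 := norm_eq_zero.1 hz0.symm
    simp [hw0, hz0', nonlinearity]
  set x : ℝ := ‖w‖ / ‖z‖ with hx
  have hx0 : 0 ≤ x := by positivity
  have hx1 : x ≤ 1 := (div_le_one hz0).2 hwz
  have hwx : ‖w‖ = x * ‖z‖ := by rw [hx, div_mul_cancel₀ _ hz0.ne']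
  have hzα : 0 < ‖z‖ ^ α := Real.rpow_pos_of_pos hz0 _
  -- As the exponent is at most two, the power is at least as large as the square on `[0, 1]`.
  have hxα : x ^ 2 ≤ x ^ α := by
    rcases eq_or_lt_of_le hx0 with h | h
    · rw [← h, Real.zero_rpow hα0.ne']
      norm_num
    · rw [← Real.rpow_two]
      exact Real.rpow_le_rpow_of_exponent_ge h hx1 hα2
  have hwα : ‖w‖ ^ α = x ^ α * ‖z‖ ^ α := by rw [hwx, Real.mul_rpow hx0 hz0.le]
  have hle : ‖w‖ ^ α ≤ ‖z‖ ^ α := Real.rpow_le_rpow (norm_nonneg _) hwz hα0.le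
  have h1 : nonlinearity n z - nonlinearity n w =
      ((‖z‖ ^ α : ℝ) : ℂ) * (z - w) + ((‖z‖ ^ α - ‖w‖ ^ α : ℝ) : ℂ) * w := by
    simp only [nonlinearity, ← hα]
    push_cast
    ring
  have h2 : (‖z‖ ^ α - ‖w‖ ^ α) * ‖w‖ ≤ 2 * (‖z‖ - ‖w‖) * ‖z‖ ^ α := by
    have h3 : (1 - x ^ α) * x ≤ 2 * (1 - x) := by
      have h5 : (1 - x ^ α) * x ≤ (1 - x ^ 2) * x := mul_le_mul_of_nonneg_right (by linarith) hx0
      have h6 : (1 - x) * (x * (1 + x)) ≤ (1 - x) * 2 :=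
        mul_le_mul_of_nonneg_left (by nlinarith) (by linarith)
      linarith
    rw [hwα, hwx]
    nlinarith [mul_le_mul_of_nonneg_right h3 (mul_pos hzα hz0).le]
  have h4 : ‖z‖ - ‖w‖ ≤ ‖z - w‖ := norm_sub_norm_le z w
  rw [h1]
  refine (norm_add_le _ _).trans ?_
  rw [norm_mul, norm_mul, Complex.norm_real, Complex.norm_real, Real.norm_of_nonneg hzα.le,
    Real.norm_of_nonneg (sub_nonneg.2 hle)]
  nlinarith [mul_le_mul_of_nonneg_right h4 hzα.le]

theorem norm_nonlinearity_sub_le (hn : 3 ≤ n) (z w : ℂ) :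
    ‖nonlinearity n z - nonlinearity n w‖ ≤
      3 * (‖z - w‖ * ‖z‖ ^ ((4 : ℝ) / n) + ‖z - w‖ * ‖w‖ ^ ((4 : ℝ) / n)) := by
  have hz : 0 ≤ ‖z - w‖ * ‖z‖ ^ ((4 : ℝ) / n) := by positivity
  have hw : 0 ≤ ‖z - w‖ * ‖w‖ ^ ((4 : ℝ) / n) := by positivity
  rcases le_total ‖w‖ ‖z‖ with h | h
  · linarith [norm_nonlinearity_sub_le_of_le hn h]
  · have h1 := norm_nonlinearity_sub_le_of_le hn h
    rw [norm_sub_rev, norm_sub_rev w z] at h1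
    linarith

theorem enorm_nonlinearity_sub_le (hn : 3 ≤ n) (z w : ℂ) :
    ‖nonlinearity n z - nonlinearity n w‖ₑ ≤
      3 * (‖z - w‖ₑ * ‖z‖ₑ ^ ((4 : ℝ) / n) + ‖z - w‖ₑ * ‖w‖ₑ ^ ((4 : ℝ) / n)) := by
  have hα : 0 ≤ (4 : ℝ) / n := by positivity
  simp_rw [← ofReal_norm]
  rw [ENNReal.ofReal_rpow_of_nonneg (norm_nonneg _) hα,
    ENNReal.ofReal_rpow_of_nonneg (norm_nonneg _) hα, ← ENNReal.ofReal_mul (norm_nonneg _),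
    ← ENNReal.ofReal_mul (norm_nonneg _), ← ENNReal.ofReal_add (by positivity) (by positivity)]
  refine (ENNReal.ofReal_le_ofReal (norm_nonlinearity_sub_le hn z w)).trans ?_
  rw [ENNReal.ofReal_mul (by norm_num)]
  simp

theorem continuous_nonlinearity (n : ℕ) : Continuous (nonlinearity n) := by
  unfold nonlinearity
  refine (Complex.continuous_ofReal.comp ?_).mul continuous_id
  exact continuous_norm.rpow_const fun _ => Or.inr (by positivity)

section Holder

variable {Ω : Type*} [MeasurableSpace Ω] {μ : Measure Ω}

/-- Hölder's inequality with the exponents of the `L²`-critical nonlinearity. -/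
theorem eLpNorm_mul_rpow_le (hn : 3 ≤ n) {f g : Ω → ℂ} (hf : AEStronglyMeasurable f μ)
    (hg : AEStronglyMeasurable g μ) :
    eLpNorm (fun x => ‖f x‖ₑ * ‖g x‖ₑ ^ ((4 : ℝ) / n)) (ENNReal.ofReal (critDualExp n)) μ ≤
      eLpNorm f (ENNReal.ofReal (critExp n)) μ *
        eLpNorm g (ENNReal.ofReal (critExp n)) μ ^ ((4 : ℝ) / n) := by
  have hn0 : (3 : ℝ) ≤ n := by exact_mod_cast hn
  have hp := critExp_gt hn
  have hp' := (holderConjugate_critExp hn).pos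
  have hlt : critDualExp n < critExp n := by
    rw [critDualExp, critExp, div_lt_div_iff_of_pos_left] <;> linarith
  have hα : 0 < (4 : ℝ) / n := by positivity
  set r : ℝ := critExp n / (4 / n) with hr
  have hpqr : 1 / critDualExp n = 1 / critExp n + 1 / r := by
    rw [hr, critDualExp, critExp]
    field_simp
  have h := ENNReal.lintegral_Lp_mul_le_Lq_mul_Lr hp' hlt hpqr μ hf.enorm
    (hg.enorm.pow_const ((4 : ℝ) / n))
  rw [eLpNorm_eq_lintegral_rpow_enorm_toReal (by simpa using hp') ENNReal.ofReal_ne_top,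
    ENNReal.toReal_ofReal hp'.le,
    eLpNorm_eq_lintegral_rpow_enorm_toReal (f := f) (by simp; linarith) ENNReal.ofReal_ne_top,
    eLpNorm_eq_lintegral_rpow_enorm_toReal (f := g) (by simp; linarith) ENNReal.ofReal_ne_top,
    ENNReal.toReal_ofReal (by linarith)]
  refine h.trans_eq ?_
  congr 1
  rw [← ENNReal.rpow_mul]
  have h1 : (4 : ℝ) / n * r = critExp n := by
    rw [hr]
    field_simp
  have h2 : 1 / r = 1 / critExp n * (4 / n) := by
    rw [hr]
    field_simp
  simp_rw [← ENNReal.rpow_mul, h1, h2]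

/-- The nonlinearity is locally Lipschitz from the Lebesgue space of the norm of `V` to its dual. -/
theorem eLpNorm_nonlinearity_sub_le (hn : 3 ≤ n) {f g : Ω → ℂ} (hf : AEStronglyMeasurable f μ)
    (hg : AEStronglyMeasurable g μ) :
    eLpNorm (fun x => nonlinearity n (f x) - nonlinearity n (g x))
        (ENNReal.ofReal (critDualExp n)) μ ≤
      3 * (eLpNorm (f - g) (ENNReal.ofReal (critExp n)) μ *
        (eLpNorm f (ENNReal.ofReal (critExp n)) μ ^ ((4 : ℝ) / n) +
          eLpNorm g (ENNReal.ofReal (critExp n)) μ ^ ((4 : ℝ) / n))) := by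
  have hp' : 1 ≤ ENNReal.ofReal (critDualExp n) := by
    rw [← ENNReal.ofReal_one]
    exact ENNReal.ofReal_le_ofReal (holderConjugate_critExp hn).lt.le
  have hfg := hf.sub hg
  have h1 : AEStronglyMeasurable (fun x => ‖(f - g) x‖ₑ * ‖f x‖ₑ ^ ((4 : ℝ) / n)) μ :=
    (hfg.enorm.mul (hf.enorm.pow_const _)).aestronglyMeasurable
  have h2 : AEStronglyMeasurable (fun x => ‖(f - g) x‖ₑ * ‖g x‖ₑ ^ ((4 : ℝ) / n)) μ :=
    (hfg.enorm.mul (hg.enorm.pow_const _)).aestronglyMeasurable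
  have h3 := eLpNorm_le_nnreal_smul_eLpNorm_of_ae_le_mul' (c := 3)
    (f := fun x => nonlinearity n (f x) - nonlinearity n (g x))
    (g := fun x => ‖(f - g) x‖ₑ * ‖f x‖ₑ ^ ((4 : ℝ) / n) + ‖(f - g) x‖ₑ * ‖g x‖ₑ ^ ((4 : ℝ) / n))
    (μ := μ) (Filter.Eventually.of_forall fun x => by
      simpa using enorm_nonlinearity_sub_le hn (f x) (g x)) (ENNReal.ofReal (critDualExp n))
  refine h3.trans ?_
  rw [mul_add]
  refine le_trans (le_of_eq ?_) (mul_le_mul_right ((eLpNorm_add_le h1 h2 hp').trans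
    (add_le_add (eLpNorm_mul_rpow_le hn hfg hf) (eLpNorm_mul_rpow_le hn hfg hg))) 3)
  rfl

theorem eLpNorm_nonlinearity_le (hn : 3 ≤ n) {f : Ω → ℂ} (hf : AEStronglyMeasurable f μ) :
    eLpNorm (fun x => nonlinearity n (f x)) (ENNReal.ofReal (critDualExp n)) μ ≤
      3 * (eLpNorm f (ENNReal.ofReal (critExp n)) μ *
        eLpNorm f (ENNReal.ofReal (critExp n)) μ ^ ((4 : ℝ) / n)) := by
  have hα : 0 < (4 : ℝ) / n := by
    have : (3 : ℝ) ≤ n := by exact_mod_cast hn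
    positivity
  have h := eLpNorm_nonlinearity_sub_le hn hf (aestronglyMeasurable_const (b := (0 : ℂ)))
  have h0 : f - (fun _ => (0 : ℂ)) = f := by
    funext x
    simp
  have h1 : eLpNorm (fun _ : Ω => (0 : ℂ)) (ENNReal.ofReal (critExp n)) μ = 0 := eLpNorm_zero'
  rw [h0, h1, ENNReal.zero_rpow_of_pos hα, add_zero] at h
  simpa [nonlinearity] using h

end Holder

/-! ### Stability on intervals of small space-time norm -/

section Forcing

variable {a b : ℝ} {φ ψ e : ℝ → Space n → ℂ} {u v : ℝ → L2 n}

theorem normV_eq_of_joint (hn : 3 ≤ n)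
    (hφ : AEStronglyMeasurable (Function.uncurry φ) (slabMeasure n a b))
    (h : ∀ t ∈ Icc a b, φ t =ᵐ[volume] u t) :
    normV a b (fun t => ⇑(u t)) =
      eLpNorm (Function.uncurry φ) (ENNReal.ofReal (critExp n)) (slabMeasure n a b) := by
  rw [← normV_eq_eLpNorm hn hφ]
  exact (normV_congr h).symm

theorem normV_sub_eq_of_joint (hn : 3 ≤ n)
    (hφ : AEStronglyMeasurable (Function.uncurry φ) (slabMeasure n a b))
    (h : ∀ t ∈ Icc a b, φ t =ᵐ[volume] u t)
    (hψ : AEStronglyMeasurable (Function.uncurry ψ) (slabMeasure n a b))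
    (h' : ∀ t ∈ Icc a b, ψ t =ᵐ[volume] v t) :
    normV a b (fun t => ⇑(u t - v t)) =
      eLpNorm (Function.uncurry φ - Function.uncurry ψ) (ENNReal.ofReal (critExp n))
        (slabMeasure n a b) := by
  refine normV_eq_of_joint hn (φ := fun t x => φ t x - ψ t x) (hφ.sub hψ) fun t ht => ?_
  filter_upwards [h t ht, h' t ht, Lp.coeFn_sub (u t) (v t)] with x h1 h2 h3
  rw [h3, h1, h2, Pi.sub_apply]

theorem aestronglyMeasurable_nonlinearity
    (hφ : AEStronglyMeasurable (Function.uncurry φ) (slabMeasure n a b)) :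
    AEStronglyMeasurable (Function.uncurry fun t x => nonlinearity n (φ t x))
      (slabMeasure n a b) :=
  (continuous_nonlinearity n).comp_aestronglyMeasurable hφ

/-- The difference of two forcings in the dual norm. -/
theorem normN0_nonlinearity_sub_le (hn : 3 ≤ n)
    (hφ : AEStronglyMeasurable (Function.uncurry φ) (slabMeasure n a b))
    (hψ : AEStronglyMeasurable (Function.uncurry ψ) (slabMeasure n a b)) :
    normN0 a b (fun t x => nonlinearity n (φ t x) - nonlinearity n (ψ t x)) ≤
      3 * (eLpNorm (Function.uncurry φ - Function.uncurry ψ) (ENNReal.ofReal (critExp n))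
          (slabMeasure n a b) *
        (eLpNorm (Function.uncurry φ) (ENNReal.ofReal (critExp n)) (slabMeasure n a b) ^
            ((4 : ℝ) / n) +
          eLpNorm (Function.uncurry ψ) (ENNReal.ofReal (critExp n)) (slabMeasure n a b) ^
            ((4 : ℝ) / n))) :=
  (normN0_le_eLpNorm hn (F := fun t x => nonlinearity n (φ t x) - nonlinearity n (ψ t x))
    ((aestronglyMeasurable_nonlinearity hφ).sub
    (aestronglyMeasurable_nonlinearity hψ))).trans (eLpNorm_nonlinearity_sub_le hn hφ hψ)

theorem normN0_nonlinearity_sub_add_le (hn : 3 ≤ n)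
    (hφ : AEStronglyMeasurable (Function.uncurry φ) (slabMeasure n a b))
    (hψ : AEStronglyMeasurable (Function.uncurry ψ) (slabMeasure n a b)) :
    normN0 a b (fun t x => nonlinearity n (φ t x) - (nonlinearity n (ψ t x) + e t x)) ≤
      3 * (eLpNorm (Function.uncurry φ - Function.uncurry ψ) (ENNReal.ofReal (critExp n))
          (slabMeasure n a b) *
        (eLpNorm (Function.uncurry φ) (ENNReal.ofReal (critExp n)) (slabMeasure n a b) ^
            ((4 : ℝ) / n) +
          eLpNorm (Function.uncurry ψ) (ENNReal.ofReal (critExp n)) (slabMeasure n a b) ^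
            ((4 : ℝ) / n))) + normN0 a b e := by
  have h1 : (fun t x => nonlinearity n (φ t x) - (nonlinearity n (ψ t x) + e t x)) =
      fun t x => (nonlinearity n (φ t x) - nonlinearity n (ψ t x)) + -e t x := by
    funext t x
    ring
  have h2 : normN0 a b (fun t x => -e t x) = normN0 a b e :=
    normN0_congr (Filter.Eventually.of_forall fun p => by rw [enorm_neg])
  rw [h1]
  refine (normN0_add_le ((aestronglyMeasurable_nonlinearity hφ).sub
    (aestronglyMeasurable_nonlinearity hψ))).trans ?_
  rw [h2]
  exact add_le_add (normN0_nonlinearity_sub_le hn hφ hψ) le_rfl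

theorem IsSolution.of_joint (h : ∀ t ∈ Icc a b, φ t =ᵐ[volume] u t)
    (hu : IsSchrodingerSolution a b u (fun t x => nonlinearity n (φ t x))) : IsSolution a b u := by
  refine hu.congr (fun _ _ => rfl) ?_
  filter_upwards [ae_restrict_mem measurableSet_Icc] with t ht
  filter_upwards [h t ht] with x hx
  rw [hx]

theorem IsSolution.joint (h : ∀ t ∈ Icc a b, φ t =ᵐ[volume] u t) (hu : IsSolution a b u) :
    IsSchrodingerSolution a b u (fun t x => nonlinearity n (φ t x)) := by
  refine IsSchrodingerSolution.congr hu (fun _ _ => rfl) ?_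
  filter_upwards [ae_restrict_mem measurableSet_Icc] with t ht
  filter_upwards [h t ht] with x hx
  rw [hx]

theorem IsApproxSolution.joint (h : ∀ t ∈ Icc a b, φ t =ᵐ[volume] u t)
    (hu : IsApproxSolution a b u e) :
    IsSchrodingerSolution a b u (fun t x => nonlinearity n (φ t x) + e t x) := by
  refine IsSchrodingerSolution.congr hu (fun _ _ => rfl) ?_
  filter_upwards [ae_restrict_mem measurableSet_Icc] with t ht
  filter_upwards [h t ht] with x hx
  rw [hx]

theorem IsSchrodingerSolution.normV_sub_le (hn : 3 ≤ n) {F G : ℝ → Space n → ℂ} {σ : ℝ}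
    (hu : IsSchrodingerSolution a b u F) (hv : IsSchrodingerSolution a b v G)
    (hF : AEStronglyMeasurable (Function.uncurry F) (slabMeasure n a b))
    (hG : AEStronglyMeasurable (Function.uncurry G) (slabMeasure n a b)) (hσ : σ ∈ Icc a b) :
    normV a b (fun t => ⇑(u t - v t)) ≤
      normV a b (fun t => ⇑(freeProp (t - σ) (u σ - v σ))) +
        linearConst n * normN0 a b (fun t x => F t x - G t x) :=
  (hu.sub hv).normV_le hn (hF.sub hG) hσ

end Forcing

/-- The approximate solution `w` with error `e` is stable: whenever an initial value at some time
of the interval, and the error, are perturbations of size at most `ε ≤ ε₀`, there is a true solution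
with that initial value at distance at most `C * ε` from `w`. -/
def IsStable (ε₀ C : ℝ≥0∞) (a b : ℝ) (w : ℝ → L2 n) (e : ℝ → Space n → ℂ) : Prop :=
  ∀ σ ∈ Icc a b, ∀ (v₀ : L2 n) (ε : ℝ≥0∞), ε ≤ ε₀ →
    normV a b (fun t => ⇑(freeProp (t - σ) (v₀ - w σ))) ≤ ε → normN0 a b e ≤ ε →
    ∃ v : ℝ → L2 n, IsSolution a b v ∧ v σ = v₀ ∧ normV a b (fun t => ⇑(v t - w t)) ≤ C * ε

/-- A threshold below which the nonlinear terms contract. -/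
theorem exists_threshold (hn : 3 ≤ n) : ∃ δ : ℝ≥0∞, δ ≠ 0 ∧ δ ≠ ⊤ ∧
    linearConst n * (3 * ((2 * δ) ^ ((4 : ℝ) / n) + (2 * δ) ^ ((4 : ℝ) / n))) ≤ 2⁻¹ := by
  have hα : 0 < (4 : ℝ) / n := by
    have : (3 : ℝ) ≤ n := by exact_mod_cast hn
    positivity
  have hK0 := linearConst_ne_zero n
  have hKt := linearConst_ne_top n
  have h12 : (12 * linearConst n) ≠ 0 := mul_ne_zero (by norm_num) hK0
  have h12t : (12 * linearConst n) ≠ ⊤ := ENNReal.mul_ne_top (by norm_num) hKt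
  set κ : ℝ≥0∞ := (12 * linearConst n)⁻¹ with hκ
  have hκ0 : κ ≠ 0 := ENNReal.inv_ne_zero.2 h12t
  have hκt : κ ≠ ⊤ := ENNReal.inv_ne_top.2 h12
  refine ⟨κ ^ (1 / ((4 : ℝ) / n)) / 2, ?_, ?_, ?_⟩
  · refine (ENNReal.div_pos ?_ ENNReal.ofNat_ne_top).ne'
    exact (ENNReal.rpow_pos (pos_iff_ne_zero.2 hκ0) hκt).ne'
  · exact ENNReal.div_ne_top (ENNReal.rpow_ne_top_of_nonneg (by positivity) hκt) two_ne_zero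
  · rw [ENNReal.mul_div_cancel two_ne_zero ENNReal.ofNat_ne_top, ← ENNReal.rpow_mul,
      one_div_mul_cancel hα.ne', ENNReal.rpow_one]
    have h1 : linearConst n * (3 * (κ + κ)) = 2⁻¹ * (12 * linearConst n * κ) := by
      have h2 : (12 : ℝ≥0∞) = 2 * 6 := by norm_num
      rw [h2, mul_assoc 2, mul_assoc 2, ← mul_assoc 2⁻¹,
        ENNReal.inv_mul_cancel two_ne_zero ENNReal.ofNat_ne_top]
      ring
    rw [h1, hκ, ENNReal.mul_inv_cancel h12 h12t, mul_one]

/-- On an interval where the approximate solution has small space-time norm, a true solution is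
obtained from the contraction principle in a ball around the approximate solution. -/
theorem isStable_of_le (hn : 3 ≤ n) {δ : ℝ≥0∞} (hδt : δ ≠ ⊤)
    (hδ : linearConst n * (3 * ((2 * δ) ^ ((4 : ℝ) / n) + (2 * δ) ^ ((4 : ℝ) / n))) ≤ 2⁻¹)
    {a b : ℝ} {w : ℝ → L2 n} {e : ℝ → Space n → ℂ}
    (he : AEStronglyMeasurable (Function.uncurry e) (slabMeasure n a b))
    (hw : IsApproxSolution a b w e) (hwδ : normV a b (fun t => ⇑(w t)) ≤ δ) :
    IsStable (δ / (2 * (1 + linearConst n))) (2 * (1 + linearConst n)) a b w e := by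
  intro σ hσ v₀ ε hε hf hN
  have hα : 0 < (4 : ℝ) / n := by
    have : (3 : ℝ) ≤ n := by exact_mod_cast hn
    positivity
  set K := linearConst n with hK
  set p : ℝ≥0∞ := ENNReal.ofReal (critExp n) with hp
  have hp1 : Fact (1 ≤ p) := ⟨one_le_two.trans (isAdmissible_critExp hn).1⟩
  set ρ : ℝ≥0∞ := 2 * (1 + K) * ε with hρ
  have hρδ : ρ ≤ δ := ENNReal.mul_le_of_le_div' hε
  have hρt : ρ ≠ ⊤ := ne_top_of_le_ne_top hδt hρδ
  obtain ⟨W, hWm, hW⟩ := exists_joint hw.continuousOn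
  have hWa : AEStronglyMeasurable (Function.uncurry W) (slabMeasure n a b) :=
    hWm.aestronglyMeasurable
  have hWδ : eLpNorm (Function.uncurry W) p (slabMeasure n a b) ≤ δ := by
    rwa [normV_eq_of_joint hn hWa hW] at hwδ
  have hWp : MemLp (Function.uncurry W) p (slabMeasure n a b) :=
    ⟨hWa, (ne_top_of_le_ne_top hδt hWδ).lt_top⟩
  have hw' := hw.joint hW
  have hWe : AEStronglyMeasurable (Function.uncurry fun t x => nonlinearity n (W t x) + e t x)
      (slabMeasure n a b) := (aestronglyMeasurable_nonlinearity hWa).add he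
  -- The solution operator of the linear equation with the nonlinearity of `φ` as its forcing.
  let X := Lp ℂ p (slabMeasure n a b)
  let c : X → ℝ → Space n → ℂ := fun φ t x => φ (t, x)
  have hcm : ∀ φ : X, AEStronglyMeasurable (Function.uncurry (c φ)) (slabMeasure n a b) :=
    fun φ => Lp.aestronglyMeasurable φ
  have hct : ∀ φ : X, eLpNorm (Function.uncurry (c φ)) p (slabMeasure n a b) ≠ ⊤ :=
    fun φ => (Lp.memLp φ).2.ne
  have hNt : ∀ φ : X, eLpNorm (Function.uncurry fun t x => nonlinearity n (c φ t x))
      (ENNReal.ofReal (critDualExp n)) (slabMeasure n a b) ≠ ⊤ := fun φ =>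
    ne_top_of_le_ne_top (ENNReal.mul_ne_top (by norm_num) (ENNReal.mul_ne_top (hct φ)
      (ENNReal.rpow_ne_top_of_nonneg hα.le (hct φ)))) (eLpNorm_nonlinearity_le hn (hcm φ))
  choose u hu huσ using fun φ : X => exists_isSchrodingerSolution hn
    (aestronglyMeasurable_nonlinearity (hcm φ)) (hNt φ) σ v₀
  choose U hUm hU using fun φ : X => exists_joint (hu φ).continuousOn
  have hUa : ∀ φ : X, AEStronglyMeasurable (Function.uncurry (U φ)) (slabMeasure n a b) :=
    fun φ => (hUm φ).aestronglyMeasurable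
  have hUp : ∀ φ : X, MemLp (Function.uncurry (U φ)) p (slabMeasure n a b) := by
    intro φ
    refine ⟨hUa φ, ?_⟩
    rw [← normV_eq_of_joint hn (hUa φ) (hU φ)]
    refine lt_of_le_of_lt ((normV_le_normS0 hn _).trans
      ((hu φ).normS0_le hn (aestronglyMeasurable_nonlinearity (hcm φ)) hσ)) ?_
    refine ENNReal.add_lt_top.2 ⟨ENNReal.mul_lt_top (linearConst_ne_top n).lt_top enorm_lt_top,
      ENNReal.mul_lt_top (linearConst_ne_top n).lt_top ?_⟩
    exact lt_of_le_of_lt (normN0_le_eLpNorm hn (aestronglyMeasurable_nonlinearity (hcm φ)))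
      (hNt φ).lt_top
  let T : X → X := fun φ => (hUp φ).toLp _
  let w₀ : X := hWp.toLp _
  have hTw : ∀ φ : X, edist (T φ) w₀ = normV a b (fun t => ⇑(u φ t - w t)) := by
    intro φ
    rw [Lp.edist_toLp_toLp, normV_sub_eq_of_joint hn (hUa φ) (hU φ) hWa hW]
  have hTT : ∀ φ ψ : X, edist (T φ) (T ψ) = normV a b (fun t => ⇑(u φ t - u ψ t)) := by
    intro φ ψ
    rw [Lp.edist_toLp_toLp, normV_sub_eq_of_joint hn (hUa φ) (hU φ) (hUa ψ) (hU ψ)]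
  have hcw : ∀ φ : X, eLpNorm (Function.uncurry (c φ) - Function.uncurry W) p (slabMeasure n a b) =
      edist φ w₀ := by
    intro φ
    rw [Lp.edist_def]
    refine eLpNorm_congr_ae ?_
    filter_upwards [hWp.coeFn_toLp] with q hq
    rw [Pi.sub_apply, Pi.sub_apply, hq]
    rfl
  have hcc : ∀ φ ψ : X, eLpNorm (Function.uncurry (c φ) - Function.uncurry (c ψ)) p
      (slabMeasure n a b) = edist φ ψ := by
    intro φ ψ
    rw [Lp.edist_def]
    rfl
  -- The ball around the approximate solution, which is also the starting point of the iteration.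
  let s : Set X := {φ | edist φ w₀ ≤ ρ}
  have hsc : IsComplete s := (isClosed_le (by fun_prop) continuous_const).isComplete
  have hs2 : ∀ φ ∈ s, eLpNorm (Function.uncurry (c φ)) p (slabMeasure n a b) ≤ 2 * δ := by
    intro φ hφ
    have h1 := eLpNorm_add_le ((hcm φ).sub hWa) hWa hp1.out
    rw [sub_add_cancel, hcw φ] at h1
    refine h1.trans ((add_le_add (le_trans hφ hρδ) hWδ).trans_eq (two_mul δ).symm)
  have hW2 : eLpNorm (Function.uncurry W) p (slabMeasure n a b) ≤ 2 * δ :=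
    hWδ.trans (le_mul_of_one_le_left zero_le one_le_two)
  have hsmall : ∀ A B d : ℝ≥0∞, A ≤ 2 * δ → B ≤ 2 * δ →
      K * (3 * (d * (A ^ ((4 : ℝ) / n) + B ^ ((4 : ℝ) / n)))) ≤ 2⁻¹ * d := by
    intro A B d hA hB
    have h1 : A ^ ((4 : ℝ) / n) + B ^ ((4 : ℝ) / n) ≤
        (2 * δ) ^ ((4 : ℝ) / n) + (2 * δ) ^ ((4 : ℝ) / n) :=
      add_le_add (ENNReal.rpow_le_rpow hA hα.le) (ENNReal.rpow_le_rpow hB hα.le)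
    calc K * (3 * (d * (A ^ ((4 : ℝ) / n) + B ^ ((4 : ℝ) / n))))
        = K * (3 * (A ^ ((4 : ℝ) / n) + B ^ ((4 : ℝ) / n))) * d := by ring
      _ ≤ 2⁻¹ * d := mul_le_mul_left ((mul_le_mul_right (mul_le_mul_right h1 _) _).trans hδ) _
  have hmaps : MapsTo T s s := by
    intro φ hφ
    change edist (T φ) w₀ ≤ ρ
    rw [hTw]
    refine ((hu φ).normV_sub_le hn hw' (aestronglyMeasurable_nonlinearity (hcm φ)) hWe hσ).trans ?_
    rw [huσ φ]
    refine (add_le_add hf (mul_le_mul_right ((normN0_nonlinearity_sub_add_le hn (hcm φ) hWa).trans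
      (add_le_add le_rfl hN)) K)).trans ?_
    rw [hcw φ, mul_add]
    have h1 := (hsmall _ _ (edist φ w₀) (hs2 φ hφ) hW2).trans (mul_le_mul_right hφ _)
    refine (add_le_add le_rfl (add_le_add h1 le_rfl)).trans (le_of_eq ?_)
    have h2 : ε + K * ε = 2⁻¹ * ρ := by
      rw [hρ, mul_assoc, ← mul_assoc 2⁻¹, ENNReal.inv_mul_cancel two_ne_zero ENNReal.ofNat_ne_top]
      ring
    calc ε + (2⁻¹ * ρ + K * ε) = (ε + K * ε) + 2⁻¹ * ρ := by ring
      _ = (2⁻¹ + 2⁻¹) * ρ := by rw [h2]; ring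
      _ = ρ := by rw [ENNReal.inv_two_add_inv_two, one_mul]
  have hcontr : ContractingWith (1 / 2) (hmaps.restrict T s s) := by
    refine ⟨by norm_num, fun φ ψ => ?_⟩
    change edist (T φ) (T ψ) ≤ _ * edist (φ : X) ψ
    rw [hTT]
    refine ((hu φ).normV_sub_le hn (hu ψ) (aestronglyMeasurable_nonlinearity (hcm φ))
      (aestronglyMeasurable_nonlinearity (hcm ψ)) hσ).trans ?_
    rw [huσ, huσ, sub_self]
    have h0 : normV a b (fun t => ⇑(freeProp (t - σ) (0 : L2 n))) = 0 := by
      refine le_antisymm ((normV_le_normS0 hn _).trans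
        ((normS0_freeProp_le hn a b σ 0).trans ?_)) zero_le
      rw [enorm_zero, mul_zero]
    rw [h0, zero_add]
    refine (mul_le_mul_right (normN0_nonlinearity_sub_le hn (hcm φ) (hcm ψ)) K).trans ?_
    rw [hcc]
    refine (hsmall _ _ (edist (φ : X) ψ) (hs2 φ φ.2) (hs2 ψ ψ.2)).trans (le_of_eq ?_)
    simp
  have hw₀ : w₀ ∈ s := by
    change edist w₀ w₀ ≤ ρ
    rw [edist_self]
    exact zero_le
  obtain ⟨φ, hφs, hφ, -⟩ := hcontr.exists_fixedPoint' hsc hmaps hw₀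
    (ne_top_of_le_ne_top hρt (by rw [edist_comm]; exact hmaps hw₀))
  refine ⟨u φ, ?_, huσ φ, ?_⟩
  · have h1 : Function.uncurry (c φ) =ᵐ[slabMeasure n a b] Function.uncurry (U φ) := by
      have h2 := (hUp φ).coeFn_toLp
      have h3 : (hUp φ).toLp _ = φ := hφ
      rw [h3] at h2
      exact h2
    have h4 := Measure.ae_ae_of_ae_prod h1
    refine IsSolution.of_joint (hU φ) ((hu φ).congr (fun _ _ => rfl) ?_)
    filter_upwards [h4] with t ht
    filter_upwards [ht] with x hx
    have hx' : c φ t x = U φ t x := hx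
    rw [hx']
  · rw [← hTw]
    exact hmaps hφs

/-! ### Gluing stable intervals -/

/-- The norm of `V` is subadditive with respect to cutting the interval. -/
theorem normV_le_add (hn : 3 ≤ n) {a m b : ℝ} (hm : m ∈ Icc a b) (u : ℝ → Space n → ℂ) :
    normV a b u ≤ normV a m u + normV m b u := by
  have hp := critExp_gt hn
  have hp0 : 0 < critExp n := by linarith
  simp only [normV_eq_mixedNorm hn, mixedNorm_ofReal hp0]
  rw [← Icc_union_Icc_eq_Icc hm.1 hm.2]
  refine (ENNReal.rpow_le_rpow (lintegral_union_le _ _ _) (by positivity)).trans ?_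
  exact ENNReal.rpow_add_le_add_rpow _ _ (by positivity) ((div_le_one hp0).2 (by linarith))

theorem normV_restrict_le {a b c d : ℝ} (h : Icc c d ⊆ Icc a b) (u : ℝ → Space n → ℂ) :
    normV c d u ≤ normV a b u := mixedNorm_restrict_le h _ _ u

/-- Solutions on adjacent intervals that agree at the common end point form one solution. -/
theorem exists_glued {a m b : ℝ} (hm : m ∈ Icc a b) {v₁ v₂ : ℝ → L2 n} (h₁ : IsSolution a m v₁)
    (h₂ : IsSolution m b v₂) (h : v₁ m = v₂ m) :
    ∃ v, IsSolution a b v ∧ (∀ t ∈ Icc a m, v t = v₁ t) ∧ ∀ t ∈ Icc m b, v t = v₂ t := by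
  classical
  let v : ℝ → L2 n := fun t => if t ≤ m then v₁ t else v₂ t
  have e1 : ∀ t ∈ Icc a m, v t = v₁ t := fun t ht => if_pos ht.2
  have e2 : ∀ t ∈ Icc m b, v t = v₂ t := by
    intro t ht
    rcases eq_or_lt_of_le ht.1 with rfl | hlt
    · rw [← h]
      exact if_pos le_rfl
    · exact if_neg (not_le.2 hlt)
  refine ⟨v, IsSchrodingerSolution.glue hm ?_ ?_, e1, e2⟩
  · refine IsSchrodingerSolution.congr h₁ e1 ?_
    filter_upwards [ae_restrict_mem measurableSet_Icc] with t ht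
    rw [e1 t ht]
  · refine IsSchrodingerSolution.congr h₂ e2 ?_
    filter_upwards [ae_restrict_mem measurableSet_Icc] with t ht
    rw [e2 t ht]

/-- The size, relative to `ε`, of the forcing in the equation for the difference of a solution and
an approximate solution at distance `C * ε`. -/
def forcingConst (n : ℕ) (ε₀ C L : ℝ≥0∞) : ℝ≥0∞ :=
  3 * (C * ((L + C * ε₀) ^ ((4 : ℝ) / n) + L ^ ((4 : ℝ) / n))) + 1

theorem forcingConst_ne_top {n : ℕ} {ε₀ C L : ℝ≥0∞} (hε₀ : ε₀ ≠ ⊤) (hC : C ≠ ⊤) (hL : L ≠ ⊤) :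
    forcingConst n ε₀ C L ≠ ⊤ := by
  have hα : 0 ≤ (4 : ℝ) / n := by positivity
  refine ENNReal.add_ne_top.2 ⟨ENNReal.mul_ne_top (by norm_num) (ENNReal.mul_ne_top hC
    (ENNReal.add_ne_top.2 ⟨ENNReal.rpow_ne_top_of_nonneg hα ?_,
      ENNReal.rpow_ne_top_of_nonneg hα hL⟩)), ENNReal.one_ne_top⟩
  exact ENNReal.add_ne_top.2 ⟨hL, ENNReal.mul_ne_top hC hε₀⟩

section

variable {a b : ℝ} {v w : ℝ → L2 n} {e : ℝ → Space n → ℂ} {ε₀ ε C L : ℝ≥0∞}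

/-- The equation for the difference of a solution and an approximate solution. -/
theorem exists_forcing_sub (hn : 3 ≤ n)
    (he : AEStronglyMeasurable (Function.uncurry e) (slabMeasure n a b))
    (hv : IsSolution a b v) (hw : IsApproxSolution a b w e) (hL : normV a b (fun t => ⇑(w t)) ≤ L)
    (hC : normV a b (fun t => ⇑(v t - w t)) ≤ C * ε) (hN : normN0 a b e ≤ ε) (hε : ε ≤ ε₀) :
    ∃ G : ℝ → Space n → ℂ, AEStronglyMeasurable (Function.uncurry G) (slabMeasure n a b) ∧
      IsSchrodingerSolution a b (fun t => v t - w t) G ∧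
      normN0 a b G ≤ forcingConst n ε₀ C L * ε := by
  have hα : 0 ≤ (4 : ℝ) / n := by positivity
  obtain ⟨φ, hφm, hφ⟩ := exists_joint hv.continuousOn
  obtain ⟨W, hWm, hW⟩ := exists_joint hw.continuousOn
  have hφa : AEStronglyMeasurable (Function.uncurry φ) (slabMeasure n a b) :=
    hφm.aestronglyMeasurable
  have hWa : AEStronglyMeasurable (Function.uncurry W) (slabMeasure n a b) :=
    hWm.aestronglyMeasurable
  refine ⟨fun t x => nonlinearity n (φ t x) - (nonlinearity n (W t x) + e t x),
    (aestronglyMeasurable_nonlinearity hφa).sub ((aestronglyMeasurable_nonlinearity hWa).add he),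
    (hv.joint hφ).sub (hw.joint hW), ?_⟩
  refine (normN0_nonlinearity_sub_add_le hn hφa hWa).trans ?_
  rw [normV_eq_of_joint hn hWa hW] at hL
  rw [normV_sub_eq_of_joint hn hφa hφ hWa hW] at hC
  have hp1 : (1 : ℝ≥0∞) ≤ ENNReal.ofReal (critExp n) :=
    one_le_two.trans (isAdmissible_critExp hn).1
  have h1 := eLpNorm_add_le (hφa.sub hWa) hWa hp1
  rw [sub_add_cancel] at h1
  have h2 : eLpNorm (Function.uncurry φ) (ENNReal.ofReal (critExp n)) (slabMeasure n a b) ≤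
      L + C * ε₀ := by
    refine h1.trans ((add_le_add (hC.trans (mul_le_mul_right hε C)) hL).trans_eq (add_comm _ _))
  have h3 := mul_le_mul' hC (add_le_add (ENNReal.rpow_le_rpow h2 hα) (ENNReal.rpow_le_rpow hL hα))
  refine (add_le_add (mul_le_mul_right h3 3) hN).trans (le_of_eq ?_)
  rw [forcingConst]
  ring

/-- The free evolution of the difference stays small when the base time is moved. -/
theorem normV_freeProp_sub_le (hn : 3 ≤ n) {c d σ m : ℝ}
    (he : AEStronglyMeasurable (Function.uncurry e) (slabMeasure n c d))
    (hv : IsSolution c d v) (hw : IsApproxSolution c d w e) (hL : normV c d (fun t => ⇑(w t)) ≤ L)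
    (hC : normV c d (fun t => ⇑(v t - w t)) ≤ C * ε) (hN : normN0 c d e ≤ ε) (hε : ε ≤ ε₀)
    (hσ : σ ∈ Icc c d) (hm : m ∈ Icc c d)
    (hf : normV a b (fun t => ⇑(freeProp (t - σ) (v σ - w σ))) ≤ ε) :
    normV a b (fun t => ⇑(freeProp (t - m) (v m - w m))) ≤
      (1 + linearConst n * (linearConst n * forcingConst n ε₀ C L)) * ε := by
  obtain ⟨G, hGm, hG, hGN⟩ := exists_forcing_sub hn he hv hw hL hC hN hε
  set f := v σ - w σ with hf'
  set y := (v m - w m) - freeProp (m - σ) f with hy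
  have hyle : ‖y‖ₑ ≤ linearConst n * (forcingConst n ε₀ C L * ε) :=
    (hG.enorm_sub_freeProp_le hn hGm hσ hm).trans (mul_le_mul_right hGN _)
  have h1 : (fun t => (⇑(freeProp (t - m) (v m - w m)) : Space n → ℂ)) =
      fun t => ⇑(freeProp (t - σ) f + freeProp (t - m) y) := by
    funext t
    rw [hy, map_sub (freeProp (t - m)) _ (freeProp (m - σ) f), ← freeProp_add, sub_add_sub_cancel,
      add_sub_cancel]
  rw [h1]
  refine (normV_add_le hn (continuous_freeProp_sub σ f).continuousOn
    (continuous_freeProp_sub m y).continuousOn).trans ?_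
  refine (add_le_add hf ((normV_le_normS0 hn _).trans
    ((normS0_freeProp_le_linearConst hn a b m y).trans (mul_le_mul_right hyle _)))).trans
    (le_of_eq ?_)
  ring

end

/-- Two adjacent stable intervals form a stable interval, with worse constants: the solution is
constructed on the interval that contains the base time first, and its value at the common end
point is the initial value on the other interval. -/
theorem IsStable.glue (hn : 3 ≤ n) {ε₀ C L : ℝ≥0∞} {a m b : ℝ} (hm : m ∈ Icc a b) {w : ℝ → L2 n}
    {e : ℝ → Space n → ℂ} (he : AEStronglyMeasurable (Function.uncurry e) (slabMeasure n a b))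
    (hw : IsApproxSolution a b w e) (hL : normV a b (fun t => ⇑(w t)) ≤ L)
    (h₁ : IsStable ε₀ C a m w e) (h₂ : IsStable ε₀ C m b w e) :
    IsStable (ε₀ / (1 + linearConst n * (linearConst n * forcingConst n ε₀ C L)))
      (C + C * (1 + linearConst n * (linearConst n * forcingConst n ε₀ C L))) a b w e := by
  intro σ hσ v₀ ε hε hf hN
  set A := 1 + linearConst n * (linearConst n * forcingConst n ε₀ C L) with hA
  have hεA : A * ε ≤ ε₀ := ENNReal.mul_le_of_le_div' hε
  have hA1 : ε ≤ A * ε := le_mul_of_one_le_left zero_le le_self_add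
  have hε1 : ε ≤ ε₀ := hA1.trans hεA
  have hs1 : Icc a m ⊆ Icc a b := Icc_subset_Icc_right hm.2
  have hs2 : Icc m b ⊆ Icc a b := Icc_subset_Icc_left hm.1
  have hm1 : m ∈ Icc a m := right_mem_Icc.2 hm.1
  have hm2 : m ∈ Icc m b := left_mem_Icc.2 hm.2
  have hN1 := (normN0_restrict_le hs1 e).trans hN
  have hN2 := (normN0_restrict_le hs2 e).trans hN
  have hsum : ∀ v v₁ v₂ : ℝ → L2 n, (∀ t ∈ Icc a m, v t = v₁ t) → (∀ t ∈ Icc m b, v t = v₂ t) →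
      normV a b (fun t => ⇑(v t - w t)) ≤
        normV a m (fun t => ⇑(v₁ t - w t)) + normV m b (fun t => ⇑(v₂ t - w t)) := by
    intro v v₁ v₂ e1 e2
    refine (normV_le_add hn hm _).trans (add_le_add (le_of_eq ?_) (le_of_eq ?_))
    · exact normV_congr fun t ht => by rw [e1 t ht]
    · exact normV_congr fun t ht => by rw [e2 t ht]
  rcases le_total σ m with hσm | hσm
  · have hσ1 : σ ∈ Icc a m := ⟨hσ.1, hσm⟩
    obtain ⟨v₁, hv₁, hv₁σ, hV₁⟩ := h₁ σ hσ1 v₀ ε hε1 ((normV_restrict_le hs1 _).trans hf) hN1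
    rw [← hv₁σ] at hf
    have hf' := normV_freeProp_sub_le hn (he.mono_measure (slabMeasure_mono hs1)) hv₁
      (IsSchrodingerSolution.restrict hw hs1) ((normV_restrict_le hs1 _).trans hL) hV₁ hN1 hε1
      hσ1 hm1 hf
    obtain ⟨v₂, hv₂, hv₂m, hV₂⟩ := h₂ m hm2 (v₁ m) (A * ε) hεA
      ((normV_restrict_le hs2 _).trans hf') (hN2.trans hA1)
    obtain ⟨v, hv, e1, e2⟩ := exists_glued hm hv₁ hv₂ hv₂m.symm
    refine ⟨v, hv, (e1 σ hσ1).trans hv₁σ, ((hsum v v₁ v₂ e1 e2).trans (add_le_add hV₁ hV₂)).trans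
      (le_of_eq ?_)⟩
    ring
  · have hσ2 : σ ∈ Icc m b := ⟨hσm, hσ.2⟩
    obtain ⟨v₂, hv₂, hv₂σ, hV₂⟩ := h₂ σ hσ2 v₀ ε hε1 ((normV_restrict_le hs2 _).trans hf) hN2
    rw [← hv₂σ] at hf
    have hf' := normV_freeProp_sub_le hn (he.mono_measure (slabMeasure_mono hs2)) hv₂
      (IsSchrodingerSolution.restrict hw hs2) ((normV_restrict_le hs2 _).trans hL) hV₂ hN2 hε1
      hσ2 hm2 hf
    obtain ⟨v₁, hv₁, hv₁m, hV₁⟩ := h₁ m hm1 (v₂ m) (A * ε) hεA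
      ((normV_restrict_le hs1 _).trans hf') (hN1.trans hA1)
    obtain ⟨v, hv, e1, e2⟩ := exists_glued hm hv₁ hv₂ hv₁m
    refine ⟨v, hv, (e2 σ hσ2).trans hv₂σ, ((hsum v v₁ v₂ e1 e2).trans (add_le_add hV₁ hV₂)).trans
      (le_of_eq ?_)⟩
    ring

theorem IsStable.mono {ε₀ ε₁ C D : ℝ≥0∞} {a b : ℝ} {w : ℝ → L2 n} {e : ℝ → Space n → ℂ}
    (h : IsStable ε₀ C a b w e) (hε : ε₁ ≤ ε₀) (hC : C ≤ D) : IsStable ε₁ D a b w e := by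
  intro σ hσ v₀ ε hε' hf hN
  obtain ⟨v, hv, hvσ, hV⟩ := h σ hσ v₀ ε (hε'.trans hε) hf hN
  exact ⟨v, hv, hvσ, hV.trans (mul_le_mul_left hC _)⟩

/-! ### Stability on intervals of large space-time norm -/

/-- An interval carrying `k + 1` units of the space-time norm splits into one carrying `k` units and
one carrying a single unit, by the intermediate value theorem. -/
theorem exists_split (hn : 3 ≤ n) {a b : ℝ} (hab : a ≤ b) {w : ℝ → L2 n}
    (hw : ContinuousOn w (Icc a b)) {k : ℕ} {D : ℝ≥0∞} (hD : D ≠ ⊤)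
    (h : normV a b (fun t => ⇑(w t)) ^ critExp n ≤ (k + 1) * D) :
    ∃ m ∈ Icc a b, normV a m (fun t => ⇑(w t)) ^ critExp n ≤ k * D ∧
      normV m b (fun t => ⇑(w t)) ^ critExp n ≤ D := by
  have hp := critExp_gt hn
  have hp0 : 0 < critExp n := by linarith
  set g : ℝ → ℝ≥0∞ := fun t => eLpNorm (w t) (ENNReal.ofReal (critExp n)) volume ^ critExp n
    with hg
  have hV : ∀ c d, normV c d (fun t => ⇑(w t)) ^ critExp n = ∫⁻ t in Icc c d, g t := by
    intro c d
    rw [normV_eq_mixedNorm hn, mixedNorm_ofReal hp0, ← ENNReal.rpow_mul,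
      one_div_mul_cancel hp0.ne', ENNReal.rpow_one]
  have hgm : AEMeasurable g (volume.restrict (Icc a b)) := by
    obtain ⟨φ, hφ, hφw⟩ := exists_joint hw
    refine ((aemeasurable_eLpNorm_slice (a := a) (b := b) hφ.aestronglyMeasurable hp0).pow_const
      (critExp n)).congr ?_
    filter_upwards [ae_restrict_mem measurableSet_Icc] with t ht
    rw [hg, eLpNorm_congr_ae (hφw t ht)]
  have hkD : ((k : ℝ≥0∞) + 1) * D ≠ ⊤ :=
    ENNReal.mul_ne_top (ENNReal.add_ne_top.2 ⟨ENNReal.natCast_ne_top k, ENNReal.one_ne_top⟩) hD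
  rw [hV] at h
  have hfin : ∫⁻ t in Icc a b, g t ≠ ⊤ := ne_top_of_le_ne_top hkD h
  have hgi : IntegrableOn (fun t => (g t).toReal) (Icc a b) :=
    integrable_toReal_of_lintegral_ne_top hgm hfin
  have hVr : ∀ c d, c ≤ d → Icc c d ⊆ Icc a b →
      normV c d (fun t => ⇑(w t)) ^ critExp n = ENNReal.ofReal (∫ t in c..d, (g t).toReal) := by
    intro c d hcd hsub
    have h1 : ∫⁻ t in Icc c d, g t ≠ ⊤ := ne_top_of_le_ne_top hfin (lintegral_mono_set hsub)
    have hgm' := hgm.mono_set hsub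
    rw [hV, intervalIntegral.integral_of_le hcd, ← integral_Icc_eq_integral_Ioc,
      integral_toReal hgm' (ae_lt_top' hgm' h1), ENNReal.ofReal_toReal h1]
  have hint : ∀ c ∈ Icc a b, ∀ d ∈ Icc a b,
      IntervalIntegrable (fun t => (g t).toReal) volume c d := fun c hc d hd =>
    (hgi.mono_set (uIcc_subset_Icc hc hd)).intervalIntegrable
  have ha : a ∈ Icc a b := left_mem_Icc.2 hab
  have hb : b ∈ Icc a b := right_mem_Icc.2 hab
  set I : ℝ → ℝ := fun t => ∫ s in a..t, (g s).toReal with hI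
  have hIc : ContinuousOn I (Icc a b) := by
    have := intervalIntegral.continuousOn_primitive_interval (a := a) (b := b)
      (f := fun t => (g t).toReal) (μ := volume) (by rwa [uIcc_of_le hab])
    rwa [uIcc_of_le hab] at this
  have hIb : I b ≤ (k + 1) * D.toReal := by
    have h2 := h
    rw [← hV, hVr a b hab le_rfl] at h2
    have h3 : ((k : ℝ≥0∞) + 1) * D = ENNReal.ofReal ((k + 1) * D.toReal) := by
      rw [ENNReal.ofReal_mul (by positivity), ENNReal.ofReal_toReal hD,
        ENNReal.ofReal_add (by positivity) zero_le_one]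
      simp
    rw [h3] at h2
    exact (ENNReal.ofReal_le_ofReal_iff (by positivity)).1 h2
  have hkDr : (k : ℝ≥0∞) * D = ENNReal.ofReal (k * D.toReal) := by
    rw [ENNReal.ofReal_mul (by positivity), ENNReal.ofReal_toReal hD]
    simp
  have key : ∃ m ∈ Icc a b, I m ≤ k * D.toReal ∧ I b - I m ≤ D.toReal := by
    rcases le_total (I b) (k * D.toReal) with hle | hle
    · exact ⟨b, hb, hle, by rw [sub_self]; exact ENNReal.toReal_nonneg⟩
    · have hIa : I a = 0 := intervalIntegral.integral_same
      obtain ⟨m, hm, hIm⟩ := intermediate_value_Icc hab hIc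
        (show (k : ℝ) * D.toReal ∈ Icc (I a) (I b) from ⟨by rw [hIa]; positivity, hle⟩)
      refine ⟨m, hm, hIm.le, ?_⟩
      rw [hIm]
      linarith
  obtain ⟨m, hm, h1, h2⟩ := key
  refine ⟨m, hm, ?_, ?_⟩
  · rw [hVr a m hm.1 (Icc_subset_Icc_right hm.2), hkDr]
    exact ENNReal.ofReal_le_ofReal h1
  · rw [hVr m b hm.2 (Icc_subset_Icc_left hm.1), ← ENNReal.ofReal_toReal hD]
    refine ENNReal.ofReal_le_ofReal ?_
    rwa [← intervalIntegral.integral_interval_sub_left (hint a ha b hb) (hint a ha m hm)]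

/-- Stability when the space-time norm amounts to `k + 1` small units, by induction on `k`: the last
unit is split off and the two intervals are glued. -/
theorem exists_isStable_nat (hn : 3 ≤ n) {δ : ℝ≥0∞} (hδ0 : δ ≠ 0) (hδt : δ ≠ ⊤)
    (hδ : linearConst n * (3 * ((2 * δ) ^ ((4 : ℝ) / n) + (2 * δ) ^ ((4 : ℝ) / n))) ≤ 2⁻¹)
    (k : ℕ) : ∃ ε₀ C : ℝ≥0∞, ε₀ ≠ 0 ∧ ε₀ ≠ ⊤ ∧ C ≠ ⊤ ∧
      ∀ (a b : ℝ), a ≤ b → ∀ (w : ℝ → L2 n) (e : ℝ → Space n → ℂ),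
        AEStronglyMeasurable (Function.uncurry e) (slabMeasure n a b) →
        IsApproxSolution a b w e →
        normV a b (fun t => ⇑(w t)) ^ critExp n ≤ (k + 1) * δ ^ critExp n →
        IsStable ε₀ C a b w e := by
  have hp := critExp_gt hn
  have hp0 : 0 < critExp n := by linarith
  have hKt := linearConst_ne_top n
  have h2K : 2 * (1 + linearConst n) ≠ ⊤ :=
    ENNReal.mul_ne_top (by norm_num) (ENNReal.add_ne_top.2 ⟨ENNReal.one_ne_top, hKt⟩)
  have hstep : ∀ (a b : ℝ) (w : ℝ → L2 n) (e : ℝ → Space n → ℂ),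
      AEStronglyMeasurable (Function.uncurry e) (slabMeasure n a b) → IsApproxSolution a b w e →
      normV a b (fun t => ⇑(w t)) ^ critExp n ≤ δ ^ critExp n →
      IsStable (δ / (2 * (1 + linearConst n))) (2 * (1 + linearConst n)) a b w e :=
    fun a b w e he hw h => isStable_of_le hn hδt hδ he hw ((ENNReal.rpow_le_rpow_iff hp0).1 h)
  induction k with
  | zero =>
    refine ⟨δ / (2 * (1 + linearConst n)), 2 * (1 + linearConst n),
      (ENNReal.div_pos hδ0 h2K).ne', ENNReal.div_ne_top hδt (by simp), h2K,
      fun a b _ w e he hw h => hstep a b w e he hw ?_⟩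
    simpa using h
  | succ k ih =>
    obtain ⟨ε₀, C, hε0, hεt, hC, hst⟩ := ih
    set D := δ ^ critExp n with hD
    have hDt : D ≠ ⊤ := ENNReal.rpow_ne_top_of_nonneg hp0.le hδt
    set L : ℝ≥0∞ := (((k + 1 : ℕ) : ℝ≥0∞) + 1) * D with hL
    have hLt : L ≠ ⊤ :=
      ENNReal.mul_ne_top (ENNReal.add_ne_top.2 ⟨ENNReal.natCast_ne_top _, ENNReal.one_ne_top⟩) hDt
    set L' : ℝ≥0∞ := L ^ (1 / critExp n) with hL'
    have hLt' : L' ≠ ⊤ := ENNReal.rpow_ne_top_of_nonneg (by positivity) hLt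
    set ε₁ := min ε₀ (δ / (2 * (1 + linearConst n))) with hε₁
    set C₁ := max C (2 * (1 + linearConst n)) with hC₁
    have hε10 : ε₁ ≠ 0 := (lt_min (pos_iff_ne_zero.2 hε0) (ENNReal.div_pos hδ0 h2K)).ne'
    have hε1t : ε₁ ≠ ⊤ := ne_top_of_le_ne_top hεt (min_le_left _ _)
    have hC1t : C₁ ≠ ⊤ := (max_lt hC.lt_top h2K.lt_top).ne
    set A := 1 + linearConst n * (linearConst n * forcingConst n ε₁ C₁ L') with hA
    have hAt : A ≠ ⊤ := ENNReal.add_ne_top.2 ⟨ENNReal.one_ne_top, ENNReal.mul_ne_top hKt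
      (ENNReal.mul_ne_top hKt (forcingConst_ne_top hε1t hC1t hLt'))⟩
    refine ⟨ε₁ / A, C₁ + C₁ * A, (ENNReal.div_pos hε10 hAt).ne', ENNReal.div_ne_top hε1t (by simp [hA]),
      ENNReal.add_ne_top.2 ⟨hC1t, ENNReal.mul_ne_top hC1t hAt⟩, fun a b hab w e he hw h => ?_⟩
    obtain ⟨m, hm, hm1, hm2⟩ := exists_split hn hab hw.continuousOn hDt h
    have hs1 : Icc a m ⊆ Icc a b := Icc_subset_Icc_right hm.2
    have hs2 : Icc m b ⊆ Icc a b := Icc_subset_Icc_left hm.1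
    have hwL : normV a b (fun t => ⇑(w t)) ≤ L' := by
      rw [hL', one_div, ENNReal.le_rpow_inv_iff hp0]
      exact h
    refine IsStable.glue hn hm he hw hwL ?_ ?_
    · refine (hst a m hm.1 w e (he.mono_measure (slabMeasure_mono hs1))
        (IsSchrodingerSolution.restrict hw hs1) ?_).mono (min_le_left _ _) (le_max_left _ _)
      rwa [Nat.cast_add, Nat.cast_one] at hm1
    · exact (hstep m b w e (he.mono_measure (slabMeasure_mono hs2))
        (IsSchrodingerSolution.restrict hw hs2) hm2).mono (min_le_right _ _) (le_max_right _ _)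

/-- Approximate solutions of bounded space-time norm are stable, with constants that depend on the
bound only. -/
theorem exists_isStable (hn : 3 ≤ n) {L : ℝ≥0∞} (hL : L ≠ ⊤) :
    ∃ ε₀ C : ℝ≥0∞, ε₀ ≠ 0 ∧ ε₀ ≠ ⊤ ∧ C ≠ ⊤ ∧
      ∀ (a b : ℝ), a ≤ b → ∀ (w : ℝ → L2 n) (e : ℝ → Space n → ℂ),
        AEStronglyMeasurable (Function.uncurry e) (slabMeasure n a b) →
        IsApproxSolution a b w e → normV a b (fun t => ⇑(w t)) ≤ L → IsStable ε₀ C a b w e := by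
  have hp := critExp_gt hn
  have hp0 : 0 < critExp n := by linarith
  obtain ⟨δ, hδ0, hδt, hδ⟩ := exists_threshold hn
  have hD0 : δ ^ critExp n ≠ 0 := (ENNReal.rpow_pos (pos_iff_ne_zero.2 hδ0) hδt).ne'
  have hLp : L ^ critExp n ≠ ⊤ := ENNReal.rpow_ne_top_of_nonneg hp0.le hL
  obtain ⟨k, hk⟩ := ENNReal.exists_nat_mul_gt hD0 hLp
  obtain ⟨ε₀, C, h1, h2, h3, h4⟩ := exists_isStable_nat hn hδ0 hδt hδ k
  refine ⟨ε₀, C, h1, h2, h3, fun a b hab w e he hw hwL => h4 a b hab w e he hw ?_⟩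
  refine (ENNReal.rpow_le_rpow hwL hp0.le).trans (hk.le.trans ?_)
  exact mul_le_mul_left le_self_add _

/-! ### Strichartz bounds for the perturbed solution -/

theorem normS0_self (a : ℝ) (u : ℝ → Space n → ℂ) : normS0 a a u = 0 := by
  simp [normS0, mixedNorm]

/-- The essential bound on a continuous curve holds at every time. -/
theorem enorm_le_of_mixedNorm_top_le {a b : ℝ} (hab : a < b) {w : ℝ → L2 n}
    (hw : ContinuousOn w (Icc a b)) {M : ℝ≥0∞} (h : mixedNorm a b ⊤ 2 (fun t => ⇑(w t)) ≤ M)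
    {t : ℝ} (ht : t ∈ Icc a b) : ‖w t‖ₑ ≤ M := by
  obtain ⟨W, hWc, hW⟩ := exists_continuous_extension hab.le hw
  have hae : ∀ᵐ s ∂(volume.restrict (Icc a b)), ‖W s‖ₑ ≤ M := by
    rw [mixedNorm, eLpNorm_exponent_top] at h
    filter_upwards [ae_le_eLpNormEssSup (f := fun t => eLpNorm (w t) 2 volume)
      (μ := volume.restrict (Icc a b)), ae_restrict_mem measurableSet_Icc] with s hs hs'
    rw [hW s hs', ← eLpNorm_two_eq_enorm]
    exact le_trans hs h
  have hopen : IsOpen ({s | M < ‖W s‖ₑ} ∩ Ioo a b) :=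
    (isOpen_lt continuous_const hWc.enorm).inter isOpen_Ioo
  have hzero : volume ({s | M < ‖W s‖ₑ} ∩ Ioo a b) = 0 := by
    have h1 := ae_restrict_of_ae_restrict_of_subset (Ioo_subset_Icc_self (a := a) (b := b)) hae
    rw [ae_iff, Measure.restrict_apply' measurableSet_Ioo] at h1
    simpa only [not_le] using h1
  have hempty := (hopen.measure_eq_zero_iff volume).1 hzero
  have hclosed : IsClosed {s | ‖W s‖ₑ ≤ M} := isClosed_le hWc.enorm continuous_const
  have hsub : Ioo a b ⊆ {s | ‖W s‖ₑ ≤ M} := by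
    intro s hs
    by_contra hcon
    have hlt : M < ‖W s‖ₑ := not_le.1 hcon
    have : s ∈ {s | M < ‖W s‖ₑ} ∩ Ioo a b := ⟨hlt, hs⟩
    rw [hempty] at this
    exact this
  have h2 := closure_minimal hsub hclosed
  rw [closure_Ioo hab.ne] at h2
  have h3 : ‖W t‖ₑ ≤ M := h2 ht
  rwa [hW t ht] at h3

/-- The Strichartz norm of a solution of the nonlinear equation, in terms of its value at one time
and its space-time norm. -/
theorem IsSolution.normS0_le (hn : 3 ≤ n) {a b σ : ℝ} {v : ℝ → L2 n} (hv : IsSolution a b v)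
    (hσ : σ ∈ Icc a b) :
    normS0 a b (fun t => ⇑(v t)) ≤ linearConst n * ‖v σ‖ₑ + linearConst n *
      (3 * (normV a b (fun t => ⇑(v t)) * normV a b (fun t => ⇑(v t)) ^ ((4 : ℝ) / n))) := by
  obtain ⟨φ, hφm, hφ⟩ := exists_joint hv.continuousOn
  have hφa : AEStronglyMeasurable (Function.uncurry φ) (slabMeasure n a b) :=
    hφm.aestronglyMeasurable
  have hm := aestronglyMeasurable_nonlinearity hφa
  refine ((hv.joint hφ).normS0_le hn hm hσ).trans (add_le_add le_rfl (mul_le_mul_right ?_ _))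
  rw [normV_eq_of_joint hn hφa hφ]
  exact (normN0_le_eLpNorm hn hm).trans (eLpNorm_nonlinearity_le hn hφa)

end NLS

end

theorem lemma3p5 (n : ℕ) (hn : 3 ≤ n) (M M' L : ℝ) (hM : 0 < M) (hM' : 0 < M') (hL : 0 < L) :
    ∃ ε₁ : ℝ, 0 < ε₁ ∧ ∃ C : ℝ, 0 < C ∧
      ∀ (a b t₀ : ℝ), t₀ ∈ Set.Icc a b →
      ∀ (w : ℝ → NLS.L2 n) (e : ℝ → NLS.Space n → ℂ),
        MeasureTheory.AEStronglyMeasurable (Function.uncurry e) (NLS.slabMeasure n a b) →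
        NLS.IsApproxSolution a b w e →
        NLS.mixedNorm a b ⊤ 2 (fun t => ⇑(w t)) ≤ ENNReal.ofReal M →
        NLS.normV a b (fun t => ⇑(w t)) ≤ ENNReal.ofReal L →
      ∀ (v₀ : NLS.L2 n), ‖v₀ - w t₀‖ ≤ M' →
      ∀ (ε : ℝ), 0 < ε → ε ≤ ε₁ →
        NLS.normV a b (fun t => ⇑(NLS.freeEvolution (t - t₀) (v₀ - w t₀))) ≤ ENNReal.ofReal ε →
        NLS.normN0 a b e ≤ ENNReal.ofReal ε →
        ∃ v : ℝ → NLS.L2 n,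
          NLS.IsSolution a b v ∧ v t₀ = v₀ ∧
          NLS.normV a b (fun t => ⇑(v t - w t)) ≤ ENNReal.ofReal (ε * C) ∧
          NLS.normS0 a b (fun t => ⇑(v t - w t)) ≤ ENNReal.ofReal (C * M') ∧
          NLS.normS0 a b (fun t => ⇑(v t)) ≤ ENNReal.ofReal C := by
  have hα : 0 ≤ (4 : ℝ) / n := by positivity
  obtain ⟨ε₀, C₀, hε0, hεt, hC0, hst⟩ := NLS.exists_isStable hn (L := .ofReal L)
    ENNReal.ofReal_ne_top
  set K := NLS.linearConst n with hK
  have hKt : K ≠ ⊤ := NLS.linearConst_ne_top n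
  set B := NLS.forcingConst n ε₀ C₀ (.ofReal L) with hB
  have hBt : B ≠ ⊤ := NLS.forcingConst_ne_top hεt hC0 ENNReal.ofReal_ne_top
  have hM0 : ENNReal.ofReal M' ≠ 0 := by simpa using hM'
  set V : ℝ≥0∞ := C₀ * ε₀ + .ofReal L with hV
  have hVt : V ≠ ⊤ := ENNReal.add_ne_top.2 ⟨ENNReal.mul_ne_top hC0 hεt, ENNReal.ofReal_ne_top⟩
  set D₁ : ℝ≥0∞ := K + K * (B * ε₀) / .ofReal M' with hD₁
  set D₂ : ℝ≥0∞ := K * (.ofReal M + .ofReal M') + K * (3 * (V * V ^ ((4 : ℝ) / n))) with hD₂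
  have hD₁t : D₁ ≠ ⊤ := ENNReal.add_ne_top.2
    ⟨hKt, ENNReal.div_ne_top (ENNReal.mul_ne_top hKt (ENNReal.mul_ne_top hBt hεt)) hM0⟩
  have hD₂t : D₂ ≠ ⊤ := ENNReal.add_ne_top.2
    ⟨ENNReal.mul_ne_top hKt (ENNReal.add_ne_top.2 ⟨ENNReal.ofReal_ne_top, ENNReal.ofReal_ne_top⟩),
      ENNReal.mul_ne_top hKt (ENNReal.mul_ne_top (by norm_num) (ENNReal.mul_ne_top hVt
        (ENNReal.rpow_ne_top_of_nonneg hα hVt)))⟩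
  set D : ℝ≥0∞ := C₀ + D₁ + D₂ + 1 with hD
  have hDt : D ≠ ⊤ := ENNReal.add_ne_top.2 ⟨ENNReal.add_ne_top.2
    ⟨ENNReal.add_ne_top.2 ⟨hC0, hD₁t⟩, hD₂t⟩, ENNReal.one_ne_top⟩
  have hC₀D : C₀ ≤ D := le_self_add.trans (le_self_add.trans le_self_add)
  have hD₁D : D₁ ≤ D := le_add_self.trans (le_self_add.trans le_self_add)
  have hD₂D : D₂ ≤ D := le_add_self.trans le_self_add
  have hDpos : 0 < D.toReal := ENNReal.toReal_pos (by simp [hD]) hDt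
  refine ⟨ε₀.toReal, ENNReal.toReal_pos hε0 hεt, D.toReal, hDpos, ?_⟩
  intro a b t₀ ht₀ w e he hw hwM hwL v₀ hv₀ ε hε hε1 hf hN
  have hab : a ≤ b := ht₀.1.trans ht₀.2
  have hεε : ENNReal.ofReal ε ≤ ε₀ := ENNReal.ofReal_le_of_le_toReal hε1
  have hv₀' : ‖v₀ - w t₀‖ₑ ≤ ENNReal.ofReal M' := by
    rw [← ofReal_norm]
    exact ENNReal.ofReal_le_ofReal hv₀
  obtain ⟨v, hv, hvt, hvV⟩ := hst a b hab w e he hw hwL t₀ ht₀ v₀ _ hεε hf hN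
  refine ⟨v, hv, hvt, ?_, ?_, ?_⟩
  · rw [ENNReal.ofReal_mul hε.le, ENNReal.ofReal_toReal hDt, mul_comm]
    exact hvV.trans (mul_le_mul_left hC₀D _)
  · obtain ⟨G, hGm, hG, hGN⟩ := NLS.exists_forcing_sub hn he hv hw hwL hvV hN hεε
    rw [ENNReal.ofReal_mul hDpos.le, ENNReal.ofReal_toReal hDt]
    refine (hG.normS0_le hn hGm ht₀).trans ?_
    rw [hvt]
    refine le_trans ?_ (mul_le_mul_left hD₁D _)
    rw [hD₁, add_mul, ENNReal.div_mul_cancel hM0 ENNReal.ofReal_ne_top]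
    exact add_le_add (mul_le_mul_right hv₀' _)
      (mul_le_mul_right (hGN.trans (mul_le_mul_right hεε _)) _)
  · rw [ENNReal.ofReal_toReal hDt]
    refine le_trans ?_ hD₂D
    -- On a degenerate interval the essential supremum says nothing, but all norms vanish.
    rcases eq_or_lt_of_le hab with rfl | hlt
    · rw [NLS.normS0_self]
      exact zero_le
    have hvle : ‖v t₀‖ₑ ≤ ENNReal.ofReal M + ENNReal.ofReal M' := by
      have h1 : v t₀ = w t₀ + (v₀ - w t₀) := by rw [hvt, add_sub_cancel]
      rw [h1]
      exact (enorm_add_le _ _).trans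
        (add_le_add (NLS.enorm_le_of_mixedNorm_top_le hlt hw.continuousOn hwM ht₀) hv₀')
    have hvV' : NLS.normV a b (fun t => ⇑(v t)) ≤ V := by
      have h1 := NLS.normV_add_le hn (u := fun t => v t - w t) (hv.continuousOn.sub hw.continuousOn)
        hw.continuousOn
      simp only [sub_add_cancel] at h1
      exact h1.trans (add_le_add (hvV.trans (mul_le_mul_right hεε _)) hwL)
    refine (hv.normS0_le hn ht₀).trans (add_le_add (mul_le_mul_right hvle _)
      (mul_le_mul_right (mul_le_mul_right (mul_le_mul' hvV' (ENNReal.rpow_le_rpow hvV' hα)) _) _))
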